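/- **Setting.** Let $d,N\in\mathbb N$ and let $a_1,\dots,a_d$ be a basis of $\mathbb R^d$, $\Gamma=\mathrm{span}_{\mathbb Z}\{a_1,\dots,a_d\}$. Let either $\mathcal X=\mathbb R^d$ with Lebesgue measure, or $\mathcal X\subset\mathbb R^d$ non-empty, locally finite and $\Gamma$-invariant, with counting measure; $|\cdot|$ denotes this measure. Let $\mathcal H=L^2(\mathcal X)\otimes\mathbb C^N\simeq L^2(\mathcal X,\mathbb C^N)$, $(X_l\psi)(x)=x_l\psi(x)$, let $\chi_\Omega$ be multiplication by the indicator function of $\Omega$, and let $(T_\gamma\psi)(x)=M(\gamma,x)\psi(x-\gamma)$, $\gamma\in\Gamma$, where the matrices $M(\gamma,x)\in\mathcal U(\mathbb C^N)$ are measurable in $x$ and $M(\gamma_1+\gamma_2,x)=M(\gamma_2,x)M(\gamma_1,x-\gamma_2)$. An operator is *periodic* if it commutes with all $T_\gamma$. Let $\mathcal H_{\rm f}$ be the Hilbert space of locally square integrable $\varphi$ with $T_\gamma\varphi=\varphi$ for all $\gamma\in\Gamma$, normed by the $L^2$ norm over a fundamental domain of $\Gamma$. Let $\Gamma^*$ be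 the dual lattice ($k\cdot\gamma\in2\pi\mathbb Z$ for all $\gamma\in\Gamma$) and $(\varrho(\gamma^*)\varphi)(y)=e^{-i\gamma^*\cdot y}\varphi(y)$. The Bloch–Floquet–Zak transform $(\mathcal U\psi)(k,y)=e^{-ik\cdot y}\sum_{\gamma\in\Gamma}e^{ik\cdot\gamma}(T_\gamma\psi)(y)$ maps $\mathcal H$ onto the locally $L^2$, $\varrho$-equivariant functions $\mathbb R^d\to\mathcal H_{\rm f}$. The *fibration* $k\mapsto A(k)$ of an operator $A$ is given by $\mathcal UA\,\mathcal U^{-1}=\int^\oplus A(k)\,dk$. **Assumptions.** $H_0$ is a self-adjoint periodic operator on $\mathcal H$, bounded from below, with fibration $H_0(k)$, $k\in\mathbb R^d$, self-adjoint on a common dense domain $\mathcal D_{\rm f}\subset\mathcal H_{\rm f}$ (with the graph norm of $H_0(0)$), such that $k\mapsto H_0(k)\in\mathcal L(\mathcal D_{\rm f},\mathcal H_{\rm f})$ is $C^\infty$, $\varrho(\gamma^*)\mathcal D_{\rm f}\subset\mathcal D_{\rm f}$ and $H_0(k+\gamma^*)=\varrho(\gamma^*)H_0(k)\varrho(\gamma^*)^{-1}$.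 The real number $\mu$ is not in the spectrum of $H_0$, $\Pi_0=\chi_{(-\infty,\mu)}(H_0)$, and the fibres $\Pi_0(k)$ have finite rank. $S=\mathrm{Id}_{L^2(\mathcal X)}\otimes s$ is self-adjoint and periodic, and its fibre is in $\mathcal L(\mathcal D_{\rm f})$. Fix $i,j\in\{1,\dots,d\}$. **Conductivities.** Write $\overline{[X_j,\Pi_0]}$ for the closure of the commutator restricted to the vectors $\psi$ for which $\mathcal U\psi:\mathbb R^d\to\mathcal H_{\rm f}$ is smooth, and $\overline{[H_0,X_i]}$ for the closure of the commutator restricted to the vectors for which $\mathcal U\psi:\mathbb R^d\to\mathcal D_{\rm f}$ is smooth. Put $$\mathcal I(A)=\frac{i}{2\pi}\oint_C (H_0-z)^{-1}[A,\Pi_0](H_0-z)^{-1}\,dz,$$ where $C$ is a positively oriented circle that crosses the real axis at $\mu$ and below the spectrum of $H_0$, and $$\Pi_1=\mathcal I(\overline{[X_j,\Pi_0]}),\quad \mathcal S=i\,\mathcal I\big([\overline{[X_j,\Pi_0]},\Pi_0]\big),\quad \Pi^\varepsilon=e^{-i\varepsilon\mathcal S}\,\Pi_0\,e^{i\varepsilon\mathcal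 S},\quad J=\tfrac12\big(i\,\overline{[H_0,X_i]}\,S+i\,S\,\overline{[H_0,X_i]}\big).$$ For a basis $b=(b_1,\dots,b_d)$ of $\mathbb R^d$ with $\mathrm{span}_{\mathbb Z}\{b_1,\dots,b_d\}=\Gamma$ put $\mathcal C^b_L=\{x\in\mathcal X: x=\sum_l\alpha_lb_l,\ |\alpha_l|\le L/2 \text{ for all } l\}$. For an operator $A$ such that $\chi_KA\chi_K$ is trace class for every compact $K$, let $$\tau_b(A)=\lim_{L\to\infty,\ L\ \mathrm{odd}}\ |\mathcal C^b_L|^{-1}\,\mathrm{Tr}\big(\chi_{\mathcal C^b_L}A\,\chi_{\mathcal C^b_L}\big),$$ if the limit exists. With respect to the primitive cell $\mathcal C^b_1$, the conventional $S$-conductivity $\sigma^S_{{\rm conv},ij}$ is the number with $$\mathrm{Re}\,\tau_b(J\,\Pi^\varepsilon)-\mathrm{Re}\,\tau_b(J\,\Pi_0)=\varepsilon\,\sigma^S_{{\rm conv},ij}+o(\varepsilon)\qquad(\varepsilon\to0,\ \varepsilon\in[0,1]),$$ and the rotation $S$-conductivity is $\sigma^S_{{\rm rot},ij}=\mathrm{Re}\,\tau_b\big(i\,X_i\,[H_0,S]\,\Pi_1\big)$.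 **Proposition (Unit Cell Consistency of the $S$-conductivity).** (i) $\sigma^S_{{\rm conv},ij}$ is well defined for every basis $b$ of $\Gamma$, and does not depend on $b$. (ii) Let $i\ne j$, $n\ge2$, $\vartheta=2\pi/n$, and let $\mathrm R$ be the rotation $x_i\mapsto\cos\vartheta\,x_i-\sin\vartheta\,x_j$, $x_j\mapsto\sin\vartheta\,x_i+\cos\vartheta\,x_j$ of $\mathbb R^d$ (the other coordinates being fixed). Assume that $\Gamma$ and $\mathcal X$ are invariant under $\mathrm R$. Let $\rho\in\mathcal U(\mathbb C^N)$ and $(R\psi)(x)=\rho\,\psi(\mathrm R^{-1}x)$, and assume that $R^{-1}H_0R=H_0$ and $\rho^{-1}s\rho=s$. Let $b,b'$ be two bases of $\Gamma$, and for $\gamma\in\Gamma$ let $P_\gamma=(\mathcal C^b_1-\gamma)\cap\mathcal C^{b'}_1$ and $O_\gamma=\bigcup_{\eta\in\Gamma}(P_\gamma+\eta)$; assume that $R^{-1}\chi_{O_\gamma}R=\chi_{O_\gamma}$ for all $\gamma\in\Gamma$. Then $\sigma^S_{{\rm rot},ij}$ is well defined for $b$ and for $b'$, and has the same value for both. -/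

import Mathlib

open MeasureTheory Filter Topology
open scoped ENNReal ContDiff

noncomputable section

namespace UCC

/-! ### Linear operators in a Hilbert space, trace class operators -/

section Operators

variable {H : Type*} [NormedAddCommGroup H] [InnerProductSpace ℂ H]

/-- An everywhere defined bounded operator, seen as an operator with a domain. -/
def ofCLM (T : H →L[ℂ] H) : H →ₗ.[ℂ] H := (T : H →ₗ[ℂ] H).toPMap ⊤

/-- The product `A B` of two (unbounded) operators, with its natural domain
`{ψ ∈ D(B) | B ψ ∈ D(A)}`. -/
def prodOp (A B : H →ₗ.[ℂ] H) : H →ₗ.[ℂ] H where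
  domain :=
    { carrier := {ψ | ∃ h : ψ ∈ B.domain, B ⟨ψ, h⟩ ∈ A.domain}
      zero_mem' := ⟨B.domain.zero_mem, by
        have h0 : B ⟨0, B.domain.zero_mem⟩ = 0 := B.map_zero
        rw [h0]; exact A.domain.zero_mem⟩
      add_mem' := by
        rintro x y ⟨hx, hx'⟩ ⟨hy, hy'⟩
        refine ⟨B.domain.add_mem hx hy, ?_⟩
        have h : B ⟨x + y, B.domain.add_mem hx hy⟩ = B ⟨x, hx⟩ + B ⟨y, hy⟩ :=
          B.map_add ⟨x, hx⟩ ⟨y, hy⟩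
        rw [h]; exact A.domain.add_mem hx' hy'
      smul_mem' := by
        rintro c x ⟨hx, hx'⟩
        refine ⟨B.domain.smul_mem c hx, ?_⟩
        have h : B ⟨c • x, B.domain.smul_mem c hx⟩ = c • B ⟨x, hx⟩ := B.map_smul c ⟨x, hx⟩
        rw [h]; exact A.domain.smul_mem c hx' }
  toFun :=
    { toFun := fun ψ => A ⟨B ⟨ψ.1, ψ.2.choose⟩, ψ.2.choose_spec⟩
      map_add' := by
        intro x y
        rw [← A.map_add]
        congr 1
        exact Subtype.ext (B.map_add ⟨x.1, x.2.choose⟩ ⟨y.1, y.2.choose⟩)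
      map_smul' := by
        intro c x
        rw [RingHom.id_apply, ← A.map_smul]
        congr 1
        exact Subtype.ext (B.map_smul c ⟨x.1, x.2.choose⟩) }

/-- The commutator `[A, B] = A B - B A`, with its natural domain. -/
def commOp (A B : H →ₗ.[ℂ] H) : H →ₗ.[ℂ] H := prodOp A B - prodOp B A

/-- The closure of the restriction of the commutator `[A, B]` to the subspace `core`. -/
def closedComm (A B : H →ₗ.[ℂ] H) (core : Submodule ℂ H) : H →ₗ.[ℂ] H :=
  ((commOp A B).domRestrict core).closure

/-- `R` is the resolvent `(A - z)⁻¹`: a bounded two-sided inverse of `A - z : D(A) → H`. -/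
def IsResolventAt (A : H →ₗ.[ℂ] H) (z : ℂ) (R : H →L[ℂ] H) : Prop :=
  (∀ ψ : H, ∃ h : R ψ ∈ A.domain, A ⟨R ψ, h⟩ - z • R ψ = ψ) ∧
    ∀ ψ : A.domain, R (A ψ - z • (ψ : H)) = ψ

/-- The resolvent set of `A`. -/
def resolventSetOp (A : H →ₗ.[ℂ] H) : Set ℂ := {z | ∃ R : H →L[ℂ] H, IsResolventAt A z R}

open Classical in
/-- The resolvent `(A - z)⁻¹` for `z` in the resolvent set of `A` (and `0` elsewhere). -/
def resolventOp (A : H →ₗ.[ℂ] H) (z : ℂ) : H →L[ℂ] H :=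
  if h : ∃ R : H →L[ℂ] H, IsResolventAt A z R then h.choose else 0

/-- `P` is the spectral projection `χ_{(-∞,μ)}(A)` of the self-adjoint operator `A`, for a real
`μ` that is not in the spectrum of `A`: the orthogonal projection that reduces `A` and is such
that `A ≤ μ` on its range and `A ≥ μ` on its kernel. -/
structure IsSpectralProjBelow (A : H →ₗ.[ℂ] H) (μ : ℝ) (P : H →L[ℂ] H) : Prop where
  idem : ∀ ψ, P (P ψ) = P ψ
  symm : ∀ ψ φ, inner ℂ (P ψ) φ = inner ℂ ψ (P φ)
  reduces : ∀ ψ : A.domain, ∃ h : P ψ ∈ A.domain, A ⟨P ψ, h⟩ = P (A ψ)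
  le_on_range : ∀ ψ : A.domain, P ψ = ψ → (inner ℂ (ψ : H) (A ψ)).re ≤ μ * ‖(ψ : H)‖ ^ 2
  ge_on_ker : ∀ ψ : A.domain, P ψ = 0 → μ * ‖(ψ : H)‖ ^ 2 ≤ (inner ℂ (ψ : H) (A ψ)).re

/-- The inverse Liouvillian
`I(A) = (i / 2π) ∮ (H₀ - z)⁻¹ [A, Π₀] (H₀ - z)⁻¹ dz`,
over the positively oriented circle of centre `c` and radius `r`. -/
def invLiouvillian (H₀ : H →ₗ.[ℂ] H) (P : H →L[ℂ] H) (c r : ℝ) (A : H →L[ℂ] H) : H →L[ℂ] H :=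
  (Complex.I / (2 * Real.pi)) •
    circleIntegral
      (fun z => resolventOp H₀ z ∘L ((A ∘L P - P ∘L A) ∘L resolventOp H₀ z)) (c : ℂ) r

/-- Trace class operators of a Hilbert space: norm convergent sums
`∑ₙ ‖aₙ‖ ‖bₙ‖ < ∞` of rank one operators `ψ ↦ ⟨bₙ, ψ⟩ aₙ`. -/
def IsTraceClass (T : H →L[ℂ] H) : Prop :=
  ∃ a b : ℕ → H, (Summable fun n => ‖a n‖ * ‖b n‖) ∧
    ∀ ψ, HasSum (fun n => (inner ℂ (b n) ψ : ℂ) • a n) (T ψ)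

/-- The operator `T` is everywhere defined, bounded and trace class. -/
def IsTraceClassOp (T : H →ₗ.[ℂ] H) : Prop :=
  ∃ T' : H →L[ℂ] H, T = ofCLM T' ∧ IsTraceClass T'

end Operators

/-- `T` is trace class, and its trace `∑ᵢ ⟨eᵢ, T eᵢ⟩`, computed in any orthonormal (Hilbert)
basis `e`, is `t`. -/
def HasTrace {H : Type} [NormedAddCommGroup H] [InnerProductSpace ℂ H]
    (T : H →ₗ.[ℂ] H) (t : ℂ) : Prop :=
  ∃ T' : H →L[ℂ] H, T = ofCLM T' ∧ IsTraceClass T' ∧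
    ∀ (ι : Type) (e : HilbertBasis ι ℂ H), HasSum (fun i => (inner ℂ (e i) (T' (e i)) : ℂ)) t

/-! ### The configuration space, operators on square integrable functions -/

/-- The physical space `ℝᵈ`. -/
abbrev Space (d : ℕ) : Type := EuclideanSpace ℝ (Fin d)

/-- The space `ℂᴺ` of the internal degrees of freedom. -/
abbrev Spin (N : ℕ) : Type := EuclideanSpace ℂ (Fin N)

/-- Continuum models and discrete models. -/
inductive ConfigSpace (d : ℕ) : Type
  | continuum : ConfigSpace d
  | discrete (X : Set (Space d)) : ConfigSpace d

namespace ConfigSpace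

variable {d : ℕ}

/-- The set `𝒳 ⊆ ℝᵈ`. -/
def carrier : ConfigSpace d → Set (Space d)
  | continuum => Set.univ
  | discrete X => X

/-- The Lebesgue measure on `𝒳 = ℝᵈ`, or the counting measure on the discrete set `𝒳`
(as a measure on `ℝᵈ` that is carried by `𝒳`). -/
def measure : ConfigSpace d → Measure (Space d)
  | continuum => volume
  | discrete X => Measure.count.restrict X

/-- In a discrete model, `𝒳` is non-empty and locally finite. -/
def Admissible : ConfigSpace d → Prop
  | continuum => True
  | discrete X => X.Nonempty ∧ ∀ K : Set (Space d), Bornology.IsBounded K → (X ∩ K).Finite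

/-- An isometry of `ℝᵈ` that maps `𝒳` onto itself preserves the measure of `𝒳`. -/
theorem measurePreserving (C : ConfigSpace d) (e : Space d ≃ᵢ Space d)
    (he : MeasurePreserving e volume volume)
    (hC : ∀ x, x ∈ C.carrier ↔ e x ∈ C.carrier) :
    MeasurePreserving e C.measure C.measure := by
  cases C with
  | continuum => exact he
  | discrete X =>
    have hX : ⇑e ⁻¹' X = X := by
      ext x; exact (hC x).symm
    have hme : Measurable e := e.continuous.measurable
    refine ⟨hme, ?_⟩
    change Measure.map e (Measure.count.restrict X) = Measure.count.restrict X
    ext s hs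
    rw [Measure.map_apply hme hs, Measure.restrict_apply (hme hs), Measure.restrict_apply hs]
    have h1 : ⇑e ⁻¹' s ∩ X = ⇑e.symm '' (s ∩ X) := by
      rw [e.image_symm, Set.preimage_inter, hX]
    rw [h1, Measure.count_injective_image e.symm.injective]

end ConfigSpace

/-- Square integrable functions `L²(ν, ℂᴺ)`. -/
abbrev L2 {d : ℕ} (N : ℕ) (ν : Measure (Space d)) : Type := Lp (Spin N) 2 ν

section OperatorsOnL2

variable {d N : ℕ} {ν : Measure (Space d)}

/-- The domain `{ψ ∈ L² | g ψ ∈ L²}` of the operator of multiplication by `g`. -/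
def mulDomain (N : ℕ) (ν : Measure (Space d)) (g : Space d → ℂ) : Submodule ℂ (L2 N ν) where
  carrier := {ψ | MemLp (fun x => g x • ψ x) 2 ν}
  zero_mem' := by
    refine (memLp_congr_ae ?_).mpr (MemLp.zero (ε := Spin N) (p := 2) (μ := ν))
    filter_upwards [Lp.coeFn_zero (Spin N) 2 ν] with x hx
    rw [hx, Pi.zero_apply, smul_zero]
  add_mem' := by
    intro ψ φ hψ hφ
    refine (memLp_congr_ae ?_).mpr (MemLp.add hψ hφ)
    filter_upwards [Lp.coeFn_add ψ φ] with x hx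
    rw [hx, Pi.add_apply, Pi.add_apply, smul_add]
  smul_mem' := by
    intro c ψ hψ
    refine (memLp_congr_ae ?_).mpr (MemLp.const_smul hψ c)
    filter_upwards [Lp.coeFn_smul c ψ] with x hx
    rw [hx, Pi.smul_apply, Pi.smul_apply, smul_comm]

/-- The product `g ψ`, for `ψ` in the domain of the multiplication operator. -/
def mulFun (N : ℕ) (ν : Measure (Space d)) (g : Space d → ℂ) (ψ : mulDomain N ν g) : L2 N ν :=
  MemLp.toLp (fun x => g x • (ψ : L2 N ν) x) ψ.2

theorem mulFun_coe (g : Space d → ℂ) (ψ : mulDomain N ν g) :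
    ∀ᵐ x ∂ν, mulFun N ν g ψ x = g x • (ψ : L2 N ν) x :=
  MemLp.coeFn_toLp _

/-- The maximal operator of multiplication by a function `g`. -/
def mulOp (N : ℕ) (ν : Measure (Space d)) (g : Space d → ℂ) : L2 N ν →ₗ.[ℂ] L2 N ν where
  domain := mulDomain N ν g
  toFun :=
    { toFun := mulFun N ν g
      map_add' := by
        intro ψ φ
        refine Lp.ext ?_
        filter_upwards [mulFun_coe g (ψ + φ), mulFun_coe g ψ, mulFun_coe g φ,
          Lp.coeFn_add (mulFun N ν g ψ) (mulFun N ν g φ),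
          Lp.coeFn_add (ψ : L2 N ν) (φ : L2 N ν)] with x h1 h2 h3 h4 h5
        rw [h1, h4, Pi.add_apply, h2, h3, Submodule.coe_add, h5, Pi.add_apply, smul_add]
      map_smul' := by
        intro c ψ
        refine Lp.ext ?_
        filter_upwards [mulFun_coe g (c • ψ), mulFun_coe g ψ,
          Lp.coeFn_smul c (mulFun N ν g ψ), Lp.coeFn_smul c (ψ : L2 N ν)] with x h1 h2 h3 h4
        rw [h1, RingHom.id_apply, h3, Pi.smul_apply, h2, Submodule.coe_smul, h4, Pi.smul_apply,
          smul_comm] }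

/-- The operator `χ_Ω` of multiplication by the indicator function of `Ω`. -/
def chi (N : ℕ) (ν : Measure (Space d)) (Ω : Set (Space d)) : L2 N ν →ₗ.[ℂ] L2 N ν :=
  mulOp N ν (Ω.indicator fun _ => 1)

/-- The position operator `(X_l ψ)(x) = x_l ψ(x)`. -/
def posOp (N : ℕ) (ν : Measure (Space d)) (l : Fin d) : L2 N ν →ₗ.[ℂ] L2 N ν :=
  mulOp N ν fun x => (x l : ℂ)

theorem memLp_comp {m : Space d → Spin N →L[ℂ] Spin N} (hm : AEStronglyMeasurable m ν)
    (hu : ∀ x, m x ∈ unitary (Spin N →L[ℂ] Spin N)) {f : Space d → Space d}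
    (hf : MeasurePreserving f ν ν) (ψ : L2 N ν) : MemLp (fun x => m x (ψ (f x))) 2 ν := by
  have h1 : MemLp (fun x => ψ (f x)) 2 ν := (Lp.memLp ψ).comp_measurePreserving hf
  have h2 : AEStronglyMeasurable (fun x => m x (ψ (f x))) ν :=
    (ContinuousLinearMap.apply ℂ (Spin N)).flip.aestronglyMeasurable_comp₂ hm
      h1.aestronglyMeasurable
  refine (memLp_congr_norm h2 h1.aestronglyMeasurable ?_).mpr h1
  exact Eventually.of_forall fun x => ContinuousLinearMap.norm_map_of_mem_unitary (hu x) _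

/-- The isometry `(W ψ)(x) = m(x) ψ(f(x))` of `L²`, for unitary matrices `m(x)` and a measure
preserving map `f`. -/
def weightedComp {m : Space d → Spin N →L[ℂ] Spin N} (hm : AEStronglyMeasurable m ν)
    (hu : ∀ x, m x ∈ unitary (Spin N →L[ℂ] Spin N)) {f : Space d → Space d}
    (hf : MeasurePreserving f ν ν) : L2 N ν →L[ℂ] L2 N ν :=
  LinearIsometry.toContinuousLinearMap
    { toFun := fun ψ => MemLp.toLp (fun x => m x (ψ (f x))) (memLp_comp hm hu hf ψ)
      map_add' := by
        intro ψ φ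
        rw [← MemLp.toLp_add]
        refine MemLp.toLp_congr _ _ ?_
        filter_upwards [hf.quasiMeasurePreserving.ae (Lp.coeFn_add ψ φ)] with x hx
        change m x ((ψ + φ : L2 N ν) (f x)) = m x (ψ (f x)) + m x (φ (f x))
        rw [hx, Pi.add_apply, map_add]
      map_smul' := by
        intro c ψ
        rw [RingHom.id_apply, ← MemLp.toLp_const_smul]
        refine MemLp.toLp_congr _ _ ?_
        filter_upwards [hf.quasiMeasurePreserving.ae (Lp.coeFn_smul c ψ)] with x hx
        change m x ((c • ψ : L2 N ν) (f x)) = c • m x (ψ (f x))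
        rw [hx, Pi.smul_apply, map_smul]
      norm_map' := by
        intro ψ
        change ‖MemLp.toLp (fun x => m x (ψ (f x))) (memLp_comp hm hu hf ψ)‖ = ‖ψ‖
        rw [Lp.norm_toLp, Lp.norm_def, ← eLpNorm_comp_measurePreserving
          (Lp.aestronglyMeasurable ψ) hf]
        congr 1
        refine eLpNorm_congr_norm_ae (Eventually.of_forall fun x => ?_)
        exact ContinuousLinearMap.norm_map_of_mem_unitary (hu x) _ }

/-- The operator `S = Id ⊗ s`, that is `(S ψ)(x) = s ψ(x)`. -/
def spinOp (ν : Measure (Space d)) (s : Spin N →L[ℂ] Spin N) : L2 N ν →L[ℂ] L2 N ν :=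
  ContinuousLinearMap.compLpL 2 ν s

/-- The unimodular scalar matrix `e^{i k·y}`. -/
def phaseMat (N : ℕ) (k y : Space d) : Spin N →L[ℂ] Spin N :=
  Complex.exp (Complex.I * (inner ℝ k y : ℝ)) • ContinuousLinearMap.id ℂ (Spin N)

theorem phaseMat_unitary (k y : Space d) :
    phaseMat N k y ∈ unitary (Spin N →L[ℂ] Spin N) := by
  have h : star (Complex.exp (Complex.I * (inner ℝ k y : ℝ)))
      * Complex.exp (Complex.I * (inner ℝ k y : ℝ)) = 1 := by
    rw [RCLike.star_def, ← Complex.normSq_eq_conj_mul_self,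
      mul_comm, Complex.normSq_eq_norm_sq, Complex.norm_exp_ofReal_mul_I]
    simp
  rw [Unitary.mem_iff]
  constructor
  · change star (_ • (1 : Spin N →L[ℂ] Spin N)) * (_ • (1 : Spin N →L[ℂ] Spin N)) = 1
    rw [star_smul, star_one, smul_mul_smul_comm, h, one_mul, one_smul]
  · change (_ • (1 : Spin N →L[ℂ] Spin N)) * star (_ • (1 : Spin N →L[ℂ] Spin N)) = 1
    rw [star_smul, star_one, smul_mul_smul_comm, mul_comm, h, one_mul, one_smul]

theorem phaseMat_measurable (k : Space d) : AEStronglyMeasurable (phaseMat N k) ν := by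
  apply Continuous.aestronglyMeasurable
  unfold phaseMat
  fun_prop

/-- The multiplication operator `(E(k) φ)(y) = e^{i k·y} φ(y)`. -/
def phaseOp (N : ℕ) (ν : Measure (Space d)) (k : Space d) : L2 N ν →L[ℂ] L2 N ν :=
  weightedComp (m := phaseMat N k) (f := id) (phaseMat_measurable k) (phaseMat_unitary k)
    (MeasurePreserving.id ν)

theorem continuous_phaseOp (B : Set (Space d)) (hB : Bornology.IsBounded B)
    (hBm : MeasurableSet B) (v : L2 N (ν.restrict B)) :
    Continuous fun k => phaseOp N (ν.restrict B) k v := by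
  obtain ⟨C, hC⟩ := hB.exists_norm_le
  have hlip : ∀ k k', ‖phaseOp N (ν.restrict B) k v - phaseOp N (ν.restrict B) k' v‖
      ≤ (max C 0 * ‖v‖) * ‖k - k'‖ := by
    intro k k'
    have : ‖phaseOp N (ν.restrict B) k v - phaseOp N (ν.restrict B) k' v‖
        ≤ (max C 0 * ‖k - k'‖) * ‖v‖ := by
      apply Lp.norm_le_mul_norm_of_ae_le_mul
      filter_upwards [Lp.coeFn_sub (phaseOp N (ν.restrict B) k v) (phaseOp N (ν.restrict B) k' v),
        MemLp.coeFn_toLp (memLp_comp (phaseMat_measurable k) (phaseMat_unitary k)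
          (MeasurePreserving.id (ν.restrict B)) v),
        MemLp.coeFn_toLp (memLp_comp (phaseMat_measurable k') (phaseMat_unitary k')
          (MeasurePreserving.id (ν.restrict B)) v), ae_restrict_mem hBm] with y h1 h2 h3 hy
      rw [h1, Pi.sub_apply]
      have e2 : (phaseOp N (ν.restrict B) k v) y = phaseMat N k y (v y) := h2
      have e3 : (phaseOp N (ν.restrict B) k' v) y = phaseMat N k' y (v y) := h3
      rw [e2, e3]
      simp only [phaseMat, smul_apply, ContinuousLinearMap.id_apply]
      rw [← sub_smul, norm_smul]
      gcongr
      have hfac : Complex.exp (Complex.I * (inner ℝ k y : ℝ))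
          - Complex.exp (Complex.I * (inner ℝ k' y : ℝ))
          = Complex.exp (Complex.I * (inner ℝ k' y : ℝ))
            * (Complex.exp (Complex.I * (inner ℝ (k - k') y : ℝ)) - 1) := by
        rw [mul_sub, ← Complex.exp_add, inner_sub_left]
        push_cast
        ring_nf
      rw [hfac, norm_mul, mul_comm Complex.I, Complex.norm_exp_ofReal_mul_I, one_mul]
      refine (Real.norm_exp_I_mul_ofReal_sub_one_le).trans ?_
      rw [mul_comm]
      refine (norm_inner_le_norm _ _).trans ?_
      gcongr
      exact (hC y hy).trans (le_max_left _ _)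
    calc _ ≤ _ := this
      _ = _ := by ring
  have : LipschitzWith (Real.toNNReal (max C 0 * ‖v‖))
      fun k => phaseOp N (ν.restrict B) k v := by
    apply LipschitzWith.of_dist_le_mul
    intro k k'
    rw [dist_eq_norm, dist_eq_norm, Real.coe_toNNReal _ (by positivity)]
    exact hlip k k'
  exact this.continuous

end OperatorsOnL2

/-! ### Rotations -/

/-- The rotation of angle `θ` in the plane `(x_i, x_j)`, as a map:
`x_i ↦ cos θ x_i - sin θ x_j`, `x_j ↦ sin θ x_i + cos θ x_j`. -/
def rotFun {d : ℕ} (θ : ℝ) (i j : Fin d) (x : Space d) : Space d :=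
  WithLp.toLp 2 fun l =>
    if l = i then Real.cos θ * x i - Real.sin θ * x j
    else if l = j then Real.sin θ * x i + Real.cos θ * x j
    else x l

theorem norm_rotFun {d : ℕ} (θ : ℝ) {i j : Fin d} (hij : i ≠ j) (x : Space d) :
    ‖rotFun θ i j x‖ = ‖x‖ := by
  have hsplit : ∀ f : Fin d → ℝ, ∑ l, f l = f i + (f j + ∑ l ∈ (Finset.univ.erase i).erase j, f l) := by
    intro f
    rw [Finset.add_sum_erase _ f (Finset.mem_erase.mpr ⟨hij.symm, Finset.mem_univ j⟩),
      Finset.add_sum_erase _ f (Finset.mem_univ i)]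
  rw [EuclideanSpace.norm_eq, EuclideanSpace.norm_eq]
  congr 1
  rw [hsplit, hsplit fun l => ‖x l‖ ^ 2]
  have hrest : ∑ l ∈ (Finset.univ.erase i).erase j, ‖rotFun θ i j x l‖ ^ 2
      = ∑ l ∈ (Finset.univ.erase i).erase j, ‖x l‖ ^ 2 := by
    refine Finset.sum_congr rfl fun l hl => ?_
    simp only [Finset.mem_erase, Finset.mem_univ, and_true] at hl
    simp [rotFun, hl.1, hl.2]
  rw [hrest]
  simp only [rotFun, Real.norm_eq_abs, sq_abs, if_true, if_neg hij.symm]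
  linear_combination (x i ^ 2 + x j ^ 2) * Real.sin_sq_add_cos_sq θ

/-- The rotation of angle `θ` in the plane `(x_i, x_j)`, as an isometry of `ℝᵈ`. -/
def rot {d : ℕ} (θ : ℝ) {i j : Fin d} (hij : i ≠ j) : Space d ≃ₗᵢ[ℝ] Space d :=
  LinearIsometry.toLinearIsometryEquiv
    { toFun := rotFun θ i j
      map_add' := by
        intro x y
        ext l
        simp only [rotFun, PiLp.add_apply]
        split_ifs <;> ring
      map_smul' := by
        intro c x
        ext l
        simp only [rotFun, PiLp.smul_apply, smul_eq_mul, RingHom.id_apply]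
        split_ifs <;> ring
      norm_map' := norm_rotFun θ hij }
    rfl

theorem rot_apply {d : ℕ} (θ : ℝ) {i j : Fin d} (hij : i ≠ j) (x : Space d) :
    rot θ hij x = rotFun θ i j x := rfl

/-! ### Crystals -/

/-- The Bravais lattice `span_ℤ {a₁, …, a_d}`. -/
def lattice {d : ℕ} (a : Module.Basis (Fin d) ℝ (Space d)) : Submodule ℤ (Space d) :=
  Submodule.span ℤ (Set.range a)

/-- The cell `C_L = {x | x = ∑ αₗ aₗ with |αₗ| ≤ L/2}` (as a subset of `ℝᵈ`; its intersection
with `𝒳` is taken by the measure of `𝒳`). -/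
def cell {d : ℕ} (a : Module.Basis (Fin d) ℝ (Space d)) (L : ℕ) : Set (Space d) :=
  {x | ∀ l, |a.repr x l| ≤ (L : ℝ) / 2}

/-- The dual lattice `Γ* = {k | k·γ ∈ 2πℤ for all γ ∈ Γ}`. -/
def dualLattice {d : ℕ} (a : Module.Basis (Fin d) ℝ (Space d)) : Set (Space d) :=
  {k | ∀ γ ∈ lattice a, ∃ n : ℤ, (inner ℝ k γ : ℝ) = 2 * Real.pi * n}

/-- A fundamental domain `{k | k·aₗ ∈ [0, 2π)}` of the dual lattice. -/
def brillouin {d : ℕ} (a : Module.Basis (Fin d) ℝ (Space d)) : Set (Space d) :=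
  {k | ∀ l, (inner ℝ k (a l) : ℝ) ∈ Set.Ico 0 (2 * Real.pi)}

/-- A `d`-dimensional crystal with `N` internal degrees of freedom: a Bravais lattice with a
linear basis `a`, a configuration space on which it acts by translations, and the unitary
cocycle `M` of the (magnetic) translation operators. -/
structure Crystal (d N : ℕ) where
  a : Module.Basis (Fin d) ℝ (Space d)
  config : ConfigSpace d
  admissible : config.Admissible
  translate : ∀ γ ∈ lattice a, ∀ x ∈ config.carrier, x + γ ∈ config.carrier
  M : lattice a → Space d → Spin N →L[ℂ] Spin N
  M_unitary : ∀ γ x, M γ x ∈ unitary (Spin N →L[ℂ] Spin N)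
  M_measurable : ∀ γ, AEStronglyMeasurable (M γ) config.measure
  cocycle : ∀ γ₁ γ₂ : lattice a, ∀ᵐ x ∂config.measure,
    M (γ₁ + γ₂) x = M γ₂ x ∘L M γ₁ (x - γ₂)

namespace Crystal

variable {d N : ℕ} (C : Crystal d N)

/-- The measure of the configuration space. -/
abbrev mu : Measure (Space d) := C.config.measure

/-- The lattice `Γ`. -/
abbrev Lat : Submodule ℤ (Space d) := lattice C.a

/-- The Hilbert space `L²(𝒳, ℂᴺ)`. -/
abbrev Hil : Type := L2 N C.mu

/-- A (half-open) fundamental domain of `Γ`. -/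
abbrev fund : Set (Space d) := ZSpan.fundamentalDomain C.a

/-- The fibre Hilbert space. A locally square integrable function `φ` with `T_γ φ = φ` for all
`γ ∈ Γ` is determined by its restriction to a fundamental domain of `Γ`, which is an arbitrary
square integrable function there; its norm is that of the restriction. -/
abbrev Fib : Type := L2 N (C.mu.restrict C.fund)

theorem measurePreserving_translate (γ : C.Lat) :
    MeasurePreserving (fun x : Space d => x - γ) C.mu C.mu := by
  have h := C.config.measurePreserving (IsometryEquiv.subRight (γ : Space d))
    (measurePreserving_sub_right volume (γ : Space d)) (fun x => ?_)
  · exact h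
  · refine ⟨fun hx => ?_, fun hx => ?_⟩
    · have := C.translate (-γ) (C.Lat.neg_mem γ.2) x hx
      rwa [← sub_eq_add_neg] at this
    · have := C.translate γ γ.2 _ hx
      simpa using this

/-- The (magnetic) translation operators `(T_γ ψ)(x) = M(γ, x) ψ(x - γ)`. -/
def T (γ : C.Lat) : C.Hil →L[ℂ] C.Hil :=
  weightedComp (C.M_measurable γ) (C.M_unitary γ) (C.measurePreserving_translate γ)

/-- The operator `A` is periodic: it commutes with the (magnetic) translations. -/
def IsPeriodic (A : C.Hil →ₗ.[ℂ] C.Hil) : Prop :=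
  ∀ γ : C.Lat, prodOp A (ofCLM (C.T γ)) = prodOp (ofCLM (C.T γ)) A

/-- The position operator `X_l`. -/
abbrev X (l : Fin d) : C.Hil →ₗ.[ℂ] C.Hil := posOp N C.mu l

/-! ### The Bloch-Floquet-Zak transform -/

/-- The representation `(ϱ(g) φ)(y) = e^{-i g·y} φ(y)` of the dual lattice. -/
def varrho (g : Space d) : C.Fib →L[ℂ] C.Fib := phaseOp N (C.mu.restrict C.fund) (-g)

/-- The term `e^{-i k·y} e^{i k·γ} (T_γ ψ)(y)` of the Bloch-Floquet-Zak transform, as an element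
of the fibre space. -/
def zakTerm (ψ : C.Hil) (γ : C.Lat) (k : Space d) : C.Fib :=
  Complex.exp (Complex.I * (inner ℝ k (γ : Space d) : ℝ)) •
    phaseOp N (C.mu.restrict C.fund) (-k)
      (LpToLpRestrictCLM (Space d) (Spin N) ℂ C.mu 2 C.fund (C.T γ ψ))

theorem continuous_zakTerm (ψ : C.Hil) (γ : C.Lat) : Continuous (C.zakTerm ψ γ) := by
  have h := (continuous_phaseOp (ν := C.mu) C.fund (ZSpan.fundamentalDomain_isBounded C.a)
    (ZSpan.fundamentalDomain_measurableSet C.a)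
    (LpToLpRestrictCLM (Space d) (Spin N) ℂ C.mu 2 C.fund (C.T γ ψ))).comp continuous_neg
  unfold zakTerm
  have h1 : Continuous fun k : Space d =>
      Complex.exp (Complex.I * ((inner ℝ k (γ : Space d) : ℝ) : ℂ)) := by fun_prop
  exact h1.smul h

/-- `Φ` is the Bloch-Floquet-Zak transform of `ψ`: it is measurable, `ϱ`-equivariant, and equal to
the sum `∑_γ e^{-i k·y} e^{i k·γ} (T_γ ψ)(y)`, which converges in the mean square sense over a
fundamental domain of the dual lattice. -/
structure IsZak (ψ : C.Hil) (Φ : Space d → C.Fib) : Prop where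
  measurable : AEStronglyMeasurable Φ volume
  equivariant : ∀ g ∈ dualLattice C.a, ∀ᵐ k, Φ (k + g) = C.varrho g (Φ k)
  tendsto : Tendsto
    (fun F : Finset C.Lat =>
      eLpNorm (fun k => Φ k - ∑ γ ∈ F, C.zakTerm ψ γ k) 2 (volume.restrict (brillouin C.a)))
    atTop (𝓝 0)

theorem zakTerm_zero (γ : C.Lat) (k : Space d) : C.zakTerm 0 γ k = 0 := by
  simp [zakTerm]

theorem zakTerm_add (ψ φ : C.Hil) (γ : C.Lat) (k : Space d) :
    C.zakTerm (ψ + φ) γ k = C.zakTerm ψ γ k + C.zakTerm φ γ k := by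
  simp [zakTerm]

theorem zakTerm_smul (c : ℂ) (ψ : C.Hil) (γ : C.Lat) (k : Space d) :
    C.zakTerm (c • ψ) γ k = c • C.zakTerm ψ γ k := by
  simp [zakTerm, smul_comm c]

theorem isZak_zero : C.IsZak 0 (fun _ => 0) where
  measurable := aestronglyMeasurable_const
  equivariant := fun g _ => Eventually.of_forall fun k => by simp
  tendsto := by simp [zakTerm_zero]

theorem IsZak.add {C : Crystal d N} {ψ φ : C.Hil} {Ψ Φ : Space d → C.Fib} (hψ : C.IsZak ψ Ψ)
    (hφ : C.IsZak φ Φ) : C.IsZak (ψ + φ) (fun k => Ψ k + Φ k) where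
  measurable := hψ.measurable.add hφ.measurable
  equivariant := fun g hg => by
    filter_upwards [hψ.equivariant g hg, hφ.equivariant g hg] with k h1 h2
    rw [h1, h2, map_add]
  tendsto := by
    have h := hψ.tendsto.add hφ.tendsto
    rw [add_zero] at h
    refine tendsto_of_tendsto_of_tendsto_of_le_of_le tendsto_const_nhds h (fun _ => zero_le)
      fun F => ?_
    have hm : ∀ (χ : C.Hil), AEStronglyMeasurable (fun k => ∑ γ ∈ F, C.zakTerm χ γ k)
        (volume.restrict (brillouin C.a)) := fun χ =>
      (continuous_finsetSum F fun γ _ => C.continuous_zakTerm χ γ).aestronglyMeasurable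
    refine le_trans (le_of_eq ?_) (eLpNorm_add_le (hψ.measurable.restrict.sub (hm ψ))
      (hφ.measurable.restrict.sub (hm φ)) one_le_two)
    congr 1
    funext k
    simp only [Pi.add_apply, zakTerm_add, Finset.sum_add_distrib]
    abel

theorem IsZak.smul {C : Crystal d N} {ψ : C.Hil} {Ψ : Space d → C.Fib} (c : ℂ)
    (hψ : C.IsZak ψ Ψ) : C.IsZak (c • ψ) (fun k => c • Ψ k) where
  measurable := hψ.measurable.const_smul c
  equivariant := fun g hg => by
    filter_upwards [hψ.equivariant g hg] with k h1
    rw [h1, map_smul]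
  tendsto := by
    have h := ENNReal.Tendsto.const_mul (a := ‖c‖ₑ) hψ.tendsto (Or.inr enorm_ne_top)
    rw [mul_zero] at h
    refine h.congr fun F => ?_
    rw [← eLpNorm_const_smul]
    congr 1
    funext k
    simp only [Pi.smul_apply, zakTerm_smul, ← Finset.smul_sum, smul_sub]

/-- In the Bloch-Floquet-Zak representation `A` is the direct integral `∫^⊕ A(k) dk` of the
(unbounded) operators `A(k)` in the fibre space. -/
def IsFibration (A : C.Hil →ₗ.[ℂ] C.Hil) (f : Space d → C.Fib →ₗ.[ℂ] C.Fib) : Prop :=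
  ∀ ψ ψ' : C.Hil, (ψ, ψ') ∈ A.graph ↔
    ∃ Φ Φ' : Space d → C.Fib, C.IsZak ψ Φ ∧ C.IsZak ψ' Φ' ∧ ∀ᵐ k, (Φ k, Φ' k) ∈ (f k).graph

/-- The vectors whose Bloch-Floquet-Zak transform is a smooth `ϱ`-equivariant function with
values in the fibre space. -/
def smoothCore : Submodule ℂ C.Hil where
  carrier := {ψ | ∃ Φ : Space d → C.Fib, ContDiff ℝ ∞ Φ ∧ C.IsZak ψ Φ}
  zero_mem' := ⟨fun _ => 0, contDiff_const, C.isZak_zero⟩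
  add_mem' := by
    rintro ψ φ ⟨Ψ, h1, h2⟩ ⟨Φ, h3, h4⟩
    exact ⟨fun k => Ψ k + Φ k, h1.add h3, h2.add h4⟩
  smul_mem' := by
    rintro c ψ ⟨Ψ, h1, h2⟩
    exact ⟨fun k => c • Ψ k, h1.const_smul c, h2.smul c⟩

/-- The domain `D_f` of the fibre operators, with the graph norm of the fibre at `k = 0`:
it is identified with the graph of that operator. -/
abbrev DomFib (h : Space d → C.Fib →ₗ.[ℂ] C.Fib) : Type := (h 0).graph

/-- The vectors whose Bloch-Floquet-Zak transform is a smooth `ϱ`-equivariant function with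
values in `D_f`, for the graph norm. -/
def smoothCoreD (h : Space d → C.Fib →ₗ.[ℂ] C.Fib) : Submodule ℂ C.Hil where
  carrier := {ψ | ∃ Φ : Space d → C.DomFib h, ContDiff ℝ ∞ Φ ∧ C.IsZak ψ fun k => (Φ k).1.1}
  zero_mem' := ⟨fun _ => 0, contDiff_const, C.isZak_zero⟩
  add_mem' := by
    rintro ψ φ ⟨Ψ, h1, h2⟩ ⟨Φ, h3, h4⟩
    exact ⟨fun k => Ψ k + Φ k, h1.add h3, h2.add h4⟩
  smul_mem' := by
    rintro c ψ ⟨Ψ, h1, h2⟩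
    exact ⟨fun k => c • Ψ k, h1.const_smul c, h2.smul c⟩

/-! ### The unperturbed model -/

/-- The assumptions on the unperturbed Hamiltonian `H₀`, with fibres `h k = H₀(k)`, on the Fermi
energy `μF` and on the Fermi projection `P = Π₀ = χ_{(-∞,μF)}(H₀)`. -/
structure IsUnperturbed (H₀ : C.Hil →ₗ.[ℂ] C.Hil) (h : Space d → C.Fib →ₗ.[ℂ] C.Fib) (μF : ℝ)
    (P : C.Hil →L[ℂ] C.Hil) : Prop where
  selfAdjoint : IsSelfAdjoint H₀
  periodic : C.IsPeriodic H₀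
  bddBelow : ∃ m : ℝ, ∀ ψ : H₀.domain,
    m * ‖(ψ : C.Hil)‖ ^ 2 ≤ (inner ℂ (ψ : C.Hil) (H₀ ψ)).re
  fibration : C.IsFibration H₀ h
  fib_selfAdjoint : ∀ k, IsSelfAdjoint (h k)
  fib_domain : ∀ k, (h k).domain = (h 0).domain
  /-- `k ↦ H₀(k)` is smooth with values in the bounded operators from `D_f` to the fibre space. -/
  fib_smooth : ∃ G : Space d → (C.DomFib h →L[ℂ] C.Fib), ContDiff ℝ ∞ G ∧
    ∀ (k : Space d) (p : C.DomFib h) (hp : p.1.1 ∈ (h k).domain), G k p = h k ⟨p.1.1, hp⟩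
  fib_equivariant : ∀ g ∈ dualLattice C.a, ∀ (k : Space d) (φ : (h k).domain),
    ∃ hφ : C.varrho g φ ∈ (h (k + g)).domain, h (k + g) ⟨C.varrho g φ, hφ⟩ = C.varrho g (h k φ)
  gap : (μF : ℂ) ∈ resolventSetOp H₀
  fermi : IsSpectralProjBelow H₀ μF P
  finiteRank : ∃ p : Space d → C.Fib →L[ℂ] C.Fib, C.IsFibration (ofCLM P) (fun k => ofCLM (p k)) ∧
    ∀ k, FiniteDimensional ℂ (LinearMap.range (p k : C.Fib →ₗ[ℂ] C.Fib))

/-- The assumptions on the operator `S = Id ⊗ s`: it is self-adjoint, periodic, and its fibre is a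
bounded operator of `D_f`. -/
structure IsSpin (h : Space d → C.Fib →ₗ.[ℂ] C.Fib) (s : Spin N →L[ℂ] Spin N) : Prop where
  selfAdjoint : IsSelfAdjoint s
  periodic : C.IsPeriodic (ofCLM (spinOp C.mu s))
  bounded_dom : ∃ c : ℝ, ∀ φ : (h 0).domain,
    ∃ hφ : spinOp (C.mu.restrict C.fund) s φ ∈ (h 0).domain,
      ‖h 0 ⟨spinOp (C.mu.restrict C.fund) s φ, hφ⟩‖ ≤ c * (‖(φ : C.Fib)‖ + ‖h 0 φ‖)

/-- The positively oriented circle of centre `c` and radius `r` crosses the real axis at the Fermi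
energy and below the bottom of the spectrum of `H₀`. -/
def IsContour (H₀ : C.Hil →ₗ.[ℂ] C.Hil) (μF c r : ℝ) : Prop :=
  0 < r ∧ c + r = μF ∧ ∀ x : ℝ, x ≤ c - r → (x : ℂ) ∈ resolventSetOp H₀

/-! ### The non-equilibrium almost-stationary state -/

/-- The bounded operator `D` is the closure of `[X_j, Π₀]`, defined on the vectors with smooth
Bloch-Floquet-Zak transform. -/
def IsPosComm (P : C.Hil →L[ℂ] C.Hil) (j : Fin d) (D : C.Hil →L[ℂ] C.Hil) : Prop :=
  closedComm (C.X j) (ofCLM P) C.smoothCore = ofCLM D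

/-- `Π₁ = I(D)`, with `D` the closure of `[X_j, Π₀]`. -/
def pi1 (H₀ : C.Hil →ₗ.[ℂ] C.Hil) (P : C.Hil →L[ℂ] C.Hil) (c r : ℝ) (D : C.Hil →L[ℂ] C.Hil) :
    C.Hil →L[ℂ] C.Hil :=
  invLiouvillian H₀ P c r D

/-- `𝒮 = i I([D, Π₀])`, with `D` the closure of `[X_j, Π₀]`. -/
def genS (H₀ : C.Hil →ₗ.[ℂ] C.Hil) (P : C.Hil →L[ℂ] C.Hil) (c r : ℝ) (D : C.Hil →L[ℂ] C.Hil) :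
    C.Hil →L[ℂ] C.Hil :=
  Complex.I • invLiouvillian H₀ P c r (D ∘L P - P ∘L D)

/-- The non-equilibrium almost-stationary state `Π^ε = e^{-iε𝒮} Π₀ e^{iε𝒮}`. -/
def neass (H₀ : C.Hil →ₗ.[ℂ] C.Hil) (P : C.Hil →L[ℂ] C.Hil) (c r : ℝ) (D : C.Hil →L[ℂ] C.Hil)
    (ε : ℝ) : C.Hil →L[ℂ] C.Hil :=
  NormedSpace.exp ((-(Complex.I * ε)) • C.genS H₀ P c r D) ∘L
    (P ∘L NormedSpace.exp ((Complex.I * ε) • C.genS H₀ P c r D))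

/-! ### Trace per unit volume and conductivities -/

/-- The operator `A` is trace class on compact sets and has trace per unit volume `t`, computed
with the cells `C_L` of the linear basis `b` of the lattice:
`t = lim Tr(χ_L A χ_L) / |C_L|`, as the odd integer `L` tends to infinity. -/
structure HasTau (b : Module.Basis (Fin d) ℝ (Space d)) (A : C.Hil →ₗ.[ℂ] C.Hil) (t : ℂ) :
    Prop where
  compact : ∀ K : Set (Space d), IsCompact K →
    IsTraceClassOp (prodOp (chi N C.mu K) (prodOp A (chi N C.mu K)))
  limit : ∃ tr : ℕ → ℂ,
    (∀ L, Odd L →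
      HasTrace (prodOp (chi N C.mu (cell b L)) (prodOp A (chi N C.mu (cell b L)))) (tr L)) ∧
    Tendsto (fun L => tr L / ((C.mu (cell b L)).toReal : ℂ)) (atTop ⊓ 𝓟 {L | Odd L}) (𝓝 t)

/-- The conventional `S`-current operator `½ (i [H₀, X_i] S + i S [H₀, X_i])`, where `[H₀, X_i]`
is the closure of the commutator on the vectors whose Bloch-Floquet-Zak transform is smooth with
values in `D_f`. -/
def convCurrent (H₀ : C.Hil →ₗ.[ℂ] C.Hil) (h : Space d → C.Fib →ₗ.[ℂ] C.Fib)
    (s : Spin N →L[ℂ] Spin N) (i : Fin d) : C.Hil →ₗ.[ℂ] C.Hil :=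
  (1 / 2 : ℂ) •
    (Complex.I • prodOp (closedComm H₀ (C.X i) (C.smoothCoreD h)) (ofCLM (spinOp C.mu s)) +
      Complex.I • prodOp (ofCLM (spinOp C.mu s)) (closedComm H₀ (C.X i) (C.smoothCoreD h)))

/-- `σ` is the conventional `S`-conductivity `σ_{conv,ij}`, computed with the cells of the basis
`b`: all the traces per unit volume exist, and
`Re τ(J Π^ε) - Re τ(J Π₀) = ε σ + o(ε)` as `ε ∈ [0, 1]` tends to `0`, where `J` is the
conventional `S`-current in direction `i` and the field is in direction `j`. -/
def IsConvConductivity (H₀ : C.Hil →ₗ.[ℂ] C.Hil) (h : Space d → C.Fib →ₗ.[ℂ] C.Fib)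
    (P : C.Hil →L[ℂ] C.Hil) (c r : ℝ) (s : Spin N →L[ℂ] Spin N) (i j : Fin d)
    (b : Module.Basis (Fin d) ℝ (Space d)) (σ : ℝ) : Prop :=
  ∃ D : C.Hil →L[ℂ] C.Hil, C.IsPosComm P j D ∧ ∃ (t₀ : ℂ) (t : ℝ → ℂ),
    C.HasTau b (prodOp (C.convCurrent H₀ h s i) (ofCLM P)) t₀ ∧
    (∀ ε ∈ Set.Icc (0 : ℝ) 1,
      C.HasTau b (prodOp (C.convCurrent H₀ h s i) (ofCLM (C.neass H₀ P c r D ε))) (t ε)) ∧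
    (fun ε : ℝ => (t ε).re - t₀.re - ε * σ) =o[𝓝[>] 0] fun ε : ℝ => ε

/-- `σ` is the rotation `S`-conductivity `σ_{rot,ij} = Re τ(i X_i [H₀, S] Π₁)`, computed with the
cells of the basis `b` (the trace per unit volume exists). -/
def IsRotConductivity (H₀ : C.Hil →ₗ.[ℂ] C.Hil) (P : C.Hil →L[ℂ] C.Hil) (c r : ℝ)
    (s : Spin N →L[ℂ] Spin N) (i j : Fin d) (b : Module.Basis (Fin d) ℝ (Space d)) (σ : ℝ) :
    Prop :=
  ∃ D : C.Hil →L[ℂ] C.Hil, C.IsPosComm P j D ∧ ∃ t : ℂ,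
    C.HasTau b
      (Complex.I • prodOp (C.X i)
        (prodOp (commOp H₀ (ofCLM (spinOp C.mu s))) (ofCLM (C.pi1 H₀ P c r D)))) t ∧
    σ = t.re

/-! ### Discrete rotational symmetry -/

/-- The configuration space is invariant under the rotation of angle `θ` in the plane
`(x_i, x_j)`. -/
def RotInvariant (θ : ℝ) {i j : Fin d} (hij : i ≠ j) : Prop :=
  ∀ x, x ∈ C.config.carrier ↔ rot θ hij x ∈ C.config.carrier

variable {C} in
theorem RotInvariant.measurePreserving {θ : ℝ} {i j : Fin d} {hij : i ≠ j}
    (hX : C.RotInvariant θ hij) : MeasurePreserving (rot θ hij) C.mu C.mu :=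
  C.config.measurePreserving (rot θ hij).toIsometryEquiv
    (LinearIsometryEquiv.measurePreserving (rot θ hij)) hX

variable {C} in
theorem RotInvariant.measurePreserving_symm {θ : ℝ} {i j : Fin d} {hij : i ≠ j}
    (hX : C.RotInvariant θ hij) : MeasurePreserving (rot θ hij).symm C.mu C.mu :=
  C.config.measurePreserving (rot θ hij).symm.toIsometryEquiv
    (LinearIsometryEquiv.measurePreserving (rot θ hij).symm) fun x => by
      have := hX ((rot θ hij).symm x)
      rw [LinearIsometryEquiv.apply_symm_apply] at this
      exact this.symm

/-- The rotation operator `(R ψ)(x) = ρ ψ(R⁻¹ x)`, for a unitary matrix `ρ`. -/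
def rotOp {θ : ℝ} {i j : Fin d} {hij : i ≠ j} (hX : C.RotInvariant θ hij)
    (ρ : unitary (Spin N →L[ℂ] Spin N)) : C.Hil →L[ℂ] C.Hil :=
  weightedComp (m := fun _ => (ρ : Spin N →L[ℂ] Spin N)) aestronglyMeasurable_const
    (fun _ => ρ.2) hX.measurePreserving_symm

/-- The inverse `(R⁻¹ ψ)(x) = ρ⁻¹ ψ(R x)` of the rotation operator. -/
def rotOpInv {θ : ℝ} {i j : Fin d} {hij : i ≠ j} (hX : C.RotInvariant θ hij)
    (ρ : unitary (Spin N →L[ℂ] Spin N)) : C.Hil →L[ℂ] C.Hil :=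
  weightedComp (m := fun _ => ((ρ⁻¹ : unitary (Spin N →L[ℂ] Spin N)) : Spin N →L[ℂ] Spin N))
    aestronglyMeasurable_const (fun _ => (ρ⁻¹).2) hX.measurePreserving

/-- The conjugate `R⁻¹ A R` of an operator by the rotation operator. -/
def rotConj {θ : ℝ} {i j : Fin d} {hij : i ≠ j} (hX : C.RotInvariant θ hij)
    (ρ : unitary (Spin N →L[ℂ] Spin N)) (A : C.Hil →ₗ.[ℂ] C.Hil) : C.Hil →ₗ.[ℂ] C.Hil :=
  prodOp (ofCLM (C.rotOpInv hX ρ)) (prodOp A (ofCLM (C.rotOp hX ρ)))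

/-- The piece `P_γ = (C₁ - γ) ∩ C₁'` of the primitive cell `C₁'` of the basis `b'`, where `C₁` is
the primitive cell of the basis `b`. -/
def piece (b b' : Module.Basis (Fin d) ℝ (Space d)) (γ : Space d) : Set (Space d) :=
  {x | x + γ ∈ cell b 1 ∧ x ∈ cell b' 1}

/-- The union of all the translates of `P_γ` by vectors of the lattice. -/
def periodicPiece (b b' : Module.Basis (Fin d) ℝ (Space d)) (γ : Space d) : Set (Space d) :=
  {x | ∃ η ∈ C.Lat, x - η ∈ piece b b' γ}

/-- The hypotheses of discrete rotational symmetry of angle `θ` in the plane `(x_i, x_j)`, for the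
pair of primitive cells that are given by the bases `b` and `b'`. -/
structure IsRotSymmetric (H₀ : C.Hil →ₗ.[ℂ] C.Hil) (s : Spin N →L[ℂ] Spin N) {θ : ℝ}
    {i j : Fin d} {hij : i ≠ j} (hX : C.RotInvariant θ hij)
    (ρ : unitary (Spin N →L[ℂ] Spin N)) (b b' : Module.Basis (Fin d) ℝ (Space d)) : Prop where
  lattice_inv : ∀ γ, γ ∈ C.Lat ↔ rot θ hij γ ∈ C.Lat
  pieces_inv : ∀ γ ∈ C.Lat, C.rotConj hX ρ (chi N C.mu (C.periodicPiece b b' γ)) =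
    chi N C.mu (C.periodicPiece b b' γ)
  hamiltonian_inv : C.rotConj hX ρ H₀ = H₀
  spin_inv : ((ρ⁻¹ : unitary (Spin N →L[ℂ] Spin N)) : Spin N →L[ℂ] Spin N) ∘L
    (s ∘L (ρ : Spin N →L[ℂ] Spin N)) = s

end Crystal

end UCC

end

/-! The theorem reduces to traces over one fundamental domain `F` of `Γ`. For a periodic, locally
trace class operator `A` and a weight `g`, cutting the cell `C_L` into lattice translates turns
`Tr(χ_L g A χ_L)` into the trace over `F` of `A` times `∑ g(x + γ)`, summed over the lattice vectors
`γ` with `x + γ ∈ C_L`. For odd `L` these `γ` form a box with a centre of symmetry that does not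
depend on `L`. So there are `L^d` of them up to a boundary error, and for a constant or linear `g`
their mean of `g` is a bounded `Γ`-periodic function `g'` independent of `L`. Hence `τ_b(g A) =
tr_F(A g') / |F|`; this is `IsLocTraceClass.hasTau`, which rests on `IsLocTraceClass.trace_weighted`
and `sum_cellBox_add`.

Part (i). For `g = 1` one has `g' = 1`, and the basis `b` disappears. What remains is existence and
differentiability in `ε`. With `κ = (H₀(0) - i)⁻¹` the unbounded fibres become the bounded smooth
family `B(k) = H₀(k) κ`, the resolvents are `κ u(k, z)` with `u` smooth in `k` uniformly on the
contour (`exists_fibreResolvent`), and the Fermi projection is their contour integral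
(`IsSpectralProjBelow.eq_circleIntegral`), so its fibres `p(k)` are smooth and of bounded finite
rank. Since position acts as `i ∂_k` (`IsZak.position`), all commutators with `X` are derivatives of
fibres. The operators to be traced are sums of operators with fibres `x p y`, which are products of
two Hilbert-Schmidt operators, and their trace is a bounded bilinear form in the sup norms of `x`
and `y` (`isBoundedBilinearMap_trace`). The exponentials `e^{±iε𝒮}` are differentiable in `ε` for
these norms, hence so is the trace.

Part (ii). For `g = i x_i` the weight `g'` is `i` times the `i`-th coordinate of the mean position
`cellMean b`. Let `A_l` be `[H₀, S] Π₁` for a field in direction `l`. The values for `b` and `b'`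
differ by the real part of `i tr_F(A_j δ) / |F|`, where `δ` is the difference of the two mean
positions. This `δ` is periodic and is determined by the sets `O_γ` that contain a point
(`sum_pieces`), so multiplication by `δ` commutes with `R` (`rotConj_meanCoord_sub`). On the other
hand `R⁻¹ A_i R = cos ϑ A_i - sin ϑ A_j` and `R⁻¹ A_j R = sin ϑ A_i + cos ϑ A_j` (`rotConj_rotFib`).
Rotating the fundamental domain does not change the trace of a periodic operator
(`RotConj.tr_cpr_eq`), so the vector `(tr_F(A_i δ), tr_F(A_j δ))` is fixed by a rotation of angle `ϑ
∉ 2πℤ` and vanishes. -/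

noncomputable section

/-! ### Bounded multiplication operators, trace class and Hilbert-Schmidt operators. -/

namespace UCC

/-! ### Multiplication by bounded operator valued functions -/

section OpMul

variable {α E : Type*} [MeasurableSpace α] {ν : Measure α} [NormedAddCommGroup E]
  [InnerProductSpace ℂ E]

theorem aestronglyMeasurable_clm_apply {m : α → E →L[ℂ] E} {f : α → E}
    (hm : AEStronglyMeasurable m ν) (hf : AEStronglyMeasurable f ν) :
    AEStronglyMeasurable (fun x => m x (f x)) ν :=
  (ContinuousLinearMap.apply ℂ E).flip.aestronglyMeasurable_comp₂ hm hf

open Classical in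
/-- The bounded operator `(m ψ)(x) = m(x) ψ(x)` of `L²`, for an essentially bounded operator
valued function `m` (and `0` for other functions). -/
def opMul (ν : Measure α) (m : α → E →L[ℂ] E) : Lp E 2 ν →L[ℂ] Lp E 2 ν :=
  if h : MemLp m ∞ ν then
    (ContinuousLinearMap.id ℂ (E →L[ℂ] E)).holderL ν ∞ 2 2 (h.toLp m)
  else 0

theorem opMul_coe {m : α → E →L[ℂ] E} (h : MemLp m ∞ ν) (ψ : Lp E 2 ν) :
    ∀ᵐ x ∂ν, opMul ν m ψ x = m x (ψ x) := by
  rw [opMul, dif_pos h]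
  filter_upwards [(ContinuousLinearMap.id ℂ (E →L[ℂ] E)).coeFn_holder (r := 2) (h.toLp m) ψ,
    h.coeFn_toLp] with x h1 h2
  rw [← h2]
  exact h1

theorem opMul_eq_of_ae {m : α → E →L[ℂ] E} (h : MemLp m ∞ ν) {ψ φ : Lp E 2 ν}
    (h1 : ∀ᵐ x ∂ν, φ x = m x (ψ x)) : opMul ν m ψ = φ := by
  refine Lp.ext ?_
  filter_upwards [opMul_coe h ψ, h1] with x h2 h3
  rw [h2, h3]

theorem norm_opMul_le {m : α → E →L[ℂ] E} {c : ℝ} (hc : 0 ≤ c)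
    (hm : ∀ᵐ x ∂ν, ‖m x‖ ≤ c) : ‖opMul ν m‖ ≤ c := by
  by_cases h : MemLp m ∞ ν
  · refine ContinuousLinearMap.opNorm_le_bound _ hc fun ψ => ?_
    apply Lp.norm_le_mul_norm_of_ae_le_mul
    filter_upwards [opMul_coe h ψ, hm] with x h1 h2
    rw [h1]
    exact (m x).le_of_opNorm_le h2 _
  · rw [opMul, dif_neg h]
    exact (norm_zero (E := Lp E 2 ν →L[ℂ] Lp E 2 ν)).trans_le hc

theorem memLp_adjoint [CompleteSpace E] {m : α → E →L[ℂ] E} (h : MemLp m ∞ ν) :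
    MemLp (fun x => (m x).adjoint) ∞ ν := by
  refine (memLp_congr_norm ?_ h.1 ?_).mpr h
  · exact (ContinuousLinearMap.adjoint (𝕜 := ℂ) (E := E) (F := E)).continuous
      |>.comp_aestronglyMeasurable h.1
  · exact Eventually.of_forall fun x => LinearIsometryEquiv.norm_map _ _

theorem opMul_adjoint [CompleteSpace E] {m : α → E →L[ℂ] E} (h : MemLp m ∞ ν) :
    (opMul ν m).adjoint = opMul ν (fun x => (m x).adjoint) := by
  symm
  rw [ContinuousLinearMap.eq_adjoint_iff]
  intro ψ φ
  rw [L2.inner_def, L2.inner_def]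
  refine integral_congr_ae ?_
  filter_upwards [opMul_coe h φ, opMul_coe (memLp_adjoint h) ψ] with x h1 h2
  rw [h1, h2, ContinuousLinearMap.adjoint_inner_left]

/-- The bounded operator of multiplication by an essentially bounded scalar function. -/
def mulB (E : Type*) [NormedAddCommGroup E] [InnerProductSpace ℂ E] (ν : Measure α) (g : α → ℂ) :
    Lp E 2 ν →L[ℂ] Lp E 2 ν :=
  opMul ν fun x => g x • ContinuousLinearMap.id ℂ E

theorem memLp_smul_id {g : α → ℂ} (h : MemLp g ∞ ν) :
    MemLp (fun x => g x • ContinuousLinearMap.id ℂ E) ∞ ν := by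
  have := (ContinuousLinearMap.lsmul ℂ ℂ (E := E →L[ℂ] E)).memLp_of_bilin (r := ∞) (p := ∞) (q := ∞)
    h (memLp_top_const (μ := ν) (ContinuousLinearMap.id ℂ E))
  exact this

theorem mulB_coe {g : α → ℂ} (h : MemLp g ∞ ν) (ψ : Lp E 2 ν) :
    ∀ᵐ x ∂ν, mulB E ν g ψ x = g x • ψ x := by
  filter_upwards [opMul_coe (memLp_smul_id (E := E) h) ψ] with x h1
  rw [mulB, h1]; rfl

theorem mulB_eq_of_ae {g : α → ℂ} (h : MemLp g ∞ ν) {ψ φ : Lp E 2 ν}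
    (h1 : ∀ᵐ x ∂ν, φ x = g x • ψ x) : mulB E ν g ψ = φ := by
  refine Lp.ext ?_
  filter_upwards [mulB_coe h ψ, h1] with x h2 h3
  rw [h2, h3]

theorem norm_mulB_le {g : α → ℂ} {c : ℝ} (hc : 0 ≤ c) (hg : ∀ᵐ x ∂ν, ‖g x‖ ≤ c) :
    ‖mulB E ν g‖ ≤ c := by
  refine norm_opMul_le hc ?_
  filter_upwards [hg] with x hx
  rw [norm_smul]
  calc _ ≤ ‖g x‖ * 1 := by gcongr; exact ContinuousLinearMap.norm_id_le
    _ ≤ c := by rwa [mul_one]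

theorem memLp_top_mul {g g' : α → ℂ} (h : MemLp g ∞ ν) (h' : MemLp g' ∞ ν) :
    MemLp (fun x => g x * g' x) ∞ ν :=
  (ContinuousLinearMap.mul ℂ ℂ).memLp_of_bilin ∞ h h'

theorem mulB_mul {g g' : α → ℂ} (h : MemLp g ∞ ν) (h' : MemLp g' ∞ ν) :
    mulB E ν (fun x => g x * g' x) = mulB E ν g ∘L mulB E ν g' := by
  ext1 ψ
  refine mulB_eq_of_ae (memLp_top_mul h h') ?_
  filter_upwards [mulB_coe h (mulB E ν g' ψ), mulB_coe h' ψ] with x h1 h2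
  rw [ContinuousLinearMap.comp_apply, h1, h2, smul_smul]

theorem mulB_add {g g' : α → ℂ} (h : MemLp g ∞ ν) (h' : MemLp g' ∞ ν) :
    mulB E ν (fun x => g x + g' x) = mulB E ν g + mulB E ν g' := by
  ext1 ψ
  refine mulB_eq_of_ae (h.add h') ?_
  filter_upwards [mulB_coe h ψ, mulB_coe h' ψ, Lp.coeFn_add (mulB E ν g ψ) (mulB E ν g' ψ)]
    with x h1 h2 h3
  refine h3.trans ?_
  rw [Pi.add_apply, h1, h2]
  exact (add_smul _ _ _).symm

theorem mulB_smul {g : α → ℂ} (h : MemLp g ∞ ν) (c : ℂ) :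
    mulB E ν (fun x => c * g x) = c • mulB E ν g := by
  ext1 ψ
  refine mulB_eq_of_ae (h.const_mul c) ?_
  filter_upwards [mulB_coe h ψ, Lp.coeFn_smul c (mulB E ν g ψ)] with x h1 h3
  refine h3.trans ?_
  rw [Pi.smul_apply, h1, smul_smul]

theorem mulB_sub {g g' : α → ℂ} (h : MemLp g ∞ ν) (h' : MemLp g' ∞ ν) :
    mulB E ν (fun x => g x - g' x) = mulB E ν g - mulB E ν g' := by
  ext1 ψ
  refine mulB_eq_of_ae (h.sub h') ?_
  filter_upwards [mulB_coe h ψ, mulB_coe h' ψ, Lp.coeFn_sub (mulB E ν g ψ) (mulB E ν g' ψ)]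
    with x h1 h2 h3
  refine h3.trans ?_
  rw [Pi.sub_apply, h1, h2]
  exact (sub_smul _ _ _).symm

theorem mulB_congr {g g' : α → ℂ} (h : g =ᵐ[ν] g') : mulB E ν g = mulB E ν g' := by
  by_cases hg : MemLp g ∞ ν
  · ext1 ψ
    have hg' := (memLp_congr_ae h).mp hg
    refine mulB_eq_of_ae hg ?_
    filter_upwards [mulB_coe hg' ψ, h] with x h1 h2
    rw [h1, h2]
  -- For an unbounded `g` both sides are the default value `0`. To see that `g • id` is then
  -- unbounded as well, `g` is recovered from it by testing on a nonzero vector, so the trivial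
  -- space has to be treated apart.
  · by_cases hE : ∃ e : E, e ≠ 0
    · have key : ∀ f : α → ℂ, MemLp (fun x => f x • ContinuousLinearMap.id ℂ E) ∞ ν →
          MemLp f ∞ ν := by
        intro f hf
        obtain ⟨e, he⟩ := hE
        have h2 : (fun x => f x) = fun x =>
            (innerSL ℂ (((‖e‖ : ℂ) ^ 2)⁻¹ • e)) ((f x • ContinuousLinearMap.id ℂ E) e) := by
          funext x
          have : (‖e‖ : ℂ) ≠ 0 := by exact_mod_cast norm_ne_zero_iff.mpr he
          simp only [smul_apply, ContinuousLinearMap.id_apply, innerSL_apply_apply,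
            inner_smul_left, inner_smul_right, inner_self_eq_norm_sq_to_K]
          simp only [map_inv₀, map_pow, Complex.conj_ofReal, Complex.coe_algebraMap]
          field_simp
        have h3 := (((innerSL ℂ (((‖e‖ : ℂ) ^ 2)⁻¹ • e)).comp
          (ContinuousLinearMap.apply ℂ E e)).comp_memLp' hf)
        exact (memLp_congr_ae (Eventually.of_forall fun x => congrFun h2 x)).mpr h3
      rw [mulB, mulB, opMul, opMul, dif_neg fun h1 => hg (key _ h1),
        dif_neg fun h1 => hg ((memLp_congr_ae h).mpr (key _ h1))]
    · push Not at hE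
      ext1 ψ
      refine Lp.ext (Eventually.of_forall fun x => ?_)
      rw [hE (mulB E ν g ψ x), hE (mulB E ν g' ψ x)]

theorem mulB_one : mulB E ν (fun _ => 1) = ContinuousLinearMap.id ℂ _ := by
  ext1 ψ
  exact mulB_eq_of_ae (memLp_top_const 1) (Eventually.of_forall fun x => by simp)

theorem mulB_adjoint [CompleteSpace E] {g : α → ℂ} (h : MemLp g ∞ ν) :
    (mulB E ν g).adjoint = mulB E ν (fun x => star (g x)) := by
  rw [mulB, opMul_adjoint (memLp_smul_id h), mulB]
  congr 1
  funext x
  rw [map_smulₛₗ, ← ContinuousLinearMap.one_def, ← ContinuousLinearMap.star_eq_adjoint, star_one]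
  rfl

end OpMul

/-! ### The trace -/

section TraceClass

variable {H K G : Type} [NormedAddCommGroup H] [InnerProductSpace ℂ H]
  [NormedAddCommGroup K] [InnerProductSpace ℂ K]
  [NormedAddCommGroup G] [InnerProductSpace ℂ G]

/-- `T = ∑ₙ ⟨bₙ, ·⟩ aₙ` with `∑ₙ ‖aₙ‖ ‖bₙ‖ < ∞`. -/
structure IsRep {ι : Type*} (T : H →L[ℂ] H) (a b : ι → H) : Prop where
  summable : Summable fun n => ‖a n‖ * ‖b n‖
  hasSum : ∀ ψ, HasSum (fun n => (inner ℂ (b n) ψ : ℂ) • a n) (T ψ)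

theorem isTraceClass_iff {T : H →L[ℂ] H} : IsTraceClass T ↔ ∃ a b : ℕ → H, IsRep T a b :=
  ⟨fun ⟨a, b, h1, h2⟩ => ⟨a, b, h1, h2⟩, fun ⟨a, b, h⟩ => ⟨a, b, h.1, h.2⟩⟩

/-- A summable family has countable support, so an arbitrary index set can be embedded in `ℕ` after
dropping the zero terms. -/
theorem IsRep.isTraceClass {ι : Type*} {T : H →L[ℂ] H} {a b : ι → H} (h : IsRep T a b) :
    IsTraceClass T := by
  set s : Set ι := Function.support fun n => ‖a n‖ * ‖b n‖
  have hs : s.Countable := h.summable.countable_support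
  have : Countable s := hs.to_subtype
  have : Encodable s := Encodable.ofCountable s
  have hinj : Function.Injective (Encodable.encode : s → ℕ) := Encodable.encode_injective
  set a' : ℕ → H := Function.extend Encodable.encode (fun n : s => a n) 0
  set b' : ℕ → H := Function.extend Encodable.encode (fun n : s => b n) 0
  refine isTraceClass_iff.mpr ⟨a', b', ?_, fun ψ => ?_⟩
  · refine (Function.Injective.summable_iff hinj ?_).mp ?_
    · intro x hx
      simp only [a', Function.extend_apply' _ _ _ hx, Pi.zero_apply, norm_zero, zero_mul]
    · have : (fun n => ‖a' n‖ * ‖b' n‖) ∘ Encodable.encode = fun n : s => ‖a n‖ * ‖b n‖ := by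
        funext n
        simp only [a', b', Function.comp_apply, hinj.extend_apply]
      rw [this]
      exact h.summable.subtype s
  · refine (Function.Injective.hasSum_iff hinj ?_).mp ?_
    · intro x hx
      simp only [a', Function.extend_apply' _ _ _ hx, Pi.zero_apply, smul_zero]
    · have : (fun n => (inner ℂ (b' n) ψ : ℂ) • a' n) ∘ Encodable.encode
          = fun n : s => (inner ℂ (b n) ψ : ℂ) • a n := by
        funext n
        simp only [a', b', Function.comp_apply, hinj.extend_apply]
      rw [this]
      have hsub : (Function.support fun n => (inner ℂ (b n) ψ : ℂ) • a n) ⊆ s := ?_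
      · exact (hasSum_subtype_iff_of_support_subset hsub).mpr (h.hasSum ψ)
      intro n hn
      simp only [Function.mem_support, ne_eq, smul_eq_zero, not_or] at hn
      simp only [s, Function.mem_support, ne_eq, mul_eq_zero, norm_eq_zero, not_or]
      refine ⟨hn.2, fun hb => hn.1 ?_⟩
      rw [hb, inner_zero_left]

/-- Cauchy-Schwarz together with Bessel's inequality. It provides the absolute convergence that
allows the double sum defining a trace to be reordered. -/
theorem tsum_norm_inner_mul_le {κ : Type*} (e : HilbertBasis κ ℂ H) (x y : H) :
    (Summable fun i => ‖(inner ℂ x (e i) : ℂ) * inner ℂ (e i) y‖) ∧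
    ∑' i, ‖(inner ℂ x (e i) : ℂ) * inner ℂ (e i) y‖ ≤ ‖x‖ * ‖y‖ := by
  have hb : ∀ s : Finset κ, ∑ i ∈ s, ‖(inner ℂ x (e i) : ℂ) * inner ℂ (e i) y‖ ≤ ‖x‖ * ‖y‖ := by
    intro s
    have h1 := e.orthonormal.sum_inner_products_le (s := s) x
    have h2 := e.orthonormal.sum_inner_products_le (s := s) y
    have h3 := Finset.sum_mul_sq_le_sq_mul_sq s (fun i => ‖(inner ℂ (e i) x : ℂ)‖)
      (fun i => ‖(inner ℂ (e i) y : ℂ)‖)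
    have h4 : ∑ i ∈ s, ‖(inner ℂ x (e i) : ℂ) * inner ℂ (e i) y‖
        = ∑ i ∈ s, ‖(inner ℂ (e i) x : ℂ)‖ * ‖(inner ℂ (e i) y : ℂ)‖ :=
      Finset.sum_congr rfl fun i _ => by rw [norm_mul, norm_inner_symm]
    rw [h4]
    refine abs_le_of_sq_le_sq' ?_ (by positivity) |>.2
    rw [mul_pow]
    refine h3.trans ?_
    gcongr
  have hs := summable_of_sum_le (fun i => norm_nonneg _) hb
  exact ⟨hs, hs.tsum_le_of_sum_le hb⟩

/-- The double family `⟨bₙ, eᵢ⟩⟨eᵢ, aₙ⟩` is absolutely summable. Summing over `i` first gives `⟨bₙ,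
aₙ⟩` by Parseval, summing over `n` first gives `⟨eᵢ, T eᵢ⟩`; so the trace depends neither on the
basis nor on the representation. -/
theorem IsRep.hasSum_basis {ι κ : Type*} {T : H →L[ℂ] H} {a b : ι → H} (h : IsRep T a b)
    (e : HilbertBasis κ ℂ H) :
    HasSum (fun i => (inner ℂ (e i) (T (e i)) : ℂ)) (∑' n, (inner ℂ (b n) (a n) : ℂ)) := by
  set f : ι × κ → ℂ := fun p => inner ℂ (b p.1) (e p.2) * inner ℂ (e p.2) (a p.1)
  have hf : Summable f := by
    refine Summable.of_norm ?_
    refine (summable_prod_of_nonneg fun p => norm_nonneg _).mpr ⟨fun n => ?_, ?_⟩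
    · exact (tsum_norm_inner_mul_le e (b n) (a n)).1
    · refine Summable.of_nonneg_of_le (fun n => tsum_nonneg fun i => norm_nonneg _) (fun n => ?_)
        h.summable
      rw [mul_comm]
      exact (tsum_norm_inner_mul_le e (b n) (a n)).2
  have h1 : HasSum f (∑' n, (inner ℂ (b n) (a n) : ℂ)) := by
    have h2 := hf.hasSum
    have h3 := h2.prod_fiberwise fun n => e.hasSum_inner_mul_inner (b n) (a n)
    rw [h3.tsum_eq]
    exact h2
  have h4 : HasSum (f ∘ Prod.swap) (∑' n, (inner ℂ (b n) (a n) : ℂ)) :=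
    (Equiv.prodComm κ ι).hasSum_iff.mpr h1
  refine h4.prod_fiberwise fun i => ?_
  have h5 := (h.hasSum (e i)).mapL (innerSL ℂ (e i))
  refine h5.congr_fun fun n => ?_
  simp [f]

/-- A Hilbert basis of the space. -/
def stdIndex (H : Type) [NormedAddCommGroup H] [InnerProductSpace ℂ H] [CompleteSpace H] : Set H :=
  (exists_hilbertBasis ℂ H).choose

/-- A Hilbert basis of the space. -/
def stdBasis (H : Type) [NormedAddCommGroup H] [InnerProductSpace ℂ H] [CompleteSpace H] :
    HilbertBasis (stdIndex H) ℂ H :=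
  (exists_hilbertBasis ℂ H).choose_spec.choose

variable [CompleteSpace H] [CompleteSpace K] [CompleteSpace G]

/-- The trace of a trace class operator. -/
def tr (T : H →L[ℂ] H) : ℂ := ∑' i, inner ℂ (stdBasis H i) (T (stdBasis H i))

theorem IsRep.tr_eq {ι : Type*} {T : H →L[ℂ] H} {a b : ι → H} (h : IsRep T a b) :
    tr T = ∑' n, (inner ℂ (b n) (a n) : ℂ) :=
  (h.hasSum_basis (stdBasis H)).tsum_eq

theorem IsTraceClass.hasTrace {T : H →L[ℂ] H} (h : IsTraceClass T) :
    HasTrace (ofCLM T) (tr T) := by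
  refine ⟨T, rfl, h, fun ι e => ?_⟩
  obtain ⟨a, b, hab⟩ := isTraceClass_iff.mp h
  rw [hab.tr_eq]
  exact hab.hasSum_basis e

theorem IsRep.comp {ι : Type*} {T : H →L[ℂ] H} {a b : ι → H} (h : IsRep T a b) (U : H →L[ℂ] K)
    (V : K →L[ℂ] H) : IsRep (U ∘L T ∘L V) (fun n => U (a n)) (fun n => V.adjoint (b n)) where
  summable := by
    refine Summable.of_nonneg_of_le (fun n => by positivity) (fun n => ?_)
      (h.summable.mul_left (‖U‖ * ‖V.adjoint‖))
    calc _ ≤ (‖U‖ * ‖a n‖) * (‖V.adjoint‖ * ‖b n‖) := by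
          gcongr
          · exact U.le_opNorm _
          · exact V.adjoint.le_opNorm _
      _ = _ := by ring
  hasSum ψ := by
    have := (h.hasSum (V ψ)).mapL U
    refine this.congr_fun fun n => ?_
    rw [map_smul, ContinuousLinearMap.adjoint_inner_left]

theorem IsTraceClass.comp {T : H →L[ℂ] H} (h : IsTraceClass T) (U : H →L[ℂ] K) (V : K →L[ℂ] H) :
    IsTraceClass (U ∘L T ∘L V) := by
  obtain ⟨a, b, hab⟩ := isTraceClass_iff.mp h
  exact (hab.comp U V).isTraceClass

/-- Cyclicity: both sides are `∑ ⟨bₙ, V U aₙ⟩`. Two different spaces are allowed because this is how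
traces on `L²(𝒳)` are moved to the fibre space. -/
theorem IsTraceClass.tr_comp {T : H →L[ℂ] H} (h : IsTraceClass T) (U : H →L[ℂ] K)
    (V : K →L[ℂ] H) : tr (U ∘L T ∘L V) = tr (T ∘L (V ∘L U)) := by
  obtain ⟨a, b, hab⟩ := isTraceClass_iff.mp h
  have h1 := (hab.comp (ContinuousLinearMap.id ℂ H) (V ∘L U)).tr_eq
  rw [ContinuousLinearMap.id_comp] at h1
  rw [h1, (hab.comp U V).tr_eq]
  refine tsum_congr fun n => ?_
  simp [ContinuousLinearMap.adjoint_inner_left]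

theorem IsTraceClass.tr_mul_comm {T : H →L[ℂ] H} (h : IsTraceClass T) (U : H →L[ℂ] H) :
    tr (U ∘L T) = tr (T ∘L U) := by
  have := h.tr_comp U (ContinuousLinearMap.id ℂ H)
  rwa [ContinuousLinearMap.comp_id, ContinuousLinearMap.id_comp] at this

theorem IsTraceClass.add {T S : H →L[ℂ] H} (h : IsTraceClass T) (h' : IsTraceClass S) :
    IsTraceClass (T + S) := by
  obtain ⟨a, b, hab⟩ := isTraceClass_iff.mp h
  obtain ⟨a', b', hab'⟩ := isTraceClass_iff.mp h'
  have h1 : Summable fun n : ℕ ⊕ ℕ => ‖Sum.elim a a' n‖ * ‖Sum.elim b b' n‖ :=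
    Summable.sum _ hab.summable hab'.summable
  have h2 : ∀ ψ, HasSum (fun n : ℕ ⊕ ℕ => (inner ℂ (Sum.elim b b' n) ψ : ℂ) • Sum.elim a a' n)
      (T ψ + S ψ) := fun ψ => by
    refine HasSum.sum ?_ ?_
    · exact hab.hasSum ψ
    · exact hab'.hasSum ψ
  exact IsRep.isTraceClass ⟨h1, h2⟩

theorem isTraceClass_zero : IsTraceClass (0 : H →L[ℂ] H) :=
  isTraceClass_iff.mpr ⟨0, 0, by simp, fun ψ => by simp⟩

theorem IsTraceClass.smul {T : H →L[ℂ] H} (h : IsTraceClass T) (c : ℂ) :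
    IsTraceClass (c • T) := by
  have h1 : c • T = (c • ContinuousLinearMap.id ℂ H) ∘L T ∘L ContinuousLinearMap.id ℂ H := rfl
  rw [h1]
  exact h.comp _ _

theorem IsTraceClass.sum {ι : Type*} {s : Finset ι} {T : ι → H →L[ℂ] H}
    (h : ∀ i ∈ s, IsTraceClass (T i)) : IsTraceClass (∑ i ∈ s, T i) :=
  Finset.sum_induction _ _ (fun _ _ => IsTraceClass.add) isTraceClass_zero h

theorem IsTraceClass.summable {T : H →L[ℂ] H} (h : IsTraceClass T) :
    Summable fun i => (inner ℂ (stdBasis H i) (T (stdBasis H i)) : ℂ) := by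
  obtain ⟨a, b, hab⟩ := isTraceClass_iff.mp h
  exact (hab.hasSum_basis (stdBasis H)).summable

theorem tr_add {T S : H →L[ℂ] H} (h : IsTraceClass T) (h' : IsTraceClass S) :
    tr (T + S) = tr T + tr S := by
  rw [tr, tr, tr, ← h.summable.tsum_add h'.summable]
  exact tsum_congr fun i => by simp

theorem tr_smul (T : H →L[ℂ] H) (c : ℂ) : tr (c • T) = c * tr T := by
  rw [tr, tr, ← tsum_mul_left]
  exact tsum_congr fun i => by simp

theorem tr_zero : tr (0 : H →L[ℂ] H) = 0 := by simp [tr]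

theorem tr_sum {ι : Type*} {s : Finset ι} {T : ι → H →L[ℂ] H}
    (h : ∀ i ∈ s, IsTraceClass (T i)) : tr (∑ i ∈ s, T i) = ∑ i ∈ s, tr (T i) := by
  classical
  induction s using Finset.induction_on with
  | empty => simp [tr_zero]
  | insert i s hi ih =>
    have h1 := fun j hj => h j (Finset.mem_insert_of_mem hj)
    rw [Finset.sum_insert hi, Finset.sum_insert hi,
      tr_add (h i (Finset.mem_insert_self i s)) (IsTraceClass.sum h1), ih h1]

/-- The constant is `∑ ‖aₙ‖ ‖bₙ‖` for any representation. It controls the boundary error in the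
trace per unit volume. -/
theorem IsTraceClass.exists_norm_tr_le {T : H →L[ℂ] H} (h : IsTraceClass T) :
    ∃ c, ∀ U : H →L[ℂ] H, ‖tr (U ∘L T)‖ ≤ c * ‖U‖ := by
  obtain ⟨a, b, hab⟩ := isTraceClass_iff.mp h
  refine ⟨∑' n, ‖a n‖ * ‖b n‖, fun U => ?_⟩
  have h1 := hab.comp U (ContinuousLinearMap.id ℂ H)
  rw [ContinuousLinearMap.comp_id] at h1
  rw [h1.tr_eq, mul_comm, ← tsum_mul_left]
  refine tsum_of_norm_bounded (hab.summable.mul_left _).hasSum fun n => ?_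
  have : ∀ ψ, (ContinuousLinearMap.id ℂ H).adjoint ψ = ψ := fun ψ =>
    ext_inner_right ℂ fun φ => by
      rw [ContinuousLinearMap.adjoint_inner_left, ContinuousLinearMap.id_apply]
  rw [this]
  calc _ ≤ ‖b n‖ * ‖U (a n)‖ := norm_inner_le_norm _ _
    _ ≤ ‖b n‖ * (‖U‖ * ‖a n‖) := by gcongr; exact U.le_opNorm _
    _ = _ := by ring

/-! ### Hilbert-Schmidt operators -/

/-- The square of the Hilbert-Schmidt norm. -/
def hs (X : H →L[ℂ] K) : ℝ≥0∞ := ∑' i, ‖X (stdBasis H i)‖ₑ ^ 2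

theorem tsum_enorm_inner_sq {κ : Type*} (e : HilbertBasis κ ℂ H) (x : H) :
    ∑' i, ‖(inner ℂ (e i) x : ℂ)‖ₑ ^ 2 = ‖x‖ₑ ^ 2 := by
  have h1 := e.hasSum_inner_mul_inner x x
  have h2 : HasSum (fun i => ‖(inner ℂ (e i) x : ℂ)‖ ^ 2) (‖x‖ ^ 2) := by
    have h3 := h1.mapL Complex.reCLM
    have h4 : Complex.reCLM (inner ℂ x x) = ‖x‖ ^ 2 := by
      rw [Complex.reCLM_apply, ← inner_self_eq_norm_sq (𝕜 := ℂ) x]; rfl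
    rw [h4] at h3
    refine h3.congr_fun fun i => ?_
    have h5 := inner_mul_symm_re_eq_norm (𝕜 := ℂ) x (e i)
    rw [norm_mul, norm_inner_symm, ← sq] at h5
    exact h5.symm
  have h3 := ENNReal.ofReal_tsum_of_nonneg (fun i => sq_nonneg ‖(inner ℂ (e i) x : ℂ)‖) h2.summable
  rw [h2.tsum_eq, ENNReal.ofReal_pow (norm_nonneg _), ofReal_norm] at h3
  rw [h3]
  exact tsum_congr fun i => by rw [ENNReal.ofReal_pow (norm_nonneg _), ofReal_norm]

/-- Parseval in each basis, and an exchange of sums that is unconditional in `[0, ∞]`. -/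
theorem tsum_enorm_sq_adjoint {κ κ' : Type*} (e : HilbertBasis κ ℂ H) (f : HilbertBasis κ' ℂ K)
    (X : H →L[ℂ] K) : ∑' i, ‖X (e i)‖ₑ ^ 2 = ∑' n, ‖X.adjoint (f n)‖ₑ ^ 2 := by
  simp_rw [← tsum_enorm_inner_sq f, ← tsum_enorm_inner_sq e]
  rw [ENNReal.tsum_comm]
  refine tsum_congr fun n => tsum_congr fun i => ?_
  rw [← ContinuousLinearMap.adjoint_inner_left, ← inner_conj_symm, RCLike.enorm_conj]

theorem hs_adjoint (X : H →L[ℂ] K) : hs X.adjoint = hs X :=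
  (tsum_enorm_sq_adjoint (stdBasis H) (stdBasis K) X).symm

theorem summable_of_hs {X : H →L[ℂ] K} (h : hs X ≠ ⊤) :
    Summable fun i => ‖X (stdBasis H i)‖ ^ 2 := by
  have := ENNReal.summable_toReal h
  simpa using this

theorem tsum_of_hs (X : H →L[ℂ] K) : ∑' i, ‖X (stdBasis H i)‖ ^ 2 = (hs X).toReal := by
  rw [hs, ENNReal.tsum_toReal_eq fun i => by finiteness]
  exact tsum_congr fun i => by simp

theorem isRep_of_hs {X Y : H →L[ℂ] K} (hX : hs X ≠ ⊤) (hY : hs Y ≠ ⊤) :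
    IsRep (X ∘L Y.adjoint) (fun i => X (stdBasis H i)) (fun i => Y (stdBasis H i)) where
  summable := by
    refine Summable.of_nonneg_of_le (fun i => by positivity) (fun i => ?_)
      ((summable_of_hs hX).add (summable_of_hs hY))
    nlinarith [sq_nonneg (‖X (stdBasis H i)‖ - ‖Y (stdBasis H i)‖),
      sq_nonneg ‖X (stdBasis H i)‖, sq_nonneg ‖Y (stdBasis H i)‖]
  hasSum ψ := by
    have := ((stdBasis H).hasSum_repr (Y.adjoint ψ)).mapL X
    refine this.congr_fun fun i => ?_
    rw [map_smul, HilbertBasis.repr_apply_apply, ContinuousLinearMap.adjoint_inner_right]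

theorem isTraceClass_of_hs {X Y : H →L[ℂ] K} (hX : hs X ≠ ⊤) (hY : hs Y ≠ ⊤) :
    IsTraceClass (X ∘L Y.adjoint) :=
  (isRep_of_hs hX hY).isTraceClass

/-- Cauchy-Schwarz for `∑ ⟨Y eᵢ, X eᵢ⟩`. The explicit product of bounds is what later makes the
trace a bounded bilinear form. -/
theorem norm_tr_le_of_hs {X Y : H →L[ℂ] K} {x y : ℝ} (hx : 0 ≤ x) (hy : 0 ≤ y)
    (hX : hs X ≤ ENNReal.ofReal (x ^ 2)) (hY : hs Y ≤ ENNReal.ofReal (y ^ 2)) :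
    ‖tr (X ∘L Y.adjoint)‖ ≤ x * y := by
  have hX' : hs X ≠ ⊤ := ne_top_of_le_ne_top ENNReal.ofReal_ne_top hX
  have hY' : hs Y ≠ ⊤ := ne_top_of_le_ne_top ENNReal.ofReal_ne_top hY
  rw [(isRep_of_hs hX' hY').tr_eq]
  have h1 : ‖∑' i, (inner ℂ (Y (stdBasis H i)) (X (stdBasis H i)) : ℂ)‖
      ≤ ∑' i, ‖X (stdBasis H i)‖ * ‖Y (stdBasis H i)‖ :=
    tsum_of_norm_bounded (isRep_of_hs hX' hY').summable.hasSum fun i => by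
      rw [mul_comm]; exact norm_inner_le_norm _ _
  refine h1.trans ((isRep_of_hs hX' hY').summable.tsum_le_of_sum_le fun s => ?_)
  have hb : ∀ (Z : H →L[ℂ] K) (z : ℝ), hs Z ≤ ENNReal.ofReal (z ^ 2) →
      ∑ i ∈ s, ‖Z (stdBasis H i)‖ ^ 2 ≤ z ^ 2 := by
    intro Z z hz
    have hz' : hs Z ≠ ⊤ := ne_top_of_le_ne_top ENNReal.ofReal_ne_top hz
    refine ((summable_of_hs hz').sum_le_tsum s fun i _ => by positivity).trans ?_
    rw [tsum_of_hs]
    exact ENNReal.toReal_le_of_le_ofReal (by positivity) hz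
  refine abs_le_of_sq_le_sq' ?_ (by positivity) |>.2
  rw [mul_pow]
  refine (Finset.sum_mul_sq_le_sq_mul_sq s _ _).trans ?_
  gcongr
  · exact hb X x hX
  · exact hb Y y hY

/-- Expanding `X ψ` in an orthonormal basis `f` of `V`, each `f m` contributes `‖X* f m‖² ≤ ‖X‖²` by
Parseval. -/
theorem tsum_enorm_sq_le_finrank {κ : Type*} (e : HilbertBasis κ ℂ H) (X : H →L[ℂ] K)
    (V : Submodule ℂ K) [FiniteDimensional ℂ V] (hV : ∀ ψ, X ψ ∈ V) :
    ∑' i, ‖X (e i)‖ₑ ^ 2 ≤ Module.finrank ℂ V * ‖X‖ₑ ^ 2 := by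
  set f := stdOrthonormalBasis ℂ V
  have h1 : ∀ ψ, ‖X ψ‖ₑ ^ 2 = ∑ m, ‖(inner ℂ (X.adjoint (f m : K)) ψ : ℂ)‖ₑ ^ 2 := by
    intro ψ
    have h2 := f.sum_sq_norm_inner_right ⟨X ψ, hV ψ⟩
    have h3 : ‖X ψ‖ₑ ^ 2 = ENNReal.ofReal (‖(⟨X ψ, hV ψ⟩ : V)‖ ^ 2) := by
      rw [ENNReal.ofReal_pow (norm_nonneg _), Submodule.coe_norm, ofReal_norm]
    rw [h3, ← h2, ENNReal.ofReal_sum_of_nonneg fun m _ => by positivity]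
    refine Finset.sum_congr rfl fun m _ => ?_
    rw [ENNReal.ofReal_pow (norm_nonneg _), ofReal_norm, ContinuousLinearMap.adjoint_inner_left]
    rfl
  simp_rw [h1]
  rw [Summable.tsum_finsetSum fun m _ => ENNReal.summable]
  have h4 : ∀ m, ∑' i, ‖(inner ℂ (X.adjoint (f m : K)) (e i) : ℂ)‖ₑ ^ 2 ≤ ‖X‖ₑ ^ 2 := by
    intro m
    have h5 : ∑' i, ‖(inner ℂ (X.adjoint (f m : K)) (e i) : ℂ)‖ₑ ^ 2
        = ‖X.adjoint (f m : K)‖ₑ ^ 2 := by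
      rw [← tsum_enorm_inner_sq e]
      refine tsum_congr fun i => ?_
      rw [← inner_conj_symm, RCLike.enorm_conj]
    rw [h5]
    gcongr
    refine (X.adjoint.le_opENorm _).trans ?_
    have h6 : ‖(f m : K)‖ₑ = 1 := by
      rw [← ofReal_norm, ← Submodule.coe_norm, f.orthonormal.1 m, ENNReal.ofReal_one]
    have h7 : ‖X.adjoint‖ₑ = ‖X‖ₑ := by
      rw [← ofReal_norm, ← ofReal_norm, LinearIsometryEquiv.norm_map]
    rw [h6, h7, mul_one]
  refine (Finset.sum_le_sum fun m _ => h4 m).trans ?_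
  simp

end TraceClass

end UCC

end

/-! ### Decomposition of `L²(𝒳)` along translates of the fundamental domain, and traces of periodic
operators. -/

noncomputable section

namespace UCC

/-! ### Shortcut instances -/

section Instances

variable {d N : ℕ} (C : Crystal d N)

scoped instance : NormedAddCommGroup C.Hil := inferInstance
scoped instance : NormedSpace ℂ C.Hil := inferInstance
scoped instance : SeminormedAddCommGroup C.Hil := inferInstance
scoped instance : AddCommGroup C.Hil := inferInstance
scoped instance : AddCommMonoid C.Hil := inferInstance
scoped instance : TopologicalSpace C.Hil := inferInstance
scoped instance : UniformSpace C.Hil := inferInstance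
scoped instance : Module ℂ C.Hil := inferInstance

scoped instance : NormedAddCommGroup (C.Hil →L[ℂ] C.Hil) := inferInstance
scoped instance : NormedSpace ℂ (C.Hil →L[ℂ] C.Hil) := inferInstance
scoped instance : SeminormedAddCommGroup (C.Hil →L[ℂ] C.Hil) := inferInstance
scoped instance : AddCommGroup (C.Hil →L[ℂ] C.Hil) := inferInstance
scoped instance : AddCommMonoid (C.Hil →L[ℂ] C.Hil) := inferInstance
scoped instance : TopologicalSpace (C.Hil →L[ℂ] C.Hil) := inferInstance
scoped instance : Module ℂ (C.Hil →L[ℂ] C.Hil) := inferInstance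

scoped instance : NormedAddCommGroup C.Fib := inferInstance
scoped instance : NormedSpace ℂ C.Fib := inferInstance
scoped instance : NormedSpace ℝ C.Fib := inferInstance
scoped instance : SeminormedAddCommGroup C.Fib := inferInstance
scoped instance : AddCommGroup C.Fib := inferInstance
scoped instance : AddCommMonoid C.Fib := inferInstance
scoped instance : TopologicalSpace C.Fib := inferInstance
scoped instance : UniformSpace C.Fib := inferInstance
scoped instance : Module ℂ C.Fib := inferInstance
scoped instance : Module ℝ C.Fib := inferInstance

scoped instance : NormedAddCommGroup (C.Fib →L[ℂ] C.Fib) := inferInstance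
scoped instance : NormedSpace ℂ (C.Fib →L[ℂ] C.Fib) := inferInstance
scoped instance : NormedSpace ℝ (C.Fib →L[ℂ] C.Fib) := inferInstance
scoped instance : SeminormedAddCommGroup (C.Fib →L[ℂ] C.Fib) := inferInstance
scoped instance : AddCommGroup (C.Fib →L[ℂ] C.Fib) := inferInstance
scoped instance : AddCommMonoid (C.Fib →L[ℂ] C.Fib) := inferInstance
scoped instance : TopologicalSpace (C.Fib →L[ℂ] C.Fib) := inferInstance
scoped instance : UniformSpace (C.Fib →L[ℂ] C.Fib) := inferInstance
scoped instance : Module ℂ (C.Fib →L[ℂ] C.Fib) := inferInstance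
scoped instance : Module ℝ (C.Fib →L[ℂ] C.Fib) := inferInstance

end Instances

/-! ### Lattices -/

/-- The coordinates of the lattice vectors. -/
def latEquiv {d : ℕ} (b : Module.Basis (Fin d) ℝ (Space d)) : (Fin d → ℤ) ≃ lattice b :=
  (b.restrictScalars ℤ).equivFun.symm.toEquiv

theorem latEquiv_apply {d : ℕ} (b : Module.Basis (Fin d) ℝ (Space d)) (n : Fin d → ℤ) :
    (latEquiv b n : Space d) = ∑ l, (n l : ℝ) • b l := by
  have : latEquiv b n = ∑ l, n l • (b.restrictScalars ℤ) l := by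
    change (b.restrictScalars ℤ).equivFun.symm n = _
    rw [Module.Basis.equivFun_symm_apply]
  rw [this]
  simp [Int.cast_smul_eq_zsmul]

theorem repr_latEquiv {d : ℕ} (b : Module.Basis (Fin d) ℝ (Space d)) (n : Fin d → ℤ) (l : Fin d) :
    b.repr (latEquiv b n) l = n l := by
  rw [latEquiv_apply, b.repr_sum_self]

instance {d : ℕ} (b : Module.Basis (Fin d) ℝ (Space d)) : Countable (lattice b) :=
  (latEquiv b).symm.injective.countable

namespace Crystal

variable {d N : ℕ} (C : Crystal d N)

theorem measurableSet_fund : MeasurableSet C.fund := ZSpan.fundamentalDomain_measurableSet C.a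

theorem isBounded_fund : Bornology.IsBounded C.fund := ZSpan.fundamentalDomain_isBounded C.a

theorem mu_lt_top {s : Set (Space d)} (hs : Bornology.IsBounded s) : C.mu s < ⊤ := by
  refine (measure_mono subset_closure).trans_lt ?_
  have hc : Bornology.IsBounded (closure s) := hs.closure
  have ha := C.admissible
  unfold Crystal.mu
  cases hC : C.config with
  | continuum =>
    change (volume : Measure (Space d)) _ < ⊤
    exact hc.measure_lt_top
  | discrete X =>
    rw [hC] at ha
    change (Measure.count.restrict X) (closure s) < ⊤
    rw [Measure.restrict_apply isClosed_closure.measurableSet, Set.inter_comm]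
    exact Measure.count_apply_lt_top.mpr (ha.2 _ hc)

/-- Needed to divide by the volume of a cell. In a discrete model a point of `𝒳` is moved into the
fundamental domain by a lattice vector, which leaves `𝒳` invariant. -/
theorem mu_fund_ne_zero : C.mu C.fund ≠ 0 := by
  have ha := C.admissible
  have ht := C.translate
  unfold Crystal.mu
  cases hC : C.config with
  | continuum =>
    change (volume : Measure (Space d)) _ ≠ 0
    exact ZSpan.measure_fundamentalDomain_ne_zero C.a
  | discrete X =>
    rw [hC] at ha ht
    change (Measure.count.restrict X) C.fund ≠ 0
    rw [Measure.restrict_apply C.measurableSet_fund]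
    obtain ⟨x, hx⟩ := ha.1
    have h1 : ZSpan.fract C.a x ∈ C.fund ∩ X := by
      refine ⟨ZSpan.fract_mem_fundamentalDomain C.a x, ?_⟩
      have := ht (-(ZSpan.floor C.a x)) (C.Lat.neg_mem (ZSpan.floor C.a x).2) x hx
      rwa [← sub_eq_add_neg] at this
    rw [Measure.count_ne_zero_iff]
    exact ⟨_, h1⟩

instance : IsFiniteMeasure (C.mu.restrict C.fund) :=
  ⟨by rw [Measure.restrict_apply_univ]; exact C.mu_lt_top C.isBounded_fund⟩

theorem exists_unique_sub_mem (x : Space d) : ∃! γ : C.Lat, x - γ ∈ C.fund := by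
  obtain ⟨v, hv, hu⟩ := ZSpan.exist_unique_vadd_mem_fundamentalDomain C.a x
  refine ⟨-v, ?_, fun w hw => ?_⟩
  · have : x - ((-v : C.Lat) : Space d) = v +ᵥ x := by
      rw [Submodule.vadd_def, vadd_eq_add]; push_cast; abel
    change x - ((-v : C.Lat) : Space d) ∈ _
    rw [this]; exact hv
  · have h1 := hu (-w) (by
      have : (-w : C.Lat) +ᵥ x = x - (w : Space d) := by
        rw [Submodule.vadd_def, vadd_eq_add]; push_cast; abel
      change (-w : C.Lat) +ᵥ x ∈ _
      rw [this]; exact hw)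
    exact neg_eq_iff_eq_neg.mp h1

variable {C} in
theorem eq_of_sub_mem {x : Space d} {γ γ' : C.Lat} (h : x - γ ∈ C.fund) (h' : x - γ' ∈ C.fund) :
    γ = γ' :=
  (C.exists_unique_sub_mem x).unique h h'

theorem ae_of_ae_fund {p : Space d → Prop}
    (h : ∀ γ : C.Lat, ∀ᵐ x ∂C.mu.restrict C.fund, p (x - (γ : Space d))) : ∀ᵐ x ∂C.mu, p x := by
  have h1 : ∀ γ : C.Lat, ∀ᵐ x ∂C.mu, x + (γ : Space d) ∈ C.fund → p x := by
    intro γ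
    have h2 := (ae_restrict_iff' C.measurableSet_fund).mp (h γ)
    filter_upwards [(C.measurePreserving_translate (-γ)).quasiMeasurePreserving.ae h2] with x hx hxγ
    have e : x - ((-γ : C.Lat) : Space d) = x + γ := by push_cast; abel
    rw [e] at hx
    simpa using hx hxγ
  filter_upwards [ae_all_iff.mpr h1] with x hx
  obtain ⟨γ, hγ, -⟩ := C.exists_unique_sub_mem x
  exact hx (-γ) (by push_cast; rwa [← sub_eq_add_neg])

/-! ### Magnetic translations -/

theorem T_coe (γ : C.Lat) (ψ : C.Hil) : ∀ᵐ x ∂C.mu, C.T γ ψ x = C.M γ x (ψ (x - γ)) :=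
  MemLp.coeFn_toLp (memLp_comp (C.M_measurable γ) (C.M_unitary γ)
    (C.measurePreserving_translate γ) ψ)

theorem norm_T (γ : C.Lat) (ψ : C.Hil) : ‖C.T γ ψ‖ = ‖ψ‖ :=
  by
  rw [T, weightedComp, LinearIsometry.coe_toContinuousLinearMap, LinearIsometry.norm_map]

theorem T_T (γ₁ γ₂ : C.Lat) (ψ : C.Hil) : C.T γ₂ (C.T γ₁ ψ) = C.T (γ₁ + γ₂) ψ := by
  refine Lp.ext ?_
  filter_upwards [C.T_coe γ₂ (C.T γ₁ ψ), C.T_coe (γ₁ + γ₂) ψ, C.cocycle γ₁ γ₂,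
    (C.measurePreserving_translate γ₂).quasiMeasurePreserving.ae (C.T_coe γ₁ ψ)] with x h1 h2 h3 h4
  rw [h1, h2, h3, h4, ContinuousLinearMap.comp_apply]
  congr 3
  push_cast
  abel

/-- No normalization of the cocycle at `γ = 0` is assumed: the cocycle identity makes `T 0`
idempotent, and an idempotent isometry is the identity. -/
theorem T_zero (ψ : C.Hil) : C.T 0 ψ = ψ := by
  have h := C.T_T 0 0 ψ
  rw [add_zero] at h
  rw [← sub_eq_zero, ← norm_eq_zero, ← C.norm_T 0, map_sub, h, sub_self, norm_zero]

theorem T_T_neg (γ : C.Lat) (ψ : C.Hil) : C.T γ (C.T (-γ) ψ) = ψ := by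
  rw [T_T, neg_add_cancel, T_zero]

theorem T_adjoint (γ : C.Lat) : (C.T γ).adjoint = C.T (-γ) := by
  ext1 ψ
  have h := (C.T γ).norm_map_iff_adjoint_comp_self.mp (C.norm_T γ)
  have h1 := congrArg (fun U : C.Hil →L[ℂ] C.Hil => U (C.T (-γ) ψ)) h
  simpa [C.T_T_neg γ ψ] using h1

/-! ### Restriction to the fundamental domain -/

/-- Restriction of functions to the fundamental domain. -/
def res : C.Hil →L[ℂ] C.Fib := LpToLpRestrictCLM (Space d) (Spin N) ℂ C.mu 2 C.fund

theorem res_coe (ψ : C.Hil) : ∀ᵐ x ∂C.mu.restrict C.fund, C.res ψ x = ψ x :=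
  LpToLpRestrictCLM_coeFn ℂ C.fund ψ

theorem res_surjective : Function.Surjective C.res := by
  intro φ
  have h := (memLp_indicator_iff_restrict C.measurableSet_fund).mpr (Lp.memLp φ)
  refine ⟨h.toLp _, Lp.ext ?_⟩
  filter_upwards [C.res_coe (h.toLp _), ae_restrict_of_ae h.coeFn_toLp,
    ae_restrict_mem C.measurableSet_fund] with x h1 h2 h3
  rw [h1, h2, Set.indicator_of_mem h3]

/-- Extension by zero of functions on the fundamental domain. -/
def ext : C.Fib →L[ℂ] C.Hil := C.res.adjoint

/-- The indicator function of a set, with complex values. -/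
abbrev ind (Ω : Set (Space d)) : Space d → ℂ := Ω.indicator fun _ => 1

variable {C} in
theorem memLp_ind {ν : Measure (Space d)} {Ω : Set (Space d)} (h : MeasurableSet Ω) :
    MemLp (ind Ω) ⊤ ν :=
  (memLp_top_const (μ := ν) (1 : ℂ)).indicator h

theorem ext_res : C.ext ∘L C.res = mulB (Spin N) C.mu (ind C.fund) := by
  ext1 ψ
  refine ext_inner_left ℂ fun φ => ?_
  rw [ext, ContinuousLinearMap.comp_apply, ContinuousLinearMap.adjoint_inner_right, L2.inner_def,
    L2.inner_def, ← integral_indicator C.measurableSet_fund]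
  have h1 : ∀ᵐ x ∂C.mu, x ∈ C.fund →
      inner ℂ (C.res φ x) (C.res ψ x) = inner ℂ (φ x) (ψ x) := by
    rw [← ae_restrict_iff' C.measurableSet_fund]
    filter_upwards [C.res_coe ψ, C.res_coe φ] with x h1 h2
    rw [h1, h2]
  refine integral_congr_ae ?_
  filter_upwards [h1, mulB_coe (E := Spin N) (memLp_ind (ν := C.mu) C.measurableSet_fund) ψ]
    with x h1 h2
  rw [h2]
  by_cases hx : x ∈ C.fund
  · rw [Set.indicator_of_mem hx, h1 hx, ind, Set.indicator_of_mem hx, one_smul]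
  · rw [Set.indicator_of_notMem hx, ind, Set.indicator_of_notMem hx, zero_smul, inner_zero_right]

theorem res_mulB {g : Space d → ℂ} (h : MemLp g ⊤ C.mu) (ψ : C.Hil) :
    C.res (mulB (Spin N) C.mu g ψ) = mulB (Spin N) (C.mu.restrict C.fund) g (C.res ψ) := by
  symm
  refine mulB_eq_of_ae (h.restrict _) ?_
  filter_upwards [C.res_coe (mulB (Spin N) C.mu g ψ), C.res_coe ψ,
    ae_restrict_of_ae (mulB_coe h ψ)] with x h1 h2 h3
  rw [h1, h2, h3]

theorem res_ext (φ : C.Fib) : C.res (C.ext φ) = φ := by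
  obtain ⟨ψ, rfl⟩ := C.res_surjective φ
  have h := congrArg (fun U : C.Hil →L[ℂ] C.Hil => U ψ) C.ext_res
  simp only [ContinuousLinearMap.comp_apply] at h
  rw [h, C.res_mulB (memLp_ind C.measurableSet_fund)]
  refine mulB_eq_of_ae (memLp_ind C.measurableSet_fund) ?_
  filter_upwards [ae_restrict_mem C.measurableSet_fund] with x hx
  rw [ind, Set.indicator_of_mem hx, one_smul]

theorem mulB_ext {g : Space d → ℂ} (h : MemLp g ⊤ C.mu) (φ : C.Fib) :
    mulB (Spin N) C.mu g (C.ext φ) = C.ext (mulB (Spin N) (C.mu.restrict C.fund) g φ) := by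
  refine ext_inner_right ℂ fun ψ => ?_
  have h' : MemLp (fun x => star (g x)) ⊤ C.mu := h.star
  have e1 : (fun x => star (star (g x))) = g := by funext x; rw [star_star]
  have h1 : (mulB (Spin N) C.mu fun x => star (g x)).adjoint = mulB (Spin N) C.mu g :=
    (mulB_adjoint h').trans (congrArg _ e1)
  have h2 : (mulB (Spin N) (C.mu.restrict C.fund) fun x => star (g x)).adjoint =
      mulB (Spin N) (C.mu.restrict C.fund) g :=
    (mulB_adjoint (h'.restrict C.fund)).trans (congrArg _ e1)
  have e2 : ∀ ψ φ, (inner ℂ (C.ext φ) ψ : ℂ) = inner ℂ φ (C.res ψ) := fun ψ φ =>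
    ContinuousLinearMap.adjoint_inner_left _ _ _
  rw [← h1, ContinuousLinearMap.adjoint_inner_left, e2, C.res_mulB h', e2, ← h2,
    ContinuousLinearMap.adjoint_inner_left]

theorem memLp_comp_sub {g : Space d → ℂ} (h : MemLp g ⊤ C.mu) (γ : C.Lat) :
    MemLp (fun x => g (x - γ)) ⊤ C.mu :=
  h.comp_measurePreserving (C.measurePreserving_translate γ)

theorem memLp_comp_add {g : Space d → ℂ} (h : MemLp g ⊤ C.mu) (γ : C.Lat) :
    MemLp (fun x => g (x + γ)) ⊤ C.mu := by
  have := C.memLp_comp_sub h (-γ)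
  push_cast at this
  simpa only [sub_neg_eq_add] using this

theorem T_mulB {g : Space d → ℂ} (h : MemLp g ⊤ C.mu) (γ : C.Lat) (ψ : C.Hil) :
    C.T γ (mulB (Spin N) C.mu g ψ) = mulB (Spin N) C.mu (fun x => g (x - γ)) (C.T γ ψ) := by
  symm
  refine mulB_eq_of_ae (C.memLp_comp_sub h γ) ?_
  filter_upwards [C.T_coe γ (mulB (Spin N) C.mu g ψ), C.T_coe γ ψ,
    (C.measurePreserving_translate γ).quasiMeasurePreserving.ae (mulB_coe h ψ)] with x h1 h2 h3
  rw [h1, h2, h3, map_smul]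

/-- The coefficient `(T_γ ψ)|_F`. -/
def coef (γ : C.Lat) : C.Hil →L[ℂ] C.Fib := C.res ∘L C.T γ

theorem coef_adjoint (γ : C.Lat) : (C.coef γ).adjoint = C.T (-γ) ∘L C.ext := by
  rw [coef, ContinuousLinearMap.adjoint_comp, T_adjoint, ext]

theorem coef_T (γ γ' : C.Lat) (ψ : C.Hil) : C.coef γ (C.T γ' ψ) = C.coef (γ' + γ) ψ := by
  rw [coef, ContinuousLinearMap.comp_apply, T_T]; rfl

theorem coef_coe (γ : C.Lat) (ψ : C.Hil) :
    ∀ᵐ x ∂C.mu.restrict C.fund, C.coef γ ψ x = C.M γ x (ψ (x - γ)) := by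
  filter_upwards [C.res_coe (C.T γ ψ), ae_restrict_of_ae (C.T_coe γ ψ)] with x h1 h2
  rw [← h2, ← h1]; rfl

theorem res_T_ext {γ : C.Lat} (hγ : γ ≠ 0) (φ : C.Fib) : C.res (C.T γ (C.ext φ)) = 0 := by
  obtain ⟨ψ, rfl⟩ := C.res_surjective φ
  have h := congrArg (fun U : C.Hil →L[ℂ] C.Hil => U ψ) C.ext_res
  simp only [ContinuousLinearMap.comp_apply] at h
  have hm := memLp_ind (ν := C.mu) C.measurableSet_fund
  rw [h, C.T_mulB hm, C.res_mulB (C.memLp_comp_sub hm γ)]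
  refine mulB_eq_of_ae ((C.memLp_comp_sub hm γ).restrict _) ?_
  filter_upwards [ae_restrict_mem C.measurableSet_fund,
    Lp.coeFn_zero (Spin N) 2 (C.mu.restrict C.fund)] with x hx h0
  have : x - γ ∉ C.fund := fun h1 => hγ (eq_of_sub_mem h1 (by simpa using hx))
  rw [ind, Set.indicator_of_notMem this, zero_smul, h0, Pi.zero_apply]

theorem coef_adjoint_self (γ : C.Lat) (φ : C.Fib) : C.coef γ ((C.coef γ).adjoint φ) = φ := by
  rw [coef_adjoint, coef, ContinuousLinearMap.comp_apply, ContinuousLinearMap.comp_apply,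
    C.T_T_neg, res_ext]

theorem coef_adjoint_of_ne {γ γ' : C.Lat} (h : γ ≠ γ') (φ : C.Fib) :
    C.coef γ ((C.coef γ').adjoint φ) = 0 := by
  rw [coef_adjoint, ContinuousLinearMap.comp_apply, coef_T]
  refine C.res_T_ext (fun h1 => h ?_) φ
  rwa [neg_add_eq_zero, eq_comm] at h1

theorem eq_zero_of_coef {ψ : C.Hil} (h : ∀ γ, C.coef γ ψ = 0) : ψ = 0 := by
  refine Lp.ext ?_
  have h0 := Lp.coeFn_zero (Spin N) 2 C.mu
  have h1 : ∀ᵐ x ∂C.mu, ψ x = 0 := by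
    refine C.ae_of_ae_fund fun γ => ?_
    have h2 := C.coef_coe γ ψ
    rw [h γ] at h2
    filter_upwards [h2, Lp.coeFn_zero (Spin N) 2 (C.mu.restrict C.fund)] with x h3 h4
    rw [← norm_eq_zero, ← ContinuousLinearMap.norm_map_of_mem_unitary (C.M_unitary γ x), ← h3, h4,
      Pi.zero_apply, norm_zero]
  filter_upwards [h0, h1] with x h2 h3
  rw [h2, h3, Pi.zero_apply]

/-- The isometric embedding of the fibre space as the functions supported in `F - γ`. -/
def emb (γ : C.Lat) : C.Fib →ₗᵢ[ℂ] C.Hil where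
  toLinearMap := (C.coef γ).adjoint
  norm_map' φ := by
    refine (ContinuousLinearMap.norm_map_iff_adjoint_comp_self _).mpr ?_ φ
    ext1 φ
    rw [ContinuousLinearMap.adjoint_adjoint]
    exact C.coef_adjoint_self γ φ

theorem emb_apply (γ : C.Lat) (φ : C.Fib) : C.emb γ φ = (C.coef γ).adjoint φ := rfl

/-- The pieces are orthogonal because the translates of the fundamental domain are disjoint, and
total because a function that vanishes on each translate is zero; here the unitarity of `M` is used.
-/
theorem isHilbertSum_emb : IsHilbertSum ℂ (fun _ : C.Lat => C.Fib) C.emb := by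
  refine IsHilbertSum.mk ?_ ?_
  · intro γ γ' h φ φ'
    rw [emb_apply, emb_apply, ContinuousLinearMap.adjoint_inner_left, C.coef_adjoint_of_ne h,
      inner_zero_right]
  · rw [top_le_iff, Submodule.topologicalClosure_eq_top_iff, Submodule.eq_bot_iff]
    intro ψ hψ
    refine C.eq_zero_of_coef fun γ => ?_
    refine ext_inner_left ℂ fun φ => ?_
    rw [inner_zero_right, ← ContinuousLinearMap.adjoint_inner_left]
    exact hψ _ (Submodule.mem_iSup_of_mem γ ⟨φ, rfl⟩)

/-! ### Traces of periodic operators -/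

/-- A periodic bounded operator whose matrix elements between the translates of the fundamental
domain are trace class. -/
structure IsLocTraceClass (A : C.Hil →L[ℂ] C.Hil) : Prop where
  comm : ∀ γ ψ, A (C.T γ ψ) = C.T γ (A ψ)
  traceClass : ∀ γ γ', IsTraceClass (C.coef γ ∘L A ∘L (C.coef γ').adjoint)

/-- The compression of an operator to the fundamental domain. -/
def cpr (A : C.Hil →L[ℂ] C.Hil) : C.Fib →L[ℂ] C.Fib := C.res ∘L A ∘L C.ext

variable {C} in
theorem IsLocTraceClass.coef_comp {A : C.Hil →L[ℂ] C.Hil} (hA : C.IsLocTraceClass A) (γ : C.Lat) :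
    C.coef γ ∘L A ∘L (C.coef γ).adjoint = C.cpr A := by
  ext1 φ
  rw [coef_adjoint, coef, cpr]
  simp only [ContinuousLinearMap.comp_apply]
  rw [hA.comm, C.T_T_neg]

variable {C} in
theorem IsLocTraceClass.traceClass_cpr {A : C.Hil →L[ℂ] C.Hil} (hA : C.IsLocTraceClass A) :
    IsTraceClass (C.cpr A) := by
  rw [← hA.coef_comp 0]; exact hA.traceClass 0 0

variable {C} in
theorem IsLocTraceClass.add {A B : C.Hil →L[ℂ] C.Hil} (hA : C.IsLocTraceClass A)
    (hB : C.IsLocTraceClass B) : C.IsLocTraceClass (A + B) where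
  comm γ ψ := by
    rw [add_apply, add_apply, hA.comm, hB.comm, map_add]
  traceClass γ γ' := by
    rw [ContinuousLinearMap.add_comp, ContinuousLinearMap.comp_add]
    exact (hA.traceClass γ γ').add (hB.traceClass γ γ')

open scoped Pointwise in
theorem exists_finset_cover {Ω : Set (Space d)} (h : Bornology.IsBounded Ω) :
    ∃ s : Finset C.Lat, ∀ γ : C.Lat, ∀ x ∈ C.fund, x + γ ∈ Ω → γ ∈ s := by
  have h1 : Bornology.IsBounded (Ω - C.fund) := h.sub C.isBounded_fund
  have h2 := ZSpan.setFinite_inter C.a h1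
  have h3 : {γ : C.Lat | (γ : Space d) ∈ Ω - C.fund}.Finite := by
    refine Set.Finite.of_finite_image (f := Subtype.val) (h2.subset ?_)
      Subtype.val_injective.injOn
    rintro _ ⟨γ, hγ, rfl⟩
    exact ⟨hγ, γ.2⟩
  refine ⟨h3.toFinset, fun γ x hx hγ => ?_⟩
  rw [Set.Finite.mem_toFinset]
  exact ⟨x + γ, hγ, x, hx, add_sub_cancel_left x (γ : Space d)⟩

theorem mulB_coef_adjoint {w : Space d → ℂ} (hw : MemLp w ⊤ C.mu) (γ : C.Lat) (φ : C.Fib) :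
    mulB (Spin N) C.mu w ((C.coef (-γ)).adjoint φ) = (C.coef (-γ)).adjoint
      (mulB (Spin N) (C.mu.restrict C.fund) (fun x => w (x + γ)) φ) := by
  have h1 : mulB (Spin N) C.mu w = mulB (Spin N) C.mu (fun x => w (x - γ + γ)) := by
    congr 1; funext x; rw [sub_add_cancel]
  rw [coef_adjoint, neg_neg, ContinuousLinearMap.comp_apply, ContinuousLinearMap.comp_apply,
    ← C.mulB_ext (C.memLp_comp_add hw γ), C.T_mulB (C.memLp_comp_add hw γ), ← h1]

theorem coef_adjoint_coef (γ : C.Lat) (ψ : C.Hil) :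
    (C.coef (-γ)).adjoint (C.coef (-γ) ψ) =
      mulB (Spin N) C.mu (fun x => ind C.fund (x - γ)) ψ := by
  have h := congrArg (fun U : C.Hil →L[ℂ] C.Hil => U (C.T (-γ) ψ)) C.ext_res
  simp only [ContinuousLinearMap.comp_apply] at h
  rw [coef_adjoint, neg_neg, coef, ContinuousLinearMap.comp_apply, ContinuousLinearMap.comp_apply,
    h, C.T_mulB (memLp_ind C.measurableSet_fund), T_T_neg]

/-- A bounded set meets finitely many translates of the fundamental domain, so the orthogonal
decomposition of a function supported in it is a finite sum. -/
theorem mulB_ind_eq_sum {Ω : Set (Space d)} (hΩ : MeasurableSet Ω) {s : Finset C.Lat}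
    (hs : ∀ γ : C.Lat, ∀ x ∈ C.fund, x + γ ∈ Ω → γ ∈ s) (ψ : C.Hil) :
    mulB (Spin N) C.mu (ind Ω) ψ =
      ∑ γ ∈ s, (C.coef (-γ)).adjoint (C.coef (-γ) (mulB (Spin N) C.mu (ind Ω) ψ)) := by
  refine mulB_eq_of_ae (memLp_ind hΩ) ?_
  have hm := fun γ : C.Lat => C.memLp_comp_sub (memLp_ind C.measurableSet_fund) γ
  have h1 := fun γ : C.Lat => mulB_coe (E := Spin N) (hm γ) (mulB (Spin N) C.mu (ind Ω) ψ)
  filter_upwards [ae_all_iff.mpr h1, mulB_coe (memLp_ind hΩ) ψ,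
    Lp.coeFn_finsetSum s fun γ => (C.coef (-γ)).adjoint (C.coef (-γ) (mulB (Spin N) C.mu (ind Ω) ψ))]
    with x h2 h3 h4
  rw [h4, Finset.sum_apply]
  simp_rw [coef_adjoint_coef, h2, h3, smul_smul]
  rw [← Finset.sum_smul]
  congr 1
  rw [← Finset.sum_mul]
  by_cases hx : x ∈ Ω
  · obtain ⟨γ, hγ, hu⟩ := C.exists_unique_sub_mem x
    have hγs : γ ∈ s := hs γ (x - γ) hγ (by simpa using hx)
    rw [Finset.sum_eq_single_of_mem γ hγs]
    · rw [ind, Set.indicator_of_mem hγ, one_mul]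
    · intro γ' _ hne
      rw [ind, Set.indicator_of_notMem fun h => hne (hu γ' h)]
  · have h0 : ind Ω x = 0 := Set.indicator_of_notMem hx _
    rw [h0, mul_zero]

variable {C} in
/-- The trace of a periodic operator over a bounded set, with a weight `w`, as a trace over the
fundamental domain. -/
theorem IsLocTraceClass.trace_weighted {A : C.Hil →L[ℂ] C.Hil} (hA : C.IsLocTraceClass A)
    {Ω : Set (Space d)} (hΩ : MeasurableSet Ω) {s : Finset C.Lat}
    (hs : ∀ γ : C.Lat, ∀ x ∈ C.fund, x + γ ∈ Ω → γ ∈ s) {w : Space d → ℂ} (hw : MemLp w ⊤ C.mu)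
    (hwΩ : ∀ x ∉ Ω, w x = 0) :
    IsTraceClass (mulB (Spin N) C.mu w ∘L A ∘L mulB (Spin N) C.mu (ind Ω)) ∧
    tr (mulB (Spin N) C.mu w ∘L A ∘L mulB (Spin N) C.mu (ind Ω)) =
      tr (C.cpr A ∘L
        mulB (Spin N) (C.mu.restrict C.fund) (fun x => ∑ γ ∈ s, w (x + γ))) := by
  have hind := memLp_ind (ν := C.mu) hΩ
  have hw1 : mulB (Spin N) C.mu w = mulB (Spin N) C.mu w ∘L mulB (Spin N) C.mu (ind Ω) := by
    rw [← mulB_mul hw hind]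
    congr 1
    funext x
    by_cases hx : x ∈ Ω
    · rw [ind, Set.indicator_of_mem hx, mul_one]
    · rw [hwΩ x hx, zero_mul]
  have hw2 : mulB (Spin N) C.mu w = mulB (Spin N) C.mu (ind Ω) ∘L mulB (Spin N) C.mu w := by
    rw [← mulB_mul hind hw]
    congr 1
    funext x
    by_cases hx : x ∈ Ω
    · rw [ind, Set.indicator_of_mem hx, one_mul]
    · rw [hwΩ x hx, mul_zero]
  have hw3 : ∀ ψ, mulB (Spin N) C.mu w ψ =
      ∑ γ ∈ s, mulB (Spin N) C.mu w ((C.coef (-γ)).adjoint (C.coef (-γ) ψ)) := by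
    intro ψ
    have h1 := C.mulB_ind_eq_sum hΩ hs (mulB (Spin N) C.mu w ψ)
    rw [← ContinuousLinearMap.comp_apply (mulB (Spin N) C.mu (ind Ω)), ← hw2] at h1
    rw [h1]
    refine Finset.sum_congr rfl fun γ _ => ?_
    rw [coef_adjoint_coef, coef_adjoint_coef]
    have hm := C.memLp_comp_sub (memLp_ind C.measurableSet_fund) γ
    rw [← ContinuousLinearMap.comp_apply, ← ContinuousLinearMap.comp_apply (mulB (Spin N) C.mu w),
      ← mulB_mul hm hw, ← mulB_mul hw hm]
    congr 2
    funext x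
    exact mul_comm _ _
  -- Block decomposition of `A` between the finitely many translates that meet `Ω`; each block is
  -- trace class by hypothesis.
  have key : mulB (Spin N) C.mu w ∘L A ∘L mulB (Spin N) C.mu (ind Ω) =
      ∑ p ∈ s ×ˢ s, (mulB (Spin N) C.mu w ∘L (C.coef (-p.1)).adjoint) ∘L
        (C.coef (-p.1) ∘L A ∘L (C.coef (-p.2)).adjoint) ∘L
        (C.coef (-p.2) ∘L mulB (Spin N) C.mu (ind Ω)) := by
    ext1 ψ
    rw [ContinuousLinearMap.comp_apply, hw3, Finset.sum_product, sum_apply]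
    refine Finset.sum_congr rfl fun γ _ => ?_
    rw [sum_apply, ContinuousLinearMap.comp_apply, C.mulB_ind_eq_sum hΩ hs ψ, map_sum, map_sum,
      map_sum, map_sum]
    refine Finset.sum_congr rfl fun γ' _ => ?_
    simp only [ContinuousLinearMap.comp_apply]
  have htc : ∀ p ∈ s ×ˢ s, IsTraceClass ((mulB (Spin N) C.mu w ∘L (C.coef (-p.1)).adjoint) ∘L
        (C.coef (-p.1) ∘L A ∘L (C.coef (-p.2)).adjoint) ∘L
        (C.coef (-p.2) ∘L mulB (Spin N) C.mu (ind Ω))) := fun p _ =>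
    (hA.traceClass _ _).comp _ _
  rw [key]
  refine ⟨IsTraceClass.sum htc, ?_⟩
  rw [tr_sum htc, Finset.sum_product]
  have hsum : ∀ s' : Finset C.Lat,
      MemLp (fun x => ∑ γ ∈ s', w (x + γ)) ⊤ (C.mu.restrict C.fund) ∧
      tr (C.cpr A ∘L
        mulB (Spin N) (C.mu.restrict C.fund) (fun x => ∑ γ ∈ s', w (x + γ))) =
      ∑ γ ∈ s', tr (C.cpr A ∘L
        mulB (Spin N) (C.mu.restrict C.fund) (fun x => w (x + γ))) := by
    classical
    intro s'
    induction s' using Finset.induction_on with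
    | empty =>
      simp only [Finset.sum_empty]
      refine ⟨MemLp.zero, ?_⟩
      have h0 : mulB (Spin N) (C.mu.restrict C.fund) (fun _ => (0 : ℂ)) = 0 := by
        ext1 φ
        refine mulB_eq_of_ae MemLp.zero ?_
        filter_upwards [Lp.coeFn_zero (Spin N) 2 (C.mu.restrict C.fund)] with x hx
        exact hx.trans (zero_smul ℂ _).symm
      rw [h0, ContinuousLinearMap.comp_zero, tr_zero]
    | insert γ s' hγ ih =>
      have hm := (C.memLp_comp_add hw γ).restrict C.fund
      simp only [Finset.sum_insert hγ]
      refine ⟨hm.add ih.1, ?_⟩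
      rw [mulB_add hm ih.1, ContinuousLinearMap.comp_add, tr_add, ih.2]
      · exact hA.traceClass_cpr.comp (ContinuousLinearMap.id ℂ _) _
      · exact hA.traceClass_cpr.comp (ContinuousLinearMap.id ℂ _) _
  rw [(hsum s).2]
  refine Finset.sum_congr rfl fun γ hγ => ?_
  -- The factor that appears after a cyclic permutation. It contains `coef (-γ') ∘ (coef (-γ))*`,
  -- which is `0` off the diagonal and `1` on it, and by periodicity every diagonal block of `A` is
  -- `cpr A`.
  have hterm : ∀ γ', (C.coef (-γ') ∘L mulB (Spin N) C.mu (ind Ω)) ∘L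
      (mulB (Spin N) C.mu w ∘L (C.coef (-γ)).adjoint) =
      C.coef (-γ') ∘L (C.coef (-γ)).adjoint ∘L
        mulB (Spin N) (C.mu.restrict C.fund) (fun x => w (x + γ)) := by
    intro γ'
    ext1 φ
    have h1 := congrArg (fun U : C.Hil →L[ℂ] C.Hil => U ((C.coef (-γ)).adjoint φ)) hw2
    simp only [ContinuousLinearMap.comp_apply] at h1 ⊢
    rw [← h1, C.mulB_coef_adjoint hw]
  rw [Finset.sum_eq_single_of_mem γ hγ]
  · rw [(hA.traceClass _ _).tr_comp, hterm, hA.coef_comp]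
    congr 2
    ext1 φ
    exact C.coef_adjoint_self _ _
  · intro γ' _ hne
    rw [(hA.traceClass _ _).tr_comp, hterm]
    have h0 : C.coef (-γ') ∘L (C.coef (-γ)).adjoint ∘L
        mulB (Spin N) (C.mu.restrict C.fund) (fun x => w (x + γ)) = 0 := by
      ext1 φ
      exact C.coef_adjoint_of_ne (fun h => hne (neg_injective h)) _
    rw [h0, ContinuousLinearMap.comp_zero, tr_zero]

end Crystal

end UCC

end

/-! ### Fourier analysis on the dual torus, and phases in the fibre space. -/

noncomputable section

namespace UCC
namespace Crystal

variable {d N : ℕ} (C : Crystal d N)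

/-! ### The dual torus -/

/-- The normalized Haar measure of the circle. -/
@[reducible] def circleMeasureSpace : MeasureSpace UnitAddCircle := ⟨AddCircle.haarAddCircle⟩

attribute [local instance] circleMeasureSpace

theorem isProbabilityMeasure_circle : IsProbabilityMeasure (volume : Measure UnitAddCircle) :=
  inferInstanceAs (IsProbabilityMeasure AddCircle.haarAddCircle)

attribute [local instance] isProbabilityMeasure_circle

/-- The linear map `k ↦ (k·aₗ / 2π)ₗ`. -/
def dualMap : Space d →ₗ[ℝ] (Fin d → ℝ) where
  toFun k l := inner ℝ k (C.a l) / (2 * Real.pi)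
  map_add' k k' := by funext l; simp only [inner_add_left, Pi.add_apply, add_div]
  map_smul' c k := by
    funext l
    simp only [inner_smul_left, Pi.smul_apply, smul_eq_mul, RingHom.id_apply, conj_trivial,
      mul_div_assoc]

theorem dualMap_injective : Function.Injective C.dualMap := by
  refine (injective_iff_map_eq_zero _).mpr fun k hk =>
    InnerProductSpace.ext_inner_right_basis C.a fun l => ?_
  have h : inner ℝ k (C.a l) / (2 * Real.pi) = 0 := congrFun hk l
  have hpi : (2 * Real.pi) ≠ 0 := by positivity
  rw [inner_zero_left]
  exact (div_eq_zero_iff.mp h).resolve_right hpi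

/-- The linear coordinates `k ↦ (k·aₗ / 2π)ₗ` on the momentum space. -/
def dualEquiv : Space d ≃L[ℝ] (Fin d → ℝ) :=
  (C.dualMap.linearEquivOfInjective C.dualMap_injective (by simp)).toContinuousLinearEquiv

theorem dualEquiv_apply (k : Space d) (l : Fin d) :
    C.dualEquiv k l = inner ℝ k (C.a l) / (2 * Real.pi) := rfl

theorem inner_latEquiv (k : Space d) (n : Fin d → ℤ) :
    inner ℝ k (latEquiv C.a n : Space d) = 2 * Real.pi * ∑ l, n l * C.dualEquiv k l := by
  rw [latEquiv_apply, inner_sum, Finset.mul_sum]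
  refine Finset.sum_congr rfl fun l _ => ?_
  rw [inner_smul_right, dualEquiv_apply]
  field_simp

theorem mem_brillouin (k : Space d) : k ∈ brillouin C.a ↔ ∀ l, C.dualEquiv k l ∈ Set.Ico 0 1 := by
  refine forall_congr' fun l => ?_
  have hpi : 0 < 2 * Real.pi := by positivity
  rw [dualEquiv_apply, Set.mem_Ico, Set.mem_Ico, le_div_iff₀ hpi, div_lt_one hpi, zero_mul]

/-- The vectors of the dual lattice. -/
def dualVec (n : Fin d → ℤ) : Space d := C.dualEquiv.symm fun l => n l

theorem dualEquiv_dualVec (n : Fin d → ℤ) (l : Fin d) : C.dualEquiv (C.dualVec n) l = n l := by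
  rw [dualVec, ContinuousLinearEquiv.apply_symm_apply]

theorem dualVec_mem (n : Fin d → ℤ) : C.dualVec n ∈ dualLattice C.a := by
  intro γ hγ
  obtain ⟨m, hm⟩ := (latEquiv C.a).surjective ⟨γ, hγ⟩
  refine ⟨∑ l, m l * n l, ?_⟩
  have h := C.inner_latEquiv (C.dualVec n) m
  rw [hm] at h
  rw [h]
  simp only [dualEquiv_dualVec]
  push_cast
  rfl

theorem neg_mem_dualLattice {g : Space d} (hg : g ∈ dualLattice C.a) : -g ∈ dualLattice C.a := by
  intro γ hγ
  obtain ⟨n, hn⟩ := hg γ hγ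
  exact ⟨-n, by rw [inner_neg_left, hn]; push_cast; ring⟩

theorem exists_dualVec_sub_mem (k : Space d) : ∃ n, k - C.dualVec n ∈ brillouin C.a := by
  refine ⟨fun l => ⌊C.dualEquiv k l⌋, (C.mem_brillouin _).mpr fun l => ?_⟩
  rw [map_sub, Pi.sub_apply, dualEquiv_dualVec]
  exact ⟨sub_nonneg.mpr (Int.floor_le _), by linarith [Int.lt_floor_add_one (C.dualEquiv k l)]⟩

/-- The parametrization of the Brillouin zone by the torus. -/
def torusMap (τ : UnitAddTorus (Fin d)) : Space d :=
  C.dualEquiv.symm (UnitAddTorus.measurableEquivPiIoc 0 τ).1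

theorem measurableEmbedding_torusMap : MeasurableEmbedding C.torusMap := by
  refine (C.dualEquiv.symm.toHomeomorph.measurableEmbedding).comp
    ((MeasurableEmbedding.subtype_coe ?_).comp
      (UnitAddTorus.measurableEquivPiIoc (0 : Fin d → ℝ)).measurableEmbedding)
  exact MeasurableSet.univ_pi' fun _ => measurableSet_Ioc

/-- The normalized Lebesgue measure of the Brillouin zone. -/
def beta : Measure (Space d) := Measure.map C.torusMap volume

instance : IsProbabilityMeasure C.beta :=
  Measure.isProbabilityMeasure_map C.measurableEmbedding_torusMap.measurable.aemeasurable

/-- The linear image of Lebesgue measure is a Haar measure, hence a multiple of Lebesgue measure,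
and half-open boxes of the two kinds differ by a null set. The value of `c` is irrelevant: only null
sets and convergence to `0` in `L²` are compared. -/
theorem exists_beta_eq : ∃ c : ℝ≥0∞, c ≠ 0 ∧ c ≠ ⊤ ∧
    C.beta = c • volume.restrict (brillouin C.a) := by
  set S : Set (Fin d → ℝ) := Set.univ.pi fun _ => Set.Ioc 0 1
  set S' : Set (Fin d → ℝ) := Set.univ.pi fun _ => Set.Ico 0 1
  have hS : MeasurableSet S := MeasurableSet.univ_pi fun _ => measurableSet_Ioc
  have hS' : MeasurableSet S' := MeasurableSet.univ_pi fun _ => measurableSet_Ico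
  have hSS : S =ᵐ[volume] S' :=
    (Measure.univ_pi_Ioc_ae_eq_Icc (f := fun _ : Fin d => (0 : ℝ)) (g := fun _ => 1)).trans
      (Measure.univ_pi_Ico_ae_eq_Icc (f := fun _ : Fin d => (0 : ℝ)) (g := fun _ => 1)).symm
  have h1 : C.beta = Measure.map C.dualEquiv.symm (volume.restrict S') := by
    rw [beta]
    have hc : C.torusMap = C.dualEquiv.symm ∘ (Subtype.val ∘
      UnitAddTorus.measurableEquivPiIoc (0 : Fin d → ℝ)) := rfl
    have hset : {x : Fin d → ℝ | ∀ i, x i ∈ Set.Ioc ((0 : Fin d → ℝ) i) ((0 : Fin d → ℝ) i + 1)}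
        = S := by
      ext x; simp [S, Set.mem_pi]
    rw [hc, ← Measure.map_map C.dualEquiv.symm.continuous.measurable
        (measurable_subtype_coe.comp (MeasurableEquiv.measurable _)),
      ← Measure.map_map measurable_subtype_coe (MeasurableEquiv.measurable _),
      (UnitAddTorus.measurePreserving_equivPiIoc (0 : Fin d → ℝ)).map_eq,
      ← Measure.restrict_congr_set hSS]
    congr 1
    have hmS := hS
    rw [← hset] at hmS ⊢
    exact map_comap_subtype_coe hmS volume
  have h2 : (Measure.map C.dualEquiv.symm (volume : Measure (Fin d → ℝ))).IsAddHaarMeasure :=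
    C.dualEquiv.symm.isAddHaarMeasure_map volume
  have h3 := Measure.isAddLeftInvariant_eq_smul (Measure.map C.dualEquiv.symm
    (volume : Measure (Fin d → ℝ))) (volume : Measure (Space d))
  refine ⟨Measure.addHaarScalarFactor (Measure.map C.dualEquiv.symm
    (volume : Measure (Fin d → ℝ))) (volume : Measure (Space d)), ?_, ENNReal.coe_ne_top, ?_⟩
  · exact ENNReal.coe_ne_zero.mpr
      (Measure.addHaarScalarFactor_pos_of_isAddHaarMeasure _ _).ne'
  · have h4 : C.dualEquiv.symm ⁻¹' (brillouin C.a) = S' := by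
      ext x
      rw [Set.mem_preimage, mem_brillouin, ContinuousLinearEquiv.apply_symm_apply]
      simp [S', Set.mem_pi]
    have h5 : MeasurableSet (brillouin C.a) := by
      have : brillouin C.a = C.dualEquiv ⁻¹' S' := by
        rw [← h4, ← Set.preimage_comp]; ext; simp
      rw [this]
      exact C.dualEquiv.continuous.measurable hS'
    rw [h1, ← h4, ← Measure.restrict_map C.dualEquiv.symm.continuous.measurable h5]
    exact (congrArg (fun ν : Measure (Space d) => ν.restrict (brillouin C.a)) h3).trans
      (Measure.restrict_smul _ _ _)

theorem ae_beta {p : Space d → Prop} :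
    (∀ᵐ k ∂C.beta, p k) ↔ ∀ᵐ k ∂volume.restrict (brillouin C.a), p k := by
  obtain ⟨c, h0, -, h⟩ := C.exists_beta_eq
  rw [h]
  exact Measure.ae_ennreal_smul_measure_iff h0

theorem measurableSet_brillouin : MeasurableSet (brillouin C.a) := by
  have : brillouin C.a = C.dualEquiv ⁻¹' (Set.univ.pi fun _ => Set.Ico 0 1) := by
    ext k; rw [mem_brillouin]; simp [Set.mem_pi]
  rw [this]
  exact C.dualEquiv.continuous.measurable (MeasurableSet.univ_pi fun _ => measurableSet_Ico)

theorem ae_beta_mem : ∀ᵐ k ∂C.beta, k ∈ brillouin C.a :=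
  C.ae_beta.mpr (ae_restrict_mem C.measurableSet_brillouin)

theorem ae_beta_of_ae {p : Space d → Prop} (h : ∀ᵐ k, p k) : ∀ᵐ k ∂C.beta, p k :=
  C.ae_beta.mpr (ae_restrict_of_ae h)

/-- Countably many dual translates of the Brillouin zone cover momentum space. For equivariant
objects the hypothesis reduces to a statement on one zone. -/
theorem ae_of_ae_beta {p : Space d → Prop}
    (h : ∀ g ∈ dualLattice C.a, ∀ᵐ k ∂C.beta, p (k + g)) : ∀ᵐ k, p k := by
  have h1 : ∀ n : Fin d → ℤ, ∀ᵐ k, k - C.dualVec n ∈ brillouin C.a → p k := by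
    intro n
    have h2 := (ae_restrict_iff' C.measurableSet_brillouin).mp
      (C.ae_beta.mp (h _ (C.dualVec_mem n)))
    have h3 := (measurePreserving_sub_right volume (C.dualVec n)).quasiMeasurePreserving.ae h2
    filter_upwards [h3] with k hk
    simpa using hk
  filter_upwards [ae_all_iff.mpr h1] with k hk
  obtain ⟨n, hn⟩ := C.exists_dualVec_sub_mem k
  exact hk n hn

/-! ### Characters -/

/-- The character `k ↦ e^{i k·γ}`. -/
def chr (γ : C.Lat) (k : Space d) : ℂ := Complex.exp (Complex.I * (inner ℝ k (γ : Space d) : ℝ))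

theorem norm_chr (γ : C.Lat) (k : Space d) : ‖C.chr γ k‖ = 1 := by
  rw [chr, mul_comm, Complex.norm_exp_ofReal_mul_I]

theorem continuous_chr (γ : C.Lat) : Continuous (C.chr γ) := by
  unfold chr; fun_prop

theorem chr_add (γ γ' : C.Lat) (k : Space d) : C.chr (γ + γ') k = C.chr γ k * C.chr γ' k := by
  rw [chr, chr, chr, ← Complex.exp_add, Submodule.coe_add, inner_add_right]
  push_cast
  ring_nf

theorem star_chr (γ : C.Lat) (k : Space d) : (starRingEnd ℂ) (C.chr γ k) = C.chr (-γ) k := by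
  rw [chr, chr, ← Complex.exp_conj, map_mul, Complex.conj_I, Complex.conj_ofReal,
    Submodule.coe_neg, inner_neg_right]
  push_cast
  ring_nf

theorem chr_torusMap (n : Fin d → ℤ) (τ : UnitAddTorus (Fin d)) :
    C.chr (latEquiv C.a n) (C.torusMap τ) = UnitAddTorus.mFourier n τ := by
  set q := (UnitAddTorus.measurableEquivPiIoc (0 : Fin d → ℝ) τ).1
  have h1 : ∀ l, τ l = ((q l : ℝ) : UnitAddCircle) := by
    intro l
    have h2 := (UnitAddTorus.measurableEquivPiIoc (0 : Fin d → ℝ)).symm_apply_apply τ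
    have h3 := congrFun (UnitAddTorus.coe_symm_measurableEquivPiIoc_apply (0 : Fin d → ℝ)
      (UnitAddTorus.measurableEquivPiIoc (0 : Fin d → ℝ) τ)) l
    rw [h2] at h3
    exact h3
  have h2 : UnitAddTorus.mFourier n τ = ∏ l, fourier (n l) (τ l) := rfl
  rw [h2, chr, inner_latEquiv, torusMap, ContinuousLinearEquiv.apply_symm_apply]
  simp_rw [h1, fourier_coe_apply]
  rw [← Complex.exp_sum]
  congr 1
  push_cast
  rw [Finset.mul_sum, Finset.mul_sum]
  refine Finset.sum_congr rfl fun l _ => ?_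
  simp only [q, div_one]
  ring

theorem integral_chr {γ : C.Lat} (hγ : γ ≠ 0) : ∫ k, C.chr γ k ∂C.beta = 0 := by
  obtain ⟨n, rfl⟩ := (latEquiv C.a).surjective γ
  have hn : n ≠ 0 := by
    rintro rfl
    refine hγ (Subtype.ext ?_)
    rw [latEquiv_apply]; simp
  rw [beta, C.measurableEmbedding_torusMap.integral_map]
  simp_rw [chr_torusMap]
  have h := (UnitAddTorus.orthonormal_mFourier (d := Fin d)).2 hn.symm
  change inner ℂ (UnitAddTorus.mFourierLp 2 0) (UnitAddTorus.mFourierLp 2 n) = (0 : ℂ) at h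
  rw [L2.inner_def] at h
  rw [← h]
  refine integral_congr_ae ?_
  filter_upwards [UnitAddTorus.coeFn_mFourierLp 2 n,
    UnitAddTorus.coeFn_mFourierLp 2 (0 : Fin d → ℤ)] with τ h1 h2
  rw [h1, h2, UnitAddTorus.mFourier_zero]
  simp

/-- Completeness of the Fourier basis of the torus, transported by `torusMap`. -/
theorem eq_zero_of_integral_chr {f : Space d → ℂ} (hf : MemLp f 2 C.beta)
    (h : ∀ γ, ∫ k, C.chr γ k * f k ∂C.beta = 0) : f =ᵐ[C.beta] 0 := by
  have hm := C.measurableEmbedding_torusMap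
  have hf' : MemLp (f ∘ C.torusMap) 2 volume :=
    (hm.memLp_map_measure_iff).mp hf
  have h0 : hf'.toLp _ = 0 := by
    refine (UnitAddTorus.mFourierBasis (d := Fin d)).repr.injective ?_
    ext n
    rw [UnitAddTorus.mFourierBasis_repr, map_zero, lp.coeFn_zero, Pi.zero_apply,
      UnitAddTorus.mFourierCoeff, ← h (latEquiv C.a (-n)), beta, hm.integral_map]
    refine integral_congr_ae ?_
    filter_upwards [hf'.coeFn_toLp] with τ hτ
    rw [hτ, chr_torusMap, smul_eq_mul, Function.comp_apply]
  have h1 : f ∘ C.torusMap =ᵐ[volume] 0 := by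
    refine hf'.coeFn_toLp.symm.trans ?_
    rw [h0]
    exact Lp.coeFn_zero _ _ _
  rw [beta]
  exact hm.ae_map_iff.mpr h1

/-! ### Phases in the fibre space -/

/-- The operator of multiplication by `e^{i k·y}` in the fibre space. -/
abbrev ph (k : Space d) : C.Fib →L[ℂ] C.Fib := phaseOp N (C.mu.restrict C.fund) k

theorem phaseOp_coe {ν : Measure (Space d)} (k : Space d) (φ : L2 N ν) :
    ∀ᵐ y ∂ν, phaseOp N ν k φ y = Complex.exp (Complex.I * (inner ℝ k y : ℝ)) • φ y :=
  MemLp.coeFn_toLp (memLp_comp (phaseMat_measurable k) (phaseMat_unitary k)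
    (MeasurePreserving.id ν) φ)

theorem memLp_phase {ν : Measure (Space d)} (k : Space d) :
    MemLp (fun y : Space d => Complex.exp (Complex.I * (inner ℝ k y : ℝ))) ⊤ ν := by
  refine memLp_top_of_bound (C := 1) (by fun_prop) (Eventually.of_forall fun y => ?_)
  rw [mul_comm, Complex.norm_exp_ofReal_mul_I]

theorem phaseOp_eq_mulB {ν : Measure (Space d)} (k : Space d) :
    phaseOp N ν k = mulB (Spin N) ν fun y => Complex.exp (Complex.I * (inner ℝ k y : ℝ)) := by
  ext1 φ
  symm
  exact mulB_eq_of_ae (memLp_phase k) (phaseOp_coe k φ)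

theorem phaseOp_add {ν : Measure (Space d)} (k k' : Space d) :
    phaseOp N ν (k + k') = phaseOp N ν k ∘L phaseOp N ν k' := by
  rw [phaseOp_eq_mulB, phaseOp_eq_mulB, phaseOp_eq_mulB, ← mulB_mul (memLp_phase k) (memLp_phase k')]
  congr 1
  funext y
  rw [← Complex.exp_add, inner_add_left]
  push_cast
  ring_nf

theorem phaseOp_zero {ν : Measure (Space d)} :
    phaseOp N ν 0 = ContinuousLinearMap.id ℂ (L2 N ν) := by
  rw [phaseOp_eq_mulB, ← mulB_one]
  congr 1
  funext y
  simp

theorem norm_phaseOp {ν : Measure (Space d)} (k : Space d) (φ : L2 N ν) :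
    ‖phaseOp N ν k φ‖ = ‖φ‖ := by
  rw [phaseOp, weightedComp, LinearIsometry.coe_toContinuousLinearMap, LinearIsometry.norm_map]

theorem phaseOp_neg_apply {ν : Measure (Space d)} (k : Space d) (φ : L2 N ν) :
    phaseOp N ν (-k) (phaseOp N ν k φ) = φ := by
  rw [← ContinuousLinearMap.comp_apply, ← phaseOp_add, neg_add_cancel, phaseOp_zero]; rfl

theorem phaseOp_apply_neg {ν : Measure (Space d)} (k : Space d) (φ : L2 N ν) :
    phaseOp N ν k (phaseOp N ν (-k) φ) = φ := by
  rw [← ContinuousLinearMap.comp_apply, ← phaseOp_add, add_neg_cancel, phaseOp_zero]; rfl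

theorem phaseOp_adjoint {ν : Measure (Space d)} (k : Space d) :
    (phaseOp N ν k).adjoint = phaseOp N ν (-k) := by
  ext1 ψ
  have h := (phaseOp N ν k).norm_map_iff_adjoint_comp_self.mp (norm_phaseOp k)
  have h1 := congrArg (fun U : L2 N ν →L[ℂ] L2 N ν => U (phaseOp N ν (-k) ψ)) h
  simpa [phaseOp_apply_neg] using h1

theorem ae_fund_norm_le : ∃ c : ℝ, 0 ≤ c ∧ ∀ᵐ y ∂C.mu.restrict C.fund, ‖y‖ ≤ c := by
  obtain ⟨c, hc⟩ := C.isBounded_fund.exists_norm_le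
  refine ⟨max c 0, le_max_right _ _, ?_⟩
  filter_upwards [ae_restrict_mem C.measurableSet_fund] with y hy
  exact (hc y hy).trans (le_max_left _ _)

theorem memLp_inner_fund (q : Space d) :
    MemLp (fun y : Space d => Complex.I * (inner ℝ q y : ℝ)) ⊤ (C.mu.restrict C.fund) := by
  obtain ⟨c, hc, h⟩ := C.ae_fund_norm_le
  refine memLp_top_of_bound (C := ‖q‖ * c) (by fun_prop) ?_
  filter_upwards [h] with y hy
  rw [norm_mul, Complex.norm_I, one_mul, Complex.norm_real]
  exact (norm_inner_le_norm _ _).trans (by gcongr)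

/-- The operators of multiplication by `i q·y` in the fibre space. -/
def posFib : Space d →L[ℝ] (C.Fib →L[ℂ] C.Fib) :=
  LinearMap.toContinuousLinearMap
    { toFun := fun q =>
        mulB (Spin N) (C.mu.restrict C.fund) fun y => Complex.I * (inner ℝ q y : ℝ)
      map_add' := fun q q' => by
        rw [← mulB_add (C.memLp_inner_fund q) (C.memLp_inner_fund q')]
        congr 1; funext y; rw [inner_add_left]; push_cast; ring
      map_smul' := fun c q => by
        have := mulB_smul (E := Spin N) (C.memLp_inner_fund q) (c : ℂ)
        rw [RingHom.id_apply]
        refine Eq.trans ?_ (this.trans ?_)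
        · congr 1; funext y; rw [inner_smul_left]; simp; ring
        · rfl }

theorem posFib_apply (q : Space d) : C.posFib q =
    mulB (Spin N) (C.mu.restrict C.fund) fun y => Complex.I * (inner ℝ q y : ℝ) := rfl

/-- Taylor's estimate covers `|t| ≤ 1`; for larger `t` the trivial bound `2|t|` is at most `2 t²`.
-/
theorem norm_exp_sub_le (t : ℝ) :
    ‖Complex.exp (Complex.I * t) - 1 - Complex.I * t‖ ≤ 2 * t ^ 2 := by
  by_cases h : |t| ≤ 1
  · have h1 : ‖Complex.I * (t : ℂ)‖ ≤ 1 := by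
      rw [norm_mul, Complex.norm_I, one_mul, Complex.norm_real]; exact h
    have h2 := Complex.norm_exp_sub_one_sub_id_le h1
    rw [norm_mul, Complex.norm_I, one_mul, Complex.norm_real, Real.norm_eq_abs, sq_abs] at h2
    nlinarith [sq_nonneg t]
  · push Not at h
    have h1 := Real.norm_exp_I_mul_ofReal_sub_one_le (x := t)
    have h2 : ‖Complex.I * (t : ℂ)‖ = |t| := by
      rw [norm_mul, Complex.norm_I, one_mul, Complex.norm_real, Real.norm_eq_abs]
    rw [Real.norm_eq_abs] at h1
    refine (norm_sub_le _ _).trans ?_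
    rw [h2]
    nlinarith [sq_abs t]

/-- Differentiability holds in operator norm because `y` is bounded on the fundamental domain: the
remainder is multiplication by a function of size at most `2 (‖q‖ c)²`. -/
theorem hasFDerivAt_ph (k : Space d) :
    HasFDerivAt C.ph ((ContinuousLinearMap.mul ℝ (C.Fib →L[ℂ] C.Fib) (C.ph k)).comp C.posFib) k := by
  obtain ⟨c, hc, h⟩ := C.ae_fund_norm_le
  rw [hasFDerivAt_iff_isLittleO_nhds_zero]
  have hO : (fun q => C.ph (k + q) - C.ph k -
      ((ContinuousLinearMap.mul ℝ (C.Fib →L[ℂ] C.Fib) (C.ph k)).comp C.posFib) q)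
      =O[𝓝 0] fun q => ‖q‖ ^ 2 := by
    refine Asymptotics.IsBigO.of_bound (2 * c ^ 2) (Eventually.of_forall fun q => ?_)
    have h1 : C.ph (k + q) - C.ph k -
        ((ContinuousLinearMap.mul ℝ (C.Fib →L[ℂ] C.Fib) (C.ph k)).comp C.posFib) q =
        C.ph k ∘L mulB (Spin N) (C.mu.restrict C.fund) fun y =>
          Complex.exp (Complex.I * (inner ℝ q y : ℝ)) - 1 - Complex.I * (inner ℝ q y : ℝ) := by
      have e1 : MemLp (fun y : Space d => Complex.exp (Complex.I * (inner ℝ q y : ℝ)) - 1) ⊤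
          (C.mu.restrict C.fund) := (memLp_phase q).sub (memLp_top_const 1)
      rw [mulB_sub e1 (C.memLp_inner_fund q),
        mulB_sub (memLp_phase q) (memLp_top_const 1), mulB_one, ← phaseOp_eq_mulB,
        ContinuousLinearMap.comp_sub, ContinuousLinearMap.comp_sub, ← phaseOp_add,
        ContinuousLinearMap.comp_id]
      rfl
    rw [h1]
    have h2 : ‖C.ph k‖ ≤ 1 :=
      ContinuousLinearMap.opNorm_le_bound _ zero_le_one fun φ => by
        rw [one_mul, norm_phaseOp]
    have h3 : ‖mulB (Spin N) (C.mu.restrict C.fund) fun y =>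
          Complex.exp (Complex.I * (inner ℝ q y : ℝ)) - 1 - Complex.I * (inner ℝ q y : ℝ)‖
        ≤ 2 * (‖q‖ * c) ^ 2 := by
      refine norm_mulB_le (by positivity) ?_
      filter_upwards [h] with y hy
      refine (norm_exp_sub_le _).trans ?_
      rw [← sq_abs]
      gcongr
      exact (abs_real_inner_le_norm _ _).trans (by gcongr)
    calc _ ≤ ‖C.ph k‖ * _ := ContinuousLinearMap.opNorm_comp_le _ _
      _ ≤ 1 * (2 * (‖q‖ * c) ^ 2) := by gcongr
      _ = 2 * c ^ 2 * ‖‖q‖ ^ 2‖ := by rw [norm_pow, norm_norm]; ring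
  refine hO.trans_isLittleO ?_
  have := Asymptotics.isLittleO_norm_pow_id (E' := Space d) one_lt_two
  exact this

/-- Bootstrap: the equation `f' = f · L` shows that `f'` is as smooth as `f`, so every order of
differentiability gives the next one. -/
theorem contDiff_of_hasFDerivAt_mul {V A : Type*} [NormedAddCommGroup V] [NormedSpace ℝ V]
    [NormedRing A] [NormedAlgebra ℝ A] {f : V → A} {L : V →L[ℝ] A}
    (h : ∀ k, HasFDerivAt f ((ContinuousLinearMap.mul ℝ A (f k)).comp L) k) : ContDiff ℝ ∞ f := by
  rw [contDiff_infty]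
  intro n
  induction n with
  | zero =>
    exact contDiff_zero.mpr (continuous_iff_continuousAt.mpr fun k => (h k).continuousAt)
  | succ n ih =>
    rw [Nat.cast_add, Nat.cast_one, contDiff_succ_iff_hasFDerivAt]
    exact ⟨_, ((ContinuousLinearMap.mul ℝ A).contDiff.comp ih).clm_comp contDiff_const, h⟩

theorem contDiff_ph : ContDiff ℝ ∞ C.ph :=
  contDiff_of_hasFDerivAt_mul C.hasFDerivAt_ph

end Crystal
end UCC

end

/-! ### The Bloch-Floquet-Zak transform as a unitary map onto functions on one Brillouin zone. -/

noncomputable section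

namespace UCC
namespace Crystal

variable {d N : ℕ} (C : Crystal d N)

/-! ### The Bloch-Floquet-Zak transform as a unitary operator -/

/-- The square integrable functions on the Brillouin zone with values in the fibre space. -/
abbrev ZakSpace : Type := Lp C.Fib 2 C.beta

theorem ph_add (k k' : Space d) : C.ph (k + k') = C.ph k ∘L C.ph k' := phaseOp_add k k'

theorem ph_adjoint (k : Space d) : (C.ph k).adjoint = C.ph (-k) := phaseOp_adjoint k

instance : SecondCountableTopology C.Fib :=
  have : Fact ((2 : ℝ≥0∞) ≠ ⊤) := ⟨ENNReal.ofNat_ne_top⟩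
  Lp.SecondCountableTopology

theorem continuous_ph : Continuous C.ph := C.contDiff_ph.continuous

theorem continuous_wave (γ : C.Lat) (v : C.Fib) :
    Continuous fun k => C.chr γ k • C.ph (-k) v :=
  (C.continuous_chr γ).smul ((C.continuous_ph.comp continuous_neg).clm_apply continuous_const)

theorem norm_wave (γ : C.Lat) (v : C.Fib) (k : Space d) : ‖C.chr γ k • C.ph (-k) v‖ = ‖v‖ := by
  rw [norm_smul, norm_chr, one_mul, norm_phaseOp]

theorem memLp_wave (γ : C.Lat) (v : C.Fib) :
    MemLp (fun k => C.chr γ k • C.ph (-k) v) 2 C.beta :=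
  MemLp.of_bound (C.continuous_wave γ v).aestronglyMeasurable ‖v‖
    (Eventually.of_forall fun k => (C.norm_wave γ v k).le)

/-- The wave `k ↦ e^{i k·γ} e^{-i k·y} v(y)`. -/
def wave (γ : C.Lat) : C.Fib →ₗᵢ[ℂ] C.ZakSpace where
  toFun v := (C.memLp_wave γ v).toLp _
  map_add' v w := by
    rw [← MemLp.toLp_add]
    refine MemLp.toLp_congr _ _ (Eventually.of_forall fun k => ?_)
    simp only [map_add, smul_add, Pi.add_apply]
  map_smul' c v := by
    rw [RingHom.id_apply, ← MemLp.toLp_const_smul]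
    refine MemLp.toLp_congr _ _ (Eventually.of_forall fun k => ?_)
    simp only [map_smul, Pi.smul_apply]
    rw [smul_comm]
  norm_map' v := by
    change ‖(C.memLp_wave γ v).toLp _‖ = ‖v‖
    have h : eLpNorm (fun k => C.chr γ k • C.ph (-k) v) 2 C.beta =
        eLpNorm (fun _ : Space d => v) 2 C.beta :=
      eLpNorm_congr_norm_ae (Eventually.of_forall fun k => C.norm_wave γ v k)
    rw [Lp.norm_toLp, h, eLpNorm_const _ two_ne_zero (IsProbabilityMeasure.ne_zero _)]
    simp

theorem wave_coe (γ : C.Lat) (v : C.Fib) :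
    ∀ᵐ k ∂C.beta, C.wave γ v k = C.chr γ k • C.ph (-k) v :=
  (C.memLp_wave γ v).coeFn_toLp

theorem inner_wave (γ : C.Lat) (v : C.Fib) (f : C.ZakSpace) :
    inner ℂ (C.wave γ v) f = ∫ k, C.chr (-γ) k * inner ℂ v (C.ph k (f k)) ∂C.beta := by
  rw [L2.inner_def]
  refine integral_congr_ae ?_
  filter_upwards [C.wave_coe γ v] with k hk
  rw [hk, inner_smul_left, star_chr, ← ph_adjoint, ContinuousLinearMap.adjoint_inner_left]

/-- Orthogonality is that of the characters. If `f` is orthogonal to all waves, then for each `v`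
all Fourier coefficients of `k ↦ ⟨v, e^{i k·y} f(k)⟩` vanish, so `f = 0`. Matching this
decomposition with the one given by `emb` defines the transform. -/
theorem isHilbertSum_wave : IsHilbertSum ℂ (fun _ : C.Lat => C.Fib) C.wave := by
  refine IsHilbertSum.mk ?_ ?_
  · intro γ γ' h v w
    rw [inner_wave]
    have h1 : ∀ᵐ k ∂C.beta, C.chr (-γ) k * inner ℂ v (C.ph k (C.wave γ' w k)) =
        C.chr (-γ + γ') k * inner ℂ v w := by
      filter_upwards [C.wave_coe γ' w] with k hk
      rw [hk, map_smul, phaseOp_apply_neg, inner_smul_right, chr_add, mul_assoc]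
    rw [integral_congr_ae h1, integral_mul_const, C.integral_chr, zero_mul]
    intro h0
    exact h (neg_add_eq_zero.mp h0)
  · rw [top_le_iff, Submodule.topologicalClosure_eq_top_iff, Submodule.eq_bot_iff]
    intro f hf
    have h1 : ∀ v : C.Fib, (fun k => inner ℂ v (C.ph k (f k))) =ᵐ[C.beta] 0 := by
      intro v
      refine C.eq_zero_of_integral_chr ?_ fun γ => ?_
      · have hm : AEStronglyMeasurable (fun k => C.ph k (f k)) C.beta :=
          aestronglyMeasurable_clm_apply C.continuous_ph.aestronglyMeasurable
            (Lp.aestronglyMeasurable f)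
        refine MemLp.of_le_mul (c := ‖v‖) (Lp.memLp f)
          (aestronglyMeasurable_const.inner hm) (Eventually.of_forall fun k => ?_)
        refine (norm_inner_le_norm _ _).trans ?_
        rw [norm_phaseOp]
      · have h2 := hf _ (Submodule.mem_iSup_of_mem (-γ) ⟨v, rfl⟩)
        have h3 := C.inner_wave (-γ) v f
        rw [neg_neg] at h3
        rw [← h3]
        exact h2
    have h2 : (fun k => C.ph k (f k)) =ᵐ[C.beta] 0 := ae_eq_zero_of_forall_inner (𝕜 := ℂ) h1
    refine Lp.ext ?_
    filter_upwards [h2, Lp.coeFn_zero C.Fib 2 C.beta] with k h3 h4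
    rw [h4, Pi.zero_apply, ← norm_eq_zero, ← norm_phaseOp k, h3, Pi.zero_apply, norm_zero]

/-- The Bloch-Floquet-Zak transform, as a unitary operator. -/
def zk : C.Hil ≃ₗᵢ[ℂ] C.ZakSpace :=
  C.isHilbertSum_emb.linearIsometryEquiv.trans C.isHilbertSum_wave.linearIsometryEquiv.symm

theorem coef_symm (γ : C.Lat) (w : lp (fun _ : C.Lat => C.Fib) 2) :
    C.coef γ (C.isHilbertSum_emb.linearIsometryEquiv.symm w) = w γ := by
  have h1 := (C.isHilbertSum_emb.hasSum_linearIsometryEquiv_symm w).mapL (C.coef γ)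
  have h2 := hasSum_single (f := fun γ' => C.coef γ (C.emb γ' (w γ'))) γ ?_
  · rw [emb_apply, coef_adjoint_self] at h2
    exact h1.unique h2
  · intro γ' hne
    exact C.coef_adjoint_of_ne hne.symm _

theorem coef_eq (γ : C.Lat) (ψ : C.Hil) : C.isHilbertSum_emb.linearIsometryEquiv ψ γ =
    C.coef γ ψ := by
  rw [← coef_symm, LinearIsometryEquiv.symm_apply_apply]

theorem hasSum_zk (ψ : C.Hil) : HasSum (fun γ => C.wave γ (C.coef γ ψ)) (C.zk ψ) := by
  have h := C.isHilbertSum_wave.hasSum_linearIsometryEquiv_symm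
    (C.isHilbertSum_emb.linearIsometryEquiv ψ)
  simp_rw [coef_eq] at h
  exact h

theorem zk_coef_adjoint (γ : C.Lat) (v : C.Fib) : C.zk ((C.coef γ).adjoint v) = C.wave γ v := by
  refine (C.hasSum_zk _).unique ?_
  have h := hasSum_single (f := fun γ' => C.wave γ' (C.coef γ' ((C.coef γ).adjoint v))) γ ?_
  · rwa [coef_adjoint_self] at h
  · intro γ' hne
    rw [C.coef_adjoint_of_ne hne, map_zero]

theorem inner_coef (γ : C.Lat) (v : C.Fib) (ψ : C.Hil) : inner ℂ v (C.coef γ ψ) =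
    ∫ k, C.chr (-γ) k * inner ℂ v (C.ph k (C.zk ψ k)) ∂C.beta := by
  rw [← inner_wave, ← zk_coef_adjoint, LinearIsometryEquiv.inner_map_map,
    ContinuousLinearMap.adjoint_inner_left]

theorem zakTerm_eq (ψ : C.Hil) (γ : C.Lat) (k : Space d) :
    C.zakTerm ψ γ k = C.chr γ k • C.ph (-k) (C.coef γ ψ) := rfl

theorem tendsto_eLpNorm_beta {ι : Type*} {l : Filter ι} {f : ι → Space d → C.Fib} :
    Tendsto (fun i => eLpNorm (f i) 2 C.beta) l (𝓝 0) ↔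
      Tendsto (fun i => eLpNorm (f i) 2 (volume.restrict (brillouin C.a))) l (𝓝 0) := by
  obtain ⟨c, h0, ht, h⟩ := C.exists_beta_eq
  have hp : (0 : ℝ) < (1 / (2 : ℝ≥0∞)).toReal := by simp
  have h1 : c ^ (1 / (2 : ℝ≥0∞)).toReal ≠ 0 := by
    simp [ENNReal.rpow_eq_zero_iff, h0, ht]
  have h2 : c ^ (1 / (2 : ℝ≥0∞)).toReal ≠ ⊤ := ENNReal.rpow_ne_top_of_nonneg hp.le ht
  simp_rw [h, eLpNorm_smul_measure_of_ne_top ENNReal.ofNat_ne_top, smul_eq_mul]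
  constructor
  · intro h3
    have h4 := ENNReal.Tendsto.const_mul (a := (c ^ (1 / (2 : ℝ≥0∞)).toReal)⁻¹) h3
      (Or.inr (ENNReal.inv_ne_top.mpr h1))
    simp_rw [← mul_assoc, ENNReal.inv_mul_cancel h1 h2, one_mul, mul_zero] at h4
    exact h4
  · intro h3
    have h4 := ENNReal.Tendsto.const_mul (a := c ^ (1 / (2 : ℝ≥0∞)).toReal) h3 (Or.inr h2)
    rwa [mul_zero] at h4

theorem beta_absolutelyContinuous : C.beta ≪ volume := by
  refine Measure.AbsolutelyContinuous.mk fun s _ h => ?_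
  have := C.ae_beta_of_ae (p := fun k => k ∉ s) (measure_eq_zero_iff_ae_notMem.mp h)
  exact measure_eq_zero_iff_ae_notMem.mpr this

theorem sum_wave_coe (ψ : C.Hil) (F : Finset C.Lat) :
    ∀ᵐ k ∂C.beta, (∑ γ ∈ F, C.wave γ (C.coef γ ψ)) k = ∑ γ ∈ F, C.zakTerm ψ γ k := by
  have h := fun γ => C.wave_coe γ (C.coef γ ψ)
  filter_upwards [ae_all_iff.mpr h, Lp.coeFn_finsetSum F fun γ => C.wave γ (C.coef γ ψ)]
    with k h1 h2
  rw [h2, Finset.sum_apply]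
  exact Finset.sum_congr rfl fun γ _ => h1 γ

theorem tendsto_zk (ψ : C.Hil) : Tendsto (fun F : Finset C.Lat =>
    eLpNorm (fun k => C.zk ψ k - ∑ γ ∈ F, C.zakTerm ψ γ k) 2 C.beta) atTop (𝓝 0) := by
  have h : Tendsto (fun F => ∑ γ ∈ F, C.wave γ (C.coef γ ψ)) atTop (𝓝 (C.zk ψ)) := C.hasSum_zk ψ
  rw [Lp.tendsto_Lp_iff_tendsto_eLpNorm'] at h
  refine h.congr fun F => ?_
  rw [eLpNorm_sub_comm]
  refine eLpNorm_congr_ae ?_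
  filter_upwards [C.sum_wave_coe ψ F] with k hk
  rw [Pi.sub_apply, hk]

/-- The defining series converges in mean square to `zk ψ` over one zone, and such limits are
unique; equivariance then carries the information to all momenta. -/
theorem isZak_iff {ψ : C.Hil} {Φ : Space d → C.Fib} : C.IsZak ψ Φ ↔
    AEStronglyMeasurable Φ volume ∧
    (∀ g ∈ dualLattice C.a, ∀ᵐ k, Φ (k + g) = C.varrho g (Φ k)) ∧ Φ =ᵐ[C.beta] C.zk ψ := by
  have hm : ∀ F : Finset C.Lat, AEStronglyMeasurable (fun k => ∑ γ ∈ F, C.zakTerm ψ γ k) C.beta :=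
    fun F => (continuous_finsetSum F fun γ _ => C.continuous_zakTerm ψ γ).aestronglyMeasurable
  constructor
  · intro h
    refine ⟨h.1, h.2, ?_⟩
    have hΦ : AEStronglyMeasurable Φ C.beta := h.1.mono_ac C.beta_absolutelyContinuous
    have h1 := C.tendsto_eLpNorm_beta.mpr h.tendsto
    have h2 := h1.add (C.tendsto_zk ψ)
    rw [add_zero] at h2
    have h3 : eLpNorm (Φ - ⇑(C.zk ψ)) 2 C.beta ≤ 0 := by
      refine ge_of_tendsto' h2 fun F => ?_
      have h4 := eLpNorm_sub_le (p := 2) (hΦ.sub (hm F))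
        ((Lp.aestronglyMeasurable (C.zk ψ)).sub (hm F)) one_le_two
      refine le_trans (le_of_eq ?_) h4
      congr 1
      funext k
      simp only [Pi.sub_apply]
      abel
    have h5 := (eLpNorm_eq_zero_iff (hΦ.sub (Lp.aestronglyMeasurable (C.zk ψ))) two_ne_zero).mp
      (le_antisymm h3 zero_le)
    filter_upwards [h5] with k hk
    exact sub_eq_zero.mp hk
  · rintro ⟨h1, h2, h3⟩
    refine ⟨h1, h2, C.tendsto_eLpNorm_beta.mp ((C.tendsto_zk ψ).congr fun F => ?_)⟩
    refine eLpNorm_congr_ae ?_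
    filter_upwards [h3] with k hk
    rw [hk]

variable {C} in
theorem IsZak.ae_eq_zk {ψ : C.Hil} {Φ : Space d → C.Fib} (h : C.IsZak ψ Φ) :
    Φ =ᵐ[C.beta] C.zk ψ := (C.isZak_iff.mp h).2.2

variable {C} in
theorem IsZak.eq {ψ ψ' : C.Hil} {Φ Φ' : Space d → C.Fib} (h : C.IsZak ψ Φ) (h' : C.IsZak ψ' Φ')
    (he : Φ =ᵐ[volume] Φ') : ψ = ψ' :=
  C.zk.injective (Lp.ext (h.ae_eq_zk.symm.trans
    (EventuallyEq.trans (C.beta_absolutelyContinuous.ae_le he) h'.ae_eq_zk)))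

variable {C} in
theorem IsZak.congr {ψ : C.Hil} {Φ Φ' : Space d → C.Fib} (h : C.IsZak ψ Φ)
    (he : Φ =ᵐ[volume] Φ') : C.IsZak ψ Φ' := by
  refine C.isZak_iff.mpr ⟨h.1.congr he, fun g hg => ?_,
    EventuallyEq.trans (EventuallyEq.symm (C.beta_absolutelyContinuous.ae_le he)) h.ae_eq_zk⟩
  filter_upwards [h.equivariant g hg, he,
    (measurePreserving_add_right volume g).quasiMeasurePreserving.ae he] with k h1 h2 h3
  rw [← h3, h1, h2]

variable {C} in
theorem IsZak.sub {ψ φ : C.Hil} {Ψ Φ : Space d → C.Fib} (hψ : C.IsZak ψ Ψ) (hφ : C.IsZak φ Φ) :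
    C.IsZak (ψ - φ) (fun k => Ψ k - Φ k) := by
  have h := hψ.add (hφ.smul (-1))
  have e : ψ + (-1 : ℂ) • φ = ψ - φ := by rw [neg_one_smul, sub_eq_add_neg]
  rw [e] at h
  refine h.congr (Eventually.of_forall fun k => ?_)
  simp only [neg_one_smul, sub_eq_add_neg]

theorem isBounded_brillouin : Bornology.IsBounded (brillouin C.a) := by
  have h : brillouin C.a ⊆ C.dualEquiv.symm '' Set.Icc 0 1 := by
    intro k hk
    refine ⟨C.dualEquiv k, ?_, ContinuousLinearEquiv.symm_apply_apply _ _⟩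
    have := (C.mem_brillouin k).mp hk
    exact ⟨fun l => (this l).1, fun l => (this l).2.le⟩
  exact ((isCompact_Icc.image C.dualEquiv.symm.continuous).isBounded).subset h

theorem exists_bound_of_continuous {E : Type*} [NormedAddCommGroup E] {f : Space d → E}
    (hf : Continuous f) : ∃ c, 0 ≤ c ∧ ∀ k ∈ brillouin C.a, ‖f k‖ ≤ c := by
  obtain ⟨c, hc⟩ := (C.isBounded_brillouin.isCompact_closure.image hf).isBounded.exists_norm_le
  exact ⟨max c 0, le_max_right _ _, fun k hk =>
    (hc _ ⟨k, subset_closure hk, rfl⟩).trans (le_max_left _ _)⟩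

theorem memLp_of_continuous {E : Type*} [NormedAddCommGroup E] {f : Space d → E}
    (hf : Continuous f) (p : ℝ≥0∞) : MemLp f p C.beta := by
  obtain ⟨c, -, hc⟩ := C.exists_bound_of_continuous hf
  refine MemLp.of_bound hf.aestronglyMeasurable c ?_
  filter_upwards [C.ae_beta_mem] with k hk
  exact hc k hk

/-- A continuous function is bounded on the zone, hence square integrable there, and `zk` is
surjective. -/
theorem exists_isZak_of_continuous {Φ : Space d → C.Fib} (hΦ : Continuous Φ)
    (he : ∀ g ∈ dualLattice C.a, ∀ k, Φ (k + g) = C.varrho g (Φ k)) : ∃ ψ, C.IsZak ψ Φ := by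
  refine ⟨C.zk.symm ((C.memLp_of_continuous hΦ 2).toLp Φ), C.isZak_iff.mpr
    ⟨hΦ.aestronglyMeasurable, fun g hg => Eventually.of_forall (he g hg), ?_⟩⟩
  rw [LinearIsometryEquiv.apply_symm_apply]
  exact (MemLp.coeFn_toLp _).symm

variable {C} in
theorem IsZak.equivariant_of_continuous {ψ : C.Hil} {Φ : Space d → C.Fib} (h : C.IsZak ψ Φ)
    (hΦ : Continuous Φ) {g : Space d} (hg : g ∈ dualLattice C.a) (k : Space d) :
    Φ (k + g) = C.varrho g (Φ k) := by
  have h1 : Continuous fun k => Φ (k + g) := by fun_prop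
  have h2 : Continuous fun k => C.varrho g (Φ k) := by fun_prop
  exact congrFun ((h1.ae_eq_iff_eq volume h2).mp (h.equivariant g hg)) k

theorem chr_add_dual (γ : C.Lat) (k : Space d) {g : Space d} (hg : g ∈ dualLattice C.a) :
    C.chr γ (k + g) = C.chr γ k := by
  obtain ⟨n, hn⟩ := hg γ γ.2
  rw [chr, chr, inner_add_left, hn, Complex.exp_eq_exp_iff_exists_int]
  exact ⟨n, by push_cast; ring⟩

theorem zakTerm_add_dual (ψ : C.Hil) (γ : C.Lat) (k : Space d) {g : Space d}
    (hg : g ∈ dualLattice C.a) : C.zakTerm ψ γ (k + g) = C.varrho g (C.zakTerm ψ γ k) := by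
  rw [zakTerm_eq, zakTerm_eq, C.chr_add_dual γ k hg, map_smul, varrho, neg_add, add_comm,
    ph_add]
  rfl

theorem contDiff_chr (γ : C.Lat) : ContDiff ℝ ∞ (C.chr γ) := by
  have h1 : ContDiff ℝ ∞ fun k : Space d => ((inner ℝ k (γ : Space d) : ℝ) : ℂ) :=
    Complex.ofRealCLM.contDiff.comp (contDiff_id.inner ℝ contDiff_const)
  exact (contDiff_const.mul h1).cexp

theorem contDiff_zakTerm (ψ : C.Hil) (γ : C.Lat) : ContDiff ℝ ∞ (C.zakTerm ψ γ) := by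
  have h1 : ContDiff ℝ ∞ fun k => C.ph (-k) (C.coef γ ψ) :=
    ((ContinuousLinearMap.apply ℂ C.Fib (C.coef γ ψ)).restrictScalars ℝ).contDiff.comp
      (C.contDiff_ph.comp contDiff_neg)
  exact (C.contDiff_chr γ).smul h1

/-- For a function supported on finitely many translates the series is a finite sum of waves, and
therefore smooth in `k`. -/
theorem isZak_of_coef {ψ : C.Hil} {s : Finset C.Lat} (h : ∀ γ ∉ s, C.coef γ ψ = 0) :
    C.IsZak ψ fun k => ∑ γ ∈ s, C.zakTerm ψ γ k := by
  refine C.isZak_iff.mpr ⟨(continuous_finsetSum s fun γ _ =>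
    C.continuous_zakTerm ψ γ).aestronglyMeasurable, fun g hg => Eventually.of_forall fun k => ?_, ?_⟩
  · rw [map_sum]
    exact Finset.sum_congr rfl fun γ _ => C.zakTerm_add_dual ψ γ k hg
  · have h1 : C.zk ψ = ∑ γ ∈ s, C.wave γ (C.coef γ ψ) :=
      (C.hasSum_zk ψ).unique (hasSum_sum_of_ne_finset_zero fun γ hγ => by rw [h γ hγ, map_zero])
    rw [h1]
    filter_upwards [C.sum_wave_coe ψ s] with k hk
    exact hk.symm

theorem contDiff_sum_zakTerm (ψ : C.Hil) (s : Finset C.Lat) :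
    ContDiff ℝ ∞ fun k => ∑ γ ∈ s, C.zakTerm ψ γ k :=
  ContDiff.sum fun γ _ => C.contDiff_zakTerm ψ γ

theorem memLp_chr (γ : C.Lat) : MemLp (C.chr γ) ⊤ C.beta :=
  C.memLp_of_continuous (C.continuous_chr γ) ⊤

/-- Translations become multiplications by scalar characters, which is why operators that act
fibrewise are periodic. -/
theorem zk_T (γ : C.Lat) (ψ : C.Hil) :
    C.zk (C.T γ ψ) = mulB C.Fib C.beta (C.chr (-γ)) (C.zk ψ) := by
  have h1 := ((Equiv.addLeft γ).hasSum_iff.mpr (C.hasSum_zk ψ)).mapL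
    (mulB C.Fib C.beta (C.chr (-γ)))
  have h2 : ∀ γ', mulB C.Fib C.beta (C.chr (-γ)) (C.wave (γ + γ') (C.coef (γ + γ') ψ)) =
      C.wave γ' (C.coef γ' (C.T γ ψ)) := by
    intro γ'
    refine mulB_eq_of_ae (C.memLp_chr _) ?_
    filter_upwards [C.wave_coe γ' (C.coef γ' (C.T γ ψ)),
      C.wave_coe (γ + γ') (C.coef (γ + γ') ψ)] with k h3 h4
    rw [h3, h4, coef_T, smul_smul, ← chr_add, neg_add_cancel_left]
  refine (C.hasSum_zk (C.T γ ψ)).unique ?_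
  convert h1 using 2 with γ'
  exact (h2 γ').symm

end Crystal
end UCC

end

/-! ### Contour integrals and exponentials of operators with continuous fibres. -/

noncomputable section

namespace UCC

/-- The continuous functions with values in a normed space. -/
abbrev CN (X A : Type*) [TopologicalSpace X] [NormedAddCommGroup A] : Type _ := C(X, A)

/-- Evaluation of continuous functions. -/
def evalCN {X A : Type*} [TopologicalSpace X] [CompactSpace X] [NormedAddCommGroup A]
    [NormedSpace ℂ A] (k : X) : CN X A →L[ℂ] A := ContinuousMap.evalCLM ℂ k

/-! ### Circle integrals of continuous functions on a circle -/

section CircleIntegral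

variable {A B : Type*} [NormedAddCommGroup A] [NormedSpace ℂ A] [NormedAddCommGroup B]
  [NormedSpace ℂ B] {c : ℂ} {r : ℝ}

open Classical in
/-- Extension by zero of a function on a circle. -/
def circleExt (f : CN (Metric.sphere c r) A) (z : ℂ) : A :=
  if h : z ∈ Metric.sphere c r then f ⟨z, h⟩ else 0

theorem circleExt_of_mem (f : CN (Metric.sphere c r) A) {z : ℂ} (h : z ∈ Metric.sphere c r) :
    circleExt f z = f ⟨z, h⟩ := dif_pos h

theorem continuousOn_circleExt (f : CN (Metric.sphere c r) A) :
    ContinuousOn (circleExt f) (Metric.sphere c r) := by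
  rw [continuousOn_iff_continuous_domRestrict]
  refine f.continuous.congr fun z => ?_
  rw [Set.domRestrict_apply, circleExt_of_mem f z.2]

theorem circleIntegrable_circleExt (hr : 0 ≤ r) (f : CN (Metric.sphere c r) A) :
    CircleIntegrable (circleExt f) c r :=
  (continuousOn_circleExt f).circleIntegrable hr

theorem circleIntegral_congr_sphere (hr : 0 ≤ r) {f g : ℂ → A}
    (h : ∀ z ∈ Metric.sphere c r, f z = g z) : circleIntegral f c r = circleIntegral g c r :=
  circleIntegral.integral_congr hr h

/-- The circle integral of continuous functions on a circle, as a bounded operator. -/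
def cint [CompleteSpace A] (hr : 0 ≤ r) : CN (Metric.sphere c r) A →L[ℂ] A :=
  LinearMap.mkContinuous
    { toFun := fun f => circleIntegral (circleExt f) c r
      map_add' := fun f g => by
        rw [← circleIntegral.integral_add (circleIntegrable_circleExt hr f)
          (circleIntegrable_circleExt hr g)]
        refine circleIntegral_congr_sphere hr fun z hz => ?_
        rw [circleExt_of_mem _ hz, circleExt_of_mem _ hz, circleExt_of_mem _ hz]; rfl
      map_smul' := fun a f => by
        rw [RingHom.id_apply, ← circleIntegral.integral_smul]
        refine circleIntegral_congr_sphere hr fun z hz => ?_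
        rw [circleExt_of_mem _ hz, circleExt_of_mem _ hz]; rfl }
    (2 * Real.pi * r) fun f => by
      refine circleIntegral.norm_integral_le_of_norm_le_const hr fun z hz => ?_
      rw [circleExt_of_mem _ hz]
      exact f.norm_coe_le_norm _

theorem cint_apply [CompleteSpace A] (hr : 0 ≤ r) (f : CN (Metric.sphere c r) A) :
    cint hr f = circleIntegral (circleExt f) c r := rfl

theorem cint_eq [CompleteSpace A] (hr : 0 ≤ r) {f : CN (Metric.sphere c r) A} {g : ℂ → A}
    (h : ∀ z (hz : z ∈ Metric.sphere c r), g z = f ⟨z, hz⟩) :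
    circleIntegral g c r = cint hr f := by
  refine circleIntegral_congr_sphere hr fun z hz => ?_
  rw [h z hz, circleExt_of_mem]

theorem map_cint [CompleteSpace A] [CompleteSpace B] (hr : 0 ≤ r) (T : A →L[ℂ] B)
    (f : CN (Metric.sphere c r) A) {g : CN (Metric.sphere c r) B} (h : ∀ z, g z = T (f z)) :
    T (cint hr f) = cint hr g := by
  have h1 := circleIntegrable_circleExt hr f
  rw [cint_apply, cint_apply, circleIntegral, ← ContinuousLinearMap.intervalIntegral_comp_comm]
  · refine intervalIntegral.integral_congr fun θ _ => ?_
    have hz := circleMap_mem_sphere c hr θ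
    simp only [map_smul]
    rw [circleExt_of_mem _ hz, circleExt_of_mem _ hz, h]
  · exact h1.out

end CircleIntegral

/-- The homomorphisms of normed algebras. -/
abbrev NormedAlgHom (A B : Type*) [NormedRing A] [NormedAlgebra ℂ A] [NormedRing B]
    [NormedAlgebra ℂ B] : Type _ := A →ₐ[ℂ] B

/-- A contractive algebra homomorphism, as a bounded operator. -/
def algCLM {A B : Type*} [NormedRing A] [NormedAlgebra ℂ A] [NormedRing B] [NormedAlgebra ℂ B]
    (f : NormedAlgHom A B) (h : ∀ x, ‖f x‖ ≤ 1 * ‖x‖) : A →L[ℂ] B :=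
  f.toLinearMap.mkContinuous 1 h

/-- A contractive algebra homomorphism commutes with the exponential. -/
theorem map_exp_of_contractive {A B : Type*} [NormedRing A] [NormedAlgebra ℂ A] [CompleteSpace A]
    [NormedRing B] [NormedAlgebra ℂ B] (f : NormedAlgHom A B) (h : ∀ x, ‖f x‖ ≤ 1 * ‖x‖) (x : A) :
    f (NormedSpace.exp x) = NormedSpace.exp (f x) := by
  have : NormedAlgebra ℚ A := NormedAlgebra.restrictScalars ℚ ℂ A
  have : NormedAlgebra ℚ B := NormedAlgebra.restrictScalars ℚ ℂ B
  exact NormedSpace.map_exp f (algCLM f h).continuous x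

theorem exp_apply {X A : Type*} [TopologicalSpace X] [CompactSpace X] [NormedRing A]
    [NormedAlgebra ℂ A] [CompleteSpace A] (f : CN X A) (k : X) :
    NormedSpace.exp f k = NormedSpace.exp (f k) :=
  map_exp_of_contractive
    (AlgHom.ofLinearMap (evalCN k : CN X A →L[ℂ] A).toLinearMap rfl fun _ _ => rfl)
    (fun f => by rw [one_mul]; exact f.norm_coe_le_norm k) f

namespace Crystal

variable {d N : ℕ} (C : Crystal d N)

/-! ### Operators with continuous fibres -/

/-- The closure of the Brillouin zone. -/
def zone : Set (Space d) := {k | C.dualEquiv k ∈ Set.Icc (0 : Fin d → ℝ) 1}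

theorem isCompact_zone : IsCompact C.zone :=
  C.dualEquiv.toHomeomorph.isCompact_preimage.mpr isCompact_Icc

instance : CompactSpace C.zone := isCompact_iff_compactSpace.mp C.isCompact_zone

theorem brillouin_subset_zone : brillouin C.a ⊆ C.zone := fun k hk =>
  ⟨fun l => ((C.mem_brillouin k).mp hk l).1, fun l => ((C.mem_brillouin k).mp hk l).2.le⟩

/-- A retraction of the momentum space to the closure of the Brillouin zone. -/
def clamp (k : Space d) : C.zone :=
  ⟨C.dualEquiv.symm fun l => max 0 (min 1 (C.dualEquiv k l)), by
    change C.dualEquiv _ ∈ Set.Icc (0 : Fin d → ℝ) 1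
    rw [ContinuousLinearEquiv.apply_symm_apply]
    exact ⟨fun l => le_max_left _ _, fun l => max_le zero_le_one (min_le_left _ _)⟩⟩

theorem continuous_clamp : Continuous C.clamp := by
  refine Continuous.subtype_mk (C.dualEquiv.symm.continuous.comp ?_) _
  refine continuous_pi fun l => ?_
  have : Continuous fun k => C.dualEquiv k l := (continuous_apply l).comp C.dualEquiv.continuous
  fun_prop

theorem clamp_of_mem {k : Space d} (hk : k ∈ C.zone) : (C.clamp k : Space d) = k := by
  change C.dualEquiv.symm _ = k
  rw [ContinuousLinearEquiv.symm_apply_eq]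
  funext l
  have h0 : 0 ≤ C.dualEquiv k l := hk.1 l
  have h1 : C.dualEquiv k l ≤ 1 := hk.2 l
  rw [min_eq_right h1, max_eq_right h0]

/-- The operator with fibres `F(k)`. -/
def Op (F : Space d → C.Fib →L[ℂ] C.Fib) : C.Hil →L[ℂ] C.Hil :=
  C.zk.symm.toLinearIsometry.toContinuousLinearMap ∘L opMul C.beta F ∘L
    C.zk.toLinearIsometry.toContinuousLinearMap

theorem Op_apply (F : Space d → C.Fib →L[ℂ] C.Fib) (ψ : C.Hil) :
    C.Op F ψ = C.zk.symm (opMul C.beta F (C.zk ψ)) := rfl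

theorem zk_Op' (F : Space d → C.Fib →L[ℂ] C.Fib) (ψ : C.Hil) :
    C.zk (C.Op F ψ) = opMul C.beta F (C.zk ψ) := by
  rw [Op_apply, LinearIsometryEquiv.apply_symm_apply]

variable {F G : Space d → C.Fib →L[ℂ] C.Fib}

theorem zk_Op (hF : Continuous F) (ψ : C.Hil) :
    ∀ᵐ k ∂C.beta, C.zk (C.Op F ψ) k = F k (C.zk ψ k) := by
  rw [zk_Op']
  exact opMul_coe (C.memLp_of_continuous hF ⊤) _

theorem Op_eq_of_ae (hF : Continuous F) {ψ φ : C.Hil}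
    (h : ∀ᵐ k ∂C.beta, C.zk φ k = F k (C.zk ψ k)) : C.Op F ψ = φ := by
  rw [Op_apply, opMul_eq_of_ae (C.memLp_of_continuous hF ⊤) h,
    LinearIsometryEquiv.symm_apply_apply]

theorem Op_congr (hF : Continuous F) (hG : Continuous G) (h : ∀ k ∈ brillouin C.a, F k = G k) :
    C.Op F = C.Op G := by
  ext1 ψ
  refine C.Op_eq_of_ae hF ?_
  filter_upwards [C.zk_Op hG ψ, C.ae_beta_mem] with k h1 h2
  rw [h1, h k h2]

theorem Op_mul (hF : Continuous F) (hG : Continuous G) :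
    C.Op (fun k => F k ∘L G k) = C.Op F ∘L C.Op G := by
  ext1 ψ
  refine C.Op_eq_of_ae (hF.clm_comp hG) ?_
  filter_upwards [C.zk_Op hF (C.Op G ψ), C.zk_Op hG ψ] with k h1 h2
  rw [ContinuousLinearMap.comp_apply, h1, h2, ContinuousLinearMap.comp_apply]

theorem Op_add (hF : Continuous F) (hG : Continuous G) :
    C.Op (fun k => F k + G k) = C.Op F + C.Op G := by
  ext1 ψ
  refine C.Op_eq_of_ae (hF.add hG) ?_
  rw [add_apply, map_add]
  filter_upwards [C.zk_Op hF ψ, C.zk_Op hG ψ, Lp.coeFn_add (C.zk (C.Op F ψ)) (C.zk (C.Op G ψ))]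
    with k h1 h2 h3
  rw [h3, Pi.add_apply, h1, h2]; rfl

theorem Op_smul (hF : Continuous F) (c : ℂ) : C.Op (fun k => c • F k) = c • C.Op F := by
  ext1 ψ
  refine C.Op_eq_of_ae (hF.const_smul c) ?_
  rw [smul_apply, map_smul]
  filter_upwards [C.zk_Op hF ψ, Lp.coeFn_smul c (C.zk (C.Op F ψ))] with k h1 h3
  rw [h3, Pi.smul_apply, h1]; rfl

theorem Op_sub (hF : Continuous F) (hG : Continuous G) :
    C.Op (fun k => F k - G k) = C.Op F - C.Op G := by
  have h : (fun k => F k - G k) = fun k => F k + (-1 : ℂ) • G k := by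
    funext k; rw [neg_one_smul, sub_eq_add_neg]
  have hG' : Continuous fun k => (-1 : ℂ) • G k := hG.const_smul (-1 : ℂ)
  rw [h, C.Op_add hF hG', C.Op_smul hG, neg_one_smul,
    sub_eq_add_neg]

theorem Op_one : C.Op (fun _ => ContinuousLinearMap.id ℂ C.Fib) = ContinuousLinearMap.id ℂ _ := by
  ext1 ψ
  exact C.Op_eq_of_ae continuous_const (Eventually.of_forall fun k => rfl)

theorem Op_adjoint (hF : Continuous F) : (C.Op F).adjoint = C.Op fun k => (F k).adjoint := by
  ext1 ψ
  refine ext_inner_left ℂ fun φ => ?_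
  rw [ContinuousLinearMap.adjoint_inner_right, ← C.zk.inner_map_map, zk_Op',
    ← C.zk.inner_map_map φ, zk_Op', ← opMul_adjoint (C.memLp_of_continuous hF ⊤),
    ContinuousLinearMap.adjoint_inner_right]

theorem norm_Op_le {c : ℝ} (hc : 0 ≤ c) (h : ∀ k ∈ brillouin C.a, ‖F k‖ ≤ c) : ‖C.Op F‖ ≤ c := by
  refine ContinuousLinearMap.opNorm_le_bound _ hc fun ψ => ?_
  rw [← C.zk.norm_map, zk_Op', ← C.zk.norm_map ψ]
  refine (ContinuousLinearMap.le_opNorm _ _).trans ?_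
  gcongr
  refine norm_opMul_le hc ?_
  filter_upwards [C.ae_beta_mem] with k hk
  exact h k hk

theorem Op_T (hF : Continuous F) (γ : C.Lat) (ψ : C.Hil) :
    C.Op F (C.T γ ψ) = C.T γ (C.Op F ψ) := by
  refine C.Op_eq_of_ae hF ?_
  rw [zk_T, zk_T]
  filter_upwards [mulB_coe (C.memLp_chr (-γ)) (C.zk (C.Op F ψ)), C.zk_Op hF ψ,
    mulB_coe (C.memLp_chr (-γ)) (C.zk ψ)] with k h1 h2 h3
  rw [h1, h2, h3, map_smul]

/-- The algebra homomorphism that maps a continuous function on the closure of the Brillouin zone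
to the operator with these fibres. -/
def opAlg : NormedAlgHom (CN C.zone (C.Fib →L[ℂ] C.Fib)) (C.Hil →L[ℂ] C.Hil) :=
  have hc := fun f : CN C.zone (C.Fib →L[ℂ] C.Fib) => f.continuous.comp C.continuous_clamp
  AlgHom.ofLinearMap
    { toFun := fun f => C.Op fun k => f (C.clamp k)
      map_add' := fun f g => C.Op_add (hc f) (hc g)
      map_smul' := fun a f => C.Op_smul (hc f) a }
    C.Op_one (fun f g => C.Op_mul (hc f) (hc g))

theorem norm_opAlg_le (f : CN C.zone (C.Fib →L[ℂ] C.Fib)) : ‖C.opAlg f‖ ≤ 1 * ‖f‖ := by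
  rw [one_mul]
  exact C.norm_Op_le (norm_nonneg f) fun k _ => f.norm_coe_le_norm _

/-- The algebra homomorphism `opAlg` as a bounded operator. -/
def opCLM : CN C.zone (C.Fib →L[ℂ] C.Fib) →L[ℂ] (C.Hil →L[ℂ] C.Hil) :=
  algCLM (A := CN C.zone (C.Fib →L[ℂ] C.Fib)) (B := C.Hil →L[ℂ] C.Hil)
    C.opAlg C.norm_opAlg_le

/-- The restriction of a continuous function to the closure of the Brillouin zone. -/
def toZone {A : Type*} [NormedAddCommGroup A] (F : Space d → A) (hF : Continuous F) :
    CN C.zone A :=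
  ⟨fun k => F k, hF.comp continuous_subtype_val⟩

/-- Only the values on one zone matter for `Op`, and on its compact closure continuous families form
a Banach algebra. Since `Op` is a contractive homomorphism on it, limits such as exponentials and
contour integrals can be computed fibre by fibre. -/
theorem opAlg_toZone (hF : Continuous F) : C.opAlg (C.toZone F hF) = C.Op F := by
  refine C.Op_congr ((C.toZone F hF).continuous.comp C.continuous_clamp) hF fun k hk => ?_
  change F _ = F k
  rw [C.clamp_of_mem (C.brillouin_subset_zone hk)]

theorem continuous_exp_comp {A : Type*} [NormedRing A] [NormedAlgebra ℂ A] [CompleteSpace A]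
    {f : Space d → A} (hf : Continuous f) : Continuous fun k => NormedSpace.exp (f k) :=
  have : NormedAlgebra ℚ A := NormedAlgebra.restrictScalars ℚ ℂ A
  NormedSpace.exp_continuous.comp hf

theorem toZone_exp {A : Type*} [NormedRing A] [NormedAlgebra ℂ A] [CompleteSpace A]
    {f : Space d → A} (hf : Continuous f) :
    NormedSpace.exp (C.toZone f hf) = C.toZone _ (continuous_exp_comp hf) := by
  ext1 k
  exact exp_apply (C.toZone f hf) k

theorem Op_exp (hF : Continuous F) :
    C.Op (fun k => NormedSpace.exp (F k)) = NormedSpace.exp (C.Op F) := by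
  have h1 := map_exp_of_contractive (A := CN C.zone (C.Fib →L[ℂ] C.Fib)) (B := C.Hil →L[ℂ] C.Hil)
    C.opAlg C.norm_opAlg_le (C.toZone F hF)
  have h2 := congrArg C.opAlg (C.toZone_exp (A := C.Fib →L[ℂ] C.Fib) hF)
  have h3 := C.opAlg_toZone (F := fun k => NormedSpace.exp (F k))
    (continuous_exp_comp (A := C.Fib →L[ℂ] C.Fib) hF)
  exact h3.symm.trans (h2.symm.trans (h1.trans (congrArg NormedSpace.exp (C.opAlg_toZone hF))))

/-- By currying, the integrand is a continuous function on the circle with values in `C(zone,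
ℒ(Fib))`. Its integral commutes with two bounded maps: evaluation at `k` and the map to operators on
`L²(𝒳)`. -/
theorem circleIntegral_Op {c : ℂ} {r : ℝ} (hr : 0 ≤ r)
    {f : Space d → CN (Metric.sphere c r) (C.Fib →L[ℂ] C.Fib)} (hf : Continuous f) {R : ℂ → C.Hil →L[ℂ] C.Hil}
    (hR : ∀ z (hz : z ∈ Metric.sphere c r), R z = C.Op fun k => f k ⟨z, hz⟩) :
    circleIntegral R c r = C.Op fun k => cint hr (f k) := by
  have hjoint : Continuous fun p : Metric.sphere c r × C.zone => f p.2 p.1 := by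
    have h1 : Continuous fun p : Metric.sphere c r × C.zone => f p.2 :=
      hf.comp (continuous_subtype_val.comp continuous_snd)
    exact h1.eval continuous_fst
  set g : CN (Metric.sphere c r) (CN C.zone (C.Fib →L[ℂ] C.Fib)) := ContinuousMap.curry ⟨_, hjoint⟩
  have hg : ∀ z k, g z k = f k z := fun z k => rfl
  have h1 : ∀ z, C.opCLM (g z) = C.Op fun k => f k z := fun z =>
    C.opAlg_toZone ((continuous_eval_const z).comp hf)
  set g' : CN (Metric.sphere c r) (C.Hil →L[ℂ] C.Hil) :=
    ⟨fun z => C.opCLM (g z), C.opCLM.continuous.comp g.continuous⟩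
  have h2 : circleIntegral R c r = cint hr g' :=
    cint_eq hr fun z hz => (hR z hz).trans (h1 ⟨z, hz⟩).symm
  have h4 : C.opCLM (cint hr g) = cint hr g' := map_cint hr C.opCLM g (fun z => rfl)
  rw [h2, ← h4]
  have h3 : cint hr g = C.toZone (fun k => cint hr (f k)) ((cint hr).continuous.comp hf) := by
    ext1 k
    exact map_cint hr (evalCN k) g fun z => (hg z k).symm
  rw [h3]
  exact C.opAlg_toZone _

/-! ### Equivariant families -/

/-- The family of operators `F` is `ϱ`-equivariant. -/
def Equi (F : Space d → C.Fib →L[ℂ] C.Fib) : Prop :=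
  ∀ g ∈ dualLattice C.a, ∀ k φ, F (k + g) (C.varrho g φ) = C.varrho g (F k φ)

variable {C}

theorem Equi.comp (hF : C.Equi F) (hG : C.Equi G) : C.Equi fun k => F k ∘L G k :=
  fun g hg k φ => by
    rw [ContinuousLinearMap.comp_apply, hG g hg, hF g hg, ContinuousLinearMap.comp_apply]

theorem Equi.sub (hF : C.Equi F) (hG : C.Equi G) : C.Equi fun k => F k - G k :=
  fun g hg k φ => by
    rw [sub_apply, sub_apply, hF g hg, hG g hg, map_sub]

theorem Equi.smul (hF : C.Equi F) (c : ℂ) : C.Equi fun k => c • F k :=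
  fun g hg k φ => by rw [smul_apply, smul_apply, hF g hg, map_smul]

theorem Equi.cint {c : ℂ} {r : ℝ} (hr : 0 ≤ r)
    {f : Space d → CN (Metric.sphere c r) (C.Fib →L[ℂ] C.Fib)} (h : ∀ z, C.Equi fun k => f k z) :
    C.Equi fun k => UCC.cint hr (f k) := by
  intro g hg k φ
  set g1 : CN (Metric.sphere c r) C.Fib :=
    ⟨fun z => f (k + g) z (C.varrho g φ), (f (k + g)).continuous.clm_apply continuous_const⟩
  set g2 : CN (Metric.sphere c r) C.Fib := ⟨fun z => f k z φ, (f k).continuous.clm_apply continuous_const⟩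
  have h1 : UCC.cint hr (f (k + g)) (C.varrho g φ) = UCC.cint hr g1 :=
    map_cint hr (ContinuousLinearMap.apply ℂ C.Fib (C.varrho g φ)) (f (k + g)) fun z => rfl
  have h2 : UCC.cint hr (f k) φ = UCC.cint hr g2 :=
    map_cint hr (ContinuousLinearMap.apply ℂ C.Fib φ) (f k) fun z => rfl
  rw [h1, h2]
  exact (map_cint hr (C.varrho g) g2 fun z => h z g hg k φ).symm

theorem IsZak.op {ψ : C.Hil} {Φ : Space d → C.Fib} (h : C.IsZak ψ Φ) (hF : Continuous F)
    (hE : C.Equi F) : C.IsZak (C.Op F ψ) fun k => F k (Φ k) := by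
  refine C.isZak_iff.mpr ⟨?_, fun g hg => ?_, ?_⟩
  · exact aestronglyMeasurable_clm_apply hF.aestronglyMeasurable h.measurable
  · filter_upwards [h.equivariant g hg] with k hk
    rw [hk, hE g hg]
  · filter_upwards [h.ae_eq_zk, C.zk_Op hF ψ] with k h1 h2
    rw [h1, h2]

variable (C)

theorem varrho_neg_apply (g : Space d) (φ : C.Fib) : C.varrho g (C.varrho (-g) φ) = φ := by
  have h := phaseOp_neg_apply (ν := C.mu.restrict C.fund) g φ
  rw [varrho, varrho, neg_neg]
  exact h

/-- Testing on constant functions from a countable dense set gives equality almost everywhere on the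
zone; equivariance extends it to almost all momenta and continuity to all of them. This transports
identities between operators, such as `P² = P`, to every fibre. -/
theorem eq_of_Op_eq (hF : Continuous F) (hG : Continuous G) (hFE : C.Equi F) (hGE : C.Equi G)
    (h : C.Op F = C.Op G) : F = G := by
  have h1 : ∀ v : C.Fib, ∀ᵐ k ∂C.beta, F k v = G k v := by
    intro v
    have hv : MemLp (fun _ : Space d => v) 2 C.beta := memLp_const v
    set ψ := C.zk.symm (hv.toLp _)
    have h2 := C.zk_Op hF ψ
    rw [h] at h2
    have h3 : ∀ᵐ k ∂C.beta, C.zk ψ k = v := by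
      simp only [ψ, LinearIsometryEquiv.apply_symm_apply]
      exact hv.coeFn_toLp
    filter_upwards [h2, C.zk_Op hG ψ, h3] with k h4 h5 h6
    rw [h6] at h4 h5
    rw [← h4, h5]
  have h2 : ∀ᵐ k ∂C.beta, F k = G k := by
    have h3 := ae_all_iff.mpr fun n : ℕ => h1 (TopologicalSpace.denseSeq C.Fib n)
    filter_upwards [h3] with k hk
    refine ContinuousLinearMap.coeFn_injective
      (Continuous.ext_on (TopologicalSpace.denseRange_denseSeq C.Fib) (F k).continuous
        (G k).continuous ?_)
    rintro _ ⟨n, rfl⟩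
    exact hk n
  have h3 : F =ᵐ[volume] G := by
    refine C.ae_of_ae_beta fun g hg => ?_
    filter_upwards [h2] with k hk
    ext1 φ
    rw [← C.varrho_neg_apply g φ, hFE g hg, hGE g hg, hk]
  exact (hF.ae_eq_iff_eq volume hG).mp h3

/-- The transform of `(coef γ)* v` is a wave, so the squared norm of its image is `∫ ‖F(k) e^{-i
k·y} v‖² dβ`. The sum over a basis of `v` is taken under the integral and is at most rank times
squared norm for each `k`. -/
theorem hs_Op_coef_adjoint_le (hF : Continuous F) {V : Space d → Submodule ℂ C.Fib}
    (hV : ∀ k φ, F k φ ∈ V k) [∀ k, FiniteDimensional ℂ (V k)] {n : ℕ}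
    (hn : ∀ k ∈ brillouin C.a, Module.finrank ℂ (V k) ≤ n) {c : ℝ} (hc : 0 ≤ c)
    (hFc : ∀ k ∈ brillouin C.a, ‖F k‖ ≤ c) (γ : C.Lat) :
    hs (C.Op F ∘L (C.coef γ).adjoint) ≤ ENNReal.ofReal (n * c ^ 2) := by
  have hFp : Continuous fun k => F k ∘L C.ph (-k) :=
    hF.clm_comp (C.continuous_ph.comp continuous_neg)
  have h1 : ∀ v, ‖(C.Op F ∘L (C.coef γ).adjoint) v‖ₑ ^ 2 =
      ∫⁻ k, ‖(F k ∘L C.ph (-k)) v‖ₑ ^ 2 ∂C.beta := by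
    intro v
    have h2 : ‖(C.Op F ∘L (C.coef γ).adjoint) v‖ₑ = ‖C.zk (C.Op F ((C.coef γ).adjoint v))‖ₑ := by
      rw [← ofReal_norm, ← ofReal_norm, LinearIsometryEquiv.norm_map]; rfl
    rw [h2, Lp.enorm_def, ← ENNReal.rpow_natCast, Nat.cast_ofNat,
      eLpNorm_eq_lintegral_rpow_enorm_toReal two_ne_zero ENNReal.ofNat_ne_top,
      ENNReal.toReal_ofNat, ← ENNReal.rpow_mul, one_div, inv_mul_cancel₀ two_ne_zero,
      ENNReal.rpow_one]
    refine lintegral_congr_ae ?_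
    filter_upwards [C.zk_Op hF ((C.coef γ).adjoint v), C.wave_coe γ v] with k h3 h4
    rw [zk_coef_adjoint, h4] at h3
    rw [h3, map_smul, ← ofReal_norm, norm_smul, norm_chr, one_mul, ofReal_norm]
    exact ENNReal.rpow_natCast _ 2
  have h2 : ∀ᵐ k ∂C.beta, ∑' i, ‖(F k ∘L C.ph (-k)) (stdBasis C.Fib i)‖ₑ ^ 2 ≤
      ENNReal.ofReal (n * c ^ 2) := by
    filter_upwards [C.ae_beta_mem] with k hk
    refine (tsum_enorm_sq_le_finrank (stdBasis C.Fib) (F k ∘L C.ph (-k)) (V k)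
      fun φ => hV k _).trans ?_
    have h3 : ‖F k ∘L C.ph (-k)‖ ≤ c := by
      refine ContinuousLinearMap.opNorm_le_bound _ hc fun φ => ?_
      refine ((F k).le_opNorm _).trans ?_
      have h4 : ‖C.ph (-k) φ‖ = ‖φ‖ := norm_phaseOp _ _
      exact mul_le_mul (hFc k hk) h4.le (norm_nonneg _) hc
    rw [← ofReal_norm, ← ENNReal.ofReal_pow (norm_nonneg _), ENNReal.ofReal_mul (by positivity),
      ENNReal.ofReal_natCast]
    gcongr
    exact_mod_cast hn k hk
  rw [hs]
  simp_rw [h1]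
  rw [ENNReal.tsum_eq_iSup_sum]
  refine iSup_le fun s => ?_
  rw [← lintegral_finsetSum]
  · refine (lintegral_mono_ae (g := fun _ => ENNReal.ofReal (n * c ^ 2)) ?_).trans ?_
    · filter_upwards [h2] with k hk
      exact (ENNReal.sum_le_tsum s).trans hk
    · rw [lintegral_const, measure_univ, mul_one]
  · intro i _
    exact (hFp.clm_apply continuous_const).enorm.measurable.pow_const 2

end Crystal
end UCC

end

/-! ### Periodic integration by parts, and position operators as momentum derivatives. -/

noncomputable section

namespace UCC

/-! ### Derivatives of operator valued functions -/

section ApplyRule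

variable {V E E' : Type*} [NormedAddCommGroup V] [NormedSpace ℝ V] [NormedAddCommGroup E]
  [NormedSpace ℂ E] [NormedAddCommGroup E'] [NormedSpace ℂ E'] {F : V → E →L[ℂ] E'} {Φ : V → E}

/-- Application of complex linear operators, as a real bilinear map. -/
def realApply (E E' : Type*) [NormedAddCommGroup E] [NormedSpace ℂ E] [NormedAddCommGroup E']
    [NormedSpace ℂ E'] : (E →L[ℂ] E') →L[ℝ] E →L[ℝ] E' :=
  ContinuousLinearMap.restrictScalarsL ℂ E E' ℝ ℝ

theorem realApply_apply (U : E →L[ℂ] E') (φ : E) : realApply E E' U φ = U φ := rfl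

theorem contDiff_apply {n : WithTop ℕ∞} (hF : ContDiff ℝ n F) (hΦ : ContDiff ℝ n Φ) :
    ContDiff ℝ n fun k => F k (Φ k) :=
  ((realApply E E').contDiff.comp hF).clm_apply hΦ

theorem fderiv_apply_rule {k : V} (hF : DifferentiableAt ℝ F k) (hΦ : DifferentiableAt ℝ Φ k)
    (v : V) : fderiv ℝ (fun k => F k (Φ k)) k v =
      fderiv ℝ F k v (Φ k) + F k (fderiv ℝ Φ k v) := by
  have h := ((realApply E E').hasFDerivAt_of_bilinear hF.hasFDerivAt hΦ.hasFDerivAt).fderiv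
  have h1 := congrArg (fun L : V →L[ℝ] E' => L v) h
  refine h1.trans ?_
  simp only [add_apply, ContinuousLinearMap.precompR_apply, ContinuousLinearMap.precompL_apply,
    realApply_apply]
  exact add_comm _ _

theorem fderiv_map (T : E →L[ℂ] E') {k : V} (hΦ : DifferentiableAt ℝ Φ k) (v : V) :
    fderiv ℝ (fun k => T (Φ k)) k v = T (fderiv ℝ Φ k v) := by
  have h := ((T.restrictScalars ℝ).hasFDerivAt.comp k hΦ.hasFDerivAt).fderiv
  exact congrArg (fun L : V →L[ℝ] E' => L v) h

end ApplyRule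

namespace Crystal

variable {d N : ℕ} (C : Crystal d N)

/-! ### Integrals of periodic functions of the momentum -/

/-- The basis of the dual lattice. -/
def dualBasis : Module.Basis (Fin d) ℝ (Space d) := Module.Basis.ofEquivFun C.dualEquiv.toLinearEquiv

theorem brillouin_eq : brillouin C.a = ZSpan.fundamentalDomain C.dualBasis := by
  ext k
  rw [mem_brillouin, ZSpan.mem_fundamentalDomain]
  rfl

theorem mem_dualLattice_of_mem_span {g : Space d}
    (hg : g ∈ Submodule.span ℤ (Set.range C.dualBasis)) : g ∈ dualLattice C.a := by
  induction hg using Submodule.span_induction with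
  | mem g hg =>
    obtain ⟨l, rfl⟩ := hg
    have : C.dualBasis l = C.dualVec (Pi.single l 1) := by
      rw [dualBasis, Module.Basis.coe_ofEquivFun, dualVec]
      change C.dualEquiv.symm _ = _
      congr 1
      funext m
      by_cases h : m = l
      · subst h; simp
      · simp [h]
    rw [this]
    exact C.dualVec_mem _
  | zero => exact fun γ _ => ⟨0, by simp⟩
  | add g g' _ _ h h' =>
    intro γ hγ
    obtain ⟨n, hn⟩ := h γ hγ
    obtain ⟨n', hn'⟩ := h' γ hγ
    exact ⟨n + n', by rw [inner_add_left, hn, hn']; push_cast; ring⟩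
  | smul m g _ h =>
    intro γ hγ
    obtain ⟨n, hn⟩ := h γ hγ
    refine ⟨m * n, ?_⟩
    rw [← Int.cast_smul_eq_zsmul ℝ, inner_smul_left, hn]
    push_cast
    simp
    ring

/-- A translate of the Brillouin zone is again a fundamental domain of the dual lattice. -/
theorem integral_beta_add {E : Type*} [NormedAddCommGroup E] [NormedSpace ℝ E] {f : Space d → E}
    (hf : ∀ g ∈ dualLattice C.a, ∀ k, f (k + g) = f k) (q : Space d) :
    ∫ k, f (q + k) ∂C.beta = ∫ k, f k ∂C.beta := by
  obtain ⟨c, -, -, h⟩ := C.exists_beta_eq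
  rw [h, integral_smul_measure, integral_smul_measure]
  congr 1
  have h1 := ZSpan.isAddFundamentalDomain' C.dualBasis (volume : Measure (Space d))
  have : Countable (Submodule.span ℤ (Set.range C.dualBasis)).toAddSubgroup :=
    inferInstanceAs (Countable (lattice C.dualBasis))
  have h2 := h1.vadd_of_comm q
  have h3 := h2.setIntegral_eq h1 (f := f) fun g k => by
    rw [AddSubgroup.vadd_def, vadd_eq_add, add_comm]
    exact hf _ (C.mem_dualLattice_of_mem_span g.2) k
  rw [brillouin_eq, ← h3]
  have h4 := (measurePreserving_add_left (volume : Measure (Space d)) q).setIntegral_image_emb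
    (measurableEmbedding_addLeft q) f (ZSpan.fundamentalDomain C.dualBasis)
  rw [← h4]
  rfl

/-- It is the derivative at `t = 0` of `∫ f(t v + k) dβ`, which is constant in `t`. -/
theorem integral_fderiv_eq_zero {E : Type*} [NormedAddCommGroup E] [NormedSpace ℝ E]
    [CompleteSpace E] {f : Space d → E} (hf : ContDiff ℝ 1 f)
    (hper : ∀ g ∈ dualLattice C.a, ∀ k, f (k + g) = f k) (v : Space d) :
    ∫ k, fderiv ℝ f k v ∂C.beta = 0 := by
  have hc : Continuous fun k => fderiv ℝ f k v :=
    (hf.continuous_fderiv one_ne_zero).clm_apply continuous_const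
  obtain ⟨M, hM⟩ : ∃ M, ∀ k ∈ brillouin C.a, ∀ t ∈ Metric.ball (0 : ℝ) 1,
      ‖fderiv ℝ f (t • v + k) v‖ ≤ M := by
    have hK : IsCompact ((fun p : ℝ × Space d => p.1 • v + p.2) ''
        (Metric.closedBall (0 : ℝ) 1 ×ˢ closure (brillouin C.a))) :=
      ((isCompact_closedBall _ _).prod C.isBounded_brillouin.isCompact_closure).image (by fun_prop)
    obtain ⟨M, hM⟩ := (hK.image hc).isBounded.exists_norm_le
    exact ⟨M, fun k hk t ht => hM _ ⟨_, ⟨(t, k), ⟨Metric.ball_subset_closedBall ht,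
      subset_closure hk⟩, rfl⟩, rfl⟩⟩
  have h := (hasDerivAt_integral_of_dominated_loc_of_deriv_le (μ := C.beta) (𝕜 := ℝ)
    (F := fun t k => f (t • v + k)) (F' := fun t k => fderiv ℝ f (t • v + k) v) (x₀ := 0)
    (bound := fun _ => M) (s := Metric.ball 0 1) (Metric.ball_mem_nhds _ one_pos)
    (Eventually.of_forall fun t => by
      have : Continuous fun k => f (t • v + k) := hf.continuous.comp (by fun_prop)
      exact this.aestronglyMeasurable)
    (by
      have : Continuous fun k => f ((0 : ℝ) • v + k) := hf.continuous.comp (by fun_prop)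
      exact (C.memLp_of_continuous this 1).integrable le_rfl)
    (by
      have : Continuous fun k => fderiv ℝ f ((0 : ℝ) • v + k) v := hc.comp (by fun_prop)
      exact this.aestronglyMeasurable)
    (by
      filter_upwards [C.ae_beta_mem] with k hk t ht
      exact hM k hk t ht)
    (integrable_const M)
    (Eventually.of_forall fun k t _ => by
      have h1 : HasDerivAt (fun t : ℝ => t • v + k) v t := by
        simpa using ((hasDerivAt_id t).smul_const v).add_const k
      exact ((hf.differentiable one_ne_zero) _).hasFDerivAt.comp_hasDerivAt t h1)).2
  have h2 : (fun t : ℝ => ∫ k, f (t • v + k) ∂C.beta) = fun _ => ∫ k, f k ∂C.beta := by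
    funext t
    exact C.integral_beta_add hper _
  rw [h2] at h
  have h3 := h.unique (hasDerivAt_const _ _)
  simpa using h3

/-! ### Position operators -/

theorem ph_mulB {g : Space d → ℂ} (hg : MemLp g ⊤ (C.mu.restrict C.fund)) (k : Space d)
    (φ : C.Fib) : C.ph k (mulB (Spin N) (C.mu.restrict C.fund) g φ) =
      mulB (Spin N) (C.mu.restrict C.fund) g (C.ph k φ) := by
  rw [ph, phaseOp_eq_mulB, ← ContinuousLinearMap.comp_apply, ← ContinuousLinearMap.comp_apply,
    ← mulB_mul (memLp_phase k) hg, ← mulB_mul hg (memLp_phase k)]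
  congr 2
  funext y
  exact mul_comm _ _

variable {C} in
theorem IsZak.coef_eq_integral {ψ : C.Hil} {Φ : Space d → C.Fib} (h : C.IsZak ψ Φ)
    (hΦ : Continuous Φ) (γ : C.Lat) :
    C.coef γ ψ = ∫ k, C.chr (-γ) k • C.ph k (Φ k) ∂C.beta := by
  have hc : Continuous fun k => C.chr (-γ) k • C.ph k (Φ k) :=
    (C.continuous_chr _).smul (C.continuous_ph.clm_apply hΦ)
  refine ext_inner_left ℂ fun v => ?_
  rw [inner_coef, ← integral_inner ((C.memLp_of_continuous hc 1).integrable le_rfl)]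
  refine integral_congr_ae ?_
  filter_upwards [h.ae_eq_zk] with k hk
  rw [← hk, inner_smul_right]

/-- The unit vectors of the coordinate axes. -/
def axis (l : Fin d) : Space d := EuclideanSpace.single l 1

theorem inner_axis (l : Fin d) (y : Space d) : (inner ℝ (axis l) y : ℝ) = y l := by
  rw [axis, EuclideanSpace.inner_single_left]; simp

theorem fderiv_ph (k v : Space d) : fderiv ℝ C.ph k v = C.ph k ∘L C.posFib v := by
  rw [(C.hasFDerivAt_ph k).fderiv]; rfl

theorem fderiv_chr (γ : C.Lat) (k v : Space d) :
    fderiv ℝ (C.chr γ) k v = Complex.I * (inner ℝ v (γ : Space d) : ℝ) * C.chr γ k := by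
  set L : Space d →L[ℝ] ℂ := Complex.I • (Complex.ofRealCLM.comp ((innerSL ℝ).flip (γ : Space d)))
  have hL : ∀ k, L k = Complex.I * (inner ℝ k (γ : Space d) : ℝ) := fun k => rfl
  have h1 : HasFDerivAt (C.chr γ) (Complex.exp (L k) • L) k := L.hasFDerivAt.cexp
  rw [h1.fderiv, smul_apply, hL, chr, hL, smul_eq_mul, mul_comm]

variable {C} in
theorem IsZak.fderiv_add {ψ : C.Hil} {Φ : Space d → C.Fib} (h : C.IsZak ψ Φ)
    (hΦ : ContDiff ℝ ∞ Φ) {g : Space d} (hg : g ∈ dualLattice C.a) (k v : Space d) :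
    fderiv ℝ Φ (k + g) v = C.varrho g (fderiv ℝ Φ k v) := by
  have h1 : (fun k => Φ (k + g)) = fun k => C.varrho g (Φ k) :=
    funext fun k => h.equivariant_of_continuous hΦ.continuous hg k
  have h2 := fderiv_comp_add_right (𝕜 := ℝ) (f := Φ) (x := k) g
  rw [← h2, h1]
  exact fderiv_map _ (hΦ.differentiable (by simp) k) v

theorem contDiff_fderiv_apply {E : Type*} [NormedAddCommGroup E] [NormedSpace ℝ E]
    {Φ : Space d → E} (hΦ : ContDiff ℝ ∞ Φ) (v : Space d) :
    ContDiff ℝ ∞ fun k => fderiv ℝ Φ k v :=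
  (hΦ.fderiv_right (m := ∞) (by simp)).clm_apply contDiff_const

variable {C} in
/-- In the Bloch-Floquet-Zak representation the position operator `X_l` acts as `i ∂_l`. -/
theorem IsZak.position {ψ : C.Hil} {Φ : Space d → C.Fib} (h : C.IsZak ψ Φ) (hΦ : ContDiff ℝ ∞ Φ)
    (l : Fin d) : ∃ ψ' : C.Hil, C.IsZak ψ' (fun k => Complex.I • fderiv ℝ Φ k (axis l)) ∧
      ∀ᵐ x ∂C.mu, ψ' x = (x l : ℂ) • ψ x := by
  have hΦ' : ContDiff ℝ ∞ fun k => Complex.I • fderiv ℝ Φ k (axis l) :=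
    (contDiff_fderiv_apply hΦ _).const_smul _
  obtain ⟨ψ', hψ'⟩ := C.exists_isZak_of_continuous hΦ'.continuous fun g hg k => by
    rw [h.fderiv_add hΦ hg, map_smul]
  refine ⟨ψ', hψ', ?_⟩
  -- Integration by parts in the inversion formula. The derivative of `e^{-i k·γ} e^{i k·y}` brings
  -- down `i (y_l - γ_l)`, and `y - γ` is the point at which `coef γ ψ` samples `ψ`.
  have hcoef : ∀ γ : C.Lat, C.coef γ ψ' = (-Complex.I) • C.posFib (axis l) (C.coef γ ψ) -
      (((γ : Space d) l : ℝ) : ℂ) • C.coef γ ψ := by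
    intro γ
    set u : Space d → C.Fib := fun k => C.chr (-γ) k • C.ph k (Φ k)
    have hphi : ContDiff ℝ ∞ fun k => C.ph k (Φ k) := contDiff_apply C.contDiff_ph hΦ
    have hu : ContDiff ℝ ∞ u := (C.contDiff_chr _).smul hphi
    have hder : ∀ k, fderiv ℝ u k (axis l) =
        C.posFib (axis l) (u k) - (Complex.I * ((γ : Space d) l : ℝ)) • u k +
          C.chr (-γ) k • C.ph k (fderiv ℝ Φ k (axis l)) := by
      intro k
      have d1 := (C.contDiff_chr (-γ)).differentiable (by simp) k
      have d2 := hphi.differentiable (by simp) k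
      have d3 := hΦ.differentiable (by simp) k
      have d4 := C.contDiff_ph.differentiable (by simp) k
      have e1 := congrArg (fun L : Space d →L[ℝ] C.Fib => L (axis l)) (fderiv_fun_smul d1 d2)
      refine e1.trans ?_
      change C.chr (-γ) k • fderiv ℝ (fun k => C.ph k (Φ k)) k (axis l) +
        fderiv ℝ (C.chr (-γ)) k (axis l) • C.ph k (Φ k) = _
      have e3 : fderiv ℝ (fun k => C.ph k (Φ k)) k (axis l) =
        fderiv ℝ C.ph k (axis l) (Φ k) + C.ph k (fderiv ℝ Φ k (axis l)) :=
        fderiv_apply_rule d4 d3 (axis l)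
      rw [e3, fderiv_chr, fderiv_ph, inner_axis]
      have e2 : C.ph k (C.posFib (axis l) (Φ k)) = C.posFib (axis l) (C.ph k (Φ k)) :=
        C.ph_mulB (C.memLp_inner_fund _) k _
      simp only [u, ContinuousLinearMap.comp_apply, e2, map_smul]
      push_cast
      rw [PiLp.neg_apply]
      push_cast
      module
    have hper : ∀ g ∈ dualLattice C.a, ∀ k, u (k + g) = u k := by
      intro g hg k
      simp only [u]
      rw [C.chr_add_dual _ _ hg, h.equivariant_of_continuous hΦ.continuous hg, ph_add, varrho,
        ContinuousLinearMap.comp_apply]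
      congr 2
      exact phaseOp_apply_neg _ _
    have h1 := C.integral_fderiv_eq_zero (hu.of_le (by simp)) hper (axis l)
    have hint : ∀ {f : Space d → C.Fib}, Continuous f → Integrable f C.beta := fun hf =>
      (C.memLp_of_continuous hf 1).integrable le_rfl
    have c1 : Continuous fun k => C.posFib (axis l) (u k) :=
      (C.posFib (axis l)).continuous.comp hu.continuous
    have c2 : Continuous fun k => (Complex.I * ((γ : Space d) l : ℝ)) • u k :=
      hu.continuous.const_smul (Complex.I * ((γ : Space d) l : ℝ))
    have c3 : Continuous fun k => C.chr (-γ) k • C.ph k (fderiv ℝ Φ k (axis l)) :=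
      (C.continuous_chr _).smul (C.continuous_ph.clm_apply (contDiff_fderiv_apply hΦ _).continuous)
    have c12 : Continuous fun k => C.posFib (axis l) (u k) -
        (Complex.I * ((γ : Space d) l : ℝ)) • u k := c1.sub c2
    simp_rw [hder] at h1
    rw [integral_add (hint c12) (hint c3), integral_sub (hint c1) (hint c2),
      ContinuousLinearMap.integral_comp_comm _ (hint hu.continuous), integral_smul,
      ← h.coef_eq_integral hΦ.continuous] at h1
    have h2 : C.coef γ ψ' =
        Complex.I • ∫ k, C.chr (-γ) k • C.ph k (fderiv ℝ Φ k (axis l)) ∂C.beta := by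
      rw [hψ'.coef_eq_integral hΦ'.continuous, ← integral_smul]
      refine integral_congr_ae (Eventually.of_forall fun k => ?_)
      simp only [map_smul]
      rw [smul_comm]
    rw [h2, ← sub_eq_zero]
    have h3 := congrArg (fun v => Complex.I • v) h1
    simp only [smul_add, smul_sub, smul_zero, smul_smul, ← mul_assoc, Complex.I_mul_I] at h3
    rw [← h3, neg_smul]
    module
  refine C.ae_of_ae_fund fun γ => ?_
  have h1 := C.coef_coe γ ψ'
  rw [hcoef γ] at h1
  filter_upwards [h1, C.coef_coe γ ψ,
    mulB_coe (C.memLp_inner_fund (axis l)) (C.coef γ ψ),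
    Lp.coeFn_sub ((-Complex.I) • C.posFib (axis l) (C.coef γ ψ))
      ((((γ : Space d) l : ℝ) : ℂ) • C.coef γ ψ),
    Lp.coeFn_smul (-Complex.I) (C.posFib (axis l) (C.coef γ ψ)),
    Lp.coeFn_smul (((γ : Space d) l : ℝ) : ℂ) (C.coef γ ψ)] with x h2 h3 h4 h5 h6 h7
  rw [h5, Pi.sub_apply, h6, h7, Pi.smul_apply, Pi.smul_apply, posFib_apply, h4, inner_axis,
    smul_smul, h3, ← sub_smul, ← map_smul] at h2
  -- The identity was obtained after applying `M(γ, x)`, which has to be cancelled.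
  have hinj : Function.Injective (C.M γ x) := by
    refine (injective_iff_map_eq_zero _).mpr fun w hw => ?_
    rw [← norm_eq_zero, ← ContinuousLinearMap.norm_map_of_mem_unitary (C.M_unitary γ x), hw,
      norm_zero]
  rw [← hinj h2]
  congr 1
  rw [PiLp.sub_apply, Complex.ofReal_sub, ← mul_assoc, neg_mul, Complex.I_mul_I]
  ring

end Crystal
end UCC

end

/-! ### Resolvents of self-adjoint operators, and smooth inversion in Banach algebras. -/

noncomputable section

namespace UCC

/-! ### Resolvents of self-adjoint operators -/

section SelfAdjoint

variable {H : Type*} [NormedAddCommGroup H] [InnerProductSpace ℂ H]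

/-- The operator `A - z` is bounded below by `δ`. -/
def BoundedBelowAt (A : H →ₗ.[ℂ] H) (z : ℂ) (δ : ℝ) : Prop :=
  ∀ ψ φ : H, (ψ, φ) ∈ A.graph → δ * ‖ψ‖ ≤ ‖φ - z • ψ‖

/-- The operator `A - z` on the graph of `A`. -/
def graphSub (A : H →ₗ.[ℂ] H) (z : ℂ) : A.graph →L[ℂ] H :=
  (ContinuousLinearMap.snd ℂ H H - z • ContinuousLinearMap.fst ℂ H H) ∘L A.graph.subtypeL

theorem graphSub_apply (A : H →ₗ.[ℂ] H) (z : ℂ) (p : A.graph) :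
    graphSub A z p = p.1.2 - z • p.1.1 := rfl

variable {A : H →ₗ.[ℂ] H} {z : ℂ} {δ : ℝ}

theorem BoundedBelowAt.norm_le (hδ : 0 < δ) (h : BoundedBelowAt A z δ) (p : A.graph) :
    ‖p‖ ≤ (δ⁻¹ + (1 + ‖z‖ * δ⁻¹)) * ‖graphSub A z p‖ := by
  have h1 : ‖p.1.1‖ ≤ δ⁻¹ * ‖graphSub A z p‖ := by
    rw [inv_mul_eq_div, le_div_iff₀' hδ]
    exact h _ _ p.2
  have h2 : ‖p.1.2‖ ≤ (1 + ‖z‖ * δ⁻¹) * ‖graphSub A z p‖ := by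
    have : p.1.2 = graphSub A z p + z • p.1.1 := by rw [graphSub_apply]; abel
    calc ‖p.1.2‖ ≤ ‖graphSub A z p‖ + ‖z • p.1.1‖ := by rw [this]; exact norm_add_le _ _
      _ ≤ ‖graphSub A z p‖ + ‖z‖ * (δ⁻¹ * ‖graphSub A z p‖) := by
        rw [norm_smul]; gcongr
      _ = _ := by ring
  have h0 := norm_nonneg (graphSub A z p)
  change ‖p.1‖ ≤ _
  rw [Prod.norm_def]
  refine max_le (h1.trans ?_) (h2.trans ?_)
  · refine mul_le_mul_of_nonneg_right ?_ h0
    have : 0 ≤ 1 + ‖z‖ * δ⁻¹ := by positivity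
    linarith
  · refine mul_le_mul_of_nonneg_right ?_ h0
    have : 0 ≤ δ⁻¹ := by positivity
    linarith

/-- The lower bound at `z` gives injectivity and closed range. A vector orthogonal to the range
belongs to the domain of `A* = A` and is an eigenvector for `star z`, which the lower bound at `star
z` excludes. -/
theorem graphSub_bijective [CompleteSpace H] (hA : IsSelfAdjoint A) (hδ : 0 < δ)
    (h : BoundedBelowAt A z δ) (h' : BoundedBelowAt A (star z) δ) :
    Function.Bijective (graphSub A z) := by
  have hcl : IsClosed (A.graph : Set (H × H)) := hA.isClosed
  have : CompleteSpace A.graph := hcl.completeSpace_coe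
  have hK : 0 ≤ δ⁻¹ + (1 + ‖z‖ * δ⁻¹) := by positivity
  have hanti : AntilipschitzWith ⟨_, hK⟩ (graphSub A z) :=
    ContinuousLinearMap.antilipschitz_of_bound _ fun p => h.norm_le hδ p
  refine ⟨hanti.injective, ?_⟩
  have hrange : IsClosed (Set.range (graphSub A z)) :=
    hanti.isClosed_range (graphSub A z).uniformContinuous
  set V : Submodule ℂ H := LinearMap.range (graphSub A z).toLinearMap
  have hV : IsClosed (V : Set H) := by
    have : (V : Set H) = Set.range (graphSub A z) := rfl
    rw [this]; exact hrange
  have : CompleteSpace V := hV.completeSpace_coe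
  have hVtop : V = ⊤ := by
    rw [← Submodule.orthogonal_eq_bot_iff, Submodule.eq_bot_iff]
    intro y hy
    have h1 : ∀ ψ : A.domain, inner ℂ (star z • y) (ψ : H) = inner ℂ y (A ψ) := by
      intro ψ
      have hm : A ψ - z • (ψ : H) ∈ V := ⟨⟨(ψ, A ψ), A.mem_graph ψ⟩, rfl⟩
      have := Submodule.inner_left_of_mem_orthogonal hm hy
      rw [inner_sub_right, sub_eq_zero] at this
      rw [this, inner_smul_left, inner_smul_right, RCLike.star_def, RCLike.conj_conj]
    have hd := hA.dense_domain
    have hmem : y ∈ A.adjoint.domain := LinearPMap.mem_adjoint_domain_of_exists y ⟨_, h1⟩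
    have hval : A.adjoint ⟨y, hmem⟩ = star z • y := LinearPMap.adjoint_apply_eq hd ⟨y, hmem⟩ h1
    have hg : (y, star z • y) ∈ A.graph := by
      rw [← LinearPMap.isSelfAdjoint_def.mp hA, ← hval]
      exact A.adjoint.mem_graph ⟨y, hmem⟩
    have := h' _ _ hg
    rw [sub_self, norm_zero] at this
    have h3 : ‖y‖ ≤ 0 := by
      by_contra hc
      push Not at hc
      nlinarith [mul_pos hδ hc]
    exact norm_le_zero_iff.mp h3
  intro y
  have : y ∈ V := hVtop ▸ Submodule.mem_top
  exact this

theorem inner_graph_comm [CompleteSpace H] (hA : IsSelfAdjoint A) {ψ φ ψ' φ' : H} (h : (ψ, φ) ∈ A.graph)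
    (h' : (ψ', φ') ∈ A.graph) : inner ℂ φ ψ' = inner ℂ ψ φ' := by
  obtain ⟨x, hx, hx'⟩ := (LinearPMap.mem_graph_iff A).mp h
  obtain ⟨y, hy, hy'⟩ := (LinearPMap.mem_graph_iff A).mp h'
  have h1 : A.adjoint.IsFormalAdjoint A := LinearPMap.adjoint_isFormalAdjoint hA.dense_domain
  rw [LinearPMap.isSelfAdjoint_def.mp hA] at h1
  have := h1 x y
  simp only at hx hx' hy hy'
  rw [hx', hy', hx, hy] at this
  exact this

/-- Since `⟨ψ, A ψ⟩` is real, the imaginary part of `⟨ψ, (A - z) ψ⟩` is `-Im z ‖ψ‖²`. -/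
theorem boundedBelowAt_of_im [CompleteSpace H] (hA : IsSelfAdjoint A) (z : ℂ) : BoundedBelowAt A z |z.im| := by
  intro ψ φ h
  have h1 : (inner ℂ ψ φ : ℂ).im = 0 := by
    have := inner_graph_comm hA h h
    exact Complex.conj_eq_iff_im.mp ((inner_conj_symm φ ψ).trans this)
  have h2 : (inner ℂ ψ (φ - z • ψ) : ℂ).im = -(z.im * ‖ψ‖ ^ 2) := by
    rw [inner_sub_right, inner_smul_right, Complex.sub_im, h1, inner_self_eq_norm_sq_to_K]
    have : (((‖ψ‖ : ℝ) : ℂ) ^ 2) = ((‖ψ‖ ^ 2 : ℝ) : ℂ) := by push_cast; rfl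
    simp only [Complex.coe_algebraMap]
    rw [this, Complex.mul_im, Complex.ofReal_re, Complex.ofReal_im]; ring
  have h3 : |z.im| * ‖ψ‖ ^ 2 ≤ ‖ψ‖ * ‖φ - z • ψ‖ := by
    calc |z.im| * ‖ψ‖ ^ 2 = |(inner ℂ ψ (φ - z • ψ) : ℂ).im| := by
          rw [h2, abs_neg, abs_mul, abs_of_nonneg (sq_nonneg ‖ψ‖)]
      _ ≤ ‖(inner ℂ ψ (φ - z • ψ) : ℂ)‖ := Complex.abs_im_le_norm _
      _ ≤ _ := norm_inner_le_norm _ _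
  rcases (norm_nonneg ψ).eq_or_lt with h0 | h0
  · rw [← h0, mul_zero]; exact norm_nonneg _
  · rw [sq, ← mul_assoc, mul_comm] at h3
    exact le_of_mul_le_mul_left h3 h0

theorem isResolventAt_unique {R R' : H →L[ℂ] H} (h : IsResolventAt A z R)
    (h' : IsResolventAt A z R') : R = R' := by
  ext1 ψ
  obtain ⟨hd, he⟩ := h.1 ψ
  have := h'.2 ⟨R ψ, hd⟩
  rw [he] at this
  exact this.symm

theorem IsResolventAt.resolventOp_eq {R : H →L[ℂ] H} (h : IsResolventAt A z R) :
    resolventOp A z = R := by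
  have hex : ∃ R : H →L[ℂ] H, IsResolventAt A z R := ⟨R, h⟩
  rw [resolventOp, dif_pos hex]
  exact isResolventAt_unique hex.choose_spec h

theorem IsResolventAt.mem_graph {R : H →L[ℂ] H} (h : IsResolventAt A z R) (ψ : H) :
    (R ψ, ψ + z • R ψ) ∈ A.graph := by
  obtain ⟨hd, he⟩ := h.1 ψ
  refine (LinearPMap.mem_graph_iff A).mpr ⟨⟨R ψ, hd⟩, rfl, ?_⟩
  simp only
  rw [← sub_eq_iff_eq_add]; exact he

theorem IsResolventAt.apply_graph {R : H →L[ℂ] H} (h : IsResolventAt A z R) {ψ φ : H}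
    (hg : (ψ, φ) ∈ A.graph) : R (φ - z • ψ) = ψ := by
  obtain ⟨x, hx, hx'⟩ := (LinearPMap.mem_graph_iff A).mp hg
  have := h.2 x
  simp only at hx hx'
  rw [hx, hx'] at this
  exact this

theorem isResolventAt_of_graph {R : H →L[ℂ] H} (h1 : ∀ ψ, (R ψ, ψ + z • R ψ) ∈ A.graph)
    (h2 : ∀ ψ φ, (ψ, φ) ∈ A.graph → R (φ - z • ψ) = ψ) : IsResolventAt A z R := by
  refine ⟨fun ψ => ?_, fun ψ => h2 _ _ (A.mem_graph ψ)⟩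
  obtain ⟨x, hx, hx'⟩ := (LinearPMap.mem_graph_iff A).mp (h1 ψ)
  simp only at hx hx'
  obtain ⟨x, hxd⟩ := x
  simp only at hx
  subst hx
  exact ⟨hxd, by rw [hx', add_sub_cancel_right]⟩

end SelfAdjoint

/-! ### Smooth families of invertible elements -/

section Inverse

variable {V A : Type*} [NormedAddCommGroup V] [NormedSpace ℝ V] [NormedRing A] [NormedAlgebra ℂ A]
  [CompleteSpace A]

/-- Constant functions. -/
def constCN (X A : Type*) [TopologicalSpace X] [CompactSpace X] [NormedAddCommGroup A]
    [NormedSpace ℂ A] : A →L[ℂ] CN X A :=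
  LinearMap.mkContinuous
    { toFun := fun a => ContinuousMap.const X a
      map_add' := fun _ _ => rfl
      map_smul' := fun _ _ => rfl } 1 fun a => by
    rw [one_mul]
    exact (ContinuousMap.norm_le _ (norm_nonneg a)).mpr fun x => le_rfl

/-- The function `z ↦ z a` on a circle. -/
def coordCN (S : Set ℂ) (a : A) : CN S A := ⟨fun z => (z : ℂ) • a, by fun_prop⟩

/-- Inversion is smooth on the units of the Banach algebra `C(S, A)`, and a continuous function is a
unit there as soon as all its values are units. Working in `C(S, A)` makes the smoothness in `k`
uniform in `z`. -/
theorem exists_contDiff_inverse (S : Set ℂ) [CompactSpace S] {B : V → A} (hB : ContDiff ℝ ∞ B)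
    (a : A) (h : ∀ k, ∀ z ∈ S, IsUnit (B k - z • a)) :
    ∃ u : V → CN S A, ContDiff ℝ ∞ u ∧ (∀ k (z : S), u k z * (B k - (z : ℂ) • a) = 1) ∧
      ∀ k (z : S), (B k - (z : ℂ) • a) * u k z = 1 := by
  set n : V → CN S A := fun k => constCN S A (B k) - coordCN S a
  have hn : ContDiff ℝ ∞ n :=
    (((constCN S A).restrictScalars ℝ).contDiff.comp hB).sub contDiff_const
  have hu : ∀ k, IsUnit (n k) := fun k =>
    ContinuousMap.isUnit_iff_forall_isUnit _ |>.mpr fun z => h k z z.2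
  refine ⟨fun k => Ring.inverse (n k), ?_, fun k z => ?_, fun k z => ?_⟩
  · rw [contDiff_iff_contDiffAt]
    intro k
    obtain ⟨w, hw⟩ := hu k
    have h1 : ContDiffAt ℝ ∞ Ring.inverse (n k) := hw ▸ contDiffAt_ringInverse ℝ w
    exact h1.comp k hn.contDiffAt
  · have := Ring.inverse_mul_cancel _ (hu k)
    exact congrArg (fun f : CN S A => f z) this
  · have := Ring.mul_inverse_cancel _ (hu k)
    exact congrArg (fun f : CN S A => f z) this

end Inverse

end UCC

end

/-! ### The fibres of the Hamiltonian and a smooth model of their resolvents. -/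

noncomputable section

namespace UCC
namespace Crystal
variable {d N : ℕ} (C : Crystal d N)

/-! ### The fibres of the Hamiltonian -/

section Fibres

variable {C} {H₀ : C.Hil →ₗ.[ℂ] C.Hil} {h : Space d → C.Fib →ₗ.[ℂ] C.Fib} {μF : ℝ}
  {P : C.Hil →L[ℂ] C.Hil}

/-- An equivariant representative on all of momentum space is not contained in `zk ψ`. It comes from
the fibration hypothesis: with `R` the resolvent at `μF`, both `R ψ` and `H₀ R ψ = ψ + μF R ψ` have
transforms, hence so does `ψ`. -/
theorem IsUnperturbed.exists_isZak (hH : C.IsUnperturbed H₀ h μF P) (ψ : C.Hil) :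
    ∃ Φ, C.IsZak ψ Φ := by
  obtain ⟨R, hR⟩ := hH.gap
  obtain ⟨Φ, Φ', h1, h2, -⟩ := (hH.fibration _ _).mp (hR.mem_graph ψ)
  have h3 := h2.sub (h1.smul (μF : ℂ))
  rw [add_sub_cancel_right] at h3
  exact ⟨_, h3⟩

theorem IsUnperturbed.varrho_mem_graph (hH : C.IsUnperturbed H₀ h μF P) {g : Space d}
    (hg : g ∈ dualLattice C.a) {k : Space d} {φ φ' : C.Fib} (hφ : (φ, φ') ∈ (h k).graph) :
    (C.varrho g φ, C.varrho g φ') ∈ (h (k + g)).graph := by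
  obtain ⟨x, hx, hx'⟩ := (LinearPMap.mem_graph_iff _).mp hφ
  simp only at hx hx'
  obtain ⟨hd, he⟩ := hH.fib_equivariant g hg k x
  rw [(LinearPMap.mem_graph_iff _)]
  refine ⟨⟨C.varrho g x, hd⟩, by rw [← hx], ?_⟩
  simp only
  rw [he, hx']

theorem IsUnperturbed.mem_graph_of_beta (hH : C.IsUnperturbed H₀ h μF P) {ψ ψ' : C.Hil}
    (hβ : ∀ᵐ k ∂C.beta, (C.zk ψ k, C.zk ψ' k) ∈ (h k).graph) : (ψ, ψ') ∈ H₀.graph := by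
  obtain ⟨Φ, hΦ⟩ := hH.exists_isZak ψ
  obtain ⟨Φ', hΦ'⟩ := hH.exists_isZak ψ'
  refine (hH.fibration _ _).mpr ⟨Φ, Φ', hΦ, hΦ', C.ae_of_ae_beta fun g hg => ?_⟩
  filter_upwards [hβ, hΦ.ae_eq_zk, hΦ'.ae_eq_zk, C.ae_beta_of_ae (hΦ.equivariant g hg),
    C.ae_beta_of_ae (hΦ'.equivariant g hg)] with k h1 h2 h3 h4 h5
  rw [h4, h5, h2, h3]
  exact hH.varrho_mem_graph hg h1

theorem IsUnperturbed.beta_of_mem_graph (hH : C.IsUnperturbed H₀ h μF P) {ψ ψ' : C.Hil}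
    (hg : (ψ, ψ') ∈ H₀.graph) : ∀ᵐ k ∂C.beta, (C.zk ψ k, C.zk ψ' k) ∈ (h k).graph := by
  obtain ⟨Φ, Φ', h1, h2, h3⟩ := (hH.fibration _ _).mp hg
  filter_upwards [h1.ae_eq_zk, h2.ae_eq_zk, C.ae_beta_of_ae h3] with k e1 e2 e3
  rw [← e1, ← e2]
  exact e3

/-- The fibres of `H₀` have the spectral gaps of `H₀`. -/
theorem IsUnperturbed.fib_boundedBelow (hH : C.IsUnperturbed H₀ h μF P) {z : ℂ}
    {R : C.Hil →L[ℂ] C.Hil} (hR : IsResolventAt H₀ z R) {k₀ : Space d} {φ φ' : C.Fib}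
    (hφ : (φ, φ') ∈ (h k₀).graph) : ‖φ‖ ≤ ‖R‖ * ‖φ' - z • φ‖ := by
  by_contra hlt
  push Not at hlt
  obtain ⟨G, hG, hGe⟩ := hH.fib_smooth
  have hφd : φ ∈ (h 0).domain := by
    rw [← hH.fib_domain k₀]; exact LinearPMap.mem_domain_of_mem_graph hφ
  set p : C.DomFib h := ⟨(φ, h 0 ⟨φ, hφd⟩), (h 0).mem_graph ⟨φ, hφd⟩⟩
  have hGg : ∀ k, (φ, G k p) ∈ (h k).graph := by
    intro k
    have hd : φ ∈ (h k).domain := by rw [hH.fib_domain k]; exact hφd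
    rw [hGe k p hd]
    exact (h k).mem_graph ⟨φ, hd⟩
  have hG0 : G k₀ p = φ' := by
    have h1 := (h k₀).graph.sub_mem (hGg k₀) hφ
    rw [Prod.mk_sub_mk, sub_self] at h1
    exact sub_eq_zero.mp ((h k₀).graph_fst_eq_zero_snd h1 rfl)
  obtain ⟨q, hq1, hq2⟩ := exists_between hlt
  have hφ0 : 0 < ‖φ‖ := (mul_nonneg (norm_nonneg R) (norm_nonneg (φ' - z • φ))).trans_lt hlt
  have hq0 : 0 ≤ q := (mul_nonneg (norm_nonneg R) (norm_nonneg (φ' - z • φ))).trans hq1.le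
  have hcG : Continuous fun k => G k p := hG.continuous.clm_apply continuous_const
  -- If the bound fails at `k₀` for `φ`, it fails with a margin for the same `φ` on a neighbourhood
  -- of `k₀`, because the domain is common and the fibres are continuous. A wave packet equal to `φ`
  -- on this neighbourhood then violates the bound that `R` imposes on `H₀`.
  set V : Set (Space d) := {k | ‖R‖ * ‖G k p - z • φ‖ < q}
  have hV : IsOpen V := isOpen_lt (by fun_prop) continuous_const
  have hk₀ : k₀ ∈ V := by change _ < q; rw [hG0]; exact hq1
  -- Square integrable functions live on one zone, so a dual translate is chosen for which `V` meets
  -- the zone in positive measure.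
  obtain ⟨g, hg, hgV⟩ : ∃ g ∈ dualLattice C.a, ¬ ∀ᵐ k ∂C.beta, k + g ∉ V := by
    by_contra hc
    push Not at hc
    have h1 : ∀ᵐ k, k ∉ V := C.ae_of_ae_beta hc
    exact (hV.measure_pos volume ⟨k₀, hk₀⟩).ne' (measure_eq_zero_iff_ae_notMem.mpr h1)
  set U : Set (Space d) := {k | k + g ∈ V}
  have hU : MeasurableSet U := (hV.preimage (by fun_prop : Continuous fun k => k + g)).measurableSet
  set φ₁ := C.varrho (-g) φ
  set f' : Space d → C.Fib := fun k => C.varrho (-g) (G (k + g) p)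
  have hφ₁ : ‖φ₁‖ = ‖φ‖ := norm_phaseOp _ _
  have hf'c : Continuous f' := (C.varrho (-g)).continuous.comp (hcG.comp (by fun_prop))
  have hgr : ∀ k, (φ₁, f' k) ∈ (h k).graph := by
    intro k
    have := hH.varrho_mem_graph (C.neg_mem_dualLattice hg) (hGg (k + g))
    rwa [add_neg_cancel_right] at this
  have m1 : MemLp (U.indicator fun _ => φ₁) 2 C.beta := (memLp_const φ₁).indicator hU
  have m2 : MemLp (U.indicator f') 2 C.beta := (C.memLp_of_continuous hf'c 2).indicator hU
  set ψ := C.zk.symm (m1.toLp _)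
  set ψ' := C.zk.symm (m2.toLp _)
  have e1 : ∀ᵐ k ∂C.beta, C.zk ψ k = U.indicator (fun _ => φ₁) k := by
    simp only [ψ, LinearIsometryEquiv.apply_symm_apply]; exact m1.coeFn_toLp
  have e2 : ∀ᵐ k ∂C.beta, C.zk ψ' k = U.indicator f' k := by
    simp only [ψ', LinearIsometryEquiv.apply_symm_apply]; exact m2.coeFn_toLp
  have hmem : (ψ, ψ') ∈ H₀.graph := by
    refine hH.mem_graph_of_beta ?_
    filter_upwards [e1, e2] with k h1 h2
    rw [h1, h2]
    by_cases hk : k ∈ U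
    · rw [Set.indicator_of_mem hk, Set.indicator_of_mem hk]; exact hgr k
    · rw [Set.indicator_of_notMem hk, Set.indicator_of_notMem hk]; exact Submodule.zero_mem _
  have hle : ‖C.zk (((‖R‖ : ℝ) : ℂ) • (ψ' - z • ψ))‖ ≤ (q / ‖φ‖) * ‖C.zk ψ‖ := by
    refine Lp.norm_le_mul_norm_of_ae_le_mul ?_
    have e0 : C.zk (((‖R‖ : ℝ) : ℂ) • (ψ' - z • ψ)) = ((‖R‖ : ℝ) : ℂ) • (C.zk ψ' - z • C.zk ψ) := by
      rw [map_smul, map_sub, map_smul]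
    rw [e0]
    filter_upwards [e1, e2, Lp.coeFn_smul ((‖R‖ : ℝ) : ℂ) (C.zk ψ' - z • C.zk ψ),
      Lp.coeFn_sub (C.zk ψ') (z • C.zk ψ), Lp.coeFn_smul z (C.zk ψ)] with k h1 h2 h3 h4 h5
    rw [h3, Pi.smul_apply, h4, Pi.sub_apply, h5, Pi.smul_apply, h1, h2]
    by_cases hk : k ∈ U
    · rw [Set.indicator_of_mem hk, Set.indicator_of_mem hk, norm_smul, hφ₁,
        div_mul_cancel₀ _ hφ0.ne', Complex.norm_real, norm_norm]
      have h6 : f' k - z • φ₁ = C.varrho (-g) (G (k + g) p - z • φ) := by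
        rw [map_sub, map_smul]
      have h7 : ‖f' k - z • φ₁‖ = ‖G (k + g) p - z • φ‖ := by rw [h6]; exact norm_phaseOp _ _
      rw [h7]
      exact le_of_lt hk
    · rw [Set.indicator_of_notMem hk, Set.indicator_of_notMem hk]; simp
  rw [LinearIsometryEquiv.norm_map, LinearIsometryEquiv.norm_map, norm_smul, Complex.norm_real, norm_norm] at hle
  have hψ : ‖ψ‖ ≤ ‖R‖ * ‖ψ' - z • ψ‖ := by
    have := R.le_opNorm (ψ' - z • ψ)
    rwa [hR.apply_graph hmem] at this
  have hψ0 : ‖ψ‖ ≤ 0 := by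
    by_contra hc
    push Not at hc
    have : q / ‖φ‖ < 1 := (div_lt_one hφ0).mpr hq2
    nlinarith
  have hψz : ψ = 0 := norm_le_zero_iff.mp hψ0
  refine hgV ?_
  rw [hψz, map_zero] at e1
  filter_upwards [e1, Lp.coeFn_zero C.Fib 2 C.beta] with k h1 h2 hk
  rw [h2, Set.indicator_of_mem (show k ∈ U from hk)] at h1
  have : ‖φ₁‖ = 0 := by rw [← h1]; simp
  rw [hφ₁] at this
  exact hφ0.ne' this

end Fibres

/-- Smooth families of bounded operators that describe the fibres `h k` of the Hamiltonian and
their resolvents on a circle: `κ` is a fixed bijection from the fibre space to the common domain,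
`B k = h k ∘ κ` and `u k z` is the inverse of `B k - z κ`. -/
structure FibreResolvent (h : Space d → C.Fib →ₗ.[ℂ] C.Fib) (c r : ℝ) where
  lift : C.Fib →L[ℂ] C.DomFib h
  κ : C.Fib →L[ℂ] C.Fib
  lift_fst : ∀ v, (lift v).1.1 = κ v
  B : Space d → C.Fib →L[ℂ] C.Fib
  u : Space d → CN (Metric.sphere (c : ℂ) r) (C.Fib →L[ℂ] C.Fib)
  contDiff_B : ContDiff ℝ ∞ B
  contDiff_u : ContDiff ℝ ∞ u
  injective : Function.Injective κ
  graph_iff : ∀ k φ φ', (φ, φ') ∈ (h k).graph ↔ ∃ v, κ v = φ ∧ B k v = φ'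
  u_mul : ∀ (k : Space d) (z : Metric.sphere (c : ℂ) r), u k z ∘L (B k - (z : ℂ) • κ) = ContinuousLinearMap.id ℂ C.Fib
  mul_u : ∀ (k : Space d) (z : Metric.sphere (c : ℂ) r), (B k - (z : ℂ) • κ) ∘L u k z = ContinuousLinearMap.id ℂ C.Fib

variable {C} {H₀ : C.Hil →ₗ.[ℂ] C.Hil} {h : Space d → C.Fib →ₗ.[ℂ] C.Fib} {μF : ℝ}
  {P : C.Hil →L[ℂ] C.Hil} {c r : ℝ}

theorem IsUnperturbed.graphSub_bijective (hH : C.IsUnperturbed H₀ h μF P) {z : ℂ}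
    (hz : z.im ≠ 0 ∨ ∃ x : ℝ, (x : ℂ) = z ∧ z ∈ resolventSetOp H₀) (k : Space d) :
    Function.Bijective (graphSub (h k) z) := by
  rcases hz with hz | ⟨x, hx, R, hR⟩
  · refine UCC.graphSub_bijective (hH.fib_selfAdjoint k) (abs_pos.mpr hz)
      (boundedBelowAt_of_im (hH.fib_selfAdjoint k) z) ?_
    have := boundedBelowAt_of_im (hH.fib_selfAdjoint k) (star z)
    rwa [RCLike.star_def, Complex.conj_im, abs_neg] at this
  · have hb : BoundedBelowAt (h k) z (‖R‖ + 1)⁻¹ := by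
      intro φ φ' hφ
      rw [inv_mul_le_iff₀ (by positivity)]
      refine (hH.fib_boundedBelow hR hφ).trans ?_
      gcongr
      linarith
    refine UCC.graphSub_bijective (hH.fib_selfAdjoint k) (by positivity) hb ?_
    have : star z = z := by rw [← hx]; exact Complex.conj_ofReal x
    rwa [this]

/-- The circle meets the real axis only at `c - r` and at `c + r = μF`, both in the resolvent set;
every other point has nonzero imaginary part. -/
theorem IsContour.mem_sphere (hcr : C.IsContour H₀ μF c r) (hμ : (μF : ℂ) ∈ resolventSetOp H₀) {z : ℂ}
    (hz : z ∈ Metric.sphere (c : ℂ) r) :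
    z.im ≠ 0 ∨ ∃ x : ℝ, (x : ℂ) = z ∧ z ∈ resolventSetOp H₀ := by
  by_cases him : z.im = 0
  · refine Or.inr ⟨z.re, Complex.ext rfl (by simp [him]), ?_⟩
    have hzr : z = (z.re : ℂ) := Complex.ext rfl (by simp [him])
    rw [mem_sphere_iff_norm, hzr, ← Complex.ofReal_sub, Complex.norm_real, Real.norm_eq_abs] at hz
    rcases abs_eq hcr.1.le |>.mp hz with h1 | h1
    · have : z.re = μF := by rw [← hcr.2.1]; linarith
      rw [hzr, this]; exact hμ
    · rw [hzr]
      exact hcr.2.2 _ (by linarith)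
  · exact Or.inl him

/-- Composing with the fixed bijection `κ` onto the common domain replaces the unbounded `h k` by
bounded operators `B k` on a single Banach space, to which smooth inversion applies. The
invertibility of `B k - z κ` is that of `h k - z`. -/
theorem IsUnperturbed.exists_fibreResolvent (hH : C.IsUnperturbed H₀ h μF P)
    (hcr : C.IsContour H₀ μF c r) : Nonempty (C.FibreResolvent h c r) := by
  have : CompleteSpace (h 0).graph := (hH.fib_selfAdjoint 0).isClosed.completeSpace_coe
  obtain ⟨G, hG, hGe⟩ := hH.fib_smooth
  -- Any point off the real axis would do here: `κ` is `(h 0 - i)⁻¹`.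
  have hbij := hH.graphSub_bijective (z := Complex.I) (Or.inl (by simp)) 0
  set e : (h 0).graph ≃L[ℂ] C.Fib := ContinuousLinearEquiv.ofBijective (graphSub (h 0) Complex.I)
    (LinearMap.ker_eq_bot.mpr hbij.1) (LinearMap.range_eq_top.mpr hbij.2)
  set lift : C.Fib →L[ℂ] C.DomFib h := e.symm.toContinuousLinearMap
  set κ : C.Fib →L[ℂ] C.Fib := ContinuousLinearMap.fst ℂ _ _ ∘L (h 0).graph.subtypeL ∘L lift
  set B : Space d → C.Fib →L[ℂ] C.Fib := fun k => G k ∘L lift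
  have hB : ContDiff ℝ ∞ B := by
    have h1 := (((ContinuousLinearMap.compL ℂ C.Fib (C.DomFib h) C.Fib).flip
      lift).restrictScalars ℝ).contDiff.comp hG
    exact h1
  have hκ : ∀ v, (lift v).1.1 = κ v := fun v => rfl
  have hinj : Function.Injective κ := by
    intro v w hvw
    have h1 : (lift v).1.1 = (lift w).1.1 := hvw
    refine e.symm.injective (Subtype.ext (Prod.ext h1 ?_))
    have h2 := (h 0).graph.sub_mem (lift v).2 (lift w).2
    exact sub_eq_zero.mp ((h 0).graph_fst_eq_zero_snd h2 (sub_eq_zero.mpr h1))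
  have hgr : ∀ k φ φ', (φ, φ') ∈ (h k).graph ↔ ∃ v, κ v = φ ∧ B k v = φ' := by
    have hv : ∀ k v, (κ v, B k v) ∈ (h k).graph := by
      intro k v
      have hd : (lift v).1.1 ∈ (h k).domain := by
        rw [hH.fib_domain k]; exact LinearPMap.mem_domain_of_mem_graph (lift v).2
      have := LinearPMap.mem_graph (h k) ⟨_, hd⟩
      rw [← hGe k (lift v) hd] at this
      exact this
    intro k φ φ'
    constructor
    · intro hφ
      have hd : φ ∈ (h 0).domain := by
        rw [← hH.fib_domain k]; exact LinearPMap.mem_domain_of_mem_graph hφ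
      set p : C.DomFib h := ⟨(φ, h 0 ⟨φ, hd⟩), (h 0).mem_graph ⟨φ, hd⟩⟩
      have h1 : lift (e p) = p := e.symm_apply_apply p
      have h2 : κ (e p) = φ := by rw [← hκ, h1]
      refine ⟨e p, h2, ?_⟩
      have h3 := (h k).graph.sub_mem (hv k (e p)) hφ
      exact sub_eq_zero.mp ((h k).graph_fst_eq_zero_snd h3 (sub_eq_zero.mpr h2))
    · rintro ⟨v, rfl, rfl⟩
      exact hv k v
  have hunit : ∀ k, ∀ z ∈ Metric.sphere (c : ℂ) r, IsUnit (B k - z • κ) := by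
    intro k z hz
    rw [ContinuousLinearMap.isUnit_iff_bijective]
    have hb := hH.graphSub_bijective (hcr.mem_sphere hH.gap hz) k
    constructor
    · rw [injective_iff_map_eq_zero]
      intro v hv
      have h1 : (⟨(κ v, B k v), (hgr k _ _).mpr ⟨v, rfl, rfl⟩⟩ : (h k).graph) = 0 :=
        (injective_iff_map_eq_zero _).mp hb.1 _ hv
      have h2 : κ v = 0 := congrArg (fun p : (h k).graph => p.1.1) h1
      exact hinj (by rw [h2, map_zero])
    · intro w
      obtain ⟨⟨⟨φ, φ'⟩, hp⟩, hpw⟩ := hb.2 w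
      obtain ⟨v, rfl, rfl⟩ := (hgr k _ _).mp hp
      exact ⟨v, hpw⟩
  obtain ⟨u, hu, hu1, hu2⟩ := exists_contDiff_inverse (A := C.Fib →L[ℂ] C.Fib)
    (Metric.sphere (c : ℂ) r) hB κ hunit
  exact ⟨⟨lift, κ, hκ, B, u, hB, hu, hinj, hgr, hu1, hu2⟩⟩

namespace FibreResolvent

variable (E : C.FibreResolvent h c r)

theorem mem_graph (hH : C.IsUnperturbed H₀ h μF P) {F : Space d → C.Fib →L[ℂ] C.Fib}
    (hF : Continuous F) (ψ : C.Hil) :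
    (C.Op (fun k => E.κ ∘L F k) ψ, C.Op (fun k => E.B k ∘L F k) ψ) ∈ H₀.graph := by
  refine hH.mem_graph_of_beta ?_
  filter_upwards [C.zk_Op (F := fun k => E.κ ∘L F k) (continuous_const.clm_comp hF) ψ,
    C.zk_Op (F := fun k => E.B k ∘L F k) (E.contDiff_B.continuous.clm_comp hF) ψ] with k h1 h2
  rw [h1, h2]
  exact (E.graph_iff k _ _).mpr ⟨F k (C.zk ψ k), rfl, rfl⟩

theorem continuous_u (z : Metric.sphere (c : ℂ) r) : Continuous fun k => E.u k z :=
  (continuous_eval_const z).comp E.contDiff_u.continuous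

theorem isResolventAt (hH : C.IsUnperturbed H₀ h μF P) (z : Metric.sphere (c : ℂ) r) :
    IsResolventAt H₀ z (C.Op fun k => E.κ ∘L E.u k z) := by
  have hc : Continuous fun k => E.κ ∘L E.u k z := continuous_const.clm_comp (E.continuous_u z)
  have hc' : Continuous fun k => E.B k ∘L E.u k z :=
    E.contDiff_B.continuous.clm_comp (E.continuous_u z)
  refine isResolventAt_of_graph (fun ψ => ?_) fun ψ φ hg => ?_
  · have h1 := E.mem_graph hH (E.continuous_u z) ψ
    have h2 : C.Op (fun k => E.B k ∘L E.u k z) ψ =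
        ψ + (z : ℂ) • C.Op (fun k => E.κ ∘L E.u k z) ψ := by
      refine C.Op_eq_of_ae hc' ?_
      rw [map_add, map_smul]
      filter_upwards [C.zk_Op hc ψ, Lp.coeFn_add (C.zk ψ)
        ((z : ℂ) • C.zk (C.Op (fun k => E.κ ∘L E.u k z) ψ)),
        Lp.coeFn_smul (z : ℂ) (C.zk (C.Op (fun k => E.κ ∘L E.u k z) ψ))] with k h3 h4 h5
      rw [h4, Pi.add_apply, h5, Pi.smul_apply, h3]
      have := congrArg (fun T : C.Fib →L[ℂ] C.Fib => T (C.zk ψ k)) (E.mul_u k z)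
      change E.B k (E.u k z (C.zk ψ k)) - (z : ℂ) • E.κ (E.u k z (C.zk ψ k)) = C.zk ψ k at this
      exact (sub_eq_iff_eq_add.mp this).symm
    rw [← h2]; exact h1
  · refine C.Op_eq_of_ae hc ?_
    rw [map_sub, map_smul]
    filter_upwards [hH.beta_of_mem_graph hg, Lp.coeFn_sub (C.zk φ) ((z : ℂ) • C.zk ψ),
      Lp.coeFn_smul (z : ℂ) (C.zk ψ)] with k h1 h2 h3
    rw [h2, Pi.sub_apply, h3, Pi.smul_apply]
    obtain ⟨v, hv, hv'⟩ := (E.graph_iff k _ _).mp h1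
    rw [← hv, ← hv']
    have := congrArg (fun T : C.Fib →L[ℂ] C.Fib => T v) (E.u_mul k z)
    change E.u k z (E.B k v - (z : ℂ) • E.κ v) = v at this
    rw [ContinuousLinearMap.comp_apply, this]

theorem resolventOp_eq (hH : C.IsUnperturbed H₀ h μF P) (z : Metric.sphere (c : ℂ) r) :
    resolventOp H₀ z = C.Op fun k => E.κ ∘L E.u k z :=
  (E.isResolventAt hH z).resolventOp_eq

theorem equi (hH : C.IsUnperturbed H₀ h μF P) (z : Metric.sphere (c : ℂ) r) :
    C.Equi fun k => E.κ ∘L E.u k z := by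
  have hres : ∀ k φ φ', (φ, φ') ∈ (h k).graph → (E.κ ∘L E.u k z) (φ' - (z : ℂ) • φ) = φ := by
    intro k φ φ' hg
    obtain ⟨v, rfl, rfl⟩ := (E.graph_iff k _ _).mp hg
    have := congrArg (fun T : C.Fib →L[ℂ] C.Fib => T v) (E.u_mul k z)
    change E.u k z (E.B k v - (z : ℂ) • E.κ v) = v at this
    rw [ContinuousLinearMap.comp_apply, this]
  intro g hg k φ
  have h1 : (E.κ (E.u k z φ), E.B k (E.u k z φ)) ∈ (h k).graph :=
    (E.graph_iff k _ _).mpr ⟨_, rfl, rfl⟩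
  have h2 := hres _ _ _ (hH.varrho_mem_graph hg h1)
  have h3 : E.B k (E.u k z φ) - (z : ℂ) • E.κ (E.u k z φ) = φ :=
    congrArg (fun T : C.Fib →L[ℂ] C.Fib => T φ) (E.mul_u k z)
  rw [← map_smul, ← map_sub, h3] at h2
  exact h2

end FibreResolvent

end Crystal
end UCC

end

/-! ### The Fermi projection as a contour integral of resolvents. -/

noncomputable section

namespace UCC

/-! ### Riesz projections -/

section Riesz

variable {H : Type*} [NormedAddCommGroup H] [InnerProductSpace ℂ H] {A : H →ₗ.[ℂ] H}

theorem IsResolventAt.injective {z : ℂ} {R : H →L[ℂ] H} (h : IsResolventAt A z R) {ψ : H}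
    (h0 : R ψ = 0) : ψ = 0 := by
  have h1 := h.mem_graph ψ
  rw [h0, smul_zero, add_zero] at h1
  exact A.graph_fst_eq_zero_snd h1 rfl

theorem IsResolventAt.resolvent_identity {z w : ℂ} {R S : H →L[ℂ] H} (hR : IsResolventAt A z R)
    (hS : IsResolventAt A w S) : R - S = (z - w) • (S * R) := by
  ext1 ψ
  have h1 := hS.apply_graph (hR.mem_graph ψ)
  change R ψ - S ψ = (z - w) • S (R ψ)
  rw [add_sub_assoc, ← sub_smul, map_add, map_smul] at h1
  rw [← h1, add_sub_cancel_left, h1]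

theorem IsResolventAt.symm [CompleteSpace H] (hA : IsSelfAdjoint A) {x : ℝ} {R : H →L[ℂ] H}
    (hR : IsResolventAt A x R) : IsSelfAdjoint R := by
  rw [ContinuousLinearMap.isSelfAdjoint_iff_isSymmetric]
  intro ψ φ
  have h := inner_graph_comm hA (hR.mem_graph ψ) (hR.mem_graph φ)
  rw [inner_add_left, inner_add_right, inner_smul_left, inner_smul_right, Complex.conj_ofReal] at h
  exact (add_right_cancel h).symm

theorem IsResolventAt.commute {x : ℂ} {R P : H →L[ℂ] H} (hR : IsResolventAt A x R)
    (hP : ∀ ψ : A.domain, ∃ h : P ψ ∈ A.domain, A ⟨P ψ, h⟩ = P (A ψ)) : Commute R P := by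
  change R * P = P * R
  ext1 ψ
  obtain ⟨hd, he⟩ := hR.1 ψ
  obtain ⟨hd', he'⟩ := hP ⟨R ψ, hd⟩
  have h1 := hR.apply_graph (A.mem_graph ⟨_, hd'⟩)
  rw [he'] at h1
  simp only at h1
  rw [← map_smul, ← map_sub, he] at h1
  exact h1

/-- By the resolvent identity the inverse of `1 - (z - w) S` is `1 + (z - w) R`. -/
theorem isUnit_of_resolvent {z w : ℂ} {R S : H →L[ℂ] H} (hR : IsResolventAt A z R)
    (hS : IsResolventAt A w S) : IsUnit (1 - (z - w) • S) := by
  have h1 := hR.resolvent_identity hS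
  have h2 := hS.resolvent_identity hR
  refine ⟨⟨1 - (z - w) • S, 1 + (z - w) • R, ?_, ?_⟩, rfl⟩
  · have : (1 - (z - w) • S) * (1 + (z - w) • R) =
        1 + (z - w) • (R - S - (z - w) • (S * R)) := by
      simp only [sub_mul, mul_add, one_mul, mul_one, smul_mul_smul_comm, smul_sub, smul_smul]
      abel
    rw [this, h1, sub_self, smul_zero, add_zero]
  · have : (1 + (z - w) • R) * (1 - (z - w) • S) =
        1 + (z - w) • (-(S - R) + (w - z) • (R * S)) := by
      simp only [add_mul, mul_sub, one_mul, mul_one, smul_mul_smul_comm, smul_add, smul_sub,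
        smul_neg, smul_smul]
      module
    rw [this, h2, neg_add_cancel, smul_zero, add_zero]

theorem inv_notMem_spectrum {x x₀ : ℝ} (hx : x ≠ x₀) {R S : H →L[ℂ] H}
    (hR : IsResolventAt A x R) (hS : IsResolventAt A x₀ S) :
    (((x - x₀)⁻¹ : ℝ) : ℂ) ∉ spectrum ℂ S := by
  rw [spectrum.mem_iff, not_not]
  have h1 := isUnit_of_resolvent hR hS
  have hne : ((x : ℂ) - x₀) ≠ 0 := by
    rw [← Complex.ofReal_sub, Complex.ofReal_ne_zero]; exact sub_ne_zero.mpr hx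
  have h2 : algebraMap ℂ (H →L[ℂ] H) (((x - x₀)⁻¹ : ℝ) : ℂ) - S =
      (((x : ℂ) - x₀)⁻¹) • (1 - ((x : ℂ) - x₀) • S) := by
    rw [smul_sub, smul_smul, inv_mul_cancel₀ hne, one_smul, Algebra.algebraMap_eq_smul_one]
    push_cast; rfl
  rw [h2]
  exact h1.smul (Units.mk0 _ (inv_ne_zero hne))

theorem circleIntegral_inv_of_notMem {c w : ℂ} {r : ℝ} (hr : 0 ≤ r)
    (hw : w ∉ Metric.closedBall c r) : ∮ z in C(c, r), (z - w)⁻¹ = 0 := by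
  have hne : ∀ z ∈ Metric.closedBall c r, z - w ≠ 0 := fun z hz h0 =>
    hw (sub_eq_zero.mp h0 ▸ hz)
  refine Complex.circleIntegral_eq_zero_of_differentiable_on_off_countable hr
    Set.countable_empty ?_ fun z hz => ?_
  · exact (continuousOn_id.sub continuousOn_const).inv₀ hne
  · exact (differentiableAt_id.sub_const w).inv (hne z (Metric.ball_subset_closedBall hz.1))

/-- The spectral projection below a gap is a Riesz projection. -/
theorem IsSpectralProjBelow.eq_circleIntegral [CompleteSpace H] (hA : IsSelfAdjoint A) {c r : ℝ}
    (hr : 0 < r) (hres : ∀ x : ℝ, x ≤ c - r → (x : ℂ) ∈ resolventSetOp A)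
    (hgap : ((c + r : ℝ) : ℂ) ∈ resolventSetOp A) {P : H →L[ℂ] H}
    (hP : IsSpectralProjBelow A (c + r) P) {R : ℂ → H →L[ℂ] H}
    (hR : ∀ z ∈ Metric.sphere (c : ℂ) r, IsResolventAt A z (R z)) :
    P = (Complex.I / (2 * Real.pi)) • circleIntegral R c r := by
  -- The unbounded `A` is replaced by the bounded self-adjoint `S = (A - (c - r))⁻¹`, for which a
  -- continuous functional calculus is available. A spectral value `a` of `A` corresponds to `t = (a
  -- - (c - r))⁻¹`, and the gap at `c + r` to the excluded value `t = 1 / (2r)`.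
  obtain ⟨S, hS⟩ := hres (c - r) le_rfl
  obtain ⟨S', hS'⟩ := hgap
  have hSs := hS.symm hA
  have hSn : IsStarNormal S := hSs.isStarNormal
  set θ := cfcHom (R := ℂ) hSn
  -- the spectrum of the resolvent at `c - r`
  have hspec_re : ∀ t ∈ spectrum ℂ S, t = (t.re : ℂ) := fun t ht => hSs.mem_spectrum_eq_re ht
  have hspec_nonneg : ∀ t ∈ spectrum ℂ S, 0 ≤ t.re := by
    intro t ht
    by_contra hc
    push Not at hc
    have hlt : c - r + t.re⁻¹ < c - r := by linarith [inv_lt_zero.mpr hc]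
    obtain ⟨R', hR'⟩ := hres _ hlt.le
    refine inv_notMem_spectrum hlt.ne hR' hS ?_
    rwa [add_sub_cancel_left, inv_inv, ← hspec_re t ht]
  have hspec_gap : ∀ t ∈ spectrum ℂ S, 2 * r * t.re ≠ 1 := by
    intro t ht h1
    refine inv_notMem_spectrum (by linarith) hS' hS ?_
    have : (c + r - (c - r))⁻¹ = t.re := by
      rw [eq_inv_of_mul_eq_one_right h1]; congr 1; ring
    rwa [this, ← hspec_re t ht]
  have hden : ∀ (t : spectrum ℂ S) (z : Metric.sphere (c : ℂ) r),
      1 - ((z : ℂ) - ((c - r : ℝ) : ℂ)) * (t : ℂ) ≠ 0 := by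
    intro t z h0
    have ht := hspec_re t t.2
    have ht0 : (t : ℂ).re ≠ 0 := by
      intro h1
      rw [ht, h1] at h0; simp at h0
    have hz : (z : ℂ) = ((c - r + (t : ℂ).re⁻¹ : ℝ) : ℂ) := by
      rw [ht] at h0
      have hc : (((t : ℂ).re : ℝ) : ℂ) ≠ 0 := Complex.ofReal_ne_zero.mpr ht0
      rw [Complex.ofReal_add, Complex.ofReal_inv, ← sub_eq_iff_eq_add', ← one_div, eq_div_iff hc]
      exact (sub_eq_zero.mp h0).symm
    have hz2 := z.2
    rw [mem_sphere_iff_norm, hz, ← Complex.ofReal_sub, Complex.norm_real, Real.norm_eq_abs] at hz2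
    have hpos : 0 < (t : ℂ).re⁻¹ :=
      inv_pos.mpr (lt_of_le_of_ne (hspec_nonneg t t.2) ht0.symm)
    rcases abs_eq hr.le |>.mp hz2 with h1 | h1
    · refine hspec_gap t t.2 ?_
      have : (t : ℂ).re⁻¹ = 2 * r := by linarith
      rw [← this, inv_mul_cancel₀ ht0]
    · linarith
  -- the functional calculus
  set ι : C(spectrum ℂ S, ℂ) := ContinuousMap.restrict (spectrum ℂ S) (ContinuousMap.id ℂ)
  have hι : θ ι = S := cfcHom_id hSn
  set g : CN (Metric.sphere (c : ℂ) r) C(spectrum ℂ S, ℂ) := ContinuousMap.curry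
    ⟨fun p : Metric.sphere (c : ℂ) r × spectrum ℂ S =>
      (p.2 : ℂ) / (1 - ((p.1 : ℂ) - ((c - r : ℝ) : ℂ)) * (p.2 : ℂ)), by
      refine Continuous.div (by fun_prop) (by fun_prop) fun p => hden p.2 p.1⟩
  have hg : ∀ z t, g z t = (t : ℂ) / (1 - ((z : ℂ) - ((c - r : ℝ) : ℂ)) * (t : ℂ)) :=
    fun z t => rfl
  set θL : C(spectrum ℂ S, ℂ) →L[ℂ] (H →L[ℂ] H) :=
    { toLinearMap := (θ : C(spectrum ℂ S, ℂ) →ₐ[ℂ] (H →L[ℂ] H)).toLinearMap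
      cont := cfcHom_continuous hSn }
  have hθL : ∀ f, θL f = θ f := fun f => rfl
  have hRg : ∀ z (hz : z ∈ Metric.sphere (c : ℂ) r), R z = θL (g ⟨z, hz⟩) := by
    intro z hz
    have h1 : R z * (1 - (z - ((c - r : ℝ) : ℂ)) • S) = S := by
      have := hS.resolvent_identity (hR z hz)
      rw [mul_sub, mul_one, mul_smul_comm]
      have h2 : ((c - r : ℝ) : ℂ) - z = -(z - ((c - r : ℝ) : ℂ)) := by ring
      rw [h2, neg_smul] at this
      have h3 := sub_eq_iff_eq_add.mp this
      rw [sub_eq_neg_add]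
      exact h3.symm
    have h2 : θ (g ⟨z, hz⟩) * (1 - (z - ((c - r : ℝ) : ℂ)) • S) = S := by
      have h3 : g ⟨z, hz⟩ * (1 - (z - ((c - r : ℝ) : ℂ)) • ι) = ι := by
        ext1 t
        change g ⟨z, hz⟩ t * (1 - (z - ((c - r : ℝ) : ℂ)) * (t : ℂ)) = (t : ℂ)
        rw [hg, div_mul_cancel₀ _ (hden t ⟨z, hz⟩)]
      have h4 := congrArg θ h3
      rwa [map_mul, map_sub, map_one, map_smul, hι] at h4
    obtain ⟨w, hw⟩ := isUnit_of_resolvent (hR z hz) hS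
    rw [← hw] at h1 h2
    exact (Units.mul_left_inj w).mp (h1.trans h2.symm)
  set f : C(spectrum ℂ S, ℂ) := (Complex.I / (2 * Real.pi)) • cint hr.le g
  have hQ : (Complex.I / (2 * Real.pi)) • circleIntegral R c r = θ f := by
    set g' : CN (Metric.sphere (c : ℂ) r) (H →L[ℂ] H) :=
      ⟨fun z => θL (g z), θL.continuous.comp g.continuous⟩
    have h1 : circleIntegral R c r = cint hr.le g' := cint_eq hr.le hRg
    have h2 : θL (cint hr.le g) = cint hr.le g' := map_cint hr.le θL g fun z => rfl
    rw [h1, ← h2, hθL, ← map_smul]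
  -- the values of `f`
  have hf : ∀ t : spectrum ℂ S, (2 * r * (t : ℂ).re < 1 ∧ f t = 0) ∨
      (1 < 2 * r * (t : ℂ).re ∧ f t = 1) := by
    intro t
    set g₁ : CN (Metric.sphere (c : ℂ) r) ℂ := ⟨fun z => g z t, (continuous_eval_const t).comp g.continuous⟩
    have h1 : f t = (Complex.I / (2 * Real.pi)) * cint hr.le g₁ := by
      have := map_cint hr.le (evalCN t) g (g := g₁) fun z => rfl
      rw [← this]; rfl
    have ht := hspec_re t t.2
    have htn := hspec_nonneg t t.2
    rcases htn.eq_or_lt with h0 | h0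
    · refine Or.inl ⟨by rw [← h0]; simp, ?_⟩
      have : g₁ = 0 := by
        ext1 z
        change g z t = 0
        rw [hg, ht, ← h0]; simp
      rw [h1, this, map_zero, mul_zero]
    -- `w` is the spectral value of `A` that corresponds to `t`, and the integrand is `-(z - w)⁻¹`.
    -- Cauchy's formula gives `f t = 1` or `0` according to whether `w` is inside the circle, that
    -- is `1 / t < 2r`, or outside.
    · set w : ℂ := ((c - r + (t : ℂ).re⁻¹ : ℝ) : ℂ)
      have h2 : circleIntegral (fun z => -(z - w)⁻¹) c r = cint hr.le g₁ := by
        refine cint_eq hr.le fun z hz => ?_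
        change _ = g ⟨z, hz⟩ t
        have hd := hden t ⟨z, hz⟩
        rw [hg]
        simp only at hd ⊢
        have hc : (((t : ℂ).re : ℝ) : ℂ) ≠ 0 := Complex.ofReal_ne_zero.mpr h0.ne'
        rw [ht] at hd ⊢
        have h3 : z - w = -(1 - (z - ((c - r : ℝ) : ℂ)) * ((t : ℂ).re : ℂ)) / ((t : ℂ).re : ℂ) := by
          rw [eq_div_iff hc]
          simp only [w]
          push_cast
          rw [sub_mul, add_mul, inv_mul_cancel₀ hc]
          ring
        rw [h3, inv_div, div_neg, neg_neg]
      have h3 : circleIntegral (fun z => -(z - w)⁻¹) c r = -∮ z in C(c, r), (z - w)⁻¹ := by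
        have := circleIntegral.integral_smul (-1 : ℂ) (fun z => (z - w)⁻¹) (c : ℂ) r
        simpa using this
      have hdist : dist w c = |(t : ℂ).re⁻¹ - r| := by
        rw [dist_eq_norm, ← Complex.ofReal_sub, Complex.norm_real, Real.norm_eq_abs]
        congr 1; ring
      rcases lt_or_gt_of_ne (hspec_gap t t.2) with h4 | h4
      · refine Or.inl ⟨h4, ?_⟩
        rw [h1, ← h2, h3, circleIntegral_inv_of_notMem hr.le, neg_zero, mul_zero]
        rw [Metric.mem_closedBall, hdist, not_le]
        have : 2 * r < (t : ℂ).re⁻¹ := by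
          rw [lt_inv_comm₀ (by positivity) h0, lt_inv_comm₀ h0 (by positivity)]
          rw [← one_div, lt_div_iff₀ h0]; exact h4
        rw [abs_of_pos (by linarith)]; linarith
      · refine Or.inr ⟨h4, ?_⟩
        rw [h1, ← h2, h3, circleIntegral.integral_sub_inv_of_mem_ball]
        · have hpi : (Real.pi : ℂ) ≠ 0 := Complex.ofReal_ne_zero.mpr Real.pi_ne_zero
          field_simp
          rw [Complex.I_sq]; ring
        · rw [Metric.mem_ball, hdist]
          have h5 : (t : ℂ).re⁻¹ < 2 * r := by
            rw [inv_lt_comm₀ h0 (by positivity), ← one_div, div_lt_iff₀ (by positivity)]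
            linarith
          have h6 : 0 < (t : ℂ).re⁻¹ := inv_pos.mpr h0
          rw [abs_lt]
          constructor <;> linarith
  have hff : f * f = f := by
    ext1 t
    rcases hf t with ⟨-, h⟩ | ⟨-, h⟩ <;> simp [h]
  rw [hQ]
  have hcomm : ∀ g, Commute (θ g) P := fun g =>
    hSs.commute_cfcHom hSn (hS.commute hP.reduces) g
  -- vectors on which the quadratic form has both signs vanish
  have key : ∀ (q : C(spectrum ℂ S, ℂ)) (sgn : ℝ),
      (∀ t : spectrum ℂ S, 0 ≤ sgn * ((t : ℂ).re * (1 - 2 * r * (t : ℂ).re)) ∨ q t = 0) →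
      sgn ≠ 0 → q * q = q → ∀ x, θ q x = x →
      sgn * ((inner ℂ (S x) x).re - 2 * r * ‖S x‖ ^ 2) ≤ 0 → x = 0 := by
    intro q sgn hq hsgn hqq x hx hle
    have hqv : ∀ t, q t = 0 ∨ q t = 1 := by
      intro t
      have : q t * q t = q t := congrArg (fun f : C(spectrum ℂ S, ℂ) => f t) hqq
      rcases eq_or_ne (q t) 0 with h | h
      · exact Or.inl h
      · exact Or.inr (mul_right_cancel₀ h (by rw [this, one_mul]))
    -- A square root of the density of the quadratic form: for `x` in the range of `q(S)` one gets
    -- `‖(v q)(S) x‖² = sgn (⟨S x, x⟩ - 2r ‖S x‖²)`, so a form of the wrong sign forces this vector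
    -- to vanish.
    set v : C(spectrum ℂ S, ℂ) :=
      ⟨fun t => ((Real.sqrt (sgn * ((t : ℂ).re * (1 - 2 * r * (t : ℂ).re))) : ℝ) : ℂ), by fun_prop⟩
    have hv : star (v * q) * (v * q) = (sgn : ℂ) • ((ι - (2 * r : ℂ) • (ι * ι)) * q) := by
      ext1 t
      have e1 : (star (v * q) * (v * q)) t = star (v t * q t) * (v t * q t) := rfl
      have e2 : ((sgn : ℂ) • ((ι - (2 * r : ℂ) • (ι * ι)) * q)) t =
        (sgn : ℂ) * (((t : ℂ) - (2 * r : ℂ) * ((t : ℂ) * (t : ℂ))) * q t) := rfl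
      rw [e1, e2]
      rcases hqv t with h | h
      · rw [h]; simp
      · rw [h, mul_one, mul_one]
        have h0 : 0 ≤ sgn * ((t : ℂ).re * (1 - 2 * r * (t : ℂ).re)) := by
          rcases hq t with h' | h'
          · exact h'
          · rw [h'] at h; exact absurd h zero_ne_one
        change star ((Real.sqrt _ : ℝ) : ℂ) * ((Real.sqrt _ : ℝ) : ℂ) = _
        rw [RCLike.star_def, Complex.conj_ofReal, ← Complex.ofReal_mul, Real.mul_self_sqrt h0]
        conv_rhs => rw [hspec_re t t.2]
        push_cast
        ring
    have hval : (θ (v * q)) x = 0 := by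
      have h1 : ‖θ (v * q) x‖ ^ 2 = sgn * ((inner ℂ (S x) x).re - 2 * r * ‖S x‖ ^ 2) := by
        have h2 : (inner ℂ (θ (v * q) x) (θ (v * q) x) : ℂ) =
            inner ℂ x (((sgn : ℂ) • ((S - (2 * r : ℂ) • (S * S)))) x) := by
          rw [← ContinuousLinearMap.adjoint_inner_right]
          congr 1
          have h3 : (θ (v * q)).adjoint = θ (star (v * q)) := (map_star θ _).symm
          rw [h3]
          change (θ (star (v * q)) * θ (v * q)) x = _
          rw [← map_mul, hv, map_smul, map_mul, map_sub, map_smul, map_mul, hι]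
          change (sgn : ℂ) • ((S - (2 * r : ℂ) • (S * S)) (θ q x)) = _
          rw [hx]; rfl
        have h4 : (inner ℂ x (((sgn : ℂ) • ((S - (2 * r : ℂ) • (S * S)))) x) : ℂ) =
            sgn * (inner ℂ (S x) x - 2 * r * inner ℂ (S x) (S x)) := by
          have hsym := (ContinuousLinearMap.isSelfAdjoint_iff_isSymmetric.mp hSs)
          have e : ∀ y, inner ℂ (S x) y = (inner ℂ x (S y) : ℂ) := fun y => hsym x y
          rw [e, e]
          change inner ℂ x ((sgn : ℂ) • (S x - (2 * r : ℂ) • S (S x))) = _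
          rw [inner_smul_right, inner_sub_right, inner_smul_right]
        rw [h4, inner_self_eq_norm_sq_to_K, inner_self_eq_norm_sq_to_K] at h2
        have h5 := congrArg Complex.re h2
        simp only [Complex.coe_algebraMap] at h5
        have e5 : ∀ y : ℝ, ((y : ℂ) ^ 2) = ((y ^ 2 : ℝ) : ℂ) := fun y => by push_cast; rfl
        rw [e5, e5, Complex.ofReal_re, Complex.re_ofReal_mul, Complex.sub_re] at h5
        rw [h5]
        congr 2
        have : (2 * (r : ℂ) * ((‖S x‖ ^ 2 : ℝ) : ℂ)) = ((2 * r * ‖S x‖ ^ 2 : ℝ) : ℂ) := by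
          push_cast; rfl
        rw [this, Complex.ofReal_re]
      have h2 : ‖θ (v * q) x‖ ^ 2 ≤ 0 := h1.le.trans hle
      have h3 : ‖θ (v * q) x‖ = 0 := by nlinarith [norm_nonneg (θ (v * q) x)]
      exact norm_eq_zero.mp h3
    have h1 : (sgn : ℂ) • ((S - (2 * r : ℂ) • (S * S)) x) = 0 := by
      have h2 : (θ (star (v * q)) * θ (v * q)) x = 0 := by
        change θ (star (v * q)) (θ (v * q) x) = 0
        rw [hval, map_zero]
      rw [← map_mul, hv, map_smul, map_mul, map_sub, map_smul, map_mul, hι] at h2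
      change (sgn : ℂ) • ((S - (2 * r : ℂ) • (S * S)) (θ q x)) = 0 at h2
      rwa [hx] at h2
    -- From here `x = 0`: the resolvent `S` is injective, and `1 - 2r S` is invertible because `c +
    -- r` lies in the resolvent set.
    have h2 : S ((1 - (2 * r : ℂ) • S) x) = 0 := by
      have := (smul_eq_zero.mp h1).resolve_left (Complex.ofReal_ne_zero.mpr hsgn)
      rw [← this]
      change S (x - (2 * r : ℂ) • S x) = S x - (2 * r : ℂ) • S (S x)
      rw [map_sub, map_smul]
    have h3 := hS.injective h2
    have h4 := isUnit_of_resolvent hS' hS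
    have h5 : (((c + r : ℝ) : ℂ) - ((c - r : ℝ) : ℂ)) = 2 * r := by push_cast; ring
    rw [h5, ContinuousLinearMap.isUnit_iff_bijective] at h4
    exact h4.1 (by rw [h3, map_zero])
  -- Turns the bounds of `A` against `c + r` on the vectors `S x` into the sign of `⟨S x, x⟩ - 2r ‖S
  -- x‖²`.
  have hform : ∀ x (hd : S x ∈ A.domain), (inner ℂ (S x) (A ⟨S x, hd⟩)).re =
      (inner ℂ (S x) x).re + (c - r) * ‖S x‖ ^ 2 := by
    intro x hd
    obtain ⟨hd', he⟩ := hS.1 x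
    rw [sub_eq_iff_eq_add] at he
    rw [he, inner_add_right, inner_smul_right, inner_self_eq_norm_sq_to_K, Complex.add_re,
      Complex.re_ofReal_mul]
    have e5 : ∀ y : ℝ, ((y : ℂ) ^ 2) = ((y ^ 2 : ℝ) : ℂ) := fun y => by push_cast; rfl
    simp only [Complex.coe_algebraMap]
    rw [e5, Complex.ofReal_re]
  have hSP : ∀ x, P (S x) = S (P x) := fun x =>
    congrArg (fun T : H →L[ℂ] H => T x) (hS.commute hP.reduces).symm
  -- the range of `P`
  have h1 : ∀ x, P x = x → θ f x = x := by
    intro x hx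
    -- The component of `x` above the gap stays in the range of `P`, where the form of `A - (c + r)`
    -- is at most `0`; the spectral support of `1 - f` makes the same form nonnegative.
    have hy : P (θ (1 - f) x) = θ (1 - f) x := by
      have := congrArg (fun T : H →L[ℂ] H => T x) (hcomm (1 - f))
      change θ (1 - f) (P x) = P (θ (1 - f) x) at this
      rw [← this, hx]
    obtain ⟨hd, -⟩ := hS.1 (θ (1 - f) x)
    have h2 := hP.le_on_range ⟨S (θ (1 - f) x), hd⟩ (by rw [hSP, hy])
    rw [hform] at h2
    have hqq : (1 - f) * (1 - f) = 1 - f := by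
      rw [sub_mul, mul_sub, mul_sub, hff]; simp
    have h3 := key (1 - f) 1 (fun t => ?_) one_ne_zero hqq (θ (1 - f) x) ?_ (by simp only at h2; linarith)
    · rw [map_sub, map_one] at h3
      exact (sub_eq_zero.mp h3).symm
    · rcases hf t with ⟨h, -⟩ | ⟨-, h⟩
      · left
        rw [one_mul]
        exact mul_nonneg (hspec_nonneg t t.2) (by linarith)
      · right
        change 1 - f t = 0
        rw [h, sub_self]
    · change (θ (1 - f) * θ (1 - f)) x = _
      rw [← map_mul, hqq]
  have h2 : ∀ x, P x = 0 → θ f x = 0 := by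
    intro x hx
    have hy : P (θ f x) = 0 := by
      have := congrArg (fun T : H →L[ℂ] H => T x) (hcomm f)
      change θ f (P x) = P (θ f x) at this
      rw [← this, hx, map_zero]
    obtain ⟨hd, -⟩ := hS.1 (θ f x)
    have h2 := hP.ge_on_ker ⟨S (θ f x), hd⟩ (by rw [hSP, hy, map_zero])
    rw [hform] at h2
    refine key f (-1) (fun t => ?_) (by norm_num) hff (θ f x) ?_ (by simp only at h2; linarith)
    · rcases hf t with ⟨-, h⟩ | ⟨h, -⟩
      · exact Or.inr h
      · left
        have := hspec_nonneg t t.2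
        nlinarith
    · change (θ f * θ f) x = _
      rw [← map_mul, hff]
  ext1 x
  have e1 := h1 (P x) (hP.idem x)
  have e2 := h2 (x - P x) (by rw [map_sub, hP.idem, sub_self])
  rw [map_sub, e1, sub_eq_zero] at e2
  exact e2.symm

end Riesz
end UCC

end

/-! ### Smoothness and finite rank of the fibres of the Fermi projection. -/

noncomputable section

namespace UCC

theorem contDiff_mulCN {X V A : Type*} [TopologicalSpace X] [CompactSpace X]
    [NormedAddCommGroup V] [NormedSpace ℝ V] [NormedRing A] [NormedAlgebra ℂ A]
    {f g : V → CN X A} (hf : ContDiff ℝ ∞ f) (hg : ContDiff ℝ ∞ g) :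
    ContDiff ℝ ∞ fun k => f k * g k :=
  hf.mul hg

section Rank

variable {E : Type*} [NormedAddCommGroup E] [InnerProductSpace ℂ E]

/-- Nearby idempotents have the same rank. -/
theorem finrank_range_le_of_norm_sub_lt {p q : E →L[ℂ] E} (hq : ∀ x, q (q x) = q x)
    (hpq : ‖p - q‖ < 1) [FiniteDimensional ℂ p.range] :
    FiniteDimensional ℂ q.range ∧ Module.finrank ℂ q.range ≤ Module.finrank ℂ p.range := by
  set f : q.range →ₗ[ℂ] p.range :=
    (p.toLinearMap.rangeRestrict) ∘ₗ q.range.subtype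
  have hf : Function.Injective f := by
    rw [injective_iff_map_eq_zero]
    rintro ⟨x, y, rfl⟩ hx
    have h1 : p (q y) = 0 := congrArg Subtype.val hx
    have h2 : ‖(p - q) (q y)‖ = ‖q y‖ := by
      rw [sub_apply, h1, zero_sub, norm_neg, hq]
    have h3 := (p - q).le_opNorm (q y)
    rw [h2] at h3
    have h4 : ‖q y‖ ≤ 0 := by
      by_contra hc
      push Not at hc
      nlinarith
    exact Subtype.ext (norm_le_zero_iff.mp h4)
  exact ⟨Module.Finite.of_injective f hf, LinearMap.finrank_le_finrank_of_injective hf⟩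

end Rank

namespace Crystal
variable {d N : ℕ} {C : Crystal d N} {H₀ : C.Hil →ₗ.[ℂ] C.Hil}
  {h : Space d → C.Fib →ₗ.[ℂ] C.Fib} {μF : ℝ} {P : C.Hil →L[ℂ] C.Hil} {c r : ℝ}

theorem Equi.adjoint {F : Space d → C.Fib →L[ℂ] C.Fib} (hF : C.Equi F) :
    C.Equi fun k => (F k).adjoint := by
  intro g hg k φ
  refine ext_inner_left ℂ fun w => ?_
  have hadj : ∀ (w φ : C.Fib), inner ℂ w (C.varrho g φ) = inner ℂ (C.varrho (-g) w) φ := by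
    intro w φ
    rw [varrho, varrho, neg_neg, ← phaseOp_adjoint, ContinuousLinearMap.adjoint_inner_right]
  rw [ContinuousLinearMap.adjoint_inner_right, hadj, hadj, ContinuousLinearMap.adjoint_inner_right]
  congr 1
  have h1 := hF g hg k (C.varrho (-g) w)
  rw [C.varrho_neg_apply] at h1
  rw [h1]
  have h2 := C.varrho_neg_apply (-g) (F k (C.varrho (-g) w))
  rw [neg_neg] at h2
  exact h2

theorem Equi.const_op {F : Space d → C.Fib →L[ℂ] C.Fib} (hF : C.Equi F) {g : Space d}
    (hg : g ∈ dualLattice C.a) (k : Space d) :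
    F (k + g) = C.varrho g ∘L F k ∘L C.varrho (-g) := by
  ext1 φ
  rw [ContinuousLinearMap.comp_apply, ContinuousLinearMap.comp_apply, ← hF g hg,
    C.varrho_neg_apply]

namespace FibreResolvent

variable (E : C.FibreResolvent h c r)

/-- The factor `p̌` of the fibres `κ p̌(k)` of the Fermi projection. -/
def pc (hr : 0 ≤ r) (k : Space d) : C.Fib →L[ℂ] C.Fib :=
  (Complex.I / (2 * Real.pi)) • cint hr (E.u k)

/-- The fibres of the Fermi projection. -/
def p (hr : 0 ≤ r) (k : Space d) : C.Fib →L[ℂ] C.Fib := E.κ ∘L E.pc hr k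

variable (hr : 0 ≤ r)

theorem contDiff_cint {f : Space d → CN (Metric.sphere (c : ℂ) r) (C.Fib →L[ℂ] C.Fib)}
    (hf : ContDiff ℝ ∞ f) : ContDiff ℝ ∞ fun k => cint hr (f k) :=
  ((cint hr).restrictScalars ℝ).contDiff.comp hf

theorem contDiff_pc : ContDiff ℝ ∞ (E.pc hr) :=
  ContDiff.const_smul (Complex.I / (2 * Real.pi) : ℂ) (contDiff_cint hr E.contDiff_u)

theorem contDiff_comp {F G : Space d → C.Fib →L[ℂ] C.Fib} (hF : ContDiff ℝ ∞ F)
    (hG : ContDiff ℝ ∞ G) : ContDiff ℝ ∞ fun k => F k ∘L G k :=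
  hF.mul hG

theorem contDiff_p : ContDiff ℝ ∞ (E.p hr) :=
  contDiff_comp (F := fun _ => E.κ) contDiff_const (E.contDiff_pc hr)

/-- The family of resolvents `κ u(k)`. -/
def res (k : Space d) : CN (Metric.sphere (c : ℂ) r) (C.Fib →L[ℂ] C.Fib) :=
  constCN (Metric.sphere (c : ℂ) r) (C.Fib →L[ℂ] C.Fib) E.κ * E.u k

theorem contDiff_res : ContDiff ℝ ∞ E.res := contDiff_mulCN (A := C.Fib →L[ℂ] C.Fib)
  (f := fun _ => constCN (Metric.sphere (c : ℂ) r) (C.Fib →L[ℂ] C.Fib) E.κ) contDiff_const E.contDiff_u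

theorem p_eq (k : Space d) : E.p hr k = (Complex.I / (2 * Real.pi)) • cint hr (E.res k) := by
  have h1 := map_cint hr (ContinuousLinearMap.compL ℂ C.Fib C.Fib C.Fib E.κ) (E.u k) (g := E.res k)
    fun z => rfl
  rw [← h1, ← map_smul]; rfl

theorem equi_p (hH : C.IsUnperturbed H₀ h μF P) : C.Equi (E.p hr) := by
  have h1 : C.Equi fun k => cint hr (E.res k) := Equi.cint hr fun z => E.equi hH z
  have h2 := h1.smul (Complex.I / (2 * Real.pi))
  have h3 : E.p hr = fun k => (Complex.I / (2 * Real.pi) : ℂ) • cint hr (E.res k) := funext (E.p_eq hr)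
  rw [h3]; exact h2

theorem Op_p (hH : C.IsUnperturbed H₀ h μF P) (hcr : C.IsContour H₀ μF c r) :
    C.Op (E.p hr) = P := by
  have h1 : P = (Complex.I / (2 * Real.pi)) • circleIntegral (resolventOp H₀) c r := by
    refine IsSpectralProjBelow.eq_circleIntegral hH.selfAdjoint hcr.1 hcr.2.2 ?_ ?_ ?_
    · rw [hcr.2.1]; exact hH.gap
    · rw [hcr.2.1]; exact hH.fermi
    · intro z hz
      have := E.isResolventAt hH ⟨z, hz⟩
      rw [(E.resolventOp_eq hH ⟨z, hz⟩ :)]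
      exact this
  have h2 := C.circleIntegral_Op hr (f := E.res) (R := resolventOp H₀) E.contDiff_res.continuous
    fun z hz => E.resolventOp_eq hH ⟨z, hz⟩
  have hc : Continuous fun k => cint hr (E.res k) := (contDiff_cint hr E.contDiff_res).continuous
  have h3 : E.p hr = fun k => (Complex.I / (2 * Real.pi) : ℂ) • cint hr (E.res k) := funext (E.p_eq hr)
  rw [h1, h2, h3]
  exact C.Op_smul hc _

/-- Inherited from `P² = P`, since continuous equivariant fibres are determined by their operator.
-/
theorem p_idem (hH : C.IsUnperturbed H₀ h μF P) (hcr : C.IsContour H₀ μF c r) (k : Space d) :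
    E.p hr k ∘L E.p hr k = E.p hr k := by
  have hc := (E.contDiff_p hr).continuous
  have h1 : C.Op (fun k => E.p hr k ∘L E.p hr k) = C.Op (E.p hr) := by
    rw [C.Op_mul hc hc, E.Op_p hr hH hcr]
    ext1 ψ
    exact hH.fermi.idem ψ
  exact congrFun (C.eq_of_Op_eq (hc.clm_comp hc) hc ((E.equi_p hr hH).comp (E.equi_p hr hH))
    (E.equi_p hr hH) h1) k

theorem continuous_adjoint {F : Space d → C.Fib →L[ℂ] C.Fib} (hF : Continuous F) :
    Continuous fun k => (F k).adjoint :=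
  (ContinuousLinearMap.adjoint (𝕜 := ℂ) (E := C.Fib) (F := C.Fib)).continuous.comp hF

theorem p_adjoint (hH : C.IsUnperturbed H₀ h μF P) (hcr : C.IsContour H₀ μF c r) (k : Space d) :
    (E.p hr k).adjoint = E.p hr k := by
  have hc := (E.contDiff_p hr).continuous
  have h1 : C.Op (fun k => (E.p hr k).adjoint) = C.Op (E.p hr) := by
    rw [← C.Op_adjoint hc, E.Op_p hr hH hcr]
    refine (ContinuousLinearMap.eq_adjoint_iff P P).mpr (fun x y => hH.fermi.symm x y) |>.symm
  exact congrFun (C.eq_of_Op_eq (continuous_adjoint hc) hc (E.equi_p hr hH).adjoint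
    (E.equi_p hr hH) h1) k

/-- The finite rank hypothesis concerns some fibration of `P`, with no continuity. It agrees with
`E.p` almost everywhere on the zone, as is seen on a countable dense set of vectors, and
equivariance preserves the rank. -/
theorem ae_finiteDimensional (hH : C.IsUnperturbed H₀ h μF P) (hcr : C.IsContour H₀ μF c r) :
    ∀ᵐ k, FiniteDimensional ℂ (E.p hr k).range := by
  obtain ⟨p', hp', hfin⟩ := hH.finiteRank
  have hc := (E.contDiff_p hr).continuous
  have h1 : ∀ v : C.Fib, ∀ᵐ k ∂C.beta, p' k v = E.p hr k v := by
    intro v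
    have hv : MemLp (fun _ : Space d => v) 2 C.beta := memLp_const v
    set ψ := C.zk.symm (hv.toLp _)
    have h3 : ∀ᵐ k ∂C.beta, C.zk ψ k = v := by
      simp only [ψ, LinearIsometryEquiv.apply_symm_apply]
      exact hv.coeFn_toLp
    have hg : (ψ, P ψ) ∈ (ofCLM P).graph := (ofCLM P).mem_graph ⟨ψ, Submodule.mem_top⟩
    obtain ⟨Φ, Φ', hΦ, hΦ', hgr⟩ := (hp' _ _).mp hg
    have h4 := C.zk_Op hc ψ
    rw [E.Op_p hr hH hcr] at h4
    filter_upwards [C.ae_beta_of_ae hgr, hΦ.ae_eq_zk, hΦ'.ae_eq_zk, h3, h4] with k a1 a2 a3 a4 a5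
    obtain ⟨x, hx, hx'⟩ := (LinearPMap.mem_graph_iff _).mp a1
    simp only at hx hx'
    have : p' k x = Φ' k := hx'
    rw [hx, a2, a4] at this
    rw [this, a3, a5, a4]
  have h2 : ∀ᵐ k ∂C.beta, p' k = E.p hr k := by
    have h3 := ae_all_iff.mpr fun n : ℕ => h1 (TopologicalSpace.denseSeq C.Fib n)
    filter_upwards [h3] with k hk
    refine ContinuousLinearMap.coeFn_injective
      (Continuous.ext_on (TopologicalSpace.denseRange_denseSeq C.Fib) (p' k).continuous
        (E.p hr k).continuous ?_)
    rintro _ ⟨n, rfl⟩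
    exact hk n
  refine C.ae_of_ae_beta fun g hg => ?_
  filter_upwards [h2] with k hk
  have h3 : FiniteDimensional ℂ (E.p hr k).range := by
    have := hfin k
    rw [hk] at this
    exact this
  have h4 : (E.p hr (k + g)).range ≤ (E.p hr k).range.map (C.varrho g).toLinearMap := by
    rintro _ ⟨φ, rfl⟩
    refine ⟨E.p hr k (C.varrho (-g) φ), ⟨_, rfl⟩, ?_⟩
    have := (E.equi_p hr hH).const_op hg k
    change _ = E.p hr (k + g) φ
    rw [this]; rfl
  exact Submodule.finiteDimensional_of_le h4

theorem eventually_norm_sub_lt (k₀ : Space d) :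
    ∀ᶠ k in 𝓝 k₀, ‖E.p hr k - E.p hr k₀‖ < 1 := by
  have hc : Continuous fun k => ‖E.p hr k - E.p hr k₀‖ :=
    ((E.contDiff_p hr).continuous.sub continuous_const).norm
  have := hc.tendsto k₀
  rw [sub_self, norm_zero] at this
  exact this.eventually (gt_mem_nhds one_pos)

/-- A set of full measure is dense, so near `k₀` there is a momentum with a fibre of finite rank,
and idempotents at distance less than `1` can be compared. -/
theorem finiteDimensional_range_p (hH : C.IsUnperturbed H₀ h μF P)
    (hcr : C.IsContour H₀ μF c r) (k₀ : Space d) : FiniteDimensional ℂ (E.p hr k₀).range := by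
  have h1 := (Measure.dense_of_ae (E.ae_finiteDimensional hr hH hcr))
  obtain ⟨k, hk1, hk2⟩ := h1.inter_nhds_nonempty (E.eventually_norm_sub_lt hr k₀)
  have : FiniteDimensional ℂ (E.p hr k).range := hk1
  have hi : ∀ x, E.p hr k₀ (E.p hr k₀ x) = E.p hr k₀ x := fun x =>
    congrArg (fun T : C.Fib →L[ℂ] C.Fib => T x) (E.p_idem hr hH hcr k₀)
  exact (finrank_range_le_of_norm_sub_lt hi hk2).1

/-- The rank is locally bounded by the same comparison, and the closed zone is compact. -/
theorem exists_rank_bound (hH : C.IsUnperturbed H₀ h μF P)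
    (hcr : C.IsContour H₀ μF c r) :
    ∃ n : ℕ, ∀ k ∈ brillouin C.a, Module.finrank ℂ (E.p hr k).range ≤ n := by
  have hi : ∀ k x, E.p hr k (E.p hr k x) = E.p hr k x := fun k x =>
    congrArg (fun T : C.Fib →L[ℂ] C.Fib => T x) (E.p_idem hr hH hcr k)
  have h1 : ∃ n : ℕ, ∀ k ∈ C.zone, Module.finrank ℂ (E.p hr k).range ≤ n := by
    refine C.isCompact_zone.induction_on (p := fun s => ∃ n : ℕ, ∀ k ∈ s,
      Module.finrank ℂ (E.p hr k).range ≤ n) ⟨0, fun k hk => hk.elim⟩ ?_ ?_ ?_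
    · rintro s t hst ⟨n, hn⟩
      exact ⟨n, fun k hk => hn k (hst hk)⟩
    · rintro s t ⟨n, hn⟩ ⟨m, hm⟩
      refine ⟨max n m, ?_⟩
      rintro k (hk | hk)
      · exact (hn k hk).trans (le_max_left _ _)
      · exact (hm k hk).trans (le_max_right _ _)
    · intro k₀ _
      have := E.finiteDimensional_range_p hr hH hcr k₀
      refine ⟨_, mem_nhdsWithin_of_mem_nhds (E.eventually_norm_sub_lt hr k₀),
        Module.finrank ℂ (E.p hr k₀).range, fun k hk => ?_⟩
      have hk' : ‖E.p hr k₀ - E.p hr k‖ < 1 := by rw [norm_sub_rev]; exact hk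
      exact (finrank_range_le_of_norm_sub_lt (hi k) hk').2
  obtain ⟨n, hn⟩ := h1
  exact ⟨n, fun k hk => hn k (C.brillouin_subset_zone hk)⟩

end FibreResolvent

end Crystal
end UCC

end

/-! ### Graphs of unbounded operators, and closures of commutators. -/

noncomputable section

namespace UCC

/-! ### Graphs of unbounded operators -/

section Graphs

variable {H : Type*} [NormedAddCommGroup H] [InnerProductSpace ℂ H] {A B : H →ₗ.[ℂ] H}
  {ψ φ φ' χ χ' : H}

theorem mem_graph_of_apply (hd : ψ ∈ A.domain) (h : A ⟨ψ, hd⟩ = φ) : (ψ, φ) ∈ A.graph :=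
  (A.mem_graph_iff).mpr ⟨⟨ψ, hd⟩, rfl, h⟩

theorem exists_apply_of_mem_graph (h : (ψ, φ) ∈ A.graph) :
    ∃ hd : ψ ∈ A.domain, A ⟨ψ, hd⟩ = φ := by
  obtain ⟨⟨x, hx⟩, hx1, hx2⟩ := (A.mem_graph_iff).mp h
  simp only at hx1 hx2
  subst hx1
  exact ⟨hx, hx2⟩

theorem eq_of_mem_graph (h : (ψ, φ) ∈ A.graph) (h' : (ψ, φ') ∈ A.graph) : φ = φ' := by
  obtain ⟨hd, rfl⟩ := exists_apply_of_mem_graph h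
  obtain ⟨hd', rfl⟩ := exists_apply_of_mem_graph h'
  rfl

theorem mem_graph_ofCLM {T : H →L[ℂ] H} : (ψ, φ) ∈ (ofCLM T).graph ↔ T ψ = φ := by
  constructor
  · intro h
    obtain ⟨hd, h⟩ := exists_apply_of_mem_graph h
    exact h
  · intro h
    exact mem_graph_of_apply (A := ofCLM T) Submodule.mem_top h

theorem mem_graph_prodOp :
    (ψ, χ) ∈ (prodOp A B).graph ↔ ∃ φ, (ψ, φ) ∈ B.graph ∧ (φ, χ) ∈ A.graph := by
  constructor
  · intro h
    obtain ⟨hd, h⟩ := exists_apply_of_mem_graph h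
    exact ⟨_, B.mem_graph ⟨ψ, hd.choose⟩, mem_graph_of_apply hd.choose_spec h⟩
  · rintro ⟨φ, h1, h2⟩
    obtain ⟨hd, rfl⟩ := exists_apply_of_mem_graph h1
    obtain ⟨hd', h3⟩ := exists_apply_of_mem_graph h2
    exact mem_graph_of_apply (A := prodOp A B) ⟨hd, hd'⟩ h3

theorem mem_graph_add (h : (ψ, φ) ∈ A.graph) (h' : (ψ, φ') ∈ B.graph) :
    (ψ, φ + φ') ∈ (A + B).graph := by
  obtain ⟨hd, rfl⟩ := exists_apply_of_mem_graph h
  obtain ⟨hd', rfl⟩ := exists_apply_of_mem_graph h'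
  exact mem_graph_of_apply (A := A + B) ⟨hd, hd'⟩ rfl

theorem mem_graph_sub (h : (ψ, φ) ∈ A.graph) (h' : (ψ, φ') ∈ B.graph) :
    (ψ, φ - φ') ∈ (A - B).graph := by
  obtain ⟨hd, rfl⟩ := exists_apply_of_mem_graph h
  obtain ⟨hd', rfl⟩ := exists_apply_of_mem_graph h'
  exact mem_graph_of_apply (A := A - B) ⟨hd, hd'⟩ rfl

theorem mem_graph_smul (c : ℂ) (h : (ψ, φ) ∈ A.graph) : (ψ, c • φ) ∈ (c • A).graph := by
  obtain ⟨hd, rfl⟩ := exists_apply_of_mem_graph h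
  exact mem_graph_of_apply (A := c • A) hd rfl

theorem mem_graph_commOp (h1 : (ψ, φ) ∈ B.graph) (h2 : (φ, χ) ∈ A.graph)
    (h3 : (ψ, φ') ∈ A.graph) (h4 : (φ', χ') ∈ B.graph) : (ψ, χ - χ') ∈ (commOp A B).graph :=
  mem_graph_sub (mem_graph_prodOp.mpr ⟨φ, h1, h2⟩) (mem_graph_prodOp.mpr ⟨φ', h3, h4⟩)

theorem mem_graph_domRestrict {core : Submodule ℂ H} (hc : ψ ∈ core) (h : (ψ, φ) ∈ A.graph) :
    (ψ, φ) ∈ (A.domRestrict core).graph := by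
  obtain ⟨hd, rfl⟩ := exists_apply_of_mem_graph h
  exact mem_graph_of_apply (A := A.domRestrict core) ⟨hc, hd⟩ rfl

theorem mem_graph_closedComm {core : Submodule ℂ H} (hc : ψ ∈ core)
    (h : (ψ, φ) ∈ (commOp A B).graph) : (ψ, φ) ∈ (closedComm A B core).graph :=
  LinearPMap.le_graph_of_le (LinearPMap.le_closure _) (mem_graph_domRestrict hc h)

theorem eq_ofCLM {T : H →L[ℂ] H} (h : ∀ ψ, (ψ, T ψ) ∈ A.graph) : A = ofCLM T := by
  refine LinearPMap.eq_of_eq_graph (Submodule.ext ?_)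
  rintro ⟨ψ, φ⟩
  rw [mem_graph_ofCLM]
  constructor
  · exact fun h' => eq_of_mem_graph (h ψ) h'
  · rintro rfl
    exact h ψ

/-- On the core the commutator is a restriction of `D`, so the closure of its graph lies in the
closed graph of `D`. Density of the core and continuity of `D` give the whole of that graph. -/
theorem closedComm_eq_ofCLM {core : Submodule ℂ H} (hd : Dense (core : Set H)) {D : H →L[ℂ] H}
    (h : ∀ ψ ∈ core, (ψ, D ψ) ∈ (commOp A B).graph) : closedComm A B core = ofCLM D := by
  set f := (commOp A B).domRestrict core
  have hf : ∀ ψ ∈ core, (ψ, D ψ) ∈ f.graph := fun ψ hψ => mem_graph_domRestrict hψ (h ψ hψ)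
  have hf' : f.graph ≤ (ofCLM D).graph := by
    rintro ⟨ψ, φ⟩ hg
    obtain ⟨hd, -⟩ := exists_apply_of_mem_graph hg
    exact mem_graph_ofCLM.mpr (eq_of_mem_graph (hf ψ hd.1) hg)
  have hcl : IsClosed ((ofCLM D).graph : Set (H × H)) := by
    have : ((ofCLM D).graph : Set (H × H)) = {p | D p.1 = p.2} := by
      ext ⟨ψ, φ⟩; exact mem_graph_ofCLM
    rw [this]
    exact isClosed_eq (D.continuous.comp continuous_fst) continuous_snd
  have hle : f.graph.topologicalClosure ≤ (ofCLM D).graph :=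
    Submodule.topologicalClosure_minimal _ hf' hcl
  have hclos : f.IsClosable := by
    refine ⟨f.graph.topologicalClosure.toLinearPMap, ?_⟩
    refine (Submodule.toLinearPMap_graph_eq _ ?_).symm
    rintro ⟨ψ, φ⟩ hx (hx0 : ψ = 0)
    have := mem_graph_ofCLM.mp (hle hx)
    change φ = 0
    rw [← this, hx0, map_zero]
  refine eq_ofCLM fun ψ => ?_
  change (ψ, D ψ) ∈ f.closure.graph
  rw [← hclos.graph_closure_eq_closure_graph]
  have h1 : Continuous fun ψ : H => (ψ, D ψ) := by fun_prop
  exact map_mem_closure (f := fun ψ : H => (ψ, D ψ)) h1 (hd ψ) hf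

end Graphs

theorem mem_graph_mulOp {d N : ℕ} {ν : Measure (Space d)} {g : Space d → ℂ} {ψ φ : L2 N ν}
    (h : ∀ᵐ x ∂ν, φ x = g x • ψ x) : (ψ, φ) ∈ (mulOp N ν g).graph := by
  have hd : MemLp (fun x => g x • ψ x) 2 ν := (memLp_congr_ae h).mp (Lp.memLp φ)
  refine mem_graph_of_apply (A := mulOp N ν g) hd (Lp.ext ?_)
  filter_upwards [mulFun_coe g ⟨ψ, hd⟩, h] with x h1 h2
  rw [h2, ← h1]; rfl

namespace Crystal
variable {d N : ℕ} (C : Crystal d N)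

theorem chi_eq {Ω : Set (Space d)} (hΩ : MeasurableSet Ω) :
    chi N C.mu Ω = ofCLM (mulB (Spin N) C.mu (ind Ω)) :=
  eq_ofCLM fun ψ => mem_graph_mulOp (mulB_coe (memLp_ind hΩ) ψ)

/-! ### Vectors with smooth Bloch-Floquet-Zak transform -/

/-- A bounded support meets finitely many translates of the fundamental domain, so the transform is
a finite sum of waves. In the traces per unit volume the unbounded operators act only on such
vectors. -/
theorem exists_contDiff_isZak {K : Set (Space d)} (hK : Bornology.IsBounded K)
    (hKm : MeasurableSet K) (ψ : C.Hil) :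
    ∃ Φ, ContDiff ℝ ∞ Φ ∧ C.IsZak (mulB (Spin N) C.mu (ind K) ψ) Φ := by
  obtain ⟨s, hs⟩ := C.exists_finset_cover hK
  classical
  refine ⟨_, C.contDiff_sum_zakTerm (mulB (Spin N) C.mu (ind K) ψ) (s.image Neg.neg),
    C.isZak_of_coef fun γ hγ => ?_⟩
  refine Lp.ext ?_
  have h1 := (C.measurePreserving_translate γ).quasiMeasurePreserving.ae
    (mulB_coe (E := Spin N) (memLp_ind hKm) ψ)
  filter_upwards [C.coef_coe γ (mulB (Spin N) C.mu (ind K) ψ), ae_restrict_of_ae h1,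
    ae_restrict_mem C.measurableSet_fund, Lp.coeFn_zero (Spin N) 2 (C.mu.restrict C.fund)]
    with x h2 h3 h4 h5
  rw [h2, h3, h5, Pi.zero_apply]
  have h6 : x - (γ : Space d) ∉ K := by
    intro hx
    refine hγ (Finset.mem_image.mpr ⟨-γ, hs (-γ) x h4 ?_, neg_neg γ⟩)
    push_cast
    rwa [← sub_eq_add_neg]
  rw [ind, Set.indicator_of_notMem h6, zero_smul, map_zero]

theorem dense_smoothCore : Dense (C.smoothCore : Set C.Hil) := by
  rw [Submodule.dense_iff_topologicalClosure_eq_top, Submodule.topologicalClosure_eq_top_iff, Submodule.eq_bot_iff]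
  intro ψ hψ
  refine C.eq_zero_of_coef fun γ => ext_inner_left ℂ fun v => ?_
  rw [inner_zero_right, ← ContinuousLinearMap.adjoint_inner_left]
  refine Submodule.inner_right_of_mem_orthogonal ?_ hψ
  refine ⟨_, C.contDiff_sum_zakTerm _ {γ}, C.isZak_of_coef fun γ' hγ' => ?_⟩
  exact C.coef_adjoint_of_ne (fun he => hγ' (Finset.mem_singleton.mpr he)) v

variable {C}

theorem IsZak.mem_graph_X {ψ : C.Hil} {Φ : Space d → C.Fib} (h : C.IsZak ψ Φ)
    (hΦ : ContDiff ℝ ∞ Φ) (l : Fin d) : ∃ ψ' : C.Hil, (ψ, ψ') ∈ (C.X l).graph ∧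
      C.IsZak ψ' fun k => Complex.I • fderiv ℝ Φ k (axis l) := by
  obtain ⟨ψ', h1, h2⟩ := h.position hΦ l
  exact ⟨ψ', mem_graph_mulOp h2, h1⟩

/-- The partial derivative of a family of operators. -/
def pderiv (F : Space d → C.Fib →L[ℂ] C.Fib) (l : Fin d) (k : Space d) : C.Fib →L[ℂ] C.Fib :=
  fderiv ℝ F k (axis l)

theorem contDiff_pderiv {F : Space d → C.Fib →L[ℂ] C.Fib} (hF : ContDiff ℝ ∞ F) (l : Fin d) :
    ContDiff ℝ ∞ (pderiv F l) :=
  contDiff_fderiv_apply hF _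

theorem Equi.pderiv {F : Space d → C.Fib →L[ℂ] C.Fib} (hF : C.Equi F) (hs : ContDiff ℝ ∞ F)
    (l : Fin d) : C.Equi (pderiv F l) := by
  intro g hg k φ
  have h1 : (fun k => F (k + g)) = fun k => ((ContinuousLinearMap.compL ℂ C.Fib C.Fib C.Fib
      (C.varrho g)) ∘L ((ContinuousLinearMap.compL ℂ C.Fib C.Fib C.Fib).flip (C.varrho (-g)))) (F k) :=
    funext fun k => hF.const_op hg k
  have h2 := fderiv_comp_add_right (𝕜 := ℝ) (f := F) (x := k) g
  have h3 : fderiv ℝ F (k + g) (axis l) = C.varrho g ∘L (fderiv ℝ F k (axis l)) ∘L C.varrho (-g) := by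
    rw [← h2, h1]
    exact fderiv_map _ (hs.differentiable (by simp) k) _
  change fderiv ℝ F (k + g) (axis l) _ = _
  rw [h3, ContinuousLinearMap.comp_apply, ContinuousLinearMap.comp_apply]
  congr 2
  have h4 := C.varrho_neg_apply (-g) φ
  rwa [neg_neg] at h4

/-- The closure of the commutator of a position operator with a bounded operator with smooth
fibres. -/
theorem closedComm_X_Op {F : Space d → C.Fib →L[ℂ] C.Fib} (hF : C.Equi F) (hs : ContDiff ℝ ∞ F)
    (l : Fin d) : closedComm (C.X l) (ofCLM (C.Op F)) C.smoothCore =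
      ofCLM (C.Op fun k => Complex.I • Crystal.pderiv F l k) := by
  refine closedComm_eq_ofCLM C.dense_smoothCore ?_
  rintro ψ ⟨Φ, hΦ, hz⟩
  have hsΦ : ContDiff ℝ ∞ fun k => F k (Φ k) := contDiff_apply hs hΦ
  obtain ⟨φ, h1, h2⟩ := (hz.op hs.continuous hF).mem_graph_X hsΦ l
  obtain ⟨φ', h3, h4⟩ := hz.mem_graph_X hΦ l
  have h5 := mem_graph_commOp (A := C.X l) (B := ofCLM (C.Op F)) (mem_graph_ofCLM.mpr rfl) h1 h3
    (mem_graph_ofCLM.mpr rfl)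
  have hc : Continuous fun k => Complex.I • Crystal.pderiv F l k :=
    (contDiff_pderiv hs l).continuous.const_smul Complex.I
  have h6 := hz.op hc ((hF.pderiv hs l).smul Complex.I)
  -- Leibniz rule: `i ∂(F Φ) - F (i ∂Φ) = (i ∂F) Φ`.
  have h7 : C.Op (fun k => Complex.I • Crystal.pderiv F l k) ψ = φ - C.Op F φ' := by
    refine h6.eq (h2.sub (h4.op hs.continuous hF)) (Eventually.of_forall fun k => ?_)
    have h8 : fderiv ℝ (fun k => F k (Φ k)) k (axis l) =
        fderiv ℝ F k (axis l) (Φ k) + F k (fderiv ℝ Φ k (axis l)) :=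
      fderiv_apply_rule (hs.differentiable (by simp) k) (hΦ.differentiable (by simp) k) _
    simp only
    rw [h8, map_smul, smul_add, add_sub_cancel_right]; rfl
  rw [h7]
  exact h5

end Crystal
end UCC

end

/-! ### The spin operator, the conventional current and `[H₀, S]` in the fibres. -/

noncomputable section

namespace UCC

theorem spinOp_coe {d N : ℕ} {ν : Measure (Space d)} (s : Spin N →L[ℂ] Spin N) (ψ : L2 N ν) :
    ∀ᵐ x ∂ν, spinOp ν s ψ x = s (ψ x) :=
  ContinuousLinearMap.coeFn_compLpL s ψ

namespace Crystal
variable {d N : ℕ} {C : Crystal d N} {H₀ : C.Hil →ₗ.[ℂ] C.Hil}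
  {h : Space d → C.Fib →ₗ.[ℂ] C.Fib} {μF : ℝ} {P : C.Hil →L[ℂ] C.Hil} {c r : ℝ}
  {s : Spin N →L[ℂ] Spin N}

/-! ### The spin operator in the fibres -/

variable (C) in
/-- The fibre of the operator `S = Id ⊗ s`. -/
abbrev spinFib (s : Spin N →L[ℂ] Spin N) : C.Fib →L[ℂ] C.Fib := spinOp (C.mu.restrict C.fund) s

theorem res_spinOp (s : Spin N →L[ℂ] Spin N) (ψ : C.Hil) :
    C.res (spinOp C.mu s ψ) = C.spinFib s (C.res ψ) := by
  refine Lp.ext ?_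
  filter_upwards [C.res_coe (spinOp C.mu s ψ), ae_restrict_of_ae (spinOp_coe s ψ), C.res_coe ψ,
    spinOp_coe s (C.res ψ)] with x h1 h2 h3 h4
  rw [h1, h2, h4, h3]

theorem IsSpin.T_comm (hs : C.IsSpin h s) (γ : C.Lat) (ψ : C.Hil) :
    spinOp C.mu s (C.T γ ψ) = C.T γ (spinOp C.mu s ψ) := by
  have h1 := hs.periodic γ
  have h2 : (ψ, spinOp C.mu s (C.T γ ψ)) ∈
      (prodOp (ofCLM (spinOp C.mu s)) (ofCLM (C.T γ))).graph :=
    mem_graph_prodOp.mpr ⟨_, mem_graph_ofCLM.mpr rfl, mem_graph_ofCLM.mpr rfl⟩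
  rw [h1] at h2
  exact eq_of_mem_graph h2
    (mem_graph_prodOp.mpr ⟨_, mem_graph_ofCLM.mpr rfl, mem_graph_ofCLM.mpr rfl⟩)

theorem spinFib_ph (s : Spin N →L[ℂ] Spin N) (k : Space d) (φ : C.Fib) :
    C.spinFib s (C.ph k φ) = C.ph k (C.spinFib s φ) := by
  refine Lp.ext ?_
  filter_upwards [spinOp_coe s (C.ph k φ), phaseOp_coe k φ, phaseOp_coe k (C.spinFib s φ),
    spinOp_coe s φ] with x h1 h2 h3 h4
  rw [h1, h2, h3, h4, map_smul]

theorem equi_spinFib (s : Spin N →L[ℂ] Spin N) : C.Equi fun _ => C.spinFib s :=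
  fun g _ _ φ => spinFib_ph s (-g) φ

/-- As `S` commutes with the translations, it acts on every coefficient by the same fibre operator,
and this operator commutes with the scalar phases of the transform. -/
theorem IsSpin.Op_spinFib (hs : C.IsSpin h s) : C.Op (fun _ => C.spinFib s) = spinOp C.mu s := by
  ext1 ψ
  rw [← sub_eq_zero]
  refine C.eq_zero_of_coef fun γ => ?_
  rw [map_sub, sub_eq_zero]
  have h1 : C.coef γ (spinOp C.mu s ψ) = C.spinFib s (C.coef γ ψ) := by
    rw [coef, ContinuousLinearMap.comp_apply, ← hs.T_comm, res_spinOp]; rfl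
  rw [h1]
  refine ext_inner_left ℂ fun v => ?_
  rw [inner_coef, ← ContinuousLinearMap.adjoint_inner_left (C.spinFib s), inner_coef]
  refine integral_congr_ae ?_
  filter_upwards [C.zk_Op (F := fun _ => C.spinFib s) continuous_const ψ] with k hk
  rw [hk, ContinuousLinearMap.adjoint_inner_left, spinFib_ph]

namespace FibreResolvent

variable (E : C.FibreResolvent h c r)

/-- `š = κ⁻¹ s κ` makes sense because `s` preserves the common domain. Its graph is closed since `κ`
is continuous and injective, so it is bounded. -/
theorem exists_spin (hs : C.IsSpin h s) :
    ∃ š : C.Fib →L[ℂ] C.Fib, ∀ v, E.κ (š v) = C.spinFib s (E.κ v) := by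
  have h1 : ∀ v, ∃ w, E.κ w = C.spinFib s (E.κ v) := by
    intro v
    have hd : E.κ v ∈ (h 0).domain :=
      LinearPMap.mem_domain_of_mem_graph ((E.graph_iff 0 _ _).mpr ⟨v, rfl, rfl⟩)
    obtain ⟨c, hc⟩ := hs.bounded_dom
    obtain ⟨hφ, -⟩ := hc ⟨_, hd⟩
    obtain ⟨w, hw, -⟩ := (E.graph_iff 0 _ _).mp ((h 0).mem_graph ⟨_, hφ⟩)
    exact ⟨w, hw⟩
  choose f hf using h1
  set g : C.Fib →ₗ[ℂ] C.Fib :=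
    { toFun := f
      map_add' := fun v w => E.injective (by rw [hf, map_add, map_add, map_add, hf, hf])
      map_smul' := fun a v => E.injective (by
        rw [hf, map_smul, map_smul, RingHom.id_apply, map_smul, hf]) }
  refine ⟨⟨g, g.continuous_of_seq_closed_graph fun u x y hu hy => E.injective ?_⟩, hf⟩
  have h2 : Tendsto (fun n => E.κ (f (u n))) atTop (𝓝 (E.κ y)) := (E.κ.continuous.tendsto y).comp hy
  have h3 : Tendsto (fun n => E.κ (f (u n))) atTop (𝓝 (C.spinFib s (E.κ x))) := by
    simp_rw [hf]
    exact (((C.spinFib s).continuous.comp E.κ.continuous).tendsto x).comp hu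
  exact (tendsto_nhds_unique h2 h3).trans (hf x).symm

theorem exists_zak_B (hH : C.IsUnperturbed H₀ h μF P) {ψ : C.Hil} {Φ : Space d → C.Fib}
    (hΦ : Continuous Φ) (hz : C.IsZak ψ fun k => E.κ (Φ k)) :
    ∃ ψ', (ψ, ψ') ∈ H₀.graph ∧ C.IsZak ψ' fun k => E.B k (Φ k) := by
  have hc : Continuous fun k => E.B k (Φ k) := E.contDiff_B.continuous.clm_apply hΦ
  have hgr : ∀ k, (E.κ (Φ k), E.B k (Φ k)) ∈ (h k).graph :=
    fun k => (E.graph_iff k _ _).mpr ⟨_, rfl, rfl⟩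
  obtain ⟨ψ', hψ'⟩ := C.exists_isZak_of_continuous hc fun g hg k => by
    have h1 := hH.varrho_mem_graph hg (hgr k)
    rw [← hz.equivariant_of_continuous (E.κ.continuous.comp hΦ) hg k] at h1
    exact eq_of_mem_graph (hgr (k + g)) h1
  exact ⟨ψ', (hH.fibration _ _).mpr ⟨_, _, hz, hψ', Eventually.of_forall hgr⟩, hψ'⟩

/-- With `Ψ = F Φ` the commutator is `B (i ∂Ψ) - i ∂(B Ψ) = -i (∂B) Ψ`. The closure of `[H₀, X_i]`
need not be bounded, so only the values on vectors with smooth transform in the domain are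
identified. -/
theorem mem_graph_closedComm_H (hH : C.IsUnperturbed H₀ h μF P) {F : Space d → C.Fib →L[ℂ] C.Fib}
    (hF : ContDiff ℝ ∞ F) (hE : C.Equi fun k => E.κ ∘L F k) {φ : C.Hil} {Φ : Space d → C.Fib}
    (hΦ : ContDiff ℝ ∞ Φ) (hz : C.IsZak φ Φ) (i : Fin d) :
    (C.Op (fun k => E.κ ∘L F k) φ, C.Op (fun k => (-Complex.I) • (pderiv E.B i k ∘L F k)) φ) ∈
      (closedComm H₀ (C.X i) (C.smoothCoreD h)).graph := by
  have hΨ : ContDiff ℝ ∞ fun k => F k (Φ k) := contDiff_apply hF hΦ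
  set Ψ := fun k => F k (Φ k)
  have hκΨ : ContDiff ℝ ∞ fun k => E.κ (Ψ k) := (E.κ.restrictScalars ℝ).contDiff.comp hΨ
  have hz1 : C.IsZak (C.Op (fun k => E.κ ∘L F k) φ) fun k => E.κ (Ψ k) :=
    hz.op (continuous_const.clm_comp hF.continuous) hE
  have hcore : C.Op (fun k => E.κ ∘L F k) φ ∈ C.smoothCoreD h := by
    refine ⟨fun k => E.lift (Ψ k), (E.lift.restrictScalars ℝ).contDiff.comp hΨ, ?_⟩
    simp_rw [E.lift_fst]; exact hz1
  have hBΨ : ContDiff ℝ ∞ fun k => E.B k (Ψ k) := contDiff_apply E.contDiff_B hΨ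
  have hdΨ : Continuous fun k => Complex.I • fderiv ℝ Ψ k (axis i) :=
    (contDiff_fderiv_apply hΨ _).continuous.const_smul Complex.I
  obtain ⟨ψ1, hg1, hzψ1⟩ := hz1.mem_graph_X hκΨ i
  have hzψ1' : C.IsZak ψ1 fun k => E.κ (Complex.I • fderiv ℝ Ψ k (axis i)) := by
    refine hzψ1.congr (Eventually.of_forall fun k => ?_)
    have h1 : fderiv ℝ (fun k => E.κ (Ψ k)) k (axis i) = E.κ (fderiv ℝ Ψ k (axis i)) :=
      fderiv_map E.κ (hΨ.differentiable (by simp) k) _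
    simp only
    rw [h1, map_smul]
  obtain ⟨ψ2, hg2, hzψ2⟩ := E.exists_zak_B hH hdΨ hzψ1'
  obtain ⟨ψ3, hg3, hzψ3⟩ := E.exists_zak_B hH hΨ.continuous hz1
  obtain ⟨ψ4, hg4, hzψ4⟩ := hzψ3.mem_graph_X hBΨ i
  have hfin := mem_graph_closedComm hcore (mem_graph_commOp hg1 hg2 hg3 hg4)
  have hc : Continuous fun k => (-Complex.I) • (pderiv E.B i k ∘L F k) :=
    ((contDiff_pderiv E.contDiff_B i).continuous.clm_comp hF.continuous).const_smul (-Complex.I)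
  have heq : C.Op (fun k => (-Complex.I) • (pderiv E.B i k ∘L F k)) φ = ψ2 - ψ4 := by
    refine C.Op_eq_of_ae hc ?_
    filter_upwards [(hzψ2.sub hzψ4).ae_eq_zk, hz.ae_eq_zk] with k h1 h2
    have h8 : fderiv ℝ (fun k => E.B k (Ψ k)) k (axis i) =
        fderiv ℝ E.B k (axis i) (Ψ k) + E.B k (fderiv ℝ Ψ k (axis i)) :=
      fderiv_apply_rule (E.contDiff_B.differentiable (by simp) k) (hΨ.differentiable (by simp) k) _
    rw [← h1, ← h2, h8, map_smul, smul_add, sub_add_cancel_right, smul_apply, neg_smul]; rfl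
  rw [heq]
  exact hfin

/-- The fibres of the conventional current, composed with `κ`. -/
def current (š : C.Fib →L[ℂ] C.Fib) (s : Spin N →L[ℂ] Spin N) (i : Fin d) (k : Space d) :
    C.Fib →L[ℂ] C.Fib :=
  (1 / 2 : ℂ) • (pderiv E.B i k ∘L š + C.spinFib s ∘L pderiv E.B i k)

theorem continuous_current (š : C.Fib →L[ℂ] C.Fib) (s : Spin N →L[ℂ] Spin N) (i : Fin d) :
    Continuous (E.current š s i) := by
  have h1 := (contDiff_pderiv E.contDiff_B i).continuous
  have h2 : Continuous fun k => pderiv E.B i k ∘L š + C.spinFib s ∘L pderiv E.B i k :=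
    (h1.clm_comp continuous_const).add (continuous_const.clm_comp h1)
  exact h2.const_smul (1 / 2 : ℂ)

/-- The commutator is evaluated twice, on the vector and on its image under `S`; `š` keeps the
second one of the form `κ (…)`. The factor `i` of the current cancels the `-i` of the commutator. -/
theorem mem_graph_convCurrent (hH : C.IsUnperturbed H₀ h μF P) (hs : C.IsSpin h s)
    {š : C.Fib →L[ℂ] C.Fib} (hš : ∀ v, E.κ (š v) = C.spinFib s (E.κ v))
    {F : Space d → C.Fib →L[ℂ] C.Fib}
    (hF : ContDiff ℝ ∞ F) (hE : C.Equi fun k => E.κ ∘L F k) {φ : C.Hil} {Φ : Space d → C.Fib}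
    (hΦ : ContDiff ℝ ∞ Φ) (hz : C.IsZak φ Φ) (i : Fin d) :
    (C.Op (fun k => E.κ ∘L F k) φ, C.Op (fun k => E.current š s i k ∘L F k) φ) ∈
      (C.convCurrent H₀ h s i).graph := by
  have hcF := hF.continuous
  have hcB := (contDiff_pderiv E.contDiff_B i).continuous
  have hsF : ContDiff ℝ ∞ fun k => š ∘L F k :=
    contDiff_comp (F := fun _ => š) contDiff_const hF
  have hκs : ∀ k, E.κ ∘L (š ∘L F k) = C.spinFib s ∘L (E.κ ∘L F k) := fun k => by
    ext1 v; exact hš _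
  have hEs : C.Equi fun k => E.κ ∘L (š ∘L F k) := by
    simp_rw [hκs]
    exact (equi_spinFib s).comp hE
  have h1 := E.mem_graph_closedComm_H hH hF hE hΦ hz i
  have h2 := E.mem_graph_closedComm_H hH hsF hEs hΦ hz i
  have h3 : C.Op (fun k => E.κ ∘L (š ∘L F k)) φ = spinOp C.mu s (C.Op (fun k => E.κ ∘L F k) φ) := by
    simp_rw [hκs]
    rw [C.Op_mul (F := fun _ => C.spinFib s) (G := fun k => E.κ ∘L F k) continuous_const
      (continuous_const.clm_comp hcF), hs.Op_spinFib]; rfl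
  rw [h3] at h2
  have h4 := mem_graph_smul (1 / 2 : ℂ) (mem_graph_add
    (mem_graph_smul Complex.I (mem_graph_prodOp.mpr ⟨_, mem_graph_ofCLM.mpr rfl, h2⟩))
    (mem_graph_smul Complex.I (mem_graph_prodOp.mpr
      ⟨_, h1, mem_graph_ofCLM (T := spinOp C.mu s).mpr rfl⟩)))
  set a : Space d → C.Fib →L[ℂ] C.Fib := fun k => (-Complex.I) • (pderiv E.B i k ∘L (š ∘L F k))
  set b : Space d → C.Fib →L[ℂ] C.Fib := fun k => (-Complex.I) • (pderiv E.B i k ∘L F k)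
  have ca : Continuous a := (hcB.clm_comp hsF.continuous).const_smul (-Complex.I)
  have cb : Continuous b := (hcB.clm_comp hcF).const_smul (-Complex.I)
  have cb' : Continuous fun k => C.spinFib s ∘L b k := continuous_const.clm_comp cb
  have c1 : Continuous fun k => Complex.I • a k := ca.const_smul Complex.I
  have c2 : Continuous fun k => Complex.I • (C.spinFib s ∘L b k) := cb'.const_smul Complex.I
  have c3 : Continuous fun k => Complex.I • a k + Complex.I • (C.spinFib s ∘L b k) := c1.add c2
  have h5 : (fun k => E.current š s i k ∘L F k) =
      fun k => (1 / 2 : ℂ) • (Complex.I • a k + Complex.I • (C.spinFib s ∘L b k)) := by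
    funext k
    ext1 v
    simp only [current, a, b, ContinuousLinearMap.comp_apply, add_apply, smul_apply, map_smul,
      smul_smul]
    simp
  rw [h5, C.Op_smul c3, C.Op_add c1 c2, C.Op_smul ca, C.Op_smul cb',
    C.Op_mul (F := fun _ => C.spinFib s) continuous_const cb, hs.Op_spinFib]
  exact h4

/-- The fibres of `[H₀, S]`, composed with `κ`. -/
def commS (š : C.Fib →L[ℂ] C.Fib) (s : Spin N →L[ℂ] Spin N) (k : Space d) :
    C.Fib →L[ℂ] C.Fib :=
  E.B k ∘L š - C.spinFib s ∘L E.B k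

theorem continuous_commS (š : C.Fib →L[ℂ] C.Fib) (s : Spin N →L[ℂ] Spin N) :
    Continuous (E.commS š s) :=
  (E.contDiff_B.continuous.clm_comp continuous_const).sub
    (continuous_const.clm_comp E.contDiff_B.continuous)

theorem contDiff_commS (š : C.Fib →L[ℂ] C.Fib) (s : Spin N →L[ℂ] Spin N) :
    ContDiff ℝ ∞ (E.commS š s) :=
  (contDiff_comp (G := fun _ => š) E.contDiff_B contDiff_const).sub
    (contDiff_comp (F := fun _ => C.spinFib s) contDiff_const E.contDiff_B)

theorem mem_graph_commOp_S (hH : C.IsUnperturbed H₀ h μF P) (hs : C.IsSpin h s)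
    {š : C.Fib →L[ℂ] C.Fib} (hš : ∀ v, E.κ (š v) = C.spinFib s (E.κ v))
    {F : Space d → C.Fib →L[ℂ] C.Fib} (hF : Continuous F) (φ : C.Hil) :
    (C.Op (fun k => E.κ ∘L F k) φ, C.Op (fun k => E.commS š s k ∘L F k) φ) ∈
      (commOp H₀ (ofCLM (spinOp C.mu s))).graph := by
  have hcB := E.contDiff_B.continuous
  have hκs : ∀ k, E.κ ∘L (š ∘L F k) = C.spinFib s ∘L (E.κ ∘L F k) := fun k => by
    ext1 v; exact hš _
  have csF : Continuous fun k => š ∘L F k := continuous_const.clm_comp hF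
  have h1 := E.mem_graph hH hF φ
  have h2 := E.mem_graph hH csF φ
  have h3 : C.Op (fun k => E.κ ∘L (š ∘L F k)) φ = spinOp C.mu s (C.Op (fun k => E.κ ∘L F k) φ) := by
    simp_rw [hκs]
    rw [C.Op_mul (F := fun _ => C.spinFib s) (G := fun k => E.κ ∘L F k) continuous_const
      (continuous_const.clm_comp hF), hs.Op_spinFib]; rfl
  rw [h3] at h2
  have h4 := mem_graph_commOp (mem_graph_ofCLM (T := spinOp C.mu s).mpr rfl) h2 h1
    (mem_graph_ofCLM (T := spinOp C.mu s).mpr rfl)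
  have cBF : Continuous fun k => E.B k ∘L F k := hcB.clm_comp hF
  have c1 : Continuous fun k => E.B k ∘L (š ∘L F k) := hcB.clm_comp csF
  have c2 : Continuous fun k => C.spinFib s ∘L (E.B k ∘L F k) := continuous_const.clm_comp cBF
  have h5 : (fun k => E.commS š s k ∘L F k) =
      fun k => E.B k ∘L (š ∘L F k) - C.spinFib s ∘L (E.B k ∘L F k) := rfl
  rw [h5, C.Op_sub c1 c2, C.Op_mul (F := fun _ => C.spinFib s) continuous_const cBF, hs.Op_spinFib]
  exact h4

theorem equi_B (hH : C.IsUnperturbed H₀ h μF P) {F : Space d → C.Fib →L[ℂ] C.Fib}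
    (hE : C.Equi fun k => E.κ ∘L F k) : C.Equi fun k => E.B k ∘L F k := by
  intro g hg k φ
  have hgr : ∀ k v, (E.κ v, E.B k v) ∈ (h k).graph :=
    fun k v => (E.graph_iff k _ _).mpr ⟨_, rfl, rfl⟩
  have h1 := hH.varrho_mem_graph hg (hgr k (F k φ))
  have h2 := hE g hg k φ
  simp only [ContinuousLinearMap.comp_apply] at h2
  rw [← h2] at h1
  exact eq_of_mem_graph (hgr (k + g) _) h1

theorem equi_commS (hH : C.IsUnperturbed H₀ h μF P)
    {š : C.Fib →L[ℂ] C.Fib} (hš : ∀ v, E.κ (š v) = C.spinFib s (E.κ v))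
    {F : Space d → C.Fib →L[ℂ] C.Fib} (hE : C.Equi fun k => E.κ ∘L F k) :
    C.Equi fun k => E.commS š s k ∘L F k := by
  have hκs : ∀ k, E.κ ∘L (š ∘L F k) = C.spinFib s ∘L (E.κ ∘L F k) := fun k => by
    ext1 v; exact hš _
  have hEs : C.Equi fun k => E.κ ∘L (š ∘L F k) := by
    simp_rw [hκs]
    exact (equi_spinFib s).comp hE
  have h1 : (fun k => E.commS š s k ∘L F k) =
      fun k => E.B k ∘L (š ∘L F k) - C.spinFib s ∘L (E.B k ∘L F k) := rfl
  rw [h1]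
  exact (E.equi_B hH hEs).sub ((equi_spinFib s).comp (E.equi_B hH hE))

end FibreResolvent

end Crystal
end UCC

end

/-! ### The inverse Liouvillian in the fibres, and trace class bounds. -/

noncomputable section

namespace UCC

/-- Applied with `a = ϱ(g)` to get equivariance of exponentials, and with `a = κ` to lift
exponentials to the domain of the Hamiltonian. -/
theorem semiconjBy_exp {A : Type*} [NormedRing A] [NormedAlgebra ℂ A] [CompleteSpace A]
    {a x y : A} (h : a * x = y * a) : a * NormedSpace.exp x = NormedSpace.exp y * a := by
  have : NormedAlgebra ℚ A := NormedAlgebra.restrictScalars ℚ ℂ A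
  have h1 := (NormedSpace.exp_series_hasSum_exp' (𝕂 := ℂ) x).mul_left a
  have h2 := (NormedSpace.exp_series_hasSum_exp' (𝕂 := ℂ) y).mul_right a
  refine h1.unique ?_
  convert h2 using 1
  funext n
  rw [mul_smul_comm, smul_mul_assoc, (SemiconjBy.pow_right (show SemiconjBy a x y from h) n).eq]

theorem contDiff_exp_comp {V A : Type*} [NormedAddCommGroup V] [NormedSpace ℝ V] [NormedRing A]
    [NormedAlgebra ℂ A] [CompleteSpace A] {f : V → A} (hf : ContDiff ℝ ∞ f) :
    ContDiff ℝ ∞ fun k => NormedSpace.exp (f k) := by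
  have h1 : ContDiff ℝ ∞ (NormedSpace.exp : A → A) :=
    contDiff_iff_contDiffAt.mpr fun x => (NormedSpace.exp_analytic (𝕂 := ℝ) x).contDiffAt
  exact h1.comp hf

/-- A differentiability property of the Dyson series. -/
theorem exists_hasDerivAt_bilinear {A : Type*} [NormedRing A] [NormedAlgebra ℂ A] [CompleteSpace A]
    {b : A × A → ℂ} (hb : IsBoundedBilinearMap ℂ b) (a₁ a₂ s t : A) :
    ∃ b' : ℂ, HasDerivAt (fun ε : ℝ => b (a₁ * NormedSpace.exp ((-(Complex.I * ε)) • s) * a₂,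
      NormedSpace.exp ((Complex.I * ε) • t))) b' 0 := by
  have h1 : ∀ (w : ℂ) (x : A), HasDerivAt (fun ε : ℂ => NormedSpace.exp ((w * ε) • x))
      (w • x) 0 := by
    intro w x
    have h2 := hasDerivAt_exp_smul_const (𝕂 := ℂ) (w • x) 0
    rw [zero_smul, NormedSpace.exp_zero, one_mul] at h2
    refine h2.congr_of_eventuallyEq (Eventually.of_forall fun ε => ?_)
    simp only [smul_smul, mul_comm]
  have h3 := ((h1 (-Complex.I) s).const_mul a₁).mul_const a₂
  have h4 := h3.prodMk (h1 Complex.I t)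
  have h5 := (hb.hasFDerivAt _).comp_hasDerivAt (0 : ℂ) h4
  refine ⟨_, (HasDerivAt.comp_ofReal (z := 0) (by rw [Complex.ofReal_zero]; exact h5)).congr_of_eventuallyEq
    (Eventually.of_forall fun ε => ?_)⟩
  simp only [Function.comp_apply, neg_mul]

namespace Crystal
variable {d N : ℕ} {C : Crystal d N} {H₀ : C.Hil →ₗ.[ℂ] C.Hil}
  {h : Space d → C.Fib →ₗ.[ℂ] C.Fib} {μF : ℝ} {P : C.Hil →L[ℂ] C.Hil} {c r : ℝ}
  {s : Spin N →L[ℂ] Spin N}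

theorem Equi.exp {F : Space d → C.Fib →L[ℂ] C.Fib} (hF : C.Equi F) :
    C.Equi fun k => NormedSpace.exp (F k) := by
  intro g hg k φ
  have h1 : C.varrho g * F k = F (k + g) * C.varrho g := by
    ext1 v; exact (hF g hg k v).symm
  exact (congrArg (fun T : C.Fib →L[ℂ] C.Fib => T φ) (semiconjBy_exp h1)).symm

namespace FibreResolvent

variable (E : C.FibreResolvent h c r) (hr : 0 ≤ r)

/-! ### The inverse Liouvillian in the fibres -/

theorem u_sub (k : Space d) (z w : Metric.sphere (c : ℂ) r) :
    E.u k z - E.u k w = ((z : ℂ) - w) • (E.u k z ∘L (E.κ ∘L E.u k w)) := by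
  have h1 : E.u k z - E.u k w = E.u k z ∘L ((E.B k - (w : ℂ) • E.κ) ∘L E.u k w) -
      (E.u k z ∘L (E.B k - (z : ℂ) • E.κ)) ∘L E.u k w := by
    rw [E.mul_u, E.u_mul, ContinuousLinearMap.comp_id, ContinuousLinearMap.id_comp]
  rw [h1]
  ext1 v
  simp only [sub_apply, ContinuousLinearMap.comp_apply, smul_apply, map_sub, map_smul, sub_smul]
  abel

theorem u_comm (k : Space d) (z w : Metric.sphere (c : ℂ) r) :
    E.u k z ∘L (E.κ ∘L E.u k w) = E.u k w ∘L (E.κ ∘L E.u k z) := by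
  by_cases hzw : (z : ℂ) = w
  · rw [Subtype.ext hzw]
  · have h1 := E.u_sub k z w
    have h2 := E.u_sub k w z
    rw [← neg_sub (z : ℂ), ← neg_sub (E.u k z), neg_smul, neg_inj, h1] at h2
    exact smul_right_injective _ (sub_ne_zero.mpr hzw) h2

/-- The Fermi projection commutes with the resolvents, being an integral of them. The statement is
the version with one factor `κ` removed on the left, so that values stay in the domain. -/
theorem u_pc (k : Space d) (z : Metric.sphere (c : ℂ) r) :
    E.u k z ∘L E.p hr k = E.pc hr k ∘L (E.κ ∘L E.u k z) := by
  set T₁ := ContinuousLinearMap.compL ℂ C.Fib C.Fib C.Fib (E.u k z ∘L E.κ)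
  set T₂ := (ContinuousLinearMap.compL ℂ C.Fib C.Fib C.Fib).flip (E.κ ∘L E.u k z)
  set g : CN (Metric.sphere (c : ℂ) r) (C.Fib →L[ℂ] C.Fib) :=
    ⟨fun w => T₁ (E.u k w), T₁.continuous.comp (E.u k).continuous⟩
  have h1 : T₁ (cint hr (E.u k)) = cint hr g := map_cint hr T₁ (E.u k) fun w => rfl
  have h2 : T₂ (cint hr (E.u k)) = cint hr g := map_cint hr T₂ (E.u k) fun w => E.u_comm k z w
  have h3 : T₁ (E.pc hr k) = T₂ (E.pc hr k) := by
    rw [pc, T₁.map_smul, T₂.map_smul, h1, h2]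
  exact h3

/-- The fibres of the superoperator `q ↦ (i / 2π) ∮ (H₀ - z)⁻¹ q (H₀ - z)⁻¹ dz`. -/
def liou (q : Space d → C.Fib →L[ℂ] C.Fib) (k : Space d) : C.Fib →L[ℂ] C.Fib :=
  (Complex.I / (2 * Real.pi)) •
    cint hr (E.u k * constCN (Metric.sphere (c : ℂ) r) (C.Fib →L[ℂ] C.Fib) (q k ∘L E.κ) * E.u k)

variable {q : Space d → C.Fib →L[ℂ] C.Fib}

theorem contDiff_liou (hq : ContDiff ℝ ∞ q) : ContDiff ℝ ∞ (E.liou hr q) := by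
  have h1 : ContDiff ℝ ∞ fun k => q k ∘L E.κ := contDiff_comp (G := fun _ => E.κ) hq contDiff_const
  have h2 : ContDiff ℝ ∞ fun k => constCN (Metric.sphere (c : ℂ) r) (C.Fib →L[ℂ] C.Fib) (q k ∘L E.κ) :=
    ((constCN (Metric.sphere (c : ℂ) r) (C.Fib →L[ℂ] C.Fib)).restrictScalars ℝ).contDiff.comp h1
  exact ContDiff.const_smul (Complex.I / (2 * Real.pi) : ℂ)
    (contDiff_cint hr (contDiff_mulCN (A := C.Fib →L[ℂ] C.Fib)
      (contDiff_mulCN (A := C.Fib →L[ℂ] C.Fib) E.contDiff_u h2) E.contDiff_u))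

/-- The integrand of `κ ∘ liou q`. -/
def liouIntegrand (q : Space d → C.Fib →L[ℂ] C.Fib) (k : Space d) :
    CN (Metric.sphere (c : ℂ) r) (C.Fib →L[ℂ] C.Fib) :=
  E.res k * constCN (Metric.sphere (c : ℂ) r) (C.Fib →L[ℂ] C.Fib) (q k) * E.res k

theorem κ_liou (q : Space d → C.Fib →L[ℂ] C.Fib) (k : Space d) :
    E.κ ∘L E.liou hr q k = (Complex.I / (2 * Real.pi)) • cint hr (E.liouIntegrand q k) := by
  have h1 := map_cint hr (ContinuousLinearMap.compL ℂ C.Fib C.Fib C.Fib E.κ)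
    (E.u k * constCN (Metric.sphere (c : ℂ) r) (C.Fib →L[ℂ] C.Fib) (q k ∘L E.κ) * E.u k)
    (g := E.liouIntegrand q k) fun z => rfl
  rw [← h1, ← map_smul]; rfl

theorem continuous_liouIntegrand (hq : Continuous q) : Continuous (E.liouIntegrand q) := by
  have h2 : Continuous fun k => constCN (Metric.sphere (c : ℂ) r) (C.Fib →L[ℂ] C.Fib) (q k) :=
    (constCN (Metric.sphere (c : ℂ) r) (C.Fib →L[ℂ] C.Fib)).continuous.comp hq
  have h3 := E.contDiff_res.continuous
  exact (h3.mul h2).mul h3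

theorem equi_liou (hH : C.IsUnperturbed H₀ h μF P) (hq : C.Equi q) :
    C.Equi fun k => E.κ ∘L E.liou hr q k := by
  have h1 : C.Equi fun k => cint hr (E.liouIntegrand q k) :=
    Equi.cint hr fun z => ((E.equi hH z).comp hq).comp (E.equi hH z)
  have h2 := h1.smul (Complex.I / (2 * Real.pi))
  simp_rw [κ_liou]
  exact h2

theorem Op_liou (hH : C.IsUnperturbed H₀ h μF P) (hq : Continuous q) :
    (Complex.I / (2 * Real.pi)) • circleIntegral
      (fun z => resolventOp H₀ z ∘L (C.Op q ∘L resolventOp H₀ z)) (c : ℂ) r =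
      C.Op fun k => E.κ ∘L E.liou hr q k := by
  have h0 := E.continuous_liouIntegrand hq
  have h1 : Continuous fun k => cint hr (E.liouIntegrand q k) := (cint hr).continuous.comp h0
  simp_rw [κ_liou]
  rw [C.Op_smul h1, C.circleIntegral_Op hr h0]
  intro z hz
  have hc : Continuous fun k => E.κ ∘L E.u k ⟨z, hz⟩ :=
    continuous_const.clm_comp (E.continuous_u ⟨z, hz⟩)
  have hc' : Continuous fun k => q k ∘L (E.κ ∘L E.u k ⟨z, hz⟩) := hq.clm_comp hc
  have h2 := E.resolventOp_eq hH ⟨z, hz⟩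
  simp only at h2
  rw [h2, ← C.Op_mul hq hc, ← C.Op_mul hc hc']
  rfl

/-- The commutator with the Fermi projection. -/
def commP (a : Space d → C.Fib →L[ℂ] C.Fib) (k : Space d) : C.Fib →L[ℂ] C.Fib :=
  a k ∘L E.p hr k - E.p hr k ∘L a k

theorem contDiff_commP (hq : ContDiff ℝ ∞ q) : ContDiff ℝ ∞ (E.commP hr q) :=
  (contDiff_comp hq (E.contDiff_p hr)).sub (contDiff_comp (E.contDiff_p hr) hq)

theorem equi_commP (hH : C.IsUnperturbed H₀ h μF P) (hq : C.Equi q) : C.Equi (E.commP hr q) :=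
  (hq.comp (E.equi_p hr hH)).sub ((E.equi_p hr hH).comp hq)

theorem Op_commP (hH : C.IsUnperturbed H₀ h μF P) (hcr : C.IsContour H₀ μF c r)
    (hq : Continuous q) : C.Op (E.commP hr q) = C.Op q ∘L P - P ∘L C.Op q := by
  have hp := (E.contDiff_p hr).continuous
  have c1 : Continuous fun k => q k ∘L E.p hr k := hq.clm_comp hp
  have c2 : Continuous fun k => E.p hr k ∘L q k := hp.clm_comp hq
  have h1 : E.commP hr q = fun k => q k ∘L E.p hr k - E.p hr k ∘L q k := rfl
  rw [h1, C.Op_sub c1 c2, C.Op_mul hq hp, C.Op_mul hp hq, E.Op_p hr hH hcr]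

theorem invLiouvillian_Op (hH : C.IsUnperturbed H₀ h μF P) (hcr : C.IsContour H₀ μF c r)
    (hq : ContDiff ℝ ∞ q) : invLiouvillian H₀ P c r (C.Op q) =
      C.Op fun k => E.κ ∘L E.liou hr (E.commP hr q) k := by
  rw [← E.Op_liou hr hH (E.contDiff_commP hr hq).continuous, E.Op_commP hr hH hcr hq.continuous]
  rfl

/-- Idempotency of `p = κ ∘ pc`, with the injective `κ` cancelled. -/
theorem pc_comp_p (hH : C.IsUnperturbed H₀ h μF P) (hcr : C.IsContour H₀ μF c r) (k : Space d) :
    E.pc hr k ∘L E.p hr k = E.pc hr k := by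
  ext1 v
  refine E.injective ?_
  exact congrArg (fun T : C.Fib →L[ℂ] C.Fib => T v) (E.p_idem hr hH hcr k)

/-- The projection commutes with the resolvents and can be pulled out of the contour integral. Every
term then carries a factor `p` or `pc = pc ∘ p`, which is what gives it finite rank. -/
theorem liou_commP (q : Space d → C.Fib →L[ℂ] C.Fib) (k : Space d) :
    E.liou hr (E.commP hr q) k =
      E.liou hr q k ∘L E.p hr k - E.pc hr k ∘L (E.κ ∘L E.liou hr q k) := by
  set T₁ := (ContinuousLinearMap.compL ℂ C.Fib C.Fib C.Fib).flip (E.p hr k)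
  set T₂ := ContinuousLinearMap.compL ℂ C.Fib C.Fib C.Fib (E.pc hr k ∘L E.κ)
  have h1 := map_cint hr (T₁ - T₂)
    (E.u k * constCN (Metric.sphere (c : ℂ) r) (C.Fib →L[ℂ] C.Fib) (q k ∘L E.κ) * E.u k)
    (g := E.u k * constCN (Metric.sphere (c : ℂ) r) (C.Fib →L[ℂ] C.Fib)
      (E.commP hr q k ∘L E.κ) * E.u k) fun z => by
    have hu := E.u_pc hr k z
    have e1 : E.u k z ∘L ((q k ∘L E.p hr k - E.p hr k ∘L q k) ∘L E.κ) ∘L E.u k z =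
        (E.u k z ∘L (q k ∘L E.κ) ∘L E.u k z) ∘L E.p hr k -
          (E.pc hr k ∘L E.κ) ∘L (E.u k z ∘L (q k ∘L E.κ) ∘L E.u k z) := by
      ext1 v
      have hu1 := congrArg (fun T : C.Fib →L[ℂ] C.Fib => E.κ (T v)) hu
      have hu2 := congrArg (fun T : C.Fib →L[ℂ] C.Fib => T (q k (E.κ (E.u k z v)))) hu
      simp only [ContinuousLinearMap.comp_apply] at hu1 hu2
      have hp : ∀ w, E.p hr k w = E.κ (E.pc hr k w) := fun w => rfl
      simp only [ContinuousLinearMap.comp_apply, sub_apply, map_sub]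
      rw [hu2, hu1, hp (E.κ (E.u k z v))]
    exact e1
  have h2 : E.liou hr (E.commP hr q) k = (T₁ - T₂) (E.liou hr q k) := by
    rw [liou, liou, (T₁ - T₂).map_smul, h1]
  exact h2

/-! ### Trace class properties -/

theorem exists_norm_bound {x : Space d → C.Fib →L[ℂ] C.Fib} (hx : Continuous x) :
    ∃ cx, 0 ≤ cx ∧ ∀ k ∈ brillouin C.a, ‖x k‖ ≤ cx := by
  obtain ⟨cx, hcx⟩ := C.isCompact_zone.exists_bound_of_continuousOn hx.continuousOn
  exact ⟨max cx 0, le_max_right _ _, fun k hk =>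
    (hcx k (C.brillouin_subset_zone hk)).trans (le_max_left _ _)⟩

theorem exists_hs_bound (hH : C.IsUnperturbed H₀ h μF P) (hcr : C.IsContour H₀ μF c r) :
    ∃ c₀ : ℝ, 0 ≤ c₀ ∧ ∀ (y : Space d → C.Fib →L[ℂ] C.Fib) (cy : ℝ), Continuous y → 0 ≤ cy →
      (∀ k ∈ brillouin C.a, ‖y k‖ ≤ cy) → ∀ γ,
      hs (C.Op (fun k => E.p hr k ∘L y k) ∘L (C.coef γ).adjoint) ≤
        ENNReal.ofReal ((c₀ * cy) ^ 2) := by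
  obtain ⟨n, hn⟩ := E.exists_rank_bound hr hH hcr
  have hp := (E.contDiff_p hr).continuous
  obtain ⟨cp, hcp0, hcp⟩ := exists_norm_bound hp
  have : ∀ k, FiniteDimensional ℂ (E.p hr k).range := E.finiteDimensional_range_p hr hH hcr
  refine ⟨Real.sqrt n * cp, by positivity, fun y cy hy h0 hcy γ => ?_⟩
  rw [mul_assoc, mul_pow, Real.sq_sqrt (Nat.cast_nonneg n)]
  refine C.hs_Op_coef_adjoint_le (hp.clm_comp hy) (V := fun k => (E.p hr k).range)
    (fun k φ => ⟨y k φ, rfl⟩) hn (by positivity) (fun k hk => ?_) γ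
  refine (ContinuousLinearMap.opNorm_comp_le _ _).trans ?_
  exact mul_le_mul (hcp k hk) (hcy k hk) (norm_nonneg _) hcp0

/-- Writing `p = p p` with `p* = p` splits `x p y` into `(p x*)* (p y)`. Both factors have finite
rank fibres, hence Hilbert-Schmidt blocks between translates of the fundamental domain. -/
theorem Op_comp_p_comp (hH : C.IsUnperturbed H₀ h μF P) (hcr : C.IsContour H₀ μF c r)
    {x y : Space d → C.Fib →L[ℂ] C.Fib} (hx : Continuous x) (hy : Continuous y) :
    C.Op (fun k => x k ∘L (E.p hr k ∘L y k)) =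
      (C.Op fun k => E.p hr k ∘L (x k).adjoint).adjoint ∘L C.Op fun k => E.p hr k ∘L y k := by
  have hp := (E.contDiff_p hr).continuous
  have c1 : Continuous fun k => E.p hr k ∘L (x k).adjoint := hp.clm_comp (continuous_adjoint hx)
  have c2 : Continuous fun k => E.p hr k ∘L y k := hp.clm_comp hy
  have c3 : Continuous fun k => x k ∘L E.p hr k := hx.clm_comp hp
  have e1 : (fun k => (E.p hr k ∘L (x k).adjoint).adjoint) = fun k => x k ∘L E.p hr k := by
    funext k
    rw [ContinuousLinearMap.adjoint_comp, ContinuousLinearMap.adjoint_adjoint,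
      E.p_adjoint hr hH hcr]
  have e2 : (fun k => x k ∘L (E.p hr k ∘L y k)) =
      fun k => (x k ∘L E.p hr k) ∘L (E.p hr k ∘L y k) := by
    funext k
    rw [ContinuousLinearMap.comp_assoc, ← ContinuousLinearMap.comp_assoc (E.p hr k),
      E.p_idem hr hH hcr]
  rw [C.Op_adjoint c1, e1, e2, C.Op_mul c3 c2]

theorem coef_Op_comp (hH : C.IsUnperturbed H₀ h μF P) (hcr : C.IsContour H₀ μF c r)
    {x y : Space d → C.Fib →L[ℂ] C.Fib} (hx : Continuous x) (hy : Continuous y) (γ γ' : C.Lat) :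
    C.coef γ ∘L (C.Op fun k => x k ∘L (E.p hr k ∘L y k)) ∘L (C.coef γ').adjoint =
      (C.Op (fun k => E.p hr k ∘L (x k).adjoint) ∘L (C.coef γ).adjoint).adjoint ∘L
        ((C.Op (fun k => E.p hr k ∘L y k) ∘L (C.coef γ').adjoint).adjoint).adjoint := by
  rw [E.Op_comp_p_comp hr hH hcr hx hy, ContinuousLinearMap.adjoint_adjoint,
    ContinuousLinearMap.adjoint_comp, ContinuousLinearMap.adjoint_adjoint]
  simp only [ContinuousLinearMap.comp_assoc]

theorem norm_adjoint_le {x : Space d → C.Fib →L[ℂ] C.Fib} {cx : ℝ}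
    (hx : ∀ k ∈ brillouin C.a, ‖x k‖ ≤ cx) : ∀ k ∈ brillouin C.a, ‖(x k).adjoint‖ ≤ cx :=
  fun k hk => (LinearIsometryEquiv.norm_map _ _).trans_le (hx k hk)

theorem isLocTraceClass_Op (hH : C.IsUnperturbed H₀ h μF P) (hcr : C.IsContour H₀ μF c r)
    {x y : Space d → C.Fib →L[ℂ] C.Fib} (hx : Continuous x) (hy : Continuous y) :
    C.IsLocTraceClass (C.Op fun k => x k ∘L (E.p hr k ∘L y k)) := by
  have hp := (E.contDiff_p hr).continuous
  obtain ⟨c₀, -, hb⟩ := E.exists_hs_bound hr hH hcr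
  refine ⟨fun γ ψ => C.Op_T (hx.clm_comp (hp.clm_comp hy)) γ ψ, fun γ γ' => ?_⟩
  obtain ⟨cx, hx0, hcx⟩ := exists_norm_bound hx
  obtain ⟨cy, hy0, hcy⟩ := exists_norm_bound hy
  rw [E.coef_Op_comp hr hH hcr hx hy]
  refine isTraceClass_of_hs ?_ ?_
  · rw [hs_adjoint]
    exact ne_top_of_le_ne_top ENNReal.ofReal_ne_top
      (hb _ cx (continuous_adjoint hx) hx0 (norm_adjoint_le hcx) γ)
  · rw [hs_adjoint]
    exact ne_top_of_le_ne_top ENNReal.ofReal_ne_top (hb _ cy hy hy0 hcy γ')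

theorem trace_Op_bound (hH : C.IsUnperturbed H₀ h μF P) (hcr : C.IsContour H₀ μF c r) :
    ∃ c₀ : ℝ, ∀ x y : Space d → C.Fib →L[ℂ] C.Fib, Continuous x → Continuous y →
      ∀ cx cy : ℝ, 0 ≤ cx → 0 ≤ cy → (∀ k ∈ brillouin C.a, ‖x k‖ ≤ cx) →
        (∀ k ∈ brillouin C.a, ‖y k‖ ≤ cy) →
        ‖tr (C.cpr (C.Op fun k => x k ∘L (E.p hr k ∘L y k)))‖ ≤ c₀ * cx * cy := by
  obtain ⟨c₀, h0, hb⟩ := E.exists_hs_bound hr hH hcr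
  refine ⟨c₀ ^ 2, fun x y hx hy cx cy hx0 hy0 hcx hcy => ?_⟩
  rw [← (E.isLocTraceClass_Op hr hH hcr hx hy).coef_comp 0, E.coef_Op_comp hr hH hcr hx hy]
  refine (norm_tr_le_of_hs (x := c₀ * cx) (y := c₀ * cy)
    (by positivity) (by positivity) ?_ ?_).trans (le_of_eq (by ring))
  · rw [hs_adjoint]
    exact hb _ cx (continuous_adjoint hx) hx0 (norm_adjoint_le hcx) 0
  · rw [hs_adjoint]
    exact hb _ cy hy hy0 hcy 0

/-- The trace is controlled by the sup norms of `x` and `y` on the compact closed zone.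
Differentiability in `ε` of a trace thus reduces to differentiability in the Banach algebra of
continuous families. -/
theorem isBoundedBilinearMap_trace (hH : C.IsUnperturbed H₀ h μF P)
    (hcr : C.IsContour H₀ μF c r) :
    IsBoundedBilinearMap ℂ fun f : CN C.zone (C.Fib →L[ℂ] C.Fib) × CN C.zone (C.Fib →L[ℂ] C.Fib) =>
      tr (C.cpr (C.Op fun k => f.1 (C.clamp k) ∘L (E.p hr k ∘L f.2 (C.clamp k)))) := by
  obtain ⟨c₀, hc₀⟩ := E.trace_Op_bound hr hH hcr
  have hp := (E.contDiff_p hr).continuous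
  have hc : ∀ f : CN C.zone (C.Fib →L[ℂ] C.Fib), Continuous fun k => f (C.clamp k) :=
    fun f => f.continuous.comp C.continuous_clamp
  have hc2 : ∀ f g : CN C.zone (C.Fib →L[ℂ] C.Fib), Continuous fun k =>
      f (C.clamp k) ∘L (E.p hr k ∘L g (C.clamp k)) := fun f g =>
    (hc f).clm_comp (hp.clm_comp (hc g))
  have hltc := fun f g : CN C.zone (C.Fib →L[ℂ] C.Fib) => (E.isLocTraceClass_Op hr hH hcr (hc f) (hc g)).traceClass_cpr
  have hadd : ∀ A B : C.Hil →L[ℂ] C.Hil, C.cpr (A + B) = C.cpr A + C.cpr B := fun A B => by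
    ext1 v; simp [cpr]
  have hsmul : ∀ (w : ℂ) (A : C.Hil →L[ℂ] C.Hil), C.cpr (w • A) = w • C.cpr A := fun w A => by
    ext1 v; simp [cpr]
  refine ⟨fun x₁ x₂ y => ?_, fun w x y => ?_, fun x y₁ y₂ => ?_, fun w x y => ?_, ?_⟩
  · have e : (fun k => (x₁ + x₂) (C.clamp k) ∘L (E.p hr k ∘L y (C.clamp k))) = fun k =>
        x₁ (C.clamp k) ∘L (E.p hr k ∘L y (C.clamp k)) +
        x₂ (C.clamp k) ∘L (E.p hr k ∘L y (C.clamp k)) := by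
      funext k; ext1 v; rfl
    simp only [e, C.Op_add (hc2 x₁ y) (hc2 x₂ y), hadd, tr_add (hltc x₁ y) (hltc x₂ y)]
  · have e : (fun k => (w • x) (C.clamp k) ∘L (E.p hr k ∘L y (C.clamp k))) = fun k =>
        w • (x (C.clamp k) ∘L (E.p hr k ∘L y (C.clamp k))) := by
      funext k; ext1 v; rfl
    simp only [e, C.Op_smul (hc2 x y), hsmul, tr_smul, smul_eq_mul]
  · have e : (fun k => x (C.clamp k) ∘L (E.p hr k ∘L (y₁ + y₂) (C.clamp k))) = fun k =>
        x (C.clamp k) ∘L (E.p hr k ∘L y₁ (C.clamp k)) +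
        x (C.clamp k) ∘L (E.p hr k ∘L y₂ (C.clamp k)) := by
      funext k; ext1 v
      change x (C.clamp k) (E.p hr k (y₁ (C.clamp k) v + y₂ (C.clamp k) v)) = _
      rw [map_add, map_add]; rfl
    simp only [e, C.Op_add (hc2 x y₁) (hc2 x y₂), hadd, tr_add (hltc x y₁) (hltc x y₂)]
  · have e : (fun k => x (C.clamp k) ∘L (E.p hr k ∘L (w • y) (C.clamp k))) = fun k =>
        w • (x (C.clamp k) ∘L (E.p hr k ∘L y (C.clamp k))) := by
      funext k; ext1 v
      change x (C.clamp k) (E.p hr k (w • y (C.clamp k) v)) = _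
      rw [map_smul, map_smul]; rfl
    simp only [e, C.Op_smul (hc2 x y), hsmul, tr_smul, smul_eq_mul]
  · refine ⟨max c₀ 1, by positivity, fun x y => ?_⟩
    refine (hc₀ _ _ (hc x) (hc y) ‖x‖ ‖y‖ (norm_nonneg _) (norm_nonneg _)
      (fun k _ => x.norm_coe_le_norm _) (fun k _ => y.norm_coe_le_norm _)).trans ?_
    gcongr
    exact le_max_left _ _

end FibreResolvent

end Crystal
end UCC

end

/-! ### The perturbed states, the conventional current and the rotation current as fibred operators.
-/

noncomputable section

namespace UCC
namespace Crystal
variable {d N : ℕ} {C : Crystal d N} {H₀ : C.Hil →ₗ.[ℂ] C.Hil}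
  {h : Space d → C.Fib →ₗ.[ℂ] C.Fib} {μF : ℝ} {P : C.Hil →L[ℂ] C.Hil} {c r : ℝ}
  {s : Spin N →L[ℂ] Spin N}

namespace FibreResolvent

variable (E : C.FibreResolvent h c r) (hr : 0 ≤ r)

/-! ### The perturbed projections -/

/-- The fibres of the closure of `[X_j, Π₀]`. -/
def posComm (j : Fin d) (k : Space d) : C.Fib →L[ℂ] C.Fib := Complex.I • pderiv (E.p hr) j k

theorem contDiff_posComm (j : Fin d) : ContDiff ℝ ∞ (E.posComm hr j) :=
  (contDiff_pderiv (E.contDiff_p hr) j).const_smul Complex.I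

theorem equi_posComm (hH : C.IsUnperturbed H₀ h μF P) (j : Fin d) : C.Equi (E.posComm hr j) :=
  (Equi.pderiv (E.equi_p hr hH) (E.contDiff_p hr) j).smul Complex.I

theorem isPosComm (hH : C.IsUnperturbed H₀ h μF P) (hcr : C.IsContour H₀ μF c r) (j : Fin d) :
    C.IsPosComm P j (C.Op (E.posComm hr j)) := by
  have h1 := closedComm_X_Op (E.equi_p hr hH) (E.contDiff_p hr) j
  rw [E.Op_p hr hH hcr] at h1
  exact h1

/-- The fibres of `Π₁`, as operators with values in the domain of the Hamiltonian. -/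
def pertFib (j : Fin d) : Space d → C.Fib →L[ℂ] C.Fib := E.liou hr (E.commP hr (E.posComm hr j))

theorem contDiff_pertFib (j : Fin d) : ContDiff ℝ ∞ (E.pertFib hr j) :=
  E.contDiff_liou hr (E.contDiff_commP hr (E.contDiff_posComm hr j))

theorem equi_pertFib (hH : C.IsUnperturbed H₀ h μF P) (j : Fin d) :
    C.Equi fun k => E.κ ∘L E.pertFib hr j k :=
  E.equi_liou hr hH (E.equi_commP hr hH (E.equi_posComm hr hH j))

theorem Op_pertFib (hH : C.IsUnperturbed H₀ h μF P) (hcr : C.IsContour H₀ μF c r) (j : Fin d) :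
    C.Op (fun k => E.κ ∘L E.pertFib hr j k) = C.pi1 H₀ P c r (C.Op (E.posComm hr j)) :=
  (E.invLiouvillian_Op hr hH hcr (E.contDiff_posComm hr j)).symm

/-- The fibres of the generator of the non-equilibrium almost-stationary state. -/
def genFib (j : Fin d) (k : Space d) : C.Fib →L[ℂ] C.Fib :=
  Complex.I • E.liou hr (E.commP hr (E.commP hr (E.posComm hr j))) k

theorem contDiff_genFib (j : Fin d) : ContDiff ℝ ∞ (E.genFib hr j) :=
  (E.contDiff_liou hr (E.contDiff_commP hr (E.contDiff_commP hr
    (E.contDiff_posComm hr j)))).const_smul Complex.I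

theorem equi_genFib (hH : C.IsUnperturbed H₀ h μF P) (j : Fin d) :
    C.Equi fun k => E.κ ∘L E.genFib hr j k := by
  have h1 := (E.equi_liou hr hH (E.equi_commP hr hH
    (E.equi_commP hr hH (E.equi_posComm hr hH j)))).smul Complex.I
  simp only [← ContinuousLinearMap.comp_smul] at h1
  exact h1

theorem Op_genFib (hH : C.IsUnperturbed H₀ h μF P) (hcr : C.IsContour H₀ μF c r) (j : Fin d) :
    C.Op (fun k => E.κ ∘L E.genFib hr j k) = C.genS H₀ P c r (C.Op (E.posComm hr j)) := by
  have hq := E.contDiff_posComm hr j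
  have hc : Continuous fun k => E.κ ∘L E.liou hr (E.commP hr (E.commP hr (E.posComm hr j))) k :=
    continuous_const.clm_comp
      (E.contDiff_liou hr (E.contDiff_commP hr (E.contDiff_commP hr hq))).continuous
  have h1 : (fun k => E.κ ∘L E.genFib hr j k) =
      fun k => Complex.I • (E.κ ∘L E.liou hr (E.commP hr (E.commP hr (E.posComm hr j))) k) := by
    funext k
    rw [← ContinuousLinearMap.comp_smul]; rfl
  rw [h1, C.Op_smul hc, genS, ← E.Op_commP hr hH hcr hq.continuous,
    E.invLiouvillian_Op hr hH hcr (E.contDiff_commP hr hq)]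

/-- The left factor `e^{-iε𝒮}`, as an operator in the domain of the Hamiltonian. -/
def leftExp (j : Fin d) (ε : ℝ) (k : Space d) : C.Fib →L[ℂ] C.Fib :=
  NormedSpace.exp ((-(Complex.I * ε)) • (E.genFib hr j k ∘L E.κ))

/-- The right factor `e^{iε𝒮}`. -/
def rightExp (j : Fin d) (ε : ℝ) (k : Space d) : C.Fib →L[ℂ] C.Fib :=
  NormedSpace.exp ((Complex.I * ε) • (E.κ ∘L E.genFib hr j k))

theorem contDiff_leftExp (j : Fin d) (ε : ℝ) : ContDiff ℝ ∞ (E.leftExp hr j ε) := by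
  have h1 : ContDiff ℝ ∞ fun k => E.genFib hr j k ∘L E.κ :=
    contDiff_comp (G := fun _ => E.κ) (E.contDiff_genFib hr j) contDiff_const
  exact contDiff_exp_comp (A := C.Fib →L[ℂ] C.Fib) (h1.const_smul (-(Complex.I * ε)))

theorem contDiff_rightExp (j : Fin d) (ε : ℝ) : ContDiff ℝ ∞ (E.rightExp hr j ε) := by
  have h1 : ContDiff ℝ ∞ fun k => E.κ ∘L E.genFib hr j k :=
    contDiff_comp (F := fun _ => E.κ) contDiff_const (E.contDiff_genFib hr j)
  exact contDiff_exp_comp (A := C.Fib →L[ℂ] C.Fib) (h1.const_smul (Complex.I * ε))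

/-- The exponential `e^{-iε𝒮}` maps the domain into itself: the fibre of `𝒮` factors as `κ a`, and
`exp(κ a) κ = κ exp(a κ)`. This allows the unbounded current to act on the perturbed state. -/
theorem κ_leftExp (j : Fin d) (ε : ℝ) (k : Space d) : E.κ ∘L E.leftExp hr j ε k =
    NormedSpace.exp ((-(Complex.I * ε)) • (E.κ ∘L E.genFib hr j k)) ∘L E.κ := by
  refine semiconjBy_exp (A := C.Fib →L[ℂ] C.Fib) ?_
  ext1 v
  exact map_smul E.κ (-(Complex.I * ε)) _

/-- The fibres of the non-equilibrium almost-stationary state. -/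
def neassFib (j : Fin d) (ε : ℝ) (k : Space d) : C.Fib →L[ℂ] C.Fib :=
  E.leftExp hr j ε k ∘L (E.pc hr k ∘L E.rightExp hr j ε k)

theorem contDiff_neassFib (j : Fin d) (ε : ℝ) : ContDiff ℝ ∞ (E.neassFib hr j ε) :=
  contDiff_comp (E.contDiff_leftExp hr j ε)
    (contDiff_comp (E.contDiff_pc hr) (E.contDiff_rightExp hr j ε))

theorem κ_neassFib (j : Fin d) (ε : ℝ) (k : Space d) : E.κ ∘L E.neassFib hr j ε k =
    NormedSpace.exp ((-(Complex.I * ε)) • (E.κ ∘L E.genFib hr j k)) ∘L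
      (E.p hr k ∘L E.rightExp hr j ε k) := by
  rw [neassFib, ← ContinuousLinearMap.comp_assoc, κ_leftExp]; rfl

theorem equi_neassFib (hH : C.IsUnperturbed H₀ h μF P) (j : Fin d) (ε : ℝ) :
    C.Equi fun k => E.κ ∘L E.neassFib hr j ε k := by
  simp_rw [κ_neassFib]
  exact ((E.equi_genFib hr hH j).smul (-(Complex.I * ε))).exp.comp
    ((E.equi_p hr hH).comp ((E.equi_genFib hr hH j).smul (Complex.I * ε)).exp)

theorem Op_neassFib (hH : C.IsUnperturbed H₀ h μF P) (hcr : C.IsContour H₀ μF c r) (j : Fin d)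
    (ε : ℝ) : C.Op (fun k => E.κ ∘L E.neassFib hr j ε k) =
      C.neass H₀ P c r (C.Op (E.posComm hr j)) ε := by
  have hg : Continuous fun k => E.κ ∘L E.genFib hr j k :=
    continuous_const.clm_comp (E.contDiff_genFib hr j).continuous
  have hp := (E.contDiff_p hr).continuous
  have hx : ∀ w : ℂ, Continuous fun k => w • (E.κ ∘L E.genFib hr j k) :=
    fun w => hg.const_smul w
  have he : ∀ w : ℂ, Continuous fun k => NormedSpace.exp (w • (E.κ ∘L E.genFib hr j k)) :=
    fun w => continuous_exp_comp (A := C.Fib →L[ℂ] C.Fib) (hx w)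
  have hR : Continuous (E.rightExp hr j ε) := he (Complex.I * ε)
  have hO : ∀ w : ℂ, C.Op (fun k => NormedSpace.exp (w • (E.κ ∘L E.genFib hr j k))) =
      NormedSpace.exp (w • C.genS H₀ P c r (C.Op (E.posComm hr j))) := fun w => by
    rw [C.Op_exp (hx w), C.Op_smul hg, E.Op_genFib hr hH hcr]
  have hOR : C.Op (E.rightExp hr j ε) = _ := hO (Complex.I * ε)
  simp_rw [κ_neassFib]
  rw [C.Op_mul (he _) (hp.clm_comp hR), C.Op_mul hp hR, E.Op_p hr hH hcr, hO, hOR]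
  rfl

theorem neass_zero (D : C.Hil →L[ℂ] C.Hil) : C.neass H₀ P c r D 0 = P := by
  rw [neass, Complex.ofReal_zero, mul_zero, neg_zero, zero_smul, NormedSpace.exp_zero]
  rfl

/-! ### The conventional current in the perturbed state -/

variable {E hr} in
theorem mem_graph_convCurrent_neass (hH : C.IsUnperturbed H₀ h μF P)
    (hcr : C.IsContour H₀ μF c r) (hs : C.IsSpin h s)
    {š : C.Fib →L[ℂ] C.Fib} (hš : ∀ v, E.κ (š v) = C.spinFib s (E.κ v)) (i j : Fin d) (ε : ℝ)
    {φ : C.Hil} {Φ : Space d → C.Fib} (hΦ : ContDiff ℝ ∞ Φ) (hz : C.IsZak φ Φ) :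
    (φ, C.Op (fun k => E.current š s i k ∘L E.neassFib hr j ε k) φ) ∈
      (prodOp (C.convCurrent H₀ h s i)
        (ofCLM (C.neass H₀ P c r (C.Op (E.posComm hr j)) ε))).graph := by
  have h1 := E.mem_graph_convCurrent hH hs hš (E.contDiff_neassFib hr j ε)
    (E.equi_neassFib hr hH j ε) hΦ hz i
  rw [E.Op_neassFib hr hH hcr] at h1
  exact mem_graph_prodOp.mpr ⟨_, mem_graph_ofCLM.mpr rfl, h1⟩

/-- Exhibits the form `x p y` that the trace bounds require. -/
theorem current_neassFib (hH : C.IsUnperturbed H₀ h μF P) (hcr : C.IsContour H₀ μF c r)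
    (š : C.Fib →L[ℂ] C.Fib) (s : Spin N →L[ℂ] Spin N) (i j : Fin d) (ε : ℝ) (k : Space d) :
    E.current š s i k ∘L E.neassFib hr j ε k =
      (E.current š s i k ∘L (E.leftExp hr j ε k ∘L E.pc hr k)) ∘L
        (E.p hr k ∘L E.rightExp hr j ε k) := by
  rw [neassFib, ← E.pc_comp_p hr hH hcr]
  simp only [ContinuousLinearMap.comp_assoc]
  rw [← ContinuousLinearMap.comp_assoc (E.p hr k) (E.p hr k), E.p_idem hr hH hcr]

theorem isLocTraceClass_current (hH : C.IsUnperturbed H₀ h μF P) (hcr : C.IsContour H₀ μF c r)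
    (š : C.Fib →L[ℂ] C.Fib) (s : Spin N →L[ℂ] Spin N) (i j : Fin d) (ε : ℝ) :
    C.IsLocTraceClass (C.Op fun k => E.current š s i k ∘L E.neassFib hr j ε k) := by
  simp_rw [E.current_neassFib hr hH hcr]
  exact E.isLocTraceClass_Op hr hH hcr ((E.continuous_current š s i).clm_comp
    ((E.contDiff_leftExp hr j ε).continuous.clm_comp (E.contDiff_pc hr).continuous))
    (E.contDiff_rightExp hr j ε).continuous

/-- In the form `x p y` the parameter `ε` enters only through exponentials in the Banach algebra of
continuous families, and the trace is a bounded bilinear form of `x` and `y`. -/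
theorem exists_hasDerivAt_current (hH : C.IsUnperturbed H₀ h μF P)
    (hcr : C.IsContour H₀ μF c r) (š : C.Fib →L[ℂ] C.Fib) (s : Spin N →L[ℂ] Spin N)
    (i j : Fin d) :
    ∃ t' : ℂ, HasDerivAt (fun ε : ℝ =>
      tr (C.cpr (C.Op fun k => E.current š s i k ∘L E.neassFib hr j ε k))) t' 0 := by
  have hcur := E.continuous_current š s i
  have hpc := (E.contDiff_pc hr).continuous
  have hg := (E.contDiff_genFib hr j).continuous
  have c1 : Continuous fun k => E.genFib hr j k ∘L E.κ := hg.clm_comp continuous_const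
  have c2 : Continuous fun k => E.κ ∘L E.genFib hr j k := continuous_const.clm_comp hg
  obtain ⟨t', ht'⟩ := exists_hasDerivAt_bilinear (A := CN C.zone (C.Fib →L[ℂ] C.Fib))
    (E.isBoundedBilinearMap_trace hr hH hcr)
    (C.toZone _ hcur) (C.toZone _ hpc) (C.toZone _ c1) (C.toZone _ c2)
  refine ⟨t', ht'.congr_of_eventuallyEq (Eventually.of_forall fun ε => ?_)⟩
  refine congrArg (fun T => tr (C.cpr T)) ?_
  have hx : Continuous fun k => E.current š s i k ∘L (E.leftExp hr j ε k ∘L E.pc hr k) :=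
    hcur.clm_comp ((E.contDiff_leftExp hr j ε).continuous.clm_comp hpc)
  have hy := (E.contDiff_rightExp hr j ε).continuous
  have hp := (E.contDiff_p hr).continuous
  set f : CN C.zone (C.Fib →L[ℂ] C.Fib) := C.toZone _ hcur *
    NormedSpace.exp ((-(Complex.I * ε)) • C.toZone _ c1) * C.toZone _ hpc
  set g : CN C.zone (C.Fib →L[ℂ] C.Fib) := NormedSpace.exp ((Complex.I * ε) • C.toZone _ c2)
  have hf : ∀ k : C.zone, f k = E.current š s i k ∘L (E.leftExp hr j ε k ∘L E.pc hr k) := by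
    intro k
    have h2 := exp_apply (A := C.Fib →L[ℂ] C.Fib) ((-(Complex.I * ε)) • C.toZone _ c1) k
    have h3 : f k = E.current š s i k ∘L
      (NormedSpace.exp ((-(Complex.I * ε)) • C.toZone _ c1) k ∘L E.pc hr k) := rfl
    rw [h3, h2]; rfl
  have hgk : ∀ k : C.zone, g k = E.rightExp hr j ε k := fun k =>
    exp_apply (A := C.Fib →L[ℂ] C.Fib) ((Complex.I * ε) • C.toZone _ c2) k
  have hfc : Continuous fun k => f (C.clamp k) := f.continuous.comp C.continuous_clamp
  have hgc : Continuous fun k => g (C.clamp k) := g.continuous.comp C.continuous_clamp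
  simp_rw [E.current_neassFib hr hH hcr]
  refine C.Op_congr (hx.clm_comp (hp.clm_comp hy)) (hfc.clm_comp (hp.clm_comp hgc)) fun k hk => ?_
  rw [hf, hgk, C.clamp_of_mem (C.brillouin_subset_zone hk)]

/-! ### The rotation current -/

/-- The fibres of `[H₀, S] Π₁`. -/
def rotFib (š : C.Fib →L[ℂ] C.Fib) (s : Spin N →L[ℂ] Spin N) (j : Fin d) (k : Space d) :
    C.Fib →L[ℂ] C.Fib :=
  E.commS š s k ∘L E.pertFib hr j k

theorem contDiff_rotFib (š : C.Fib →L[ℂ] C.Fib) (s : Spin N →L[ℂ] Spin N) (j : Fin d) :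
    ContDiff ℝ ∞ (E.rotFib hr š s j) :=
  contDiff_comp (E.contDiff_commS š s) (E.contDiff_pertFib hr j)

/-- `liou_commP` splits `[H₀, S] Π₁` into two terms of the form `x p y`: one has `p` on the right,
the other has `pc ∘ p` on the left of the remaining contour integral. -/
theorem isLocTraceClass_rotFib (hH : C.IsUnperturbed H₀ h μF P) (hcr : C.IsContour H₀ μF c r)
    (š : C.Fib →L[ℂ] C.Fib) (s : Spin N →L[ℂ] Spin N) (j : Fin d) :
    C.IsLocTraceClass (C.Op (E.rotFib hr š s j)) := by
  have hS := E.continuous_commS š s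
  have hW := (E.contDiff_liou hr (E.contDiff_posComm hr j)).continuous
  have hp := (E.contDiff_p hr).continuous
  have hpc := (E.contDiff_pc hr).continuous
  set W := E.liou hr (E.posComm hr j)
  have x1 : Continuous fun k => E.commS š s k ∘L W k := hS.clm_comp hW
  have y1 : Continuous fun _ : Space d => ContinuousLinearMap.id ℂ C.Fib := continuous_const
  have x2 : Continuous fun k => -(E.commS š s k ∘L E.pc hr k) := (hS.clm_comp hpc).neg
  have y2 : Continuous fun k => E.κ ∘L W k := continuous_const.clm_comp hW
  have h1 : E.rotFib hr š s j = fun k =>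
      (E.commS š s k ∘L W k) ∘L (E.p hr k ∘L ContinuousLinearMap.id ℂ C.Fib) +
      (-(E.commS š s k ∘L E.pc hr k)) ∘L (E.p hr k ∘L (E.κ ∘L W k)) := by
    funext k
    rw [rotFib, pertFib, E.liou_commP hr, ContinuousLinearMap.comp_sub, ContinuousLinearMap.neg_comp,
      sub_eq_add_neg, ContinuousLinearMap.comp_id]
    nth_rewrite 1 [← E.pc_comp_p hr hH hcr]
    simp only [ContinuousLinearMap.comp_assoc]
    rfl
  rw [h1, C.Op_add (x1.clm_comp (hp.clm_comp y1)) (x2.clm_comp (hp.clm_comp y2))]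
  exact (E.isLocTraceClass_Op hr hH hcr x1 y1).add (E.isLocTraceClass_Op hr hH hcr x2 y2)

variable {E} in
theorem mem_graph_rot (hH : C.IsUnperturbed H₀ h μF P) (hcr : C.IsContour H₀ μF c r)
    (hs : C.IsSpin h s) {š : C.Fib →L[ℂ] C.Fib} (hš : ∀ v, E.κ (š v) = C.spinFib s (E.κ v))
    (j : Fin d) (φ : C.Hil) :
    (φ, C.Op (E.rotFib hr š s j) φ) ∈ (prodOp (commOp H₀ (ofCLM (spinOp C.mu s)))
      (ofCLM (C.pi1 H₀ P c r (C.Op (E.posComm hr j))))).graph := by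
  have h1 := E.mem_graph_commOp_S hH hs hš (E.contDiff_pertFib hr j).continuous φ
  rw [E.Op_pertFib hr hH hcr] at h1
  exact mem_graph_prodOp.mpr ⟨_, mem_graph_ofCLM.mpr rfl, h1⟩

variable {E} in
-- The fibres of `[H₀, S] Π₁` are smooth, so it maps vectors with smooth transform to such vectors,
-- and these lie in the domain of the position operators.
theorem exists_mem_graph_X_rot (hH : C.IsUnperturbed H₀ h μF P)
    {š : C.Fib →L[ℂ] C.Fib} (hš : ∀ v, E.κ (š v) = C.spinFib s (E.κ v))
    (i j : Fin d) {φ : C.Hil} {Φ : Space d → C.Fib} (hΦ : ContDiff ℝ ∞ Φ) (hz : C.IsZak φ Φ) :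
    ∃ ψ, (C.Op (E.rotFib hr š s j) φ, ψ) ∈ (C.X i).graph := by
  have hF := E.contDiff_rotFib hr š s j
  have hE : C.Equi (E.rotFib hr š s j) := E.equi_commS hH hš (E.equi_pertFib hr hH j)
  have h2 := hz.op hF.continuous hE
  obtain ⟨ψ, hψ, -⟩ := h2.mem_graph_X (contDiff_apply hF hΦ) i
  exact ⟨ψ, hψ⟩

end FibreResolvent

end Crystal
end UCC

end

/-! ### Lattice points in the cells of a basis. -/

noncomputable section

namespace UCC

/-! ### Counting lattice points in cells -/

section Cells

variable {d : ℕ} (b : Module.Basis (Fin d) ℝ (Space d))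

/-- Twice the opposite of the coordinates of the centre of the set of the lattice vectors that
translate `x` into a cell. -/
def cellShift (x : Space d) (l : Fin d) : ℤ := ⌊b.repr x l + 1 / 2⌋ + ⌈b.repr x l - 1 / 2⌉

/-- The integer vectors that translate `x` into the cell `C_{2q+1}`. -/
def cellBox (q : ℕ) (x : Space d) : Finset (Fin d → ℤ) :=
  Fintype.piFinset fun l => Finset.Icc (-(q : ℤ) - ⌊b.repr x l + 1 / 2⌋) (q - ⌈b.repr x l - 1 / 2⌉)

/-- The cell of odd side `2q + 1` has half-side `q + 1/2`; the integer `q` can be taken out of the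
floor and the ceiling, which then no longer depend on `q`. -/
theorem mem_cellBox {q : ℕ} {x : Space d} {n : Fin d → ℤ} :
    n ∈ cellBox b q x ↔ x + latEquiv b n ∈ cell b (2 * q + 1) := by
  rw [cellBox, Fintype.mem_piFinset]
  refine forall_congr' fun l => ?_
  rw [map_add, Finsupp.add_apply, repr_latEquiv, abs_le, Finset.mem_Icc]
  push_cast
  refine and_congr ?_ ?_
  · rw [sub_le_iff_le_add', ← sub_le_iff_le_add, Int.le_floor]
    push_cast
    constructor <;> intro h <;> linarith
  · rw [le_sub_iff_add_le, ← le_sub_iff_add_le', Int.ceil_le]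
    push_cast
    constructor <;> intro h <;> linarith

theorem ceil_le_floor (y : ℝ) : ⌈y - 1 / 2⌉ ≤ ⌊y + 1 / 2⌋ := by
  rw [Int.le_floor]
  have := Int.ceil_lt_add_one (y - 1 / 2)
  linarith

theorem floor_le_ceil_add_one (y : ℝ) : ⌊y + 1 / 2⌋ ≤ ⌈y - 1 / 2⌉ + 1 := by
  have h1 := Int.floor_le (y + 1 / 2)
  have h2 := Int.le_ceil (y - 1 / 2)
  have : ((⌊y + 1 / 2⌋ : ℤ) : ℝ) ≤ ((⌈y - 1 / 2⌉ + 1 : ℤ) : ℝ) := by push_cast; linarith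
  exact_mod_cast this

/-- Each coordinate admits `2q + 1` integers, or `2q + 2` when a translate of `x` falls on the
boundary of the closed cell. -/
theorem pow_le_card_cellBox (q : ℕ) (x : Space d) : (2 * q + 1) ^ d ≤ (cellBox b q x).card := by
  rw [cellBox, Fintype.card_piFinset]
  refine le_trans (le_of_eq ?_) (Finset.prod_le_prod' fun l _ =>
    (?_ : 2 * q + 1 ≤ (Finset.Icc (-(q : ℤ) - ⌊b.repr x l + 1 / 2⌋)
      (q - ⌈b.repr x l - 1 / 2⌉)).card))
  · simp
  · rw [Int.card_Icc]
    have := ceil_le_floor (b.repr x l)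
    omega

theorem card_cellBox_le (q : ℕ) (x : Space d) : (cellBox b q x).card ≤ (2 * q + 2) ^ d := by
  rw [cellBox, Fintype.card_piFinset]
  refine le_trans (Finset.prod_le_prod' fun l _ =>
    (?_ : (Finset.Icc (-(q : ℤ) - ⌊b.repr x l + 1 / 2⌋)
      (q - ⌈b.repr x l - 1 / 2⌉)).card ≤ 2 * q + 2)) (le_of_eq ?_)
  · rw [Int.card_Icc]
    have := floor_le_ceil_add_one (b.repr x l)
    omega
  · simp

theorem cellBox_symm {q : ℕ} {x : Space d} {n : Fin d → ℤ} (hn : n ∈ cellBox b q x) :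
    -cellShift b x - n ∈ cellBox b q x := by
  rw [cellBox, Fintype.mem_piFinset] at hn ⊢
  intro l
  have := Finset.mem_Icc.mp (hn l)
  rw [Finset.mem_Icc, Pi.sub_apply, Pi.neg_apply, cellShift]
  constructor <;> linarith [this.1, this.2]

/-- The box is mapped to itself by the reflection `n ↦ -cellShift - n`, so the mean of the
coordinate is its fixed value `-cellShift / 2`. -/
theorem sum_cellBox_coord (q : ℕ) (x : Space d) (l : Fin d) :
    (∑ n ∈ cellBox b q x, (n l : ℝ)) = -((cellBox b q x).card * (cellShift b x l : ℝ) / 2) := by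
  have h1 : (∑ n ∈ cellBox b q x, (n l : ℝ)) =
      ∑ n ∈ cellBox b q x, (((-cellShift b x - n) l : ℤ) : ℝ) := by
    refine Finset.sum_nbij' (fun n => -cellShift b x - n) (fun n => -cellShift b x - n)
      (fun n hn => cellBox_symm b hn) (fun n hn => cellBox_symm b hn) ?_ ?_ ?_
    · intro n _; abel
    · intro n _; abel
    · intro n _; rw [sub_sub_cancel]
  have h2 : (∑ n ∈ cellBox b q x, (((-cellShift b x - n) l : ℤ) : ℝ)) =
      -((cellBox b q x).card * (cellShift b x l : ℝ)) - ∑ n ∈ cellBox b q x, (n l : ℝ) := by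
    simp only [Pi.sub_apply, Pi.neg_apply, Int.cast_sub, Int.cast_neg, Finset.sum_sub_distrib,
      Finset.sum_const, nsmul_eq_mul, mul_neg]
  linarith

/-- The average position of the translates of `x` in a cell. -/
def cellMean (x : Space d) : Space d := x - (1 / 2 : ℝ) • ∑ l, (cellShift b x l : ℝ) • b l

/-- The mean of the translates of `x` in the cell is the same for all odd sides. Hence the trace of
a position dependent operator grows only like the volume, although the position itself is unbounded.
-/
theorem sum_cellBox_add (q : ℕ) (x : Space d) :
    ∑ n ∈ cellBox b q x, (x + latEquiv b n) = ((cellBox b q x).card : ℝ) • cellMean b x := by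
  rw [Finset.sum_add_distrib, Finset.sum_const, cellMean, smul_sub]
  simp_rw [latEquiv_apply]
  rw [Finset.sum_comm]
  simp_rw [← Finset.sum_smul, sum_cellBox_coord]
  rw [smul_smul, Finset.smul_sum, sub_eq_add_neg, ← Finset.sum_neg_distrib, Nat.cast_smul_eq_nsmul]
  congr 1
  refine Finset.sum_congr rfl fun l _ => ?_
  rw [smul_smul, ← neg_smul]
  congr 1
  ring

theorem cellMean_mem_cell (x : Space d) : cellMean b x ∈ cell b 1 := by
  intro l
  have h1 : b.repr (cellMean b x) l = b.repr x l - 1 / 2 * (cellShift b x l : ℝ) := by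
    rw [cellMean, map_sub, map_smul, Finsupp.sub_apply, Finsupp.smul_apply, b.repr_sum_self,
      smul_eq_mul]
  rw [h1, cellShift, abs_le]
  have h2 := Int.floor_le (b.repr x l + 1 / 2)
  have h3 := Int.le_ceil (b.repr x l - 1 / 2)
  have h4 := Int.lt_floor_add_one (b.repr x l + 1 / 2)
  have h5 := Int.ceil_lt_add_one (b.repr x l - 1 / 2)
  push_cast
  constructor <;> linarith

/-- Translating `x` by a lattice vector permutes its translates; in coordinates, `cellShift` changes
by `2n`. -/
theorem cellMean_add_latEquiv (x : Space d) (n : Fin d → ℤ) :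
    cellMean b (x + latEquiv b n) = cellMean b x := by
  have h1 : ∀ l, cellShift b (x + latEquiv b n) l = cellShift b x l + 2 * n l := by
    intro l
    rw [cellShift, cellShift, map_add, Finsupp.add_apply, repr_latEquiv,
      show b.repr x l + n l + 1 / 2 = b.repr x l + 1 / 2 + n l by ring,
      show b.repr x l + n l - 1 / 2 = b.repr x l - 1 / 2 + n l by ring, Int.floor_add_intCast,
      Int.ceil_add_intCast]
    ring
  rw [cellMean, cellMean]
  simp_rw [h1]
  push_cast
  simp_rw [add_smul, Finset.sum_add_distrib, mul_smul, ← Finset.smul_sum, ← latEquiv_apply,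
    smul_add, smul_smul]
  norm_num

theorem continuous_repr (l : Fin d) : Continuous fun x : Space d => b.repr x l :=
  (LinearMap.continuous_of_finiteDimensional (b.coord l))

theorem measurable_cellShift (l : Fin d) : Measurable fun x : Space d => cellShift b x l := by
  have h := (continuous_repr b l).measurable
  exact (Int.measurable_floor.comp (h.add_const _)).add (Int.measurable_ceil.comp (h.sub_const _))

theorem measurable_cellMean : Measurable (cellMean b) := by
  have h0 : Measurable fun x : Space d => ∑ l, (cellShift b x l : ℝ) • b l := by
    refine Finset.measurable_fun_sum _ fun l _ => ?_
    have h1 : Measurable fun x : Space d => ((cellShift b x l : ℤ) : ℝ) :=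
      (measurable_from_top (f := fun n : ℤ => (n : ℝ))).comp (measurable_cellShift b l)
    exact h1.smul_const (b l)
  exact measurable_id.sub (h0.const_smul (1 / 2 : ℝ))

theorem isClosed_cell (L : ℕ) : IsClosed (cell b L) := by
  have h : cell b L = ⋂ l, {x | |b.repr x l| ≤ (L : ℝ) / 2} := by
    ext x; simp [cell]
  rw [h]
  exact isClosed_iInter fun l => isClosed_le (continuous_repr b l).abs continuous_const

theorem isBounded_cell (L : ℕ) : Bornology.IsBounded (cell b L) := by
  refine isBounded_iff_forall_norm_le.mpr ⟨∑ l, (L : ℝ) / 2 * ‖b l‖, fun x hx => ?_⟩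
  rw [← b.sum_repr x]
  refine norm_sum_le_of_le _ fun l _ => ?_
  rw [norm_smul, Real.norm_eq_abs]
  gcongr
  exact hx l

theorem exists_norm_cellMean_le : ∃ R : ℝ, ∀ x, ‖cellMean b x‖ ≤ R := by
  obtain ⟨R, hR⟩ := isBounded_iff_forall_norm_le.mp (isBounded_cell b 1)
  exact ⟨R, fun x => hR _ (cellMean_mem_cell b x)⟩

end Cells

namespace Crystal
variable {d N : ℕ} {C : Crystal d N} {b : Module.Basis (Fin d) ℝ (Space d)}

/-- The integer coordinates of the lattice vectors, in a basis of the lattice. -/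
def latIdx (hb : lattice b = C.Lat) : (Fin d → ℤ) ≃ C.Lat :=
  (latEquiv b).trans (Equiv.setCongr (congrArg SetLike.coe hb))

theorem latIdx_coe (hb : lattice b = C.Lat) (n : Fin d → ℤ) :
    ((latIdx hb n : C.Lat) : Space d) = latEquiv b n := rfl

theorem sum_cell_eq (hb : lattice b = C.Lat) {E : Type*} [AddCommMonoid E] {q : ℕ} {x : Space d}
    {s : Finset C.Lat} (hs : ∀ γ : C.Lat, x + γ ∈ cell b (2 * q + 1) → γ ∈ s)
    {f : C.Lat → E} (hf : ∀ γ : C.Lat, x + γ ∉ cell b (2 * q + 1) → f γ = 0) :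
    ∑ γ ∈ s, f γ = ∑ n ∈ cellBox b q x, f (latIdx hb n) := by
  classical
  refine Eq.trans ?_ (Finset.sum_map (cellBox b q x) (latIdx hb).toEmbedding f)
  symm
  refine Finset.sum_subset ?_ ?_
  · intro γ hγ
    obtain ⟨n, hn, rfl⟩ := Finset.mem_map.mp hγ
    exact hs _ ((mem_cellBox b).mp hn)
  · intro γ _ hγ
    refine hf γ fun hc => hγ ?_
    obtain ⟨n, rfl⟩ := (latIdx hb).surjective γ
    exact Finset.mem_map.mpr ⟨n, (mem_cellBox b).mpr hc, rfl⟩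

theorem cellMean_add (hb : lattice b = C.Lat) (x : Space d) (γ : C.Lat) :
    cellMean b (x + γ) = cellMean b x := by
  obtain ⟨n, rfl⟩ := (latIdx hb).surjective γ
  exact cellMean_add_latEquiv b x n

end Crystal
end UCC

end

/-! ### The trace per unit volume as a trace over the fundamental domain. -/

noncomputable section

namespace UCC

theorem coe_of_mem_graph_mulOp {d N : ℕ} {ν : Measure (Space d)} {g : Space d → ℂ} {ψ φ : L2 N ν}
    (h : (ψ, φ) ∈ (mulOp N ν g).graph) : ∀ᵐ x ∂ν, φ x = g x • ψ x := by
  obtain ⟨hd, rfl⟩ := exists_apply_of_mem_graph h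
  exact mulFun_coe g ⟨ψ, hd⟩

theorem tendsto_pow_ratio (d : ℕ) :
    Tendsto (fun L : ℕ => (((L : ℝ) + 1) ^ d - (L : ℝ) ^ d) / (L : ℝ) ^ d) atTop (𝓝 0) := by
  have h1 : Tendsto (fun L : ℕ => (1 + 1 / (L : ℝ)) ^ d - 1) atTop (𝓝 ((1 + 0) ^ d - 1)) :=
    ((tendsto_const_nhds.add (tendsto_one_div_atTop_nhds_zero_nat (𝕜 := ℝ))).pow d).sub_const 1
  rw [add_zero, one_pow, sub_self] at h1
  refine h1.congr' ?_
  filter_upwards [eventually_gt_atTop 0] with L hL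
  have hL' : (L : ℝ) ≠ 0 := by positivity
  rw [sub_div, ← div_pow, div_self (pow_ne_zero d hL'), add_div, div_self hL']

/-- Numerator and denominator are both `L^d` times a constant up to the boundary error `(L + 1)^d -
L^d`, which is negligible against `L^d`. -/
theorem tendsto_ratio {l : Filter ℕ} (hl : l ≤ atTop) {d : ℕ} {T M : ℕ → ℂ} {t m : ℂ} {K K' : ℝ}
    (hT : ∀ᶠ L : ℕ in l, ‖T L - (L : ℂ) ^ d * t‖ ≤ K * (((L : ℝ) + 1) ^ d - (L : ℝ) ^ d))
    (hM : ∀ᶠ L : ℕ in l, ‖M L - (L : ℂ) ^ d * m‖ ≤ K' * (((L : ℝ) + 1) ^ d - (L : ℝ) ^ d))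
    (hm : m ≠ 0) : Tendsto (fun L => T L / M L) l (𝓝 (t / m)) := by
  have key : ∀ {T : ℕ → ℂ} {t : ℂ} {K : ℝ},
      (∀ᶠ L : ℕ in l, ‖T L - (L : ℂ) ^ d * t‖ ≤ K * (((L : ℝ) + 1) ^ d - (L : ℝ) ^ d)) →
      Tendsto (fun L : ℕ => T L / (L : ℂ) ^ d) l (𝓝 t) := by
    intro T t K hT
    rw [tendsto_iff_norm_sub_tendsto_zero]
    have h0 := ((tendsto_pow_ratio d).const_mul K).mono_left hl
    rw [mul_zero] at h0
    refine squeeze_zero' (Eventually.of_forall fun L => norm_nonneg _) ?_ h0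
    filter_upwards [hT, hl (eventually_gt_atTop 0)] with L h1 hL
    have hL' : (L : ℂ) ^ d ≠ 0 := pow_ne_zero d (by exact_mod_cast hL.ne')
    have h2 : T L / (L : ℂ) ^ d - t = (T L - (L : ℂ) ^ d * t) / (L : ℂ) ^ d := by
      field_simp
    rw [h2, norm_div, norm_pow, Complex.norm_natCast, ← mul_div_assoc]
    gcongr
  refine ((key hT).div (key hM) hm).congr' ?_
  filter_upwards [hl (eventually_gt_atTop 0)] with L hL
  have hL' : (L : ℂ) ^ d ≠ 0 := pow_ne_zero d (by exact_mod_cast hL.ne')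
  exact div_div_div_cancel_right₀ hL' _ _

theorem measurable_card_cellBox {d : ℕ} (b : Module.Basis (Fin d) ℝ (Space d)) (q : ℕ) :
    Measurable fun x => (cellBox b q x).card := by
  have h1 : (fun x => (cellBox b q x).card) = fun x => ∏ l,
      ((q - ⌈b.repr x l - 1 / 2⌉) + 1 - (-(q : ℤ) - ⌊b.repr x l + 1 / 2⌋)).toNat := by
    funext x
    rw [cellBox, Fintype.card_piFinset]
    exact Finset.prod_congr rfl fun l _ => Int.card_Icc _ _
  rw [h1]
  refine Finset.measurable_fun_prod _ fun l _ => ?_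
  have h := (continuous_repr b l).measurable
  refine (measurable_from_top (f := Int.toNat)).comp ?_
  have ha : Measurable fun x => ⌊b.repr x l + 1 / 2⌋ := Int.measurable_floor.comp (h.add_const _)
  have hb : Measurable fun x => ⌈b.repr x l - 1 / 2⌉ := Int.measurable_ceil.comp (h.sub_const _)
  exact ((measurable_const.sub hb).add_const 1).sub (measurable_const.sub ha)

namespace Crystal
variable {d N : ℕ} {C : Crystal d N} {b : Module.Basis (Fin d) ℝ (Space d)}

/-! ### Traces per unit volume -/

theorem measure_eq_sum {Ω : Set (Space d)} (hΩ : MeasurableSet Ω) {s : Finset C.Lat}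
    (hs : ∀ γ : C.Lat, ∀ x ∈ C.fund, x + γ ∈ Ω → γ ∈ s) :
    C.mu Ω = ∫⁻ x in C.fund, ∑ γ ∈ s, Ω.indicator (fun _ => 1) (x + (γ : Space d)) ∂C.mu := by
  have hm : ∀ γ : C.Lat, MeasurableSet {x | x + (γ : Space d) ∈ Ω} := fun γ =>
    (measurable_add_const (γ : Space d)) hΩ
  have hE : ∀ γ : C.Lat, MeasurableSet (C.fund ∩ {x | x + (γ : Space d) ∈ Ω}) := fun γ =>
    C.measurableSet_fund.inter (hm γ)
  set G : C.Lat → Set (Space d) := fun γ => Ω ∩ {x | x - (γ : Space d) ∈ C.fund}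
  have hG : ∀ γ : C.Lat, G γ = (fun x => x - (γ : Space d)) ⁻¹' (C.fund ∩ {x | x + (γ : Space d) ∈ Ω}) := by
    intro γ; ext x; simp [G, and_comm]
  have hΩG : Ω = ⋃ γ ∈ s, G γ := by
    ext x
    simp only [Set.mem_iUnion]
    constructor
    · intro hx
      obtain ⟨γ, hγ, -⟩ := C.exists_unique_sub_mem x
      exact ⟨γ, hs γ _ hγ (by simpa using hx), hx, hγ⟩
    · rintro ⟨γ, -, hx, -⟩; exact hx
  have hdisj : Set.PairwiseDisjoint (s : Set C.Lat) G := by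
    intro γ _ γ' _ hne
    rw [Function.onFun, Set.disjoint_left]
    rintro x ⟨-, h1⟩ ⟨-, h2⟩
    exact hne (C.eq_of_sub_mem h1 h2)
  rw [lintegral_finsetSum]
  · conv_lhs => rw [hΩG]
    rw [measure_biUnion_finset hdisj]
    · refine Finset.sum_congr rfl fun γ _ => ?_
      rw [hG, (C.measurePreserving_translate γ).measure_preimage (hE γ).nullMeasurableSet]
      have : (fun x => Ω.indicator (fun _ => (1 : ℝ≥0∞)) (x + (γ : Space d))) =
          {x | x + (γ : Space d) ∈ Ω}.indicator fun _ => 1 := by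
        funext x; rfl
      rw [this, lintegral_indicator_const (hm γ), one_mul, Measure.restrict_apply (hm γ),
        Set.inter_comm]
    · intro γ _
      rw [hG]
      exact (measurable_sub_const (γ : Space d)) (hE γ)
  · intro γ _
    exact (measurable_const.indicator hΩ).comp (measurable_add_const (γ : Space d))

theorem sum_cell_indicator (hb : lattice b = C.Lat) {R : Type*} [NonAssocSemiring R] {q : ℕ} {x : Space d}
    {s : Finset C.Lat} (hs : ∀ γ : C.Lat, x + γ ∈ cell b (2 * q + 1) → γ ∈ s) (f : Space d → R) :
    ∑ γ ∈ s, (cell b (2 * q + 1)).indicator (fun _ => 1) (x + (γ : Space d)) * f (x + (γ : Space d)) =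
      ∑ n ∈ cellBox b q x, f (x + latEquiv b n) := by
  rw [sum_cell_eq hb hs fun γ hγ => by rw [Set.indicator_of_notMem hγ, zero_mul]]
  refine Finset.sum_congr rfl fun n hn => ?_
  rw [latIdx_coe, Set.indicator_of_mem ((mem_cellBox b).mp hn), one_mul]

/-- The volume of the cell is the integral over the fundamental domain of the number of translates
of `x` in the cell, which lies between `L^d` and `(L + 1)^d`. -/
theorem norm_measure_cell_sub_le (hb : lattice b = C.Lat) (q : ℕ) :
    ‖((C.mu (cell b (2 * q + 1))).toReal : ℂ) -
      ((2 * q + 1 : ℕ) : ℂ) ^ d * ((C.mu C.fund).toReal : ℂ)‖ ≤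
      (C.mu C.fund).toReal * ((((2 * q + 1 : ℕ) : ℝ) + 1) ^ d - ((2 * q + 1 : ℕ) : ℝ) ^ d) := by
  have hΩ := (isClosed_cell b (2 * q + 1)).measurableSet
  obtain ⟨s, hs⟩ := C.exists_finset_cover (isBounded_cell b (2 * q + 1))
  have h1 : C.mu (cell b (2 * q + 1)) = ∫⁻ x in C.fund, ((cellBox b q x).card : ℝ≥0∞) ∂C.mu := by
    rw [measure_eq_sum hΩ hs]
    refine setLIntegral_congr_fun C.measurableSet_fund fun x hx => ?_
    have := sum_cell_indicator hb (R := ℝ≥0∞) (fun γ => hs γ x hx) fun _ => 1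
    simp only [mul_one] at this
    simp only [this, Finset.sum_const, nsmul_eq_mul, mul_one]
  have hfin := C.mu_lt_top (isBounded_cell b (2 * q + 1))
  have hm := C.mu_lt_top C.isBounded_fund
  have hlo : (((2 * q + 1) ^ d : ℕ) : ℝ≥0∞) * C.mu C.fund ≤ C.mu (cell b (2 * q + 1)) := by
    rw [h1, ← setLIntegral_const]
    exact lintegral_mono fun x => Nat.cast_le.mpr (pow_le_card_cellBox b q x)
  have hhi : C.mu (cell b (2 * q + 1)) ≤ (((2 * q + 2) ^ d : ℕ) : ℝ≥0∞) * C.mu C.fund := by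
    rw [h1, ← setLIntegral_const]
    exact lintegral_mono fun x => Nat.cast_le.mpr (card_cellBox_le b q x)
  have hlo' := (ENNReal.toReal_le_toReal (ENNReal.mul_ne_top (ENNReal.natCast_ne_top _) hm.ne) hfin.ne).mpr hlo
  have hhi' := (ENNReal.toReal_le_toReal hfin.ne (ENNReal.mul_ne_top (ENNReal.natCast_ne_top _) hm.ne)).mpr hhi
  rw [ENNReal.toReal_mul, ENNReal.toReal_natCast] at hlo' hhi'
  have e : ((C.mu (cell b (2 * q + 1))).toReal : ℂ) -
      ((2 * q + 1 : ℕ) : ℂ) ^ d * ((C.mu C.fund).toReal : ℂ) =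
      (((C.mu (cell b (2 * q + 1))).toReal - ((2 * q + 1 : ℕ) : ℝ) ^ d * (C.mu C.fund).toReal : ℝ) : ℂ) := by
    push_cast; ring
  rw [e, Complex.norm_real, Real.norm_eq_abs, abs_le]
  push_cast at hlo' hhi' ⊢
  have e2 : (2 * (q : ℝ) + 1 + 1) = 2 * q + 2 := by ring
  rw [e2]
  have hpow : (2 * (q : ℝ) + 1) ^ d ≤ (2 * q + 2) ^ d := by gcongr; norm_num
  have hm0 : 0 ≤ (C.mu C.fund).toReal := ENNReal.toReal_nonneg
  constructor
  · nlinarith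
  · nlinarith

/-- The trace per unit volume of `g A`, for a periodic and locally trace class operator `A` and a
weight `g` whose means over the cells are given by a bounded function `g'`. -/
theorem IsLocTraceClass.hasTau (hb : lattice b = C.Lat) {A : C.Hil →L[ℂ] C.Hil}
    (hA : C.IsLocTraceClass A) {A' : C.Hil →ₗ.[ℂ] C.Hil} {g g' : Space d → ℂ} (hg : Continuous g)
    (hg' : Measurable g') {R : ℝ} (hR : ∀ x, ‖g' x‖ ≤ R)
    (hmean : ∀ q x, ∑ n ∈ cellBox b q x, g (x + latEquiv b n) = (cellBox b q x).card * g' x)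
    (hA' : ∀ Ω : Set (Space d), MeasurableSet Ω → Bornology.IsBounded Ω → ∀ ψ : C.Hil, ∃ φ : C.Hil,
      (mulB (Spin N) C.mu (ind Ω) ψ, φ) ∈ A'.graph ∧
        ∀ᵐ x ∂C.mu, φ x = g x • A (mulB (Spin N) C.mu (ind Ω) ψ) x) :
    C.HasTau b A' (tr (C.cpr A ∘L mulB (Spin N) (C.mu.restrict C.fund) g') /
      ((C.mu C.fund).toReal : ℂ)) := by
  set w : Set (Space d) → Space d → ℂ := fun Ω x => Ω.indicator (fun _ => 1) x * g x
  have hw : ∀ {Ω}, MeasurableSet Ω → Bornology.IsBounded Ω → MemLp (w Ω) ⊤ C.mu := by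
    intro Ω hΩ hΩb
    obtain ⟨K, hK⟩ := hΩb.isCompact_closure.exists_bound_of_continuousOn hg.continuousOn
    refine memLp_top_of_bound
      ((measurable_const.indicator hΩ).mul hg.measurable).aestronglyMeasurable (max K 0)
      (Eventually.of_forall fun x => ?_)
    by_cases hx : x ∈ Ω
    · simp only [w, Set.indicator_of_mem hx, one_mul]
      exact (hK x (subset_closure hx)).trans (le_max_left _ _)
    · simp only [w, Set.indicator_of_notMem hx, zero_mul, norm_zero]
      exact le_max_right _ _
  have hw0 : ∀ {Ω : Set (Space d)}, ∀ x ∉ Ω, w Ω x = 0 := fun {Ω} x hx => by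
    simp only [w, Set.indicator_of_notMem hx, zero_mul]
  -- Only the vectors `χ_Ω ψ` are fed to `A'`, and the outer `χ_Ω` makes the weight bounded; so the
  -- compression is an everywhere defined bounded operator.
  have hcomp : ∀ {Ω}, MeasurableSet Ω → Bornology.IsBounded Ω →
      prodOp (chi N C.mu Ω) (prodOp A' (chi N C.mu Ω)) =
        ofCLM (mulB (Spin N) C.mu (w Ω) ∘L A ∘L mulB (Spin N) C.mu (ind Ω)) := by
    intro Ω hΩ hΩb
    refine eq_ofCLM fun ψ => ?_
    obtain ⟨φ, h1, h2⟩ := hA' Ω hΩ hΩb ψ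
    rw [C.chi_eq hΩ]
    refine mem_graph_prodOp.mpr ⟨φ, mem_graph_prodOp.mpr ⟨_, mem_graph_ofCLM.mpr rfl, h1⟩,
      mem_graph_ofCLM.mpr ?_⟩
    refine mulB_eq_of_ae (memLp_ind hΩ) ?_
    filter_upwards [h2, mulB_coe (hw hΩ hΩb) (A (mulB (Spin N) C.mu (ind Ω) ψ))] with x h3 h4
    rw [h3, smul_smul]
    exact h4
  refine ⟨fun K hK => ?_, ?_⟩
  · obtain ⟨s, hs⟩ := C.exists_finset_cover hK.isBounded
    exact ⟨_, hcomp hK.measurableSet hK.isBounded,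
      (hA.trace_weighted hK.measurableSet hs (hw hK.measurableSet hK.isBounded) hw0).1⟩
  · have hcm := fun L => (isClosed_cell b L).measurableSet
    have hcb := isBounded_cell b
    refine ⟨fun L => tr (mulB (Spin N) C.mu (w (cell b L)) ∘L A ∘L
      mulB (Spin N) C.mu (ind (cell b L))), fun L _ => ?_, ?_⟩
    · obtain ⟨s, hs⟩ := C.exists_finset_cover (hcb L)
      rw [hcomp (hcm L) (hcb L)]
      exact (hA.trace_weighted (hcm L) hs (hw (hcm L) (hcb L)) hw0).1.hasTrace
    · obtain ⟨K, hK⟩ := hA.traceClass_cpr.exists_norm_tr_le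
      have hK0 : 0 ≤ K * ‖ContinuousLinearMap.id ℂ C.Fib‖ := (norm_nonneg _).trans (hK _)
      have hR0 : 0 ≤ R := (norm_nonneg _).trans (hR 0)
      refine tendsto_ratio (d := d) (K := max K 0 * R) (K' := (C.mu C.fund).toReal) inf_le_left ?_ ?_ ?_
      · refine Filter.mem_inf_of_right fun L hL => ?_
        obtain ⟨q, rfl⟩ : ∃ q, L = 2 * q + 1 := hL
        obtain ⟨s, hs⟩ := C.exists_finset_cover (hcb (2 * q + 1))
        simp only [Set.mem_ofPred_eq]
        rw [(hA.trace_weighted (hcm _) hs (hw (hcm _) (hcb _)) hw0).2]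
        -- Summed over the lattice, the weight is the number of translates in the cell times their
        -- mean `g'`.
        have h1 : mulB (Spin N) (C.mu.restrict C.fund)
            (fun x => ∑ γ ∈ s, w (cell b (2 * q + 1)) (x + (γ : Space d))) =
            mulB (Spin N) (C.mu.restrict C.fund) fun x => ((cellBox b q x).card : ℂ) * g' x := by
          refine mulB_congr ?_
          filter_upwards [ae_restrict_mem C.measurableSet_fund] with x hx
          rw [← hmean]
          exact sum_cell_indicator hb (fun γ => hs γ x hx) g
        set D : ℂ := ((2 * q + 1 : ℕ) : ℂ) ^ d
        set e : ℝ := (((2 * q + 1 : ℕ) : ℝ) + 1) ^ d - ((2 * q + 1 : ℕ) : ℝ) ^ d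
        have hbd : ∀ x, ‖((cellBox b q x).card : ℂ) - D‖ ≤ e := by
          intro x
          have h2 := pow_le_card_cellBox b q x
          have h3 := card_cellBox_le b q x
          have h4 : ((2 * q + 1 : ℕ) : ℝ) ^ d ≤ ((cellBox b q x).card : ℝ) := by exact_mod_cast h2
          have h5 : ((cellBox b q x).card : ℝ) ≤ (((2 * q + 1 : ℕ) : ℝ) + 1) ^ d := by
            have : ((cellBox b q x).card : ℝ) ≤ ((2 * q + 2 : ℕ) : ℝ) ^ d := by exact_mod_cast h3
            refine this.trans (le_of_eq ?_)
            push_cast; ring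
          have h6 : ((cellBox b q x).card : ℂ) - D =
              (((cellBox b q x).card - ((2 * q + 1 : ℕ) : ℝ) ^ d : ℝ) : ℂ) := by
            simp only [D]; push_cast; ring
          rw [h6, Complex.norm_real, Real.norm_eq_abs, abs_of_nonneg (by linarith)]
          exact sub_le_sub_right h5 _
        have he0 : 0 ≤ e := (norm_nonneg _).trans (hbd 0)
        have hbd2 : ∀ x, ‖(((cellBox b q x).card : ℂ) - D) * g' x‖ ≤ e * R := fun x => by
          rw [norm_mul]
          exact mul_le_mul (hbd x) (hR x) (norm_nonneg _) he0
        have hcard : Measurable fun x => ((cellBox b q x).card : ℂ) :=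
          (measurable_from_top (f := fun n : ℕ => (n : ℂ))).comp (measurable_card_cellBox b q)
        have hm1 : MemLp g' ⊤ (C.mu.restrict C.fund) :=
          memLp_top_of_bound hg'.aestronglyMeasurable R (Eventually.of_forall hR)
        have hm2 : MemLp (fun x => (((cellBox b q x).card : ℂ) - D) * g' x) ⊤ (C.mu.restrict C.fund) :=
          memLp_top_of_bound ((hcard.sub_const D).mul hg').aestronglyMeasurable (e * R)
            (Eventually.of_forall hbd2)
        -- The leading part is `L^d g'`; the rest is at most `((L + 1)^d - L^d) R` in norm and is
        -- absorbed by the trace bound for `cpr A`.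
        have hsplit : mulB (Spin N) (C.mu.restrict C.fund) (fun x => ((cellBox b q x).card : ℂ) * g' x) =
            D • mulB (Spin N) (C.mu.restrict C.fund) g' +
              mulB (Spin N) (C.mu.restrict C.fund)
                (fun x => (((cellBox b q x).card : ℂ) - D) * g' x) := by
          rw [← mulB_smul hm1, ← mulB_add (hm1.const_mul D) hm2]
          congr 1
          funext x
          ring
        have htc : ∀ U : C.Fib →L[ℂ] C.Fib, IsTraceClass (C.cpr A ∘L U) := fun U =>
          hA.traceClass_cpr.comp (ContinuousLinearMap.id ℂ C.Fib) U
        rw [h1, hsplit, ContinuousLinearMap.comp_add, ContinuousLinearMap.comp_smul,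
          tr_add ((htc _).smul D) (htc _), tr_smul, add_sub_cancel_left,
          ← hA.traceClass_cpr.tr_mul_comm]
        refine (hK _).trans ?_
        have h7 := norm_mulB_le (E := Spin N) (ν := C.mu.restrict C.fund) (mul_nonneg he0 hR0)
          (Eventually.of_forall hbd2)
        calc _ ≤ max K 0 * (e * R) := by
              gcongr
              exact le_max_left _ _
          _ = max K 0 * R * e := by ring
      · refine Filter.mem_inf_of_right fun L hL => ?_
        obtain ⟨q, rfl⟩ : ∃ q, L = 2 * q + 1 := hL
        exact norm_measure_cell_sub_le hb q
      · rw [Ne, Complex.ofReal_eq_zero, ENNReal.toReal_eq_zero_iff, not_or]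
        exact ⟨C.mu_fund_ne_zero, (C.mu_lt_top C.isBounded_fund).ne⟩

end Crystal
end UCC

end

/-! ### Existence of both conductivities. -/

noncomputable section

namespace UCC
namespace Crystal
variable {d N : ℕ} {C : Crystal d N} {H₀ : C.Hil →ₗ.[ℂ] C.Hil}
  {h : Space d → C.Fib →ₗ.[ℂ] C.Fib} {μF : ℝ} {P : C.Hil →L[ℂ] C.Hil} {c r : ℝ}
  {s : Spin N →L[ℂ] Spin N}

/-! ### Existence of the conductivities -/

/-- With the weight `1` the trace per unit volume is `tr (cpr A) / |F|`, in which the basis `b` no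
longer occurs; so one `σ`, read off from the derivative of the trace, serves all bases. -/
theorem exists_isConvConductivity (hH : C.IsUnperturbed H₀ h μF P) (hs : C.IsSpin h s)
    (hcr : C.IsContour H₀ μF c r) (i j : Fin d) :
    ∃ σ : ℝ, ∀ b : Module.Basis (Fin d) ℝ (Space d), lattice b = C.Lat →
      C.IsConvConductivity H₀ h P c r s i j b σ := by
  obtain ⟨E⟩ := hH.exists_fibreResolvent hcr
  obtain ⟨š, hš⟩ := E.exists_spin hs
  have hr := hcr.1.le
  obtain ⟨t', ht'⟩ := E.exists_hasDerivAt_current hr hH hcr š s i j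
  set m : ℂ := ((C.mu C.fund).toReal : ℂ)
  set t : ℝ → ℂ := fun ε =>
    tr (C.cpr (C.Op fun k => E.current š s i k ∘L E.neassFib hr j ε k)) / m
  refine ⟨(t' / m).re, fun b hb => ?_⟩
  have hτ : ∀ ε, C.HasTau b (prodOp (C.convCurrent H₀ h s i)
      (ofCLM (C.neass H₀ P c r (C.Op (E.posComm hr j)) ε))) (t ε) := by
    intro ε
    have h1 := (E.isLocTraceClass_current hr hH hcr š s i j ε).hasTau hb
      (A' := prodOp (C.convCurrent H₀ h s i)
        (ofCLM (C.neass H₀ P c r (C.Op (E.posComm hr j)) ε)))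
      (g := fun _ => 1) (g' := fun _ => 1) (R := 1) continuous_const measurable_const
      (fun _ => by simp) (fun q x => by simp) fun Ω hΩ hΩb ψ => by
        obtain ⟨Φ, hΦ, hz⟩ := C.exists_contDiff_isZak hΩb hΩ ψ
        exact ⟨_, FibreResolvent.mem_graph_convCurrent_neass hH hcr hs hš i j ε hΦ hz,
          Eventually.of_forall fun x => (one_smul ℂ _).symm⟩
    rw [mulB_one, ContinuousLinearMap.comp_id] at h1
    exact h1
  -- At `ε = 0` the perturbed state is `P`, so the unperturbed value is `t 0` and the required
  -- expansion is differentiability of `Re t` at `0`.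
  have h0 := hτ 0
  rw [FibreResolvent.neass_zero] at h0
  refine ⟨_, E.isPosComm hr hH hcr j, t 0, t, h0, fun ε _ => hτ ε, ?_⟩
  have h2 : HasDerivAt (fun ε => (t ε).re) (t' / m).re 0 :=
    Complex.reCLM.hasFDerivAt.comp_hasDerivAt (0 : ℝ) (ht'.div_const m)
  have h3 := (hasDerivAt_iff_isLittleO.mp h2).mono (nhdsWithin_le_nhds (s := Set.Ioi 0))
  simpa only [sub_zero, smul_eq_mul] using h3

/-- The average of the `i`-th coordinate over the translates of a point in a cell. -/
abbrev meanCoord (b : Module.Basis (Fin d) ℝ (Space d)) (i : Fin d) (x : Space d) : ℂ :=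
  (cellMean b x i : ℂ)

theorem continuous_coord (i : Fin d) : Continuous fun x : Space d => ((x i : ℝ) : ℂ) := by
  have h1 : Continuous fun x : Space d => x i := (EuclideanSpace.proj (𝕜 := ℝ) i).continuous
  exact Complex.continuous_ofReal.comp h1

theorem measurable_meanCoord (b : Module.Basis (Fin d) ℝ (Space d)) (i : Fin d) :
    Measurable (meanCoord b i) :=
  (continuous_coord i).measurable.comp (measurable_cellMean b)

theorem exists_norm_meanCoord_le (b : Module.Basis (Fin d) ℝ (Space d)) (i : Fin d) :
    ∃ R : ℝ, ∀ x, ‖meanCoord b i x‖ ≤ R := by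
  obtain ⟨R, hR⟩ := exists_norm_cellMean_le b
  refine ⟨R, fun x => le_trans ?_ (hR x)⟩
  rw [meanCoord, Complex.norm_real]
  exact PiLp.norm_apply_le (cellMean b x) i

namespace FibreResolvent

variable (E : C.FibreResolvent h c r) (hr : 0 ≤ r)

variable {E} in
-- The weight is `i x_i`, and its mean over a cell is `i` times a coordinate of `cellMean b`. This
-- bounded function is the only trace of the basis in the result.
theorem isRotConductivity (hH : C.IsUnperturbed H₀ h μF P) (hcr : C.IsContour H₀ μF c r)
    (hs : C.IsSpin h s) {š : C.Fib →L[ℂ] C.Fib} (hš : ∀ v, E.κ (š v) = C.spinFib s (E.κ v))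
    (i j : Fin d) {b : Module.Basis (Fin d) ℝ (Space d)} (hb : lattice b = C.Lat) :
    C.IsRotConductivity H₀ P c r s i j b
      (tr (C.cpr (C.Op (E.rotFib hr š s j)) ∘L mulB (Spin N) (C.mu.restrict C.fund)
        fun x => Complex.I * meanCoord b i x) / ((C.mu C.fund).toReal : ℂ)).re := by
  obtain ⟨R, hR⟩ := exists_norm_meanCoord_le b i
  refine ⟨_, E.isPosComm hr hH hcr j, _, ?_, rfl⟩
  refine (E.isLocTraceClass_rotFib hr hH hcr š s j).hasTau hb
    (g := fun x => Complex.I * ((x i : ℝ) : ℂ)) (R := R)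
    (continuous_const.mul (continuous_coord i)) ((measurable_meanCoord b i).const_mul Complex.I)
    (fun x => ?_) (fun q x => ?_) fun Ω hΩ hΩb ψ => ?_
  · rw [norm_mul, Complex.norm_I, one_mul]
    exact hR x
  · have h1 := congrArg (fun v : Space d => v i) (sum_cellBox_add b q x)
    have h2 : (∑ n ∈ cellBox b q x, (x + latEquiv b n) i) =
        (cellBox b q x).card * cellMean b x i := by
      rw [← smul_eq_mul, ← PiLp.smul_apply, ← h1]
      exact (map_sum (EuclideanSpace.proj (𝕜 := ℝ) i : Space d →L[ℝ] ℝ)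
        (fun n => x + (latEquiv b n : Space d)) (cellBox b q x)).symm
    rw [← Finset.mul_sum, ← Complex.ofReal_sum]
    simp only [h2]
    push_cast
    ring
  · obtain ⟨Φ, hΦ, hz⟩ := C.exists_contDiff_isZak hΩb hΩ ψ
    obtain ⟨φ, hφ⟩ := exists_mem_graph_X_rot (E := E) hr (s := s) hH hš i j hΦ hz
    refine ⟨Complex.I • φ, mem_graph_smul Complex.I
      (mem_graph_prodOp.mpr ⟨_, mem_graph_rot hr hH hcr hs hš j _, hφ⟩), ?_⟩
    filter_upwards [coe_of_mem_graph_mulOp hφ, Lp.coeFn_smul Complex.I φ] with x h1 h2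
    rw [h2, Pi.smul_apply, h1, smul_smul]

end FibreResolvent

end Crystal
end UCC

end

/-! ### Conjugation of bounded and unbounded operators by the rotation. -/

noncomputable section

namespace UCC

section GraphComm
variable {H : Type*} [NormedAddCommGroup H] [InnerProductSpace ℂ H] {A B : H →ₗ.[ℂ] H} {ψ χ : H}

theorem exists_of_mem_graph_commOp (h : (ψ, χ) ∈ (commOp A B).graph) :
    ∃ φ χ₁ φ' χ₂, (ψ, φ) ∈ B.graph ∧ (φ, χ₁) ∈ A.graph ∧ (ψ, φ') ∈ A.graph ∧
      (φ', χ₂) ∈ B.graph ∧ χ = χ₁ - χ₂ := by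
  obtain ⟨hd, rfl⟩ := exists_apply_of_mem_graph h
  obtain ⟨φ, h1, h2⟩ := mem_graph_prodOp.mp ((prodOp A B).mem_graph ⟨ψ, hd.1⟩)
  obtain ⟨φ', h3, h4⟩ := mem_graph_prodOp.mp ((prodOp B A).mem_graph ⟨ψ, hd.2⟩)
  exact ⟨φ, _, φ', _, h1, h2, h3, h4, rfl⟩

end GraphComm

theorem rotFun_fst {d : ℕ} (θ : ℝ) {i j : Fin d} (hij : i ≠ j) (x : Space d) :
    rot θ hij x i = Real.cos θ * x i - Real.sin θ * x j := by
  rw [rot_apply]; simp [rotFun]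

theorem rotFun_snd {d : ℕ} (θ : ℝ) {i j : Fin d} (hij : i ≠ j) (x : Space d) :
    rot θ hij x j = Real.sin θ * x i + Real.cos θ * x j := by
  rw [rot_apply]; simp [rotFun, hij.symm]

namespace Crystal
variable {d N : ℕ} {C : Crystal d N}

/-- Functions of bounded support are dense. The proof shows that the adjoint of `T - T'` has only
zero coefficients. -/
theorem eq_of_eq_on_bounded {T T' : C.Hil →L[ℂ] C.Hil}
    (h : ∀ K : Set (Space d), MeasurableSet K → Bornology.IsBounded K → ∀ ψ : C.Hil,
      T (mulB (Spin N) C.mu (ind K) ψ) = T' (mulB (Spin N) C.mu (ind K) ψ)) : T = T' := by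
  have h1 : (T - T').adjoint = 0 := by
    ext1 φ
    refine C.eq_zero_of_coef fun γ => ext_inner_left ℂ fun v => ?_
    rw [← ContinuousLinearMap.adjoint_inner_left, ContinuousLinearMap.adjoint_inner_right,
      inner_zero_right]
    set K : Set (Space d) := (fun x => x - ((-γ : C.Lat) : Space d)) ⁻¹' C.fund
    have h2 : (C.coef γ).adjoint v = mulB (Spin N) C.mu (ind K) ((C.coef γ).adjoint v) := by
      have h3 := C.coef_adjoint_coef (-γ) ((C.coef γ).adjoint v)
      rw [neg_neg, C.coef_adjoint_self] at h3
      exact h3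
    have hKm : MeasurableSet K := (measurable_sub_const _) C.measurableSet_fund
    have hKb : Bornology.IsBounded K := by
      obtain ⟨R, hR⟩ := isBounded_iff_forall_norm_le.mp C.isBounded_fund
      refine isBounded_iff_forall_norm_le.mpr ⟨R + ‖((-γ : C.Lat) : Space d)‖, fun x hx => ?_⟩
      have h4 := norm_add_le (x - ((-γ : C.Lat) : Space d)) ((-γ : C.Lat) : Space d)
      rw [sub_add_cancel] at h4
      exact h4.trans (add_le_add (hR _ hx) le_rfl)
    rw [h2, sub_apply, h K hKm hKb, sub_self, inner_zero_left]
  have h2 := congrArg ContinuousLinearMap.adjoint h1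
  rw [ContinuousLinearMap.adjoint_adjoint, map_zero] at h2
  exact sub_eq_zero.mp h2

/-! ### The rotation operator -/

section Rotation

variable {θ : ℝ} {i j : Fin d} {hij : i ≠ j} (hX : C.RotInvariant θ hij)
  (ρ : unitary (Spin N →L[ℂ] Spin N))

theorem rotOp_coe (ψ : C.Hil) : ∀ᵐ x ∂C.mu, C.rotOp hX ρ ψ x =
    (ρ : Spin N →L[ℂ] Spin N) (ψ ((rot θ hij).symm x)) :=
  MemLp.coeFn_toLp (memLp_comp aestronglyMeasurable_const (fun _ => ρ.2)
    hX.measurePreserving_symm ψ)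

theorem rotOpInv_coe (ψ : C.Hil) : ∀ᵐ x ∂C.mu, C.rotOpInv hX ρ ψ x =
    ((ρ⁻¹ : unitary (Spin N →L[ℂ] Spin N)) : Spin N →L[ℂ] Spin N) (ψ (rot θ hij x)) :=
  MemLp.coeFn_toLp (memLp_comp aestronglyMeasurable_const (fun _ => (ρ⁻¹).2)
    hX.measurePreserving ψ)

theorem rho_inv_apply (v : Spin N) :
    ((ρ⁻¹ : unitary (Spin N →L[ℂ] Spin N)) : Spin N →L[ℂ] Spin N) ((ρ : Spin N →L[ℂ] Spin N) v) = v := by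
  have h1 : ((ρ⁻¹ * ρ : unitary (Spin N →L[ℂ] Spin N)) : Spin N →L[ℂ] Spin N) = 1 := by
    rw [inv_mul_cancel]; rfl
  exact congrArg (fun T : Spin N →L[ℂ] Spin N => T v) h1

theorem rho_apply_inv (v : Spin N) :
    (ρ : Spin N →L[ℂ] Spin N) (((ρ⁻¹ : unitary (Spin N →L[ℂ] Spin N)) : Spin N →L[ℂ] Spin N) v) = v := by
  have h1 : ((ρ * ρ⁻¹ : unitary (Spin N →L[ℂ] Spin N)) : Spin N →L[ℂ] Spin N) = 1 := by
    rw [mul_inv_cancel]; rfl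
  exact congrArg (fun T : Spin N →L[ℂ] Spin N => T v) h1

theorem rotOpInv_rotOp (ψ : C.Hil) : C.rotOpInv hX ρ (C.rotOp hX ρ ψ) = ψ := by
  refine Lp.ext ?_
  filter_upwards [rotOpInv_coe hX ρ (C.rotOp hX ρ ψ),
    hX.measurePreserving.quasiMeasurePreserving.ae (rotOp_coe hX ρ ψ)] with x h1 h2
  rw [h1, h2, rho_inv_apply, LinearIsometryEquiv.symm_apply_apply]

theorem rotOp_rotOpInv (ψ : C.Hil) : C.rotOp hX ρ (C.rotOpInv hX ρ ψ) = ψ := by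
  refine Lp.ext ?_
  filter_upwards [rotOp_coe hX ρ (C.rotOpInv hX ρ ψ),
    hX.measurePreserving_symm.quasiMeasurePreserving.ae (rotOpInv_coe hX ρ ψ)] with x h1 h2
  rw [h1, h2, rho_apply_inv, LinearIsometryEquiv.apply_symm_apply]

theorem memLp_comp_rot (hX : C.RotInvariant θ hij) {g : Space d → ℂ} (hg : MemLp g ⊤ C.mu) :
    MemLp (fun x => g (rot θ hij x)) ⊤ C.mu :=
  hg.comp_measurePreserving hX.measurePreserving

theorem mulB_rotOp {g : Space d → ℂ} (hg : MemLp g ⊤ C.mu) (ψ : C.Hil) :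
    mulB (Spin N) C.mu g (C.rotOp hX ρ ψ) =
      C.rotOp hX ρ (mulB (Spin N) C.mu (fun x => g (rot θ hij x)) ψ) := by
  refine mulB_eq_of_ae hg ?_
  filter_upwards [rotOp_coe hX ρ (mulB (Spin N) C.mu (fun x => g (rot θ hij x)) ψ),
    rotOp_coe hX ρ ψ, hX.measurePreserving_symm.quasiMeasurePreserving.ae
      (mulB_coe (memLp_comp_rot hX hg) ψ)] with x h1 h2 h3
  rw [h1, h2, h3, map_smul, LinearIsometryEquiv.apply_symm_apply]

theorem mulB_ind_rotOp {K : Set (Space d)} (hK : MeasurableSet K) (ψ : C.Hil) :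
    mulB (Spin N) C.mu (ind K) (C.rotOp hX ρ ψ) =
      C.rotOp hX ρ (mulB (Spin N) C.mu (ind (rot θ hij ⁻¹' K)) ψ) :=
  mulB_rotOp hX ρ (memLp_ind hK) ψ

/-- The conjugate of the operator `T` by the rotation operator is `T'`. -/
def RotConj (T T' : C.Hil →L[ℂ] C.Hil) : Prop := ∀ ψ, T (C.rotOp hX ρ ψ) = C.rotOp hX ρ (T' ψ)

section

variable {hX ρ} {T T' S S' : C.Hil →L[ℂ] C.Hil}

theorem RotConj.sub (h : RotConj hX ρ T T') (h' : RotConj hX ρ S S') :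
    RotConj hX ρ (T - S) (T' - S') := fun ψ => by
  rw [sub_apply, sub_apply, h, h', map_sub]

theorem RotConj.smul (h : RotConj hX ρ T T') (w : ℂ) : RotConj hX ρ (w • T) (w • T') := fun ψ => by
  rw [smul_apply, smul_apply, h, map_smul]

theorem RotConj.comp (h : RotConj hX ρ T T') (h' : RotConj hX ρ S S') :
    RotConj hX ρ (T ∘L S) (T' ∘L S') := fun ψ => by
  rw [ContinuousLinearMap.comp_apply, h', h]; rfl

theorem RotConj.sum {ι : Type*} {s : Finset ι} {T T' : ι → C.Hil →L[ℂ] C.Hil}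
    (h : ∀ a ∈ s, RotConj hX ρ (T a) (T' a)) :
    RotConj hX ρ (∑ a ∈ s, T a) (∑ a ∈ s, T' a) := fun ψ => by
  rw [sum_apply, sum_apply, map_sum]
  exact Finset.sum_congr rfl fun a ha => h a ha ψ

theorem RotConj.comp_eq (h : RotConj hX ρ T T') :
    T = C.rotOp hX ρ ∘L T' ∘L C.rotOpInv hX ρ := by
  ext1 ψ
  have := h (C.rotOpInv hX ρ ψ)
  rwa [rotOp_rotOpInv] at this

theorem RotConj.of_rotConj (h : C.rotConj hX ρ (ofCLM T) = ofCLM T) : RotConj hX ρ T T := by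
  intro ψ
  have h1 : (ψ, C.rotOpInv hX ρ (T (C.rotOp hX ρ ψ))) ∈ (C.rotConj hX ρ (ofCLM T)).graph :=
    mem_graph_prodOp.mpr ⟨_, mem_graph_prodOp.mpr ⟨_, mem_graph_ofCLM.mpr rfl,
      mem_graph_ofCLM.mpr rfl⟩, mem_graph_ofCLM.mpr rfl⟩
  rw [h] at h1
  rw [mem_graph_ofCLM.mp h1, rotOp_rotOpInv]

theorem RotConj.tr_eq (h : RotConj hX ρ T T') (ht : IsTraceClass T') : tr T = tr T' := by
  rw [h.comp_eq, ht.tr_comp]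
  congr 1
  ext1 ψ
  exact congrArg T' (rotOpInv_rotOp hX ρ ψ)

theorem rotOp_mem_graph {A : C.Hil →ₗ.[ℂ] C.Hil} (h : C.rotConj hX ρ A = A) {ψ φ : C.Hil}
    (hg : (ψ, φ) ∈ A.graph) : (C.rotOp hX ρ ψ, C.rotOp hX ρ φ) ∈ A.graph := by
  rw [← h] at hg
  obtain ⟨χ, h1, h2⟩ := mem_graph_prodOp.mp hg
  obtain ⟨χ', h3, h4⟩ := mem_graph_prodOp.mp h1
  rw [← mem_graph_ofCLM.mp h2, rotOp_rotOpInv, mem_graph_ofCLM.mp h3]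
  exact h4

theorem RotConj.resolvent {A : C.Hil →ₗ.[ℂ] C.Hil} (h : C.rotConj hX ρ A = A) {z : ℂ}
    {R : C.Hil →L[ℂ] C.Hil} (hR : IsResolventAt A z R) : RotConj hX ρ R R := by
  intro ψ
  have h1 := rotOp_mem_graph h (hR.mem_graph ψ)
  have h2 := hR.apply_graph h1
  rwa [map_add, map_smul, add_sub_cancel_right] at h2

end

/-- Conjugation by the rotation operator. -/
def rotConjEquiv : (C.Hil →L[ℂ] C.Hil) ≃L[ℂ] (C.Hil →L[ℂ] C.Hil) :=
  ContinuousLinearEquiv.equivOfInverse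
    (ContinuousLinearMap.compL ℂ C.Hil C.Hil C.Hil (C.rotOp hX ρ) ∘L
      (ContinuousLinearMap.compL ℂ C.Hil C.Hil C.Hil).flip (C.rotOpInv hX ρ))
    (ContinuousLinearMap.compL ℂ C.Hil C.Hil C.Hil (C.rotOpInv hX ρ) ∘L
      (ContinuousLinearMap.compL ℂ C.Hil C.Hil C.Hil).flip (C.rotOp hX ρ))
    (fun T => by
      ext1 ψ
      change C.rotOpInv hX ρ (C.rotOp hX ρ (T (C.rotOpInv hX ρ (C.rotOp hX ρ ψ)))) = T ψ
      rw [rotOpInv_rotOp, rotOpInv_rotOp])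
    (fun T => by
      ext1 ψ
      change C.rotOp hX ρ (C.rotOpInv hX ρ (T (C.rotOp hX ρ (C.rotOpInv hX ρ ψ)))) = T ψ
      rw [rotOp_rotOpInv, rotOp_rotOpInv])

theorem rotConjEquiv_apply (T : C.Hil →L[ℂ] C.Hil) :
    rotConjEquiv hX ρ T = C.rotOp hX ρ ∘L T ∘L C.rotOpInv hX ρ := rfl

variable {hX ρ} in
theorem RotConj.circleIntegral {f g : ℂ → C.Hil →L[ℂ] C.Hil} {c : ℂ} {r : ℝ} (hr : 0 ≤ r)
    (h : ∀ z ∈ Metric.sphere c r, RotConj hX ρ (f z) (g z)) :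
    RotConj hX ρ (_root_.circleIntegral f c r) (_root_.circleIntegral g c r) := by
  have h1 : _root_.circleIntegral f c r = rotConjEquiv hX ρ (_root_.circleIntegral g c r) := by
    rw [circleIntegral_congr_sphere hr (g := fun z => rotConjEquiv hX ρ (g z))
      fun z hz => (h z hz).comp_eq]
    -- Conjugation is a continuous linear equivalence, so it passes through the integral with no
    -- integrability condition.
    rw [_root_.circleIntegral, _root_.circleIntegral,
      intervalIntegral.integral_of_le Real.two_pi_pos.le,
      intervalIntegral.integral_of_le Real.two_pi_pos.le, ← ContinuousLinearEquiv.integral_comp_comm]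
    simp only [map_smul]
    rfl
  intro ψ
  rw [h1, rotConjEquiv_apply]
  exact congrArg (fun φ => C.rotOp hX ρ (_root_.circleIntegral g c r φ)) (rotOpInv_rotOp hX ρ ψ)

end Rotation
end Crystal
end UCC

end

/-! ### How the linear response transforms under the rotation. -/

noncomputable section

namespace UCC

theorem map_mul_mul_add_smul {X A : Type*} [TopologicalSpace X] [CompactSpace X] [NormedRing A]
    [NormedAlgebra ℂ A] (T : CN X A →L[ℂ] A) (S : A →L[ℂ] CN X A) (u : CN X A) (a a' : A) (w w' : ℂ) :
    T (u * S (w • a + w' • a') * u) = w • T (u * S a * u) + w' • T (u * S a' * u) := by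
  rw [map_add, map_smul, map_smul, mul_add, add_mul, mul_smul_comm, mul_smul_comm, smul_mul_assoc,
    smul_mul_assoc, map_add, map_smul, map_smul]

namespace Crystal
variable {d N : ℕ} {C : Crystal d N} {H₀ : C.Hil →ₗ.[ℂ] C.Hil}
  {h : Space d → C.Fib →ₗ.[ℂ] C.Fib} {μF : ℝ} {P : C.Hil →L[ℂ] C.Hil} {c r : ℝ}
  {s : Spin N →L[ℂ] Spin N} {θ : ℝ} {i j : Fin d} {hij : i ≠ j} {hX : C.RotInvariant θ hij}
  {ρ : unitary (Spin N →L[ℂ] Spin N)}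

/-! ### Rotational symmetry of the linear response -/

theorem rotOp_mem_graph_X {ψ χi χj : C.Hil} (hi : (ψ, χi) ∈ (C.X i).graph)
    (hj : (ψ, χj) ∈ (C.X j).graph) :
    (C.rotOp hX ρ ψ, C.rotOp hX ρ ((Real.cos θ : ℂ) • χi - (Real.sin θ : ℂ) • χj)) ∈ (C.X i).graph ∧
    (C.rotOp hX ρ ψ, C.rotOp hX ρ ((Real.sin θ : ℂ) • χi + (Real.cos θ : ℂ) • χj)) ∈ (C.X j).graph := by
  have hq := hX.measurePreserving_symm.quasiMeasurePreserving
  have hi' := hq.ae (coe_of_mem_graph_mulOp hi)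
  have hj' := hq.ae (coe_of_mem_graph_mulOp hj)
  have hi1 := hq.ae (Lp.coeFn_smul (Real.cos θ : ℂ) χi)
  have hi2 := hq.ae (Lp.coeFn_smul (Real.sin θ : ℂ) χi)
  have hj1 := hq.ae (Lp.coeFn_smul (Real.cos θ : ℂ) χj)
  have hj2 := hq.ae (Lp.coeFn_smul (Real.sin θ : ℂ) χj)
  constructor
  · refine mem_graph_mulOp ?_
    filter_upwards [rotOp_coe hX ρ ((Real.cos θ : ℂ) • χi - (Real.sin θ : ℂ) • χj),
      rotOp_coe hX ρ ψ, hi', hj', hi1, hj2,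
      hq.ae (Lp.coeFn_sub ((Real.cos θ : ℂ) • χi) ((Real.sin θ : ℂ) • χj))] with x h1 h2 h3 h4 h5 h6 h7
    rw [h1, h2, h7, Pi.sub_apply, h5, h6, Pi.smul_apply, Pi.smul_apply, h3, h4, smul_smul, smul_smul,
      ← sub_smul, map_smul]
    congr 1
    have h8 := rotFun_fst θ hij ((rot θ hij).symm x)
    rw [LinearIsometryEquiv.apply_symm_apply] at h8
    rw [h8]
    push_cast; ring
  · refine mem_graph_mulOp ?_
    filter_upwards [rotOp_coe hX ρ ((Real.sin θ : ℂ) • χi + (Real.cos θ : ℂ) • χj),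
      rotOp_coe hX ρ ψ, hi', hj', hi2, hj1,
      hq.ae (Lp.coeFn_add ((Real.sin θ : ℂ) • χi) ((Real.cos θ : ℂ) • χj))] with x h1 h2 h3 h4 h5 h6 h7
    rw [h1, h2, h7, Pi.add_apply, h5, h6, Pi.smul_apply, Pi.smul_apply, h3, h4, smul_smul, smul_smul,
      ← add_smul, map_smul]
    congr 1
    have h8 := rotFun_snd θ hij ((rot θ hij).symm x)
    rw [LinearIsometryEquiv.apply_symm_apply] at h8
    rw [h8]
    push_cast; ring

theorem IsPosComm.apply_eq {l : Fin d} {D : C.Hil →L[ℂ] C.Hil} (hD : C.IsPosComm P l D)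
    {φ χ₁ χ₂ : C.Hil} (hφ : φ ∈ C.smoothCore) (h1 : (P φ, χ₁) ∈ (C.X l).graph)
    (h2 : (φ, χ₂) ∈ (C.X l).graph) : D φ = χ₁ - P χ₂ := by
  have h3 := mem_graph_closedComm (core := C.smoothCore) hφ (mem_graph_commOp (B := ofCLM P)
    (mem_graph_ofCLM.mpr rfl) h1 h2 (mem_graph_ofCLM.mpr rfl))
  have h4 : closedComm (C.X l) (ofCLM P) C.smoothCore = ofCLM D := hD
  rw [h4] at h3
  exact mem_graph_ofCLM.mp h3

/-- The rotation of the closures of `[X_i, P]` and `[X_j, P]`. -/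
theorem RotConj.posComm (hP : RotConj hX ρ P P)
    (hcore : ∀ φ ∈ C.smoothCore, ∀ l, ∃ χ, (P φ, χ) ∈ (C.X l).graph)
    {Di Dj : C.Hil →L[ℂ] C.Hil} (hDi : C.IsPosComm P i Di) (hDj : C.IsPosComm P j Dj) :
    RotConj hX ρ Di ((Real.cos θ : ℂ) • Di - (Real.sin θ : ℂ) • Dj) ∧
    RotConj hX ρ Dj ((Real.sin θ : ℂ) • Di + (Real.cos θ : ℂ) • Dj) := by
  have key : ∀ K : Set (Space d), MeasurableSet K → Bornology.IsBounded K → ∀ ψ : C.Hil,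
      Di (C.rotOp hX ρ (mulB (Spin N) C.mu (ind K) ψ)) =
        C.rotOp hX ρ (((Real.cos θ : ℂ) • Di - (Real.sin θ : ℂ) • Dj)
          (mulB (Spin N) C.mu (ind K) ψ)) ∧
      Dj (C.rotOp hX ρ (mulB (Spin N) C.mu (ind K) ψ)) =
        C.rotOp hX ρ (((Real.sin θ : ℂ) • Di + (Real.cos θ : ℂ) • Dj)
          (mulB (Spin N) C.mu (ind K) ψ)) := by
    intro K hK hKb ψ
    set φ := mulB (Spin N) C.mu (ind K) ψ
    have hφ : φ ∈ C.smoothCore := C.exists_contDiff_isZak hKb hK ψ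
    -- The invariance of the whole core under the rotation is not needed: functions of bounded
    -- support lie in the core, are permuted by the rotation, and suffice by density.
    have hUφ : C.rotOp hX ρ φ ∈ C.smoothCore := by
      set K' := (rot θ hij).symm ⁻¹' K
      have hK' : MeasurableSet K' := (rot θ hij).symm.continuous.measurable hK
      have hKb' : Bornology.IsBounded K' := by
        obtain ⟨R, hR⟩ := isBounded_iff_forall_norm_le.mp hKb
        refine isBounded_iff_forall_norm_le.mpr ⟨R, fun x hx => ?_⟩
        rw [← (rot θ hij).symm.norm_map]
        exact hR _ hx
      have h1 := mulB_ind_rotOp hX ρ hK' ψ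
      have h2 : rot θ hij ⁻¹' K' = K := by
        ext x; simp [K']
      rw [h2] at h1
      have h3 : C.rotOp hX ρ φ = mulB (Spin N) C.mu (ind K') (C.rotOp hX ρ ψ) := h1.symm
      rw [h3]
      exact C.exists_contDiff_isZak hKb' hK' (C.rotOp hX ρ ψ)
    have hX' : ∀ l, ∃ χ, (φ, χ) ∈ (C.X l).graph := by
      obtain ⟨Φ, hΦ, hz⟩ := hφ
      intro l
      obtain ⟨χ, hχ, -⟩ := hz.mem_graph_X hΦ l
      exact ⟨χ, hχ⟩
    obtain ⟨a, ha⟩ := hX' i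
    obtain ⟨b, hb⟩ := hX' j
    obtain ⟨a', ha'⟩ := hcore φ hφ i
    obtain ⟨b', hb'⟩ := hcore φ hφ j
    have h1 := rotOp_mem_graph_X (hX := hX) (ρ := ρ) ha hb
    have h2 := rotOp_mem_graph_X (hX := hX) (ρ := ρ) ha' hb'
    rw [← hP] at h2
    have ei := hDi.apply_eq hφ ha' ha
    have ej := hDj.apply_eq hφ hb' hb
    constructor
    · rw [hDi.apply_eq hUφ h2.1 h1.1, hP, ← map_sub (C.rotOp hX ρ)]
      refine congrArg _ ?_
      rw [sub_apply, smul_apply, smul_apply, ei, ej, P.map_sub, P.map_smul, P.map_smul]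
      module
    · rw [hDj.apply_eq hUφ h2.2 h1.2, hP, ← map_sub (C.rotOp hX ρ)]
      refine congrArg _ ?_
      rw [add_apply, smul_apply, smul_apply, ei, ej, P.map_add, P.map_smul, P.map_smul]
      module
  constructor
  · have h1 := eq_of_eq_on_bounded (T := Di ∘L C.rotOp hX ρ)
      (T' := C.rotOp hX ρ ∘L ((Real.cos θ : ℂ) • Di - (Real.sin θ : ℂ) • Dj))
      fun K hK hKb ψ => (key K hK hKb ψ).1
    exact fun ψ => congrArg (fun T : C.Hil →L[ℂ] C.Hil => T ψ) h1
  · have h1 := eq_of_eq_on_bounded (T := Dj ∘L C.rotOp hX ρ)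
      (T' := C.rotOp hX ρ ∘L ((Real.sin θ : ℂ) • Di + (Real.cos θ : ℂ) • Dj))
      fun K hK hKb ψ => (key K hK hKb ψ).2
    exact fun ψ => congrArg (fun T : C.Hil →L[ℂ] C.Hil => T ψ) h1

theorem RotConj.spinOp (hs : ((ρ⁻¹ : unitary (Spin N →L[ℂ] Spin N)) : Spin N →L[ℂ] Spin N) ∘L
    (s ∘L (ρ : Spin N →L[ℂ] Spin N)) = s) :
    RotConj hX ρ (spinOp C.mu s) (spinOp C.mu s) := by
  intro ψ
  refine Lp.ext ?_
  filter_upwards [spinOp_coe s (C.rotOp hX ρ ψ), rotOp_coe hX ρ ψ,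
    rotOp_coe hX ρ (UCC.spinOp C.mu s ψ),
    hX.measurePreserving_symm.quasiMeasurePreserving.ae (spinOp_coe s ψ)] with x h1 h2 h3 h4
  rw [h1, h2, h3, h4]
  have h5 := congrArg (fun T : Spin N →L[ℂ] Spin N =>
    (ρ : Spin N →L[ℂ] Spin N) (T (ψ ((rot θ hij).symm x)))) hs
  simp only [ContinuousLinearMap.comp_apply, rho_apply_inv] at h5
  exact h5

theorem rotOp_mem_graph_commOp {A : C.Hil →ₗ.[ℂ] C.Hil} (hA : C.rotConj hX ρ A = A)
    {S : C.Hil →L[ℂ] C.Hil} (hS : RotConj hX ρ S S) {ψ χ : C.Hil}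
    (h : (ψ, χ) ∈ (commOp A (ofCLM S)).graph) :
    (C.rotOp hX ρ ψ, C.rotOp hX ρ χ) ∈ (commOp A (ofCLM S)).graph := by
  obtain ⟨φ, χ₁, φ', χ₂, h1, h2, h3, h4, rfl⟩ := exists_of_mem_graph_commOp h
  rw [map_sub]
  refine mem_graph_commOp (mem_graph_ofCLM.mpr ?_) (rotOp_mem_graph hA h2) (rotOp_mem_graph hA h3)
    (mem_graph_ofCLM.mpr ?_)
  · rw [hS, mem_graph_ofCLM.mp h1]
  · rw [hS, mem_graph_ofCLM.mp h4]

namespace FibreResolvent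

variable {E : C.FibreResolvent h c r} (hr : 0 ≤ r)

theorem rotConj_resolventOp (hH : C.IsUnperturbed H₀ h μF P) (E : C.FibreResolvent h c r)
    (hA : C.rotConj hX ρ H₀ = H₀) {z : ℂ} (hz : z ∈ Metric.sphere (c : ℂ) r) :
    RotConj hX ρ (resolventOp H₀ z) (resolventOp H₀ z) := by
  have h1 := E.isResolventAt hH ⟨z, hz⟩
  rw [← E.resolventOp_eq hH] at h1
  exact RotConj.resolvent hA h1

/-- `P` is a contour integral of resolvents of `H₀`, each of which commutes with the rotation. -/
theorem rotConj_fermi (hH : C.IsUnperturbed H₀ h μF P) (hcr : C.IsContour H₀ μF c r)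
    (E : C.FibreResolvent h c r) (hA : C.rotConj hX ρ H₀ = H₀) : RotConj hX ρ P P := by
  have h1 : P = (Complex.I / (2 * Real.pi)) • circleIntegral (resolventOp H₀) c r := by
    have h2 := C.circleIntegral_Op hcr.1.le (f := E.res) (R := resolventOp H₀)
      E.contDiff_res.continuous fun z hz => E.resolventOp_eq hH ⟨z, hz⟩
    have hc : Continuous fun k => cint hcr.1.le (E.res k) :=
      (contDiff_cint hcr.1.le E.contDiff_res).continuous
    rw [h2, ← C.Op_smul hc, ← E.Op_p hcr.1.le hH hcr]
    exact congrArg C.Op (funext (E.p_eq hcr.1.le))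
  rw [h1]
  exact (RotConj.circleIntegral hcr.1.le fun z hz => rotConj_resolventOp hH E hA hz).smul _

theorem rotConj_invLiouvillian (hH : C.IsUnperturbed H₀ h μF P) (hcr : C.IsContour H₀ μF c r)
    (E : C.FibreResolvent h c r) (hA : C.rotConj hX ρ H₀ = H₀) {D D' : C.Hil →L[ℂ] C.Hil}
    (hD : RotConj hX ρ D D') :
    RotConj hX ρ (invLiouvillian H₀ P c r D) (invLiouvillian H₀ P c r D') := by
  have hP := rotConj_fermi hH hcr E hA
  refine (RotConj.circleIntegral hcr.1.le fun z hz => ?_).smul _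
  have hR := rotConj_resolventOp hH E hA hz
  exact hR.comp (((hD.comp hP).sub (hP.comp hD)).comp hR)

theorem liou_add_smul (q q' : Space d → C.Fib →L[ℂ] C.Fib) (w w' : ℂ) (k : Space d) :
    E.liou hr (fun k => w • q k + w' • q' k) k = w • E.liou hr q k + w' • E.liou hr q' k := by
  have h1 := map_mul_mul_add_smul (A := C.Fib →L[ℂ] C.Fib) (cint hr)
    (constCN (Metric.sphere (c : ℂ) r) (C.Fib →L[ℂ] C.Fib)) (E.u k) (q k ∘L E.κ) (q' k ∘L E.κ) w w'
  have h2 : (w • q k + w' • q' k) ∘L E.κ = w • (q k ∘L E.κ) + w' • (q' k ∘L E.κ) := rfl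
  rw [liou, h2, h1, smul_add, smul_comm _ w, smul_comm _ w']
  rfl

theorem commP_add_smul (q q' : Space d → C.Fib →L[ℂ] C.Fib) (w w' : ℂ) :
    E.commP hr (fun k => w • q k + w' • q' k) =
      fun k => w • E.commP hr q k + w' • E.commP hr q' k := by
  funext k
  ext1 v
  simp only [commP, sub_apply, add_apply, smul_apply, ContinuousLinearMap.comp_apply, map_add,
    map_smul]
  module

/-- Linearity of the contour integral is checked in the fibres, where the integrands are continuous
on the circle. -/
theorem pi1_add_smul (hH : C.IsUnperturbed H₀ h μF P) (hcr : C.IsContour H₀ μF c r)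
    (l l' : Fin d) (w w' : ℂ) :
    C.pi1 H₀ P c r (w • C.Op (E.posComm hr l) + w' • C.Op (E.posComm hr l')) =
      w • C.pi1 H₀ P c r (C.Op (E.posComm hr l)) + w' • C.pi1 H₀ P c r (C.Op (E.posComm hr l')) := by
  have hq := E.contDiff_posComm hr l
  have hq' := E.contDiff_posComm hr l'
  have c1 : ContDiff ℝ ∞ fun k => w • E.posComm hr l k := hq.const_smul w
  have c2 : ContDiff ℝ ∞ fun k => w' • E.posComm hr l' k := hq'.const_smul w'
  have d1 : Continuous fun k => E.κ ∘L E.pertFib hr l k :=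
    continuous_const.clm_comp (E.contDiff_pertFib hr l).continuous
  have d2 : Continuous fun k => E.κ ∘L E.pertFib hr l' k :=
    continuous_const.clm_comp (E.contDiff_pertFib hr l').continuous
  have e1 : Continuous fun k => w • (E.κ ∘L E.pertFib hr l k) := d1.const_smul w
  have e2 : Continuous fun k => w' • (E.κ ∘L E.pertFib hr l' k) := d2.const_smul w'
  have h1 : w • C.Op (E.posComm hr l) + w' • C.Op (E.posComm hr l') =
      C.Op fun k => w • E.posComm hr l k + w' • E.posComm hr l' k := by
    rw [C.Op_add c1.continuous c2.continuous, C.Op_smul hq.continuous, C.Op_smul hq'.continuous]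
  have h2 : C.pi1 H₀ P c r (C.Op fun k => w • E.posComm hr l k + w' • E.posComm hr l' k) = _ :=
    E.invLiouvillian_Op hr hH hcr (c1.add c2)
  rw [h1, h2, ← E.Op_pertFib hr hH hcr, ← E.Op_pertFib hr hH hcr, ← C.Op_smul d1, ← C.Op_smul d2,
    ← C.Op_add e1 e2]
  congr 1
  funext k
  rw [commP_add_smul, liou_add_smul, ContinuousLinearMap.comp_add, ContinuousLinearMap.comp_smul,
    ContinuousLinearMap.comp_smul]
  rfl

/-- The rotation of the operators `[H₀, S] Π₁` for the fields in the directions `i` and `j`. -/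
theorem rotConj_rotFib (hH : C.IsUnperturbed H₀ h μF P) (hcr : C.IsContour H₀ μF c r)
    (hs : C.IsSpin h s) {š : C.Fib →L[ℂ] C.Fib} (hš : ∀ v, E.κ (š v) = C.spinFib s (E.κ v))
    (hA : C.rotConj hX ρ H₀ = H₀)
    (hρ : ((ρ⁻¹ : unitary (Spin N →L[ℂ] Spin N)) : Spin N →L[ℂ] Spin N) ∘L
      (s ∘L (ρ : Spin N →L[ℂ] Spin N)) = s) :
    RotConj hX ρ (C.Op (E.rotFib hr š s i)) ((Real.cos θ : ℂ) • C.Op (E.rotFib hr š s i) +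
        (-(Real.sin θ : ℂ)) • C.Op (E.rotFib hr š s j)) ∧
    RotConj hX ρ (C.Op (E.rotFib hr š s j)) ((Real.sin θ : ℂ) • C.Op (E.rotFib hr š s i) +
        (Real.cos θ : ℂ) • C.Op (E.rotFib hr š s j)) := by
  have hP := rotConj_fermi hH hcr E hA
  have hcore : ∀ φ ∈ C.smoothCore, ∀ l, ∃ χ, (P φ, χ) ∈ (C.X l).graph := by
    rintro φ ⟨Φ, hΦ, hz⟩ l
    have h1 := hz.op (E.contDiff_p hr).continuous (E.equi_p hr hH)
    rw [E.Op_p hr hH hcr] at h1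
    obtain ⟨χ, hχ, -⟩ := h1.mem_graph_X (contDiff_apply (E.contDiff_p hr) hΦ) l
    exact ⟨χ, hχ⟩
  have hD := RotConj.posComm hP hcore (E.isPosComm hr hH hcr i) (E.isPosComm hr hH hcr j)
  rw [sub_eq_add_neg, ← neg_smul] at hD
  have hS : RotConj hX ρ (UCC.spinOp C.mu s) (UCC.spinOp C.mu s) := RotConj.spinOp hρ
  have hg : ∀ l φ, (C.pi1 H₀ P c r (C.Op (E.posComm hr l)) φ, C.Op (E.rotFib hr š s l) φ) ∈
      (commOp H₀ (ofCLM (UCC.spinOp C.mu s))).graph := fun l φ => by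
    obtain ⟨φ', h1, h2⟩ := mem_graph_prodOp.mp (mem_graph_rot hr hH hcr hs hš l φ)
    rw [mem_graph_ofCLM.mp h1]
    exact h2
  have key : ∀ (l : Fin d) (w w' : ℂ), RotConj hX ρ (C.Op (E.posComm hr l))
      (w • C.Op (E.posComm hr i) + w' • C.Op (E.posComm hr j)) →
      RotConj hX ρ (C.Op (E.rotFib hr š s l))
        (w • C.Op (E.rotFib hr š s i) + w' • C.Op (E.rotFib hr š s j)) := by
    intro l w w' hl φ
    have h1 := rotConj_invLiouvillian hH hcr E hA hl φ
    have h2 : invLiouvillian H₀ P c r (w • C.Op (E.posComm hr i) + w' • C.Op (E.posComm hr j)) = _ :=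
      pi1_add_smul hr hH hcr i j w w'
    rw [h2] at h1
    have h3 := hg l (C.rotOp hX ρ φ)
    have h4 := rotOp_mem_graph_commOp hA hS
      (Submodule.add_mem _ (Submodule.smul_mem _ w (hg i φ)) (Submodule.smul_mem _ w' (hg j φ)))
    have h5 : C.pi1 H₀ P c r (C.Op (E.posComm hr l)) (C.rotOp hX ρ φ) = _ := h1
    rw [h5] at h3
    exact eq_of_mem_graph h3 h4
  exact ⟨key i _ _ hD.1, key j _ _ hD.2⟩

end FibreResolvent

end Crystal
end UCC

end

/-! ### The difference of the mean positions for two bases, and its invariance under the rotation.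
-/

noncomputable section

namespace UCC
namespace Crystal
variable {d N : ℕ} {C : Crystal d N} {b b' : Module.Basis (Fin d) ℝ (Space d)}

/-! ### The difference of the mean positions in two cells -/

/-- Here `m` moves `x` into the cell of `b`, `n` moves it into the cell of `b'`, and `γ` is the
displacement between the two images. -/
theorem mem_periodicPiece (hb : lattice b = C.Lat) (hb' : lattice b' = C.Lat) {x : Space d}
    {γ : C.Lat} : x ∈ C.periodicPiece b b' γ ↔ ∃ m ∈ cellBox b 0 x, ∃ n ∈ cellBox b' 0 x,
      γ = latIdx hb m - latIdx hb' n := by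
  constructor
  · rintro ⟨η, hη, h1, h2⟩
    obtain ⟨n, hn⟩ := (latIdx hb').surjective (-⟨η, hη⟩)
    obtain ⟨m, hm⟩ := (latIdx hb).surjective (γ - ⟨η, hη⟩)
    have hn' : ((latEquiv b' n : lattice b') : Space d) = -η := by
      rw [← latIdx_coe hb', hn]; rfl
    have hm' : ((latEquiv b m : lattice b) : Space d) = γ - η := by
      rw [← latIdx_coe hb, hm]; rfl
    refine ⟨m, (mem_cellBox b).mpr ?_, n, (mem_cellBox b').mpr ?_, ?_⟩
    · rw [hm', ← add_comm_sub]; exact h1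
    · rw [hn', ← sub_eq_add_neg]; exact h2
    · rw [hm, hn]; abel
  · rintro ⟨m, hm, n, hn, rfl⟩
    have hm' := (mem_cellBox b).mp hm
    have hn' := (mem_cellBox b').mp hn
    refine ⟨-(latIdx hb' n : C.Lat), C.Lat.neg_mem (latIdx hb' n).2, ?_, ?_⟩
    · have : x - -((latIdx hb' n : C.Lat) : Space d) + ((latIdx hb m - latIdx hb' n : C.Lat) : Space d) =
          x + (latEquiv b m : Space d) := by
        rw [AddSubgroupClass.coe_sub, latIdx_coe hb]; abel
      rw [this]; exact hm'
    · rw [sub_neg_eq_add]; exact hn'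

variable (C b b') in
/-- Lattice vectors among which are all those for which a piece is not empty. -/
theorem exists_finset_pieces : ∃ S : Finset C.Lat, ∀ (γ : C.Lat) (x : Space d),
    x ∈ C.periodicPiece b b' γ → γ ∈ S := by
  open scoped Pointwise in
  have hbd : Bornology.IsBounded (cell b 1 - cell b' 1) :=
    (isBounded_cell b 1).sub (isBounded_cell b' 1)
  obtain ⟨S, hS⟩ := C.exists_finset_cover hbd
  refine ⟨S, fun γ x hx => hS γ 0 ?_ ?_⟩
  · rw [ZSpan.mem_fundamentalDomain]
    intro l
    simp
  · obtain ⟨η, -, h1, h2⟩ := hx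
    refine ⟨_, h1, _, h2, ?_⟩
    simp

theorem latIdx_sub (hb : lattice b = C.Lat) (m n : Fin d → ℤ) :
    latIdx hb (m - n) = latIdx hb m - latIdx hb n := by
  refine Subtype.ext ?_
  rw [AddSubgroupClass.coe_sub, latIdx_coe, latIdx_coe, latIdx_coe, latEquiv_apply, latEquiv_apply,
    latEquiv_apply, ← Finset.sum_sub_distrib]
  refine Finset.sum_congr rfl fun l _ => ?_
  rw [Pi.sub_apply, Int.cast_sub, sub_smul]

/-- Away from boundaries `x` lies in exactly one `O_γ`, and the difference of the mean positions is
`γ`. The cells are closed, so a boundary point may lie in several `O_γ`; the difference is then the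
mean of these `γ`, and the left factor, at least `1`, counts them. -/
theorem sum_pieces (hb : lattice b = C.Lat) (hb' : lattice b' = C.Lat) {S : Finset C.Lat}
    (hS : ∀ (γ : C.Lat) (x : Space d), x ∈ C.periodicPiece b b' γ → γ ∈ S) (i : Fin d)
    (x : Space d) :
    (∑ γ ∈ S, ind (C.periodicPiece b b' γ) x) * (meanCoord b i x - meanCoord b' i x) =
      ∑ γ ∈ S, (((γ : Space d) i : ℝ) : ℂ) * ind (C.periodicPiece b b' γ) x ∧
    1 ≤ ‖∑ γ ∈ S, ind (C.periodicPiece b b' γ) x‖ := by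
  classical
  set D : Finset C.Lat := S.filter fun γ => x ∈ C.periodicPiece b b' γ
  have hD : ∀ γ, γ ∈ D ↔ ∃ m ∈ cellBox b 0 x, ∃ n ∈ cellBox b' 0 x,
      γ = latIdx hb m - latIdx hb' n := fun γ => by
    rw [Finset.mem_filter, ← mem_periodicPiece]
    exact ⟨fun h => h.2, fun h => ⟨hS γ x h, h⟩⟩
  have hsum : ∀ f : C.Lat → ℂ, ∑ γ ∈ S, f γ * ind (C.periodicPiece b b' γ) x = ∑ γ ∈ D, f γ := by
    intro f
    rw [Finset.sum_filter]
    refine Finset.sum_congr rfl fun γ _ => ?_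
    by_cases hx : x ∈ C.periodicPiece b b' γ
    · rw [if_pos hx, ind, Set.indicator_of_mem hx, mul_one]
    · rw [if_neg hx, ind, Set.indicator_of_notMem hx, mul_zero]
  have hcard : ∑ γ ∈ S, ind (C.periodicPiece b b' γ) x = (D.card : ℂ) := by
    have := hsum fun _ => 1
    simpa using this
  have hne : D.Nonempty := by
    have hpos : ∀ b : Module.Basis (Fin d) ℝ (Space d), (cellBox b 0 x).Nonempty := fun b =>
      Finset.card_pos.mp (lt_of_lt_of_le (by positivity) (pow_le_card_cellBox b 0 x))
    obtain ⟨m, hm⟩ := hpos b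
    obtain ⟨n, hn⟩ := hpos b'
    exact ⟨_, (hD _).mpr ⟨m, hm, n, hn, rfl⟩⟩
  -- The two boxes are symmetric, so the set of the `γ` with `x ∈ O_γ` is invariant under `γ ↦ τ -
  -- γ`. Its mean is `τ / 2`, which is the difference of the mean positions.
  set τ : C.Lat := latIdx hb (-cellShift b x) - latIdx hb' (-cellShift b' x)
  have hinv : ∀ γ ∈ D, τ - γ ∈ D := by
    intro γ hγ
    obtain ⟨m, hm, n, hn, rfl⟩ := (hD γ).mp hγ
    refine (hD _).mpr ⟨_, cellBox_symm b hm, _, cellBox_symm b' hn, ?_⟩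
    rw [latIdx_sub, latIdx_sub]
    simp only [τ]
    abel
  have hτ : (τ : Space d) i = 2 * (cellMean b x i - cellMean b' x i) := by
    have h1 : ∀ {b : Module.Basis (Fin d) ℝ (Space d)} (hb : lattice b = C.Lat),
        ((latIdx hb (-cellShift b x) : C.Lat) : Space d) = (2 : ℝ) • (cellMean b x - x) := by
      intro b hb
      rw [latIdx_coe, latEquiv_apply, cellMean, sub_sub_cancel_left, smul_neg, smul_smul]
      simp [neg_smul, Finset.sum_neg_distrib]
    have h2 : (τ : Space d) = (2 : ℝ) • (cellMean b x - x) - (2 : ℝ) • (cellMean b' x - x) := by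
      rw [← h1 hb, ← h1 hb']; rfl
    rw [h2]
    simp only [PiLp.sub_apply, PiLp.smul_apply, smul_eq_mul]
    ring
  have hcoord : (∑ γ ∈ D, (γ : Space d) i) = D.card * (cellMean b x i - cellMean b' x i) := by
    have h1 : (∑ γ ∈ D, (γ : Space d) i) = ∑ γ ∈ D, ((τ - γ : C.Lat) : Space d) i :=
      Finset.sum_nbij' (fun γ => τ - γ) (fun γ => τ - γ) hinv hinv (fun γ _ => sub_sub_cancel _ _)
        (fun γ _ => sub_sub_cancel _ _) fun γ _ => by rw [sub_sub_cancel]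
    have h2 : (∑ γ ∈ D, ((τ - γ : C.Lat) : Space d) i) =
        D.card * (τ : Space d) i - ∑ γ ∈ D, (γ : Space d) i := by
      simp only [AddSubgroupClass.coe_sub, PiLp.sub_apply, Finset.sum_sub_distrib, Finset.sum_const,
        nsmul_eq_mul]
    rw [hτ] at h2
    linarith
  constructor
  · rw [hcard, hsum fun γ => (((γ : Space d) i : ℝ) : ℂ), ← Complex.ofReal_sum, hcoord]
    push_cast
    rfl
  · rw [hcard, Complex.norm_natCast]
    exact_mod_cast hne.card_pos

theorem measurableSet_periodicPiece (γ : Space d) : MeasurableSet (C.periodicPiece b b' γ) := by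
  have h1 : C.periodicPiece b b' γ = ⋃ η : C.Lat,
      ((fun x => x - (η : Space d) + γ) ⁻¹' cell b 1 ∩ (fun x => x - (η : Space d)) ⁻¹' cell b' 1) := by
    ext x
    simp only [periodicPiece, piece, Set.mem_iUnion]
    exact ⟨fun ⟨η, hη, h⟩ => ⟨⟨η, hη⟩, h⟩, fun ⟨η, h⟩ => ⟨η, η.2, h⟩⟩
  rw [h1]
  refine MeasurableSet.iUnion fun η => MeasurableSet.inter ?_ ?_
  · exact ((isClosed_cell b 1).preimage (by fun_prop)).measurableSet
  · exact ((isClosed_cell b' 1).preimage (by fun_prop)).measurableSet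

theorem memLp_meanCoord {ν : Measure (Space d)} (i : Fin d) : MemLp (meanCoord b i) ⊤ ν := by
  obtain ⟨R, hR⟩ := exists_norm_meanCoord_le b i
  exact memLp_top_of_bound (measurable_meanCoord b i).aestronglyMeasurable R
    (Eventually.of_forall hR)

theorem memLp_sum_ind {ν : Measure (Space d)} (S : Finset C.Lat) (f : C.Lat → ℂ) :
    MemLp (fun x => ∑ γ ∈ S, f γ * ind (C.periodicPiece b b' γ) x) ⊤ ν :=
  memLp_finsetSum S fun γ _ =>
    (memLp_ind (measurableSet_periodicPiece (γ : Space d))).const_mul (f γ)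

theorem mulB_sum_ind (S : Finset C.Lat) (f : C.Lat → ℂ) :
    mulB (Spin N) C.mu (fun x => ∑ γ ∈ S, f γ * ind (C.periodicPiece b b' γ) x) =
      ∑ γ ∈ S, f γ • mulB (Spin N) C.mu (ind (C.periodicPiece b b' γ)) := by
  classical
  induction S using Finset.induction_on with
  | empty =>
    ext1 ψ
    refine mulB_eq_of_ae (memLp_sum_ind ∅ f) ?_
    filter_upwards [Lp.coeFn_zero (Spin N) 2 C.mu] with x hx
    simpa using hx
  | insert γ S hγ ih =>
    simp_rw [Finset.sum_insert hγ]
    have h1 := memLp_ind (ν := C.mu) (C.measurableSet_periodicPiece (b := b) (b' := b') (γ : Space d))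
    rw [mulB_add (h1.const_mul (f γ)) (memLp_sum_ind S f), ih, mulB_smul h1]

variable {θ : ℝ} {i j : Fin d} {hij : i ≠ j} {hX : C.RotInvariant θ hij}
  {ρ : unitary (Spin N →L[ℂ] Spin N)}

/-- The multiplication by the difference of the mean positions commutes with the rotation. -/
theorem rotConj_meanCoord_sub (hb : lattice b = C.Lat) (hb' : lattice b' = C.Lat)
    (hp : ∀ γ ∈ C.Lat, C.rotConj hX ρ (chi N C.mu (C.periodicPiece b b' γ)) =
      chi N C.mu (C.periodicPiece b b' γ)) (l : Fin d) :
    RotConj hX ρ (mulB (Spin N) C.mu fun x => meanCoord b l x - meanCoord b' l x)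
      (mulB (Spin N) C.mu fun x => meanCoord b l x - meanCoord b' l x) := by
  obtain ⟨S, hS⟩ := C.exists_finset_pieces b b'
  have hind : ∀ γ : C.Lat, RotConj hX ρ (mulB (Spin N) C.mu (ind (C.periodicPiece b b' γ)))
      (mulB (Spin N) C.mu (ind (C.periodicPiece b b' γ))) := fun γ => by
    have h1 := hp γ γ.2
    rw [C.chi_eq (C.measurableSet_periodicPiece (γ : Space d))] at h1
    exact RotConj.of_rotConj h1
  have hsum : ∀ f : C.Lat → ℂ, RotConj hX ρ
      (mulB (Spin N) C.mu fun x => ∑ γ ∈ S, f γ * ind (C.periodicPiece b b' γ) x)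
      (mulB (Spin N) C.mu fun x => ∑ γ ∈ S, f γ * ind (C.periodicPiece b b' γ) x) := fun f => by
    rw [mulB_sum_ind]
    exact RotConj.sum fun γ _ => (hind γ).smul (f γ)
  set m : Space d → ℂ := fun x => ∑ γ ∈ S, 1 * ind (C.periodicPiece b b' γ) x
  set n : Space d → ℂ := fun x => ∑ γ ∈ S, (((γ : Space d) l : ℝ) : ℂ) * ind (C.periodicPiece b b' γ) x
  set δ : Space d → ℂ := fun x => meanCoord b l x - meanCoord b' l x
  have hm : MemLp m ⊤ C.mu := memLp_sum_ind S _
  have hδ : MemLp δ ⊤ C.mu := (memLp_meanCoord l).sub (memLp_meanCoord l)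
  have hmx : ∀ x, m x = ∑ γ ∈ S, ind (C.periodicPiece b b' γ) x := fun x =>
    Finset.sum_congr rfl fun γ _ => one_mul _
  have hmδ : (fun x => m x * δ x) = n := by
    funext x
    rw [hmx]
    exact (sum_pieces hb hb' hS l x).1
  have hm1 : ∀ x, 1 ≤ ‖m x‖ := fun x => by
    rw [hmx]
    exact (sum_pieces hb hb' hS l x).2
  have hmeas : Measurable m := Finset.measurable_fun_sum _ fun γ _ => measurable_const.mul
    (measurable_const.indicator (measurableSet_periodicPiece (γ : Space d)))
  have hminv : MemLp (fun x => (m x)⁻¹) ⊤ C.mu :=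
    memLp_top_of_bound hmeas.inv.aestronglyMeasurable 1 (Eventually.of_forall fun x => by
      rw [norm_inv]; exact inv_le_one_of_one_le₀ (hm1 x))
  -- Multiplication by `m` and by `n = m δ` commute with the rotation, being combinations of the
  -- indicators of the `O_γ`. Since `|m| ≥ 1`, the factor `m` can be divided out.
  have hinj : Function.Injective (mulB (Spin N) C.mu m) := by
    refine Function.LeftInverse.injective (g := mulB (Spin N) C.mu fun x => (m x)⁻¹) fun ψ => ?_
    rw [← ContinuousLinearMap.comp_apply, ← mulB_mul hminv hm]
    have : (fun x => (m x)⁻¹ * m x) = fun _ => 1 := by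
      funext x
      exact inv_mul_cancel₀ (norm_pos_iff.mp (one_pos.trans_le (hm1 x)))
    rw [this, mulB_one]; rfl
  intro ψ
  refine hinj ?_
  have h1 : ∀ φ, mulB (Spin N) C.mu m (mulB (Spin N) C.mu δ φ) = mulB (Spin N) C.mu n φ := fun φ => by
    rw [← hmδ, mulB_mul hm hδ]; rfl
  rw [h1, hsum, hsum, h1]

/-- The trace over a fundamental domain of a periodic weight. -/
theorem IsLocTraceClass.tr_weight {A : C.Hil →L[ℂ] C.Hil} (hA : C.IsLocTraceClass A)
    {Ω : Set (Space d)} (hΩ : MeasurableSet Ω) (hΩb : Bornology.IsBounded Ω)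
    (hfd : ∀ x : Space d, ∃! γ : C.Lat, x + (γ : Space d) ∈ Ω) {δ : Space d → ℂ} (hδ : MemLp δ ⊤ C.mu)
    (hper : ∀ x (γ : C.Lat), δ (x + γ) = δ x) :
    IsTraceClass (mulB (Spin N) C.mu δ ∘L mulB (Spin N) C.mu (ind Ω) ∘L A ∘L
      mulB (Spin N) C.mu (ind Ω)) ∧
    tr (mulB (Spin N) C.mu δ ∘L mulB (Spin N) C.mu (ind Ω) ∘L A ∘L mulB (Spin N) C.mu (ind Ω)) =
      tr (C.cpr A ∘L mulB (Spin N) (C.mu.restrict C.fund) δ) := by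
  obtain ⟨s, hs⟩ := C.exists_finset_cover hΩb
  have hw := memLp_top_mul hδ (memLp_ind (ν := C.mu) hΩ)
  have h1 := hA.trace_weighted hΩ hs hw fun x hx => by
    rw [ind, Set.indicator_of_notMem hx, mul_zero]
  rw [mulB_mul hδ (memLp_ind hΩ)] at h1
  refine ⟨h1.1, h1.2.trans ?_⟩
  congr 2
  refine mulB_congr ?_
  filter_upwards [ae_restrict_mem C.measurableSet_fund] with x hx
  obtain ⟨γ, hγ, hu⟩ := hfd x
  rw [Finset.sum_eq_single_of_mem γ (hs γ x hx hγ) fun γ' _ hne => ?_]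
  · rw [ind, Set.indicator_of_mem hγ, mul_one, hper]
  · rw [ind, Set.indicator_of_notMem (fun h => hne (hu γ' h)), mul_zero]

/-- Two periodic operators which are mapped to each other by the rotation have the same trace per
unit volume. -/
theorem RotConj.tr_cpr_eq {A A' : C.Hil →L[ℂ] C.Hil} (hA : C.IsLocTraceClass A)
    (hA' : C.IsLocTraceClass A') (h : RotConj hX ρ A A')
    (hlat : ∀ γ, γ ∈ C.Lat ↔ rot θ hij γ ∈ C.Lat) {δ : Space d → ℂ} (hδ : MemLp δ ⊤ C.mu)
    (hper : ∀ x (γ : C.Lat), δ (x + γ) = δ x)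
    (hcomm : RotConj hX ρ (mulB (Spin N) C.mu δ) (mulB (Spin N) C.mu δ)) :
    tr (C.cpr A ∘L mulB (Spin N) (C.mu.restrict C.fund) δ) =
      tr (C.cpr A' ∘L mulB (Spin N) (C.mu.restrict C.fund) δ) := by
  -- The rotated fundamental domain. It is again a fundamental domain because the lattice is
  -- invariant, so the periodic weight gives the same trace over it as over `C.fund`.
  set Ω := (rot θ hij).symm ⁻¹' C.fund
  have hΩ : MeasurableSet Ω := (rot θ hij).symm.continuous.measurable C.measurableSet_fund
  have hΩb : Bornology.IsBounded Ω := by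
    obtain ⟨R, hR⟩ := isBounded_iff_forall_norm_le.mp C.isBounded_fund
    refine isBounded_iff_forall_norm_le.mpr ⟨R, fun x hx => ?_⟩
    rw [← (rot θ hij).symm.norm_map]
    exact hR _ hx
  have hpre : rot θ hij ⁻¹' Ω = C.fund := by
    ext x; simp [Ω]
  have hfund : ∀ x : Space d, ∃! γ : C.Lat, x + (γ : Space d) ∈ C.fund := fun x => by
    obtain ⟨γ, hγ, hu⟩ := C.exists_unique_sub_mem x
    refine ⟨-γ, ?_, fun γ' hγ' => ?_⟩
    · change x + ((-γ : C.Lat) : Space d) ∈ _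
      push_cast
      rw [← sub_eq_add_neg]; exact hγ
    · rw [← hu (-γ') (by push_cast; rw [sub_neg_eq_add]; exact hγ'), neg_neg]
  have hfd : ∀ x : Space d, ∃! γ : C.Lat, x + (γ : Space d) ∈ Ω := fun x => by
    obtain ⟨γ, hγ, hu⟩ := hfund ((rot θ hij).symm x)
    refine ⟨⟨rot θ hij γ, (hlat γ).mp γ.2⟩, ?_, fun γ' hγ' => ?_⟩
    · change (rot θ hij).symm (x + rot θ hij γ) ∈ C.fund
      rw [map_add, LinearIsometryEquiv.symm_apply_apply]; exact hγ
    · have h1 : (rot θ hij).symm (γ' : Space d) ∈ C.Lat := by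
        rw [hlat, LinearIsometryEquiv.apply_symm_apply]; exact γ'.2
      have h2 := hu ⟨_, h1⟩ (by
        change (rot θ hij).symm x + (rot θ hij).symm (γ' : Space d) ∈ C.fund
        rw [← map_add]; exact hγ')
      refine Subtype.ext ?_
      change (γ' : Space d) = rot θ hij γ
      rw [← h2]
      exact ((rot θ hij).apply_symm_apply _).symm
  have hind : RotConj hX ρ (mulB (Spin N) C.mu (ind Ω)) (mulB (Spin N) C.mu (ind C.fund)) := fun ψ => by
    rw [mulB_ind_rotOp hX ρ hΩ, hpre]
  have h1 := hA.tr_weight hΩ hΩb hfd hδ hper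
  have h2 := hA'.tr_weight C.measurableSet_fund C.isBounded_fund hfund hδ hper
  rw [← h1.2, ← h2.2]
  exact (hcomm.comp (hind.comp (h.comp hind))).tr_eq h2.1

end Crystal
end UCC

end

/-! ### Unit cell consistency: conclusion. -/

noncomputable section

namespace UCC
namespace Crystal
variable {d N : ℕ} {C : Crystal d N} {H₀ : C.Hil →ₗ.[ℂ] C.Hil}
  {h : Space d → C.Fib →ₗ.[ℂ] C.Fib} {μF c r : ℝ} {P : C.Hil →L[ℂ] C.Hil} {s : Spin N →L[ℂ] Spin N}

/-! ### Unit cell consistency of the rotation conductivity -/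

theorem IsLocTraceClass.smul {A : C.Hil →L[ℂ] C.Hil} (hA : C.IsLocTraceClass A) (w : ℂ) :
    C.IsLocTraceClass (w • A) where
  comm γ ψ := by
    rw [smul_apply, smul_apply, hA.comm, map_smul]
  traceClass γ γ' := by
    rw [ContinuousLinearMap.smul_comp, ContinuousLinearMap.comp_smul]
    exact (hA.traceClass γ γ').smul w

theorem IsLocTraceClass.tr_cpr_add_smul {A B : C.Hil →L[ℂ] C.Hil} (hA : C.IsLocTraceClass A)
    (hB : C.IsLocTraceClass B) (w w' : ℂ) (M : C.Fib →L[ℂ] C.Fib) :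
    tr (C.cpr (w • A + w' • B) ∘L M) = w * tr (C.cpr A ∘L M) + w' * tr (C.cpr B ∘L M) := by
  have h1 : C.cpr (w • A + w' • B) ∘L M = w • (C.cpr A ∘L M) + w' • (C.cpr B ∘L M) := by
    ext1 φ
    change C.res (w • A (C.ext (M φ)) + w' • B (C.ext (M φ))) = _
    rw [map_add, map_smul, map_smul]; rfl
  have h2 : ∀ {A : C.Hil →L[ℂ] C.Hil}, C.IsLocTraceClass A → IsTraceClass (C.cpr A ∘L M) :=
    fun hA => hA.traceClass_cpr.comp (ContinuousLinearMap.id ℂ _) M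
  rw [h1, tr_add ((h2 hA).smul w) ((h2 hB).smul w'), tr_smul, tr_smul]

/-- The only fixed vector of a rotation by a fraction of a full turn is zero. -/
theorem eq_zero_of_rotation {n : ℕ} (hn : 2 ≤ n) {v w : ℂ}
    (hv : v = (Real.cos (2 * Real.pi / n) : ℂ) * v + -(Real.sin (2 * Real.pi / n) : ℂ) * w)
    (hw : w = (Real.sin (2 * Real.pi / n) : ℂ) * v + (Real.cos (2 * Real.pi / n) : ℂ) * w) :
    w = 0 := by
  set θ := 2 * Real.pi / n
  have hn' : (2 : ℝ) ≤ n := by exact_mod_cast hn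
  have h1 : Real.cos θ ≠ 1 := by
    have h2 : 0 < θ := by positivity
    have h3 : θ < 2 * Real.pi := div_lt_self Real.two_pi_pos (by linarith)
    intro h4
    exact h2.ne' ((Real.cos_eq_one_iff_of_lt_of_lt (by linarith) h3).mp h4)
  have h2 : (Real.sin θ : ℂ) ^ 2 + (Real.cos θ : ℂ) ^ 2 = 1 := by
    exact_mod_cast Real.sin_sq_add_cos_sq θ
  -- `2 (1 - cos θ)` is the determinant of the identity minus the rotation.
  have h3 : (1 - (Real.cos θ : ℂ)) * 2 * w = 0 := by
    linear_combination (Real.sin θ : ℂ) * hv + (1 - (Real.cos θ : ℂ)) * hw - w * h2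
  refine (mul_eq_zero.mp h3).resolve_left (mul_ne_zero (sub_ne_zero.mpr ?_) two_ne_zero)
  exact_mod_cast h1.symm

/-- The coordinate `i` in `δ` is kept fixed while the direction of the field runs over `i` and `j`.
The two traces against `δ` form a vector fixed by the rotation, hence zero, and the one for `j` is,
up to a factor, the difference of the two conductivities before real parts are taken. -/
theorem IsRotSymmetric.exists_isRotConductivity {n : ℕ} (hn : 2 ≤ n) {i j : Fin d} {hij : i ≠ j}
    {hX : C.RotInvariant (2 * Real.pi / n) hij} {ρ : unitary (Spin N →L[ℂ] Spin N)}
    {b b' : Module.Basis (Fin d) ℝ (Space d)} (hsym : C.IsRotSymmetric H₀ s hX ρ b b')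
    (hb : lattice b = C.Lat) (hb' : lattice b' = C.Lat) (hH : C.IsUnperturbed H₀ h μF P)
    (hcr : C.IsContour H₀ μF c r) (hs : C.IsSpin h s) :
    ∃ σ : ℝ, C.IsRotConductivity H₀ P c r s i j b σ ∧ C.IsRotConductivity H₀ P c r s i j b' σ := by
  obtain ⟨E⟩ := hH.exists_fibreResolvent hcr
  obtain ⟨š, hš⟩ := E.exists_spin hs
  have hr := hcr.1.le
  set ν := C.mu.restrict C.fund
  set δ : Space d → ℂ := fun x => meanCoord b i x - meanCoord b' i x
  have hper : ∀ x (γ : C.Lat), δ (x + γ) = δ x := fun x γ => by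
    simp only [δ, meanCoord, cellMean_add hb, cellMean_add hb']
  have hq := fun l => E.isLocTraceClass_rotFib hr hH hcr š s l
  have hrot := E.rotConj_rotFib hr hH hcr hs hš hsym.hamiltonian_inv hsym.spin_inv
  have hδ := rotConj_meanCoord_sub hb hb' hsym.pieces_inv i
  have key : ∀ (l : Fin d) (w w' : ℂ), RotConj hX ρ (C.Op (E.rotFib hr š s l))
      (w • C.Op (E.rotFib hr š s i) + w' • C.Op (E.rotFib hr š s j)) →
      tr (C.cpr (C.Op (E.rotFib hr š s l)) ∘L mulB (Spin N) ν δ) =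
        w * tr (C.cpr (C.Op (E.rotFib hr š s i)) ∘L mulB (Spin N) ν δ) +
        w' * tr (C.cpr (C.Op (E.rotFib hr š s j)) ∘L mulB (Spin N) ν δ) := by
    intro l w w' hl
    rw [← (hq i).tr_cpr_add_smul (hq j)]
    exact hl.tr_cpr_eq (hq l) (((hq i).smul w).add ((hq j).smul w')) hsym.lattice_inv
      ((memLp_meanCoord i).sub (memLp_meanCoord i)) hper hδ
  have h0 := eq_zero_of_rotation hn (key i _ _ hrot.1) (key j _ _ hrot.2)
  have h1 := E.isRotConductivity hr hH hcr hs hš i j hb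
  refine ⟨_, h1, ?_⟩
  have h2 : tr (C.cpr (C.Op (E.rotFib hr š s j)) ∘L
      mulB (Spin N) ν fun x => Complex.I * meanCoord b i x) =
      tr (C.cpr (C.Op (E.rotFib hr š s j)) ∘L
        mulB (Spin N) ν fun x => Complex.I * meanCoord b' i x) := by
    have h3 : mulB (Spin N) ν δ = mulB (Spin N) ν (meanCoord b i) - mulB (Spin N) ν (meanCoord b' i) :=
      mulB_sub (memLp_meanCoord i) (memLp_meanCoord i)
    have h4 : ∀ M : C.Fib →L[ℂ] C.Fib, IsTraceClass (C.cpr (C.Op (E.rotFib hr š s j)) ∘L M) :=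
      (hq j).traceClass_cpr.comp (ContinuousLinearMap.id ℂ _)
    rw [mulB_smul (memLp_meanCoord i), mulB_smul (memLp_meanCoord i),
      ContinuousLinearMap.comp_smul, ContinuousLinearMap.comp_smul, tr_smul, tr_smul,
      sub_eq_iff_eq_add'.mp h3.symm, ContinuousLinearMap.comp_add, tr_add (h4 _) (h4 _), h0,
      add_zero]
  rw [h2]
  exact E.isRotConductivity hr hH hcr hs hš i j hb'

end Crystal
end UCC

end

theorem proposition5p6 {d N : ℕ} (C : UCC.Crystal d N)
    (H₀ : C.Hil →ₗ.[ℂ] C.Hil) (h : UCC.Space d → C.Fib →ₗ.[ℂ] C.Fib) (μF : ℝ)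
    (P : C.Hil →L[ℂ] C.Hil) (hH : C.IsUnperturbed H₀ h μF P)
    (s : UCC.Spin N →L[ℂ] UCC.Spin N) (hs : C.IsSpin h s)
    (c r : ℝ) (hcr : C.IsContour H₀ μF c r) (i j : Fin d) :
    (∃ σ : ℝ, ∀ b : Module.Basis (Fin d) ℝ (UCC.Space d), UCC.lattice b = C.Lat →
      C.IsConvConductivity H₀ h P c r s i j b σ) ∧
    (∀ (n : ℕ), 2 ≤ n → ∀ (hij : i ≠ j) (hX : C.RotInvariant (2 * Real.pi / n) hij)
      (ρ : unitary (UCC.Spin N →L[ℂ] UCC.Spin N))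
      (b b' : Module.Basis (Fin d) ℝ (UCC.Space d)),
      UCC.lattice b = C.Lat → UCC.lattice b' = C.Lat → C.IsRotSymmetric H₀ s hX ρ b b' →
      ∃ σ : ℝ, C.IsRotConductivity H₀ P c r s i j b σ ∧
        C.IsRotConductivity H₀ P c r s i j b' σ) := by
  exact ⟨UCC.Crystal.exists_isConvConductivity hH hs hcr i j,
    fun _ hn _ _ _ _ _ hb hb' hsym => hsym.exists_isRotConductivity hn hb hb' hH hcr hs⟩
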